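/- Let $n\ge 1$. A Calabi–Yau $n$-manifold is $(M,\omega,J,g,\Omega)$ with $(\omega,J,g)$ Kähler, $\omega=g(J\cdot,\cdot)$, $\dim_{\mathbb C}M=n$, and $\Omega$ a holomorphic volume form with $\frac{\omega^n}{n!}=(-1)^{n(n-1)/2}(\frac{i}{2})^n\,\Omega\wedge\overline\Omega$ (so $g$ is Ricci-flat). **Setting.** Let $(M_k,\omega_k,J_k,g_k,\Omega_k)$ be closed Calabi–Yau $n$-manifolds with $[\omega_k]\in H^2(M_k,\mathbb Z)$, let $p_k\in M_k$, let $\lambda_k>0$ with $\lambda_k\to0$ (e.g. $\lambda_k=i_{g_k}(p_k)$, the injectivity radius, when this tends to $0$), and let $\sigma\in\mathbb R$ be such that $[\Omega_k|_{B_{g_k}(p_k,\sigma\lambda_k)}]\ne0$ in $H^n(B_{g_k}(p_k,\sigma\lambda_k),\mathbb C)$ for all $k$. Let $(X,\omega_0,J_0,g_0,\Omega_0,p_0)$ be a connected complete flat Calabi–Yau $n$-manifold that is the blow-up limit of this sequence: for every $r>0$ there are, for all large $k$, smooth embeddings $F_{r,k}:B_{g_0}(p_0,r)\to M_k$ with $F_{r,k}(p_0)=p_k$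 such that $\lambda_k^{-2}F_{r,k}^*g_k\to g_0$, $\lambda_k^{-2}F_{r,k}^*\omega_k\to\omega_0$ and $\lambda_k^{-n}F_{r,k}^*\Omega_k\to\Omega_0$ in $C^\infty$ on compact subsets. Let $S\subset X$ be a soul, i.e. a non-empty compact totally convex embedded submanifold without boundary. Let $g_E=\sum_j(dx_j^2+dy_j^2)$, $\omega_E=\sum_j dx_j\wedge dy_j$, $\Omega_E=dz_1\wedge\dots\wedge dz_n$ on $\mathbb C^n$. There is a universal covering $\bar\pi:\mathbb C^n\to X$ with $\bar\pi(0)\in S$, $\bar\pi^*g_0=g_E$, $\bar\pi^*\omega_0=\omega_E$, $\bar\pi^*\Omega_0=\Omega_E$. For every such $\bar\pi$, the set $\bar S=\bar\pi^{-1}(S)$ is a real linear subspace of $\mathbb C^n$. Let $\bar S^\perp$ be its orthogonal complement, let $K\subset\pi_1(X)$ be the group of deck transformations of $\bar\pi$ that act on $\bar S$ as translations (the kernel of the holonomy representation of $\pi_1(S)=\pi_1(X)$ on the tangent space of $S$), let $\Lambda\subset\bar S$ be the group of these translations, and let $\pi:\tilde X=\mathbb C^n/K\to X$ be the corresponding covering,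 with group $\Gamma$ of deck transformations. **Proposition 3.1.** $\Lambda$ is a lattice in $\bar S$, $K$ is normal in $\pi_1(X)$, and $\pi$ is a finite normal covering. With $T^n=\bar S/\Lambda$: 1. $(\tilde X,\pi^*g_0)$ is isometric to $(T^n\times\bar S^\perp,h+h_E)$, where $h$ is the flat metric on $T^n$ induced by $g_E|_{\bar S}$ and $h_E=g_E|_{\bar S^\perp}$; the isometry is induced by $\bar S\oplus\bar S^\perp=\mathbb C^n$. 2. The action of $\Gamma$ on $\tilde X$ is a product action: there are actions of $\Gamma$ on $T^n$ by isometries and on $\bar S^\perp$ by linear isometries with $\gamma\cdot(x,y)=(\gamma\cdot x,\gamma\cdot y)$ for all $\gamma\in\Gamma$, $x\in T^n$, $y\in\bar S^\perp$. Moreover $T^n\times\{0\}=\pi^{-1}(S)$ is $\Gamma$-invariant, and $S=\pi(T^n\times\{0\})=(T^n\times\{0\})/\Gamma$. 3. There is a constant $\theta_0\in\mathbb R$ such that for every $y\in\bar S^\perp$ the slice $T^n\times\{y\}$ is special Lagrangian of phase $\theta_0$: $\dim_{\mathbb R}\bar S=n$, $\pi^*\omega_0|_{T^n\times\{y\}}\equiv0$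 and $\pi^*\,\mathrm{Im}(e^{i\theta_0}\Omega_0)|_{T^n\times\{y\}}\equiv0$. In particular $S$ is special Lagrangian of phase $\theta_0$. -/

import Mathlib

open Set Filter Topology Manifold Bundle
open scoped ContDiff ENNReal

namespace BlowUp

noncomputable section

/-! ### Tensors on manifolds

All manifolds are smooth real manifolds without boundary, modelled on a normed space `E`. -/

section Tensors

variable {E : Type*} [NormedAddCommGroup E] [NormedSpace ℝ E]
  {E' : Type*} [NormedAddCommGroup E'] [NormedSpace ℝ E']
  {M : Type*} [TopologicalSpace M] [ChartedSpace E M]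
  {N : Type*} [TopologicalSpace N] [ChartedSpace E' N]
  {F : Type*} [NormedAddCommGroup F] [NormedSpace ℝ F]

/-- (Not necessarily smooth) differential `k`-forms on `M` with values in `F`. -/
abbrev DForm (E : Type*) [NormedAddCommGroup E] [NormedSpace ℝ E]
    (M : Type*) [TopologicalSpace M] [ChartedSpace E M] (k : ℕ)
    (F : Type*) [NormedAddCommGroup F] [NormedSpace ℝ F] :=
  (x : M) → TangentSpace 𝓘(ℝ, E) x [⋀^Fin k]→L[ℝ] F

/-- (Not necessarily smooth) fields of bilinear forms on `M`. -/
abbrev BForm (E : Type*) [NormedAddCommGroup E] [NormedSpace ℝ E]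
    (M : Type*) [TopologicalSpace M] [ChartedSpace E M] :=
  (x : M) → TangentSpace 𝓘(ℝ, E) x →L[ℝ] TangentSpace 𝓘(ℝ, E) x →L[ℝ] ℝ

/-- The pull-back `f^*α` of a differential form by a map `f : N → M`. -/
def pullForm {k : ℕ} (f : N → M) (α : DForm E M k F) : DForm E' N k F :=
  fun x => (α (f x)).compContinuousLinearMap (mfderiv 𝓘(ℝ, E') 𝓘(ℝ, E) f x)

/-- The pull-back `f^*b` of a field of bilinear forms by a map `f : N → M`. -/
def pullBilin (f : N → M) (b : BForm E M) : BForm E' N :=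
  fun x =>
    let D : E' →L[ℝ] E := mfderiv 𝓘(ℝ, E') 𝓘(ℝ, E) f x
    ContinuousLinearMap.bilinearComp (E := E) (F := E) (E' := E') (F' := E') (b (f x)) D D

/-- The expression of a differential form in a chart `c`, a form on (the target of `c` in) `E`. -/
def formInChart {k : ℕ} (c : OpenPartialHomeomorph M E) (α : DForm E M k F) :
    E → E [⋀^Fin k]→L[ℝ] F :=
  pullForm (E' := E) (c.symm : E → M) α

/-- The expression of a field of bilinear forms in a chart. -/
def bilinInChart (c : OpenPartialHomeomorph M E) (b : BForm E M) : E → E →L[ℝ] E →L[ℝ] ℝ :=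
  pullBilin (E' := E) (c.symm : E → M) b

/-- The part of the target of the chart `c` that corresponds to points of `U`. -/
def chartDomain (c : OpenPartialHomeomorph M E) (U : Set M) : Set E :=
  c.target ∩ c.symm ⁻¹' U

/-- The form `α` is smooth on the open set `U`. -/
def SmoothFormOn {k : ℕ} (U : Set M) (α : DForm E M k F) : Prop :=
  ∀ c ∈ atlas E M, ContDiffOn ℝ ∞ (formInChart c α) (chartDomain c U)

/-- `dβ = α` on the open set `U`. -/
def IsExtDerivOn {k : ℕ} (U : Set M) (β : DForm E M k F) (α : DForm E M (k + 1) F) : Prop :=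
  ∀ c ∈ atlas E M, ∀ y ∈ chartDomain c U, extDeriv (formInChart c β) y = formInChart c α y

/-- `α` is exact on the open set `U`: `α = dβ` for a smooth `β` on `U`. For a closed form `α`
this says that its de Rham class `[α|_U]` vanishes. (A form of degree `0` is exact iff it is `0`.) -/
def IsExactOn : {k : ℕ} → (U : Set M) → DForm E M k F → Prop
  | 0, U, α => ∀ x ∈ U, α x = 0
  | _ + 1, U, α => ∃ β, SmoothFormOn U β ∧ IsExtDerivOn U β α

/-- `C^∞`-convergence on compact subsets of an open subset `s` of a normed space. -/
def ConvSmooth {V : Type*} [NormedAddCommGroup V] [NormedSpace ℝ V] (s : Set E)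
    (T : ℕ → E → V) (T' : E → V) : Prop :=
  ∀ (m : ℕ) (K : Set E), K ⊆ s → IsCompact K →
    TendstoUniformlyOn (fun k => iteratedFDeriv ℝ m (T k)) (iteratedFDeriv ℝ m T') atTop K

/-- `C^∞`-convergence of forms on the open set `U` of a manifold. -/
def FormConvOn {k : ℕ} (U : Set M) (α : ℕ → DForm E M k F) (α' : DForm E M k F) : Prop :=
  ∀ c ∈ atlas E M,
    ConvSmooth (chartDomain c U) (fun i => formInChart c (α i)) (formInChart c α')

/-- `C^∞`-convergence of fields of bilinear forms on the open set `U` of a manifold. -/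
def BilinConvOn (U : Set M) (b : ℕ → BForm E M) (b' : BForm E M) : Prop :=
  ∀ c ∈ atlas E M,
    ConvSmooth (chartDomain c U) (fun i => bilinInChart c (b i)) (bilinInChart c b')

/-! ### Integrality of a class in `H²(M, ℝ)` through periods over smooth singular cycles -/

/-- The standard `2`-simplex, as a subset of `ℝ²`. -/
def stdTriangle : Set (ℝ × ℝ) := {p | 0 ≤ p.1 ∧ 0 ≤ p.2 ∧ p.1 + p.2 ≤ 1}

/-- The boundary of an integral singular `2`-chain: the alternating sum of the three faces. -/
def chainBoundary (c : (ℝ × ℝ → M) →₀ ℤ) : (Icc (0 : ℝ) 1 → M) →₀ ℤ :=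
  c.sum fun σ a =>
    Finsupp.single (fun t : Icc (0 : ℝ) 1 => σ (1 - t, t)) a
      - Finsupp.single (fun t : Icc (0 : ℝ) 1 => σ (0, t)) a
      + Finsupp.single (fun t : Icc (0 : ℝ) 1 => σ (t, 0)) a

/-- The integral of a `2`-form over a smooth singular simplex. -/
def simplexIntegral (α : DForm E M 2 ℝ) (σ : ℝ × ℝ → M) : ℝ :=
  ∫ p in stdTriangle, α (σ p) ![mfderiv 𝓘(ℝ, ℝ × ℝ) 𝓘(ℝ, E) σ p ((1, 0) : ℝ × ℝ),
    mfderiv 𝓘(ℝ, ℝ × ℝ) 𝓘(ℝ, E) σ p ((0, 1) : ℝ × ℝ)]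

/-- The class of the closed `2`-form `α` lies in the image of `H²(M, ℤ) → H²(M, ℝ)`: its integral
over each integral smooth singular `2`-cycle is an integer. -/
def IsIntegralClass (α : DForm E M 2 ℝ) : Prop :=
  ∀ c : (ℝ × ℝ → M) →₀ ℤ, (∀ σ ∈ c.support, ContMDiff 𝓘(ℝ, ℝ × ℝ) 𝓘(ℝ, E) ∞ σ) →
    chainBoundary c = 0 → ∃ m : ℤ, (c.sum fun σ a => (a : ℝ) * simplexIntegral α σ) = m

end Tensors

/-! ### Riemannian geometry -/

section Riemannian

variable {E : Type*} [NormedAddCommGroup E] [NormedSpace ℝ E]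
  {M : Type*} [TopologicalSpace M] [ChartedSpace E M] [IsManifold 𝓘(ℝ, E) ∞ M]

/-- Smooth Riemannian metrics on `M`. -/
abbrev Metric (E : Type*) [NormedAddCommGroup E] [NormedSpace ℝ E]
    (M : Type*) [TopologicalSpace M] [ChartedSpace E M] [IsManifold 𝓘(ℝ, E) ∞ M] :=
  Bundle.ContMDiffRiemannianMetric 𝓘(ℝ, E) ∞ E (fun x : M => TangentSpace 𝓘(ℝ, E) x)

/-- The Riemannian distance of `g`: the infimum of the lengths of `C^1` paths. -/
def gDist (g : Metric E M) (x y : M) : ℝ≥0∞ :=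
  letI : Bundle.RiemannianBundle (fun x : M => TangentSpace 𝓘(ℝ, E) x) := ⟨g.toRiemannianMetric⟩
  Manifold.riemannianEDist 𝓘(ℝ, E) x y

/-- The length of the path `γ` on `[0, 1]` with respect to `g`. -/
def gLength (g : Metric E M) (γ : ℝ → M) : ℝ≥0∞ :=
  letI : Bundle.RiemannianBundle (fun x : M => TangentSpace 𝓘(ℝ, E) x) := ⟨g.toRiemannianMetric⟩
  Manifold.pathELength 𝓘(ℝ, E) γ 0 1

/-- The Riemannian distance of the pulled back metric `f^*g` on the total space `Y` of a covering
`f : Y → M`. A path in `Y` is `C^1` iff its projection to `M` is, and its `f^*g`-length is the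
`g`-length of its projection. -/
def coverDist {Y : Type*} [TopologicalSpace Y] (g : Metric E M) (f : Y → M) (a b : Y) : ℝ≥0∞ :=
  ⨅ (c : Path a b) (_ : ContMDiffOn 𝓘(ℝ, ℝ) 𝓘(ℝ, E) 1 (fun t => f (c.extend t)) (Icc 0 1)),
    gLength g (fun t => f (c.extend t))

/-- The open metric ball `B_g(p, r)`. -/
def gBall (g : Metric E M) (p : M) (r : ℝ) : Set M := {x | gDist g p x < ENNReal.ofReal r}

/-- `(M, g)` is a complete metric space. -/
def IsCompleteMetric (g : Metric E M) : Prop :=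
  ∀ u : ℕ → M, (∀ ε : ℝ, 0 < ε → ∃ N, ∀ i ≥ N, ∀ j ≥ N, gDist g (u i) (u j) < ENNReal.ofReal ε) →
    ∃ x, Tendsto u atTop (𝓝 x)

/-- `γ : [0, 1] → M` is a (possibly constant) geodesic: it has constant speed `v` and is locally
distance minimizing. -/
def IsGeodesic (g : Metric E M) (γ : ℝ → M) : Prop :=
  ∃ v : ℝ, 0 ≤ v ∧ ∀ t ∈ Icc (0 : ℝ) 1, ∃ ε > 0, ∀ s ∈ Icc (0 : ℝ) 1 ∩ Metric.ball t ε,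
    ∀ s' ∈ Icc (0 : ℝ) 1 ∩ Metric.ball t ε, gDist g (γ s) (γ s') = ENNReal.ofReal (v * |s - s'|)

/-- `S` is totally convex: each geodesic of `M` with end points in `S` stays in `S`. -/
def IsTotallyConvex (g : Metric E M) (S : Set M) : Prop :=
  ∀ γ : ℝ → M, IsGeodesic g γ → γ 0 ∈ S → γ 1 ∈ S → ∀ t ∈ Icc (0 : ℝ) 1, γ t ∈ S

/-- `S` is an embedded smooth submanifold of `M` (without boundary). -/
def IsEmbeddedSubmanifold (E : Type*) [NormedAddCommGroup E] [NormedSpace ℝ E]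
    {M : Type*} [TopologicalSpace M] [ChartedSpace E M] (S : Set M) : Prop :=
  ∀ x ∈ S, ∃ c ∈ IsManifold.maximalAtlas 𝓘(ℝ, E) ∞ M, x ∈ c.source ∧
    ∃ V : Submodule ℝ E, ∀ y ∈ c.source, y ∈ S ↔ c y ∈ V

/-- `S` is a soul of `(M, g)`: a compact totally convex (in particular totally geodesic) embedded
submanifold without boundary. -/
structure IsSoul (g : Metric E M) (S : Set M) : Prop where
  nonempty : S.Nonempty
  compact : IsCompact S
  submanifold : IsEmbeddedSubmanifold E S
  totallyConvex : IsTotallyConvex g S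

end Riemannian

/-! ### Calabi–Yau manifolds -/

/-- The standard space `ℂⁿ`. -/
abbrev Cn (n : ℕ) := EuclideanSpace ℂ (Fin n)

section CalabiYau

variable {n : ℕ} {M : Type*} [TopologicalSpace M] [ChartedSpace (Cn n) M]
  {X : Type*} [TopologicalSpace X] [ChartedSpace (Cn n) X]

/-- The standard Euclidean metric `g_E = ∑ dxⱼ² + dyⱼ²` of `ℂⁿ`. -/
def stdMetric (v w : Cn n) : ℝ := (inner ℂ v w).re

/-- The standard Kähler form `ω_E = ∑ dxⱼ ∧ dyⱼ` of `ℂⁿ`. -/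
def stdKahler (v w : Cn n) : ℝ := (inner ℂ v w).im

/-- The standard holomorphic volume form `Ω_E = dz₁ ∧ ⋯ ∧ dzₙ` of `ℂⁿ`. -/
def stdVolume (v : Fin n → Cn n) : ℂ := Matrix.det (Matrix.of fun i j => v i j)

/-- The differential of a map from a manifold to `ℂⁿ`. -/
def diffAt (f : M → Cn n) (x : M) : TangentSpace 𝓘(ℝ, Cn n) x →L[ℝ] Cn n :=
  mfderiv 𝓘(ℝ, Cn n) 𝓘(ℝ, Cn n) f x

/-- A Calabi–Yau structure `(ω, J, g, Ω)` on a manifold `M` of real dimension `2n`: a Kähler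
structure `(ω, J, g)` with a holomorphic volume form `Ω`, normalized by
`ωⁿ/n! = (-1)^{n(n-1)/2} (i/2)ⁿ Ω ∧ Ω̄`. The normalization implies that `g` is Ricci-flat. -/
structure CalabiYau (n : ℕ) (M : Type*) [TopologicalSpace M] [ChartedSpace (Cn n) M]
    [IsManifold 𝓘(ℝ, Cn n) ∞ M] where
  g : Metric (Cn n) M
  J : (x : M) → TangentSpace 𝓘(ℝ, Cn n) x →L[ℝ] TangentSpace 𝓘(ℝ, Cn n) x
  /-- the Kähler form `ω` -/
  kform : DForm (Cn n) M 2 ℝ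
  /-- the holomorphic volume form `Ω` -/
  vform : DForm (Cn n) M n ℂ
  J_sq : ∀ x v, J x (J x v) = -v
  J_isometry : ∀ x v w, g.inner x (J x v) (J x w) = g.inner x v w
  kform_apply : ∀ x v w, kform x ![v, w] = g.inner x (J x v) w
  kform_closed : IsExtDerivOn univ kform 0
  /-- `J` is integrable and `Ω` is holomorphic: around each point there is a smooth chart `c` with
  `dc ∘ J = i dc` in which `Ω = f dz₁ ∧ ⋯ ∧ dzₙ` with `f` holomorphic. -/
  holomorphic : ∀ x : M, ∃ c ∈ IsManifold.maximalAtlas 𝓘(ℝ, Cn n) ∞ M, x ∈ c.source ∧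
    (∀ y ∈ c.source, ∀ v, diffAt c y (J y v) = Complex.I • diffAt c y v) ∧
    ∃ f : Cn n → ℂ, DifferentiableOn ℂ f c.target ∧
      ∀ y ∈ c.source, ∀ v : Fin n → TangentSpace 𝓘(ℝ, Cn n) y,
        vform y v = f (c y) * stdVolume fun i => diffAt c y (v i)
  /-- The normalization `ωⁿ/n! = (-1)^{n(n-1)/2} (i/2)ⁿ Ω ∧ Ω̄`, evaluated on the real basis
  `e₁, Je₁, …, eₙ, Jeₙ` given by a unitary frame `e₁, …, eₙ`. -/
  normalized : ∀ (x : M) (e : Fin n → TangentSpace 𝓘(ℝ, Cn n) x),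
    (∀ i j, g.inner x (e i) (e j) = if i = j then 1 else 0) → (∀ i j, kform x ![e i, e j] = 0) →
      ‖vform x e‖ = 1

variable [IsManifold 𝓘(ℝ, Cn n) ∞ M] [IsManifold 𝓘(ℝ, Cn n) ∞ X]

/-- The metric `g` is flat: locally isometric to Euclidean space. -/
def IsFlatMetric (g : Metric (Cn n) X) : Prop :=
  ∀ x : X, ∃ c ∈ IsManifold.maximalAtlas 𝓘(ℝ, Cn n) ∞ X, x ∈ c.source ∧
    ∀ y ∈ c.source, ∀ v w, g.inner y v w = stdMetric (diffAt c y v) (diffAt c y w)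

/-- `(X, ω₀, g₀, Ω₀, p₀)` is the pointed `C^∞`-limit of the rescaled Calabi–Yau manifolds
`(M_k, λ_k⁻² ω_k, λ_k⁻² g_k, λ_k⁻ⁿ Ω_k, p_k)`: for each `r > 0` there are, for all large `k`,
smooth embeddings `F_k : B_{g₀}(p₀, r) → M_k` of an open ball, with `F_k(p₀) = p_k`, such that the
pull-backs of the rescaled structures converge. -/
def IsRescaledLimit {M : ℕ → Type*} [∀ k, TopologicalSpace (M k)] [∀ k, ChartedSpace (Cn n) (M k)]
    [∀ k, IsManifold 𝓘(ℝ, Cn n) ∞ (M k)] (Y : ∀ k, CalabiYau n (M k)) (p : ∀ k, M k) (lam : ℕ → ℝ)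
    (X₀ : CalabiYau n X) (p₀ : X) : Prop :=
  ∀ r : ℝ, 0 < r → ∃ F : ∀ k, X → M k,
    (∀ᶠ k in atTop, F k p₀ = p k ∧
      ContMDiffOn 𝓘(ℝ, Cn n) 𝓘(ℝ, Cn n) ∞ (F k) (gBall X₀.g p₀ r) ∧
      InjOn (F k) (gBall X₀.g p₀ r) ∧
      ∀ x ∈ gBall X₀.g p₀ r,
        Function.Injective (mfderiv 𝓘(ℝ, Cn n) 𝓘(ℝ, Cn n) (F k) x)) ∧
    BilinConvOn (gBall X₀.g p₀ r)
      (fun k => pullBilin (F k) (fun x => ((lam k) ^ 2)⁻¹ • (Y k).g.inner x)) X₀.g.inner ∧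
    FormConvOn (gBall X₀.g p₀ r)
      (fun k => pullForm (F k) (fun x => ((lam k) ^ 2)⁻¹ • (Y k).kform x)) X₀.kform ∧
    FormConvOn (gBall X₀.g p₀ r)
      (fun k => pullForm (F k) (fun x => ((lam k) ^ n)⁻¹ • (Y k).vform x)) X₀.vform

/-- `ϖ : ℂⁿ → X` is a (universal) covering that pulls `g₀`, `ω₀`, `Ω₀` back to the standard
structures of `ℂⁿ`. -/
structure IsFlatUniversalCover (X₀ : CalabiYau n X) (ϖ : Cn n → X) : Prop where
  covering : IsCoveringMap ϖ
  smooth : ContMDiff 𝓘(ℝ, Cn n) 𝓘(ℝ, Cn n) ∞ ϖ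
  metric : ∀ z v w : Cn n, pullBilin ϖ X₀.g.inner z v w = stdMetric v w
  kahler : ∀ z v w : Cn n, pullForm ϖ X₀.kform z ![v, w] = stdKahler v w
  volume : ∀ (z : Cn n) (v : Fin n → Cn n), pullForm ϖ X₀.vform z v = stdVolume v

/-- The smooth map `s : V → X` from an `n`-dimensional real vector space is an immersed special
Lagrangian of phase `θ`: an immersion with `s^*ω₀ = 0` and `s^*(Im e^{iθ} Ω₀) = 0`. -/
structure IsSpecialLagrangian {V : Type*} [NormedAddCommGroup V] [NormedSpace ℝ V]
    (X₀ : CalabiYau n X) (θ : ℝ) (s : V → X) : Prop where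
  dim : Module.finrank ℝ V = n
  smooth : ContMDiff 𝓘(ℝ, V) 𝓘(ℝ, Cn n) ∞ s
  immersion : ∀ v, Function.Injective (mfderiv 𝓘(ℝ, V) 𝓘(ℝ, Cn n) s v)
  lagrangian : ∀ v, pullForm (E' := V) s X₀.kform v = 0
  special : ∀ v (a : Fin n → V), (Complex.exp (θ * Complex.I) * pullForm s X₀.vform v a).im = 0

end CalabiYau

/-! ### The holonomy covering -/

section Covering

variable {n : ℕ} {X : Type*} [TopologicalSpace X]

/-- The group of deck transformations of `f : Y → X`. -/
def deckGroup {Y : Type*} [TopologicalSpace Y] (f : Y → X) : Subgroup (Y ≃ₜ Y) where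
  carrier := {γ | ∀ y, f (γ y) = f y}
  mul_mem' {a b} ha hb y := (ha (b y)).trans (hb y)
  one_mem' _ := rfl
  inv_mem' {a} ha y := by
    have h := ha (a⁻¹ y)
    rw [Homeomorph.inv_apply, Homeomorph.apply_symm_apply] at h
    exact h.symm

/-- Let `ϖ : ℂⁿ → X` be the universal covering and let `V = ϖ⁻¹(S)` be a linear subspace, so that
`S = V / π₁(X)`. The kernel of the holonomy representation of `π₁(X) = π₁(S)` on the tangent space
of `S`: the deck transformations that act on `V` as translations. -/
def holonomyKernel (ϖ : Cn n → X) (V : Submodule ℝ (Cn n)) : Subgroup (Cn n ≃ₜ Cn n) where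
  carrier := {γ | γ ∈ deckGroup ϖ ∧ ∃ b ∈ V, ∀ v ∈ V, γ v = v + b}
  mul_mem' := by
    rintro γ δ ⟨hγ, b, hb, h⟩ ⟨hδ, b', hb', h'⟩
    refine ⟨mul_mem hγ hδ, b' + b, add_mem hb' hb, fun v hv => ?_⟩
    rw [Homeomorph.mul_apply, h' v hv, h _ (add_mem hv hb'), add_assoc]
  one_mem' := ⟨one_mem _, 0, zero_mem _, fun v _ => by simp⟩
  inv_mem' := by
    rintro γ ⟨hγ, b, hb, h⟩
    refine ⟨inv_mem hγ, -b, neg_mem hb, fun v hv => ?_⟩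
    rw [Homeomorph.inv_apply, Homeomorph.symm_apply_eq, h _ (add_mem hv (neg_mem hb))]
    simp

/-- The set `Λ ⊆ V` of the translations of `V` by which the holonomy kernel acts on `V`, so that
`V / Λ` is the holonomy covering of `S`. -/
def transLattice (ϖ : Cn n → X) (V : Submodule ℝ (Cn n)) : Submodule ℤ V :=
  AddSubgroup.toIntSubmodule
    { carrier := {b | ∃ γ ∈ holonomyKernel ϖ V, ∀ v ∈ V, γ v = v + b}
      add_mem' := by
        rintro a b ⟨γ, hγ, h⟩ ⟨δ, hδ, h'⟩
        refine ⟨γ * δ, mul_mem hγ hδ, fun v hv => ?_⟩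
        rw [Homeomorph.mul_apply, h' v hv, h _ (add_mem hv b.2), Submodule.coe_add]
        abel
      zero_mem' := ⟨1, one_mem _, fun v _ => by simp⟩
      neg_mem' := by
        rintro b ⟨γ, hγ, h⟩
        refine ⟨γ⁻¹, inv_mem hγ, fun v hv => ?_⟩
        rw [Homeomorph.inv_apply, Homeomorph.symm_apply_eq, Submodule.coe_neg,
          h _ (add_mem hv (neg_mem b.2))]
        simp }

/-- The flat torus (with the quotient metric) `V / Λ`. -/
abbrev HolTorus (ϖ : Cn n → X) (V : Submodule ℝ (Cn n)) := V ⧸ transLattice ϖ V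

/-- The orbit relation of the holonomy kernel on `ℂⁿ`. -/
def holSetoid (ϖ : Cn n → X) (V : Submodule ℝ (Cn n)) : Setoid (Cn n) where
  r z w := ∃ γ ∈ holonomyKernel ϖ V, γ z = w
  iseqv :=
    { refl := fun z => ⟨1, one_mem _, rfl⟩
      symm := by
        rintro z w ⟨γ, hγ, rfl⟩
        exact ⟨γ⁻¹, inv_mem hγ, by simp⟩
      trans := by
        rintro z w u ⟨γ, hγ, rfl⟩ ⟨δ, hδ, rfl⟩
        exact ⟨δ * γ, mul_mem hδ hγ, rfl⟩ }

/-- The covering space `X̃` of `X` that belongs to the holonomy kernel (the total space of the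
pull-back of the normal bundle of `S` to the holonomy covering of `S`), as a quotient of the
universal covering `ℂⁿ`; it carries the quotient topology. -/
abbrev HolCover (ϖ : Cn n → X) (V : Submodule ℝ (Cn n)) := Quotient (holSetoid ϖ V)

/-- The covering projection `π : X̃ → X`. -/
def holProj (ϖ : Cn n → X) (V : Submodule ℝ (Cn n)) : HolCover ϖ V → X :=
  Quotient.lift ϖ (by
    rintro z w ⟨γ, hγ, rfl⟩
    exact (hγ.1 z).symm)

/-- The real inner product on `ℂⁿ` (used for `Vᗮ` and the metrics on `V`, `V / Λ`) is the standard
Euclidean one. -/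
theorem real_inner_eq_stdMetric (v w : Cn n) : inner ℝ v w = stdMetric v w := by
  simp [stdMetric, PiLp.inner_apply]

end Covering

end

end BlowUp

open BlowUp

/-!
# Collapsing Calabi–Yau manifolds: the flat blow-up limit and its soul

*The flat limit.* Let `X` be the limit. As `X` is flat and complete, a germ of an isometry from `ℂⁿ`
to `X` extends along all rays, and so to a local isometry `ℂⁿ → X` (`exists_isomOn_univ`), which is
a covering (`IsomOn.isCoveringMap`). The complex structure of a Kähler manifold is parallel, so its
pull-back to `ℂⁿ` is constant (`exists_complexStructure_eq`). The pulled back volume form is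
a holomorphic multiple of `dz₁ ∧ ⋯ ∧ dzₙ`, by a function of modulus one, which is constant.
After a unitary change of coordinates, all structures are the standard ones
(`exists_isFlatUniversalCover`). The preimage of the soul is closed and convex, because the soul is
totally convex, and it does not have a boundary, so it is a linear subspace `V`
(`IsomOn.exists_submodule_eq_preimage`). Deck transformations are rigid motions that preserve `V`,
and `V` modulo the deck group is the compact soul. So Bieberbach's theorem applies to the action
on `V`: the translations `Λ` span `V` (`IsCrystallographic.span_translations`), and the point group
is finite (`IsCrystallographic.finite_range`).

*`V` is Lagrangian.* If the dimension of `V` were less than `n`, the given balls in the manifolds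
`M k` would lie in the image of a tube about `V`. The volume form vanishes on `V`, and the radial
contraction of the tube to `V` provides a primitive of its pull-back. This primitive is invariant
under the rigid motions that relate points with the same image, so it descends
(`isExactOn_vform_of_finrank_le`), whereas the class of the volume form is not zero; hence
`n ≤ dim V` (`le_finrank_of_not_isExactOn`). For `a` and `b` in `Λ`, the parallelogram with the
sides `a` and `b` becomes a closed surface in `M k`, on which the integral of the Kähler form
is an integer. Divided by `λ_k²`, with `λ_k → 0`, this integer converges to `ω_E(a, b)`, so it
vanishes for large `k`, and `ω_E(a, b) = 0` (`stdKahler_eq_zero_of_translations`). As `Λ` spans `V`,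
`V` is isotropic, and thus Lagrangian.

*The covering.* A deck transformation whose linear part is the identity on the Lagrangian `V` has
the identity as its linear part, because the latter is complex linear. So the kernel of the holonomy
consists of the translations by `Λ` (`eq_add_of_mem_holonomyKernel`), and the quotient of `ℂⁿ` is
`V / Λ × Vᗮ` (`exists_homeomorph_torus`), isometrically (`coverDist_eq_edist`). The linear parts of
deck transformations preserve `V` and `Vᗮ`, which makes the action a product
(`exists_product_action`). Finally, `dz₁ ∧ ⋯ ∧ dzₙ` has a constant phase on the `n`-dimensional
space `V` (`exists_phase`), and all slices are translates of `V` (`exists_isSpecialLagrangian`).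
-/

open scoped Interval

namespace BlowUp

/-! ### Bieberbach's theorem -/

section Bieberbach

/-- A bounded sequence returns infinitely often to the `ε`-neighbourhood of one of its terms. -/
theorem exists_dist_le_of_bounded {F : Type*} [MetricSpace F] [ProperSpace F] {u : ℕ → F}
    {x₀ : F} {C : ℝ} (hu : ∀ k, dist (u k) x₀ ≤ C) {ε : ℝ} (hε : 0 < ε) :
    ∃ i, ∃ᶠ j in atTop, dist (u j) (u i) ≤ ε := by
  obtain ⟨a, -, φ, hφ, hlim⟩ := (isCompact_closedBall x₀ C).tendsto_subseq (x := u) fun k => hu k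
  obtain ⟨N, hN⟩ := (Metric.tendsto_atTop.1 hlim) (ε / 2) (half_pos hε)
  refine ⟨φ N, frequently_atTop.2 fun m => ⟨φ (max N m), le_trans (le_max_right _ _) (hφ.id_le _), ?_⟩⟩
  have h1 := hN (max N m) (le_max_left _ _)
  have h2 := hN N le_rfl
  have h3 := dist_triangle_right (u (φ (max N m))) (u (φ N)) a
  simp only [Function.comp] at h1 h2
  linarith

variable {E : Type*} [NormedAddCommGroup E] [InnerProductSpace ℝ E]

/-- The deviation from the identity of a linear isometry, as a bounded operator. -/
noncomputable def deviation (A : E ≃ₗᵢ[ℝ] E) : E →L[ℝ] E :=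
  (A : E →L[ℝ] E) - ContinuousLinearMap.id ℝ E

@[simp] theorem deviation_apply (A : E ≃ₗᵢ[ℝ] E) (x : E) : deviation A x = A x - x := rfl

theorem norm_deviation_le_iff {A : E ≃ₗᵢ[ℝ] E} {c : ℝ} (hc : 0 ≤ c) :
    ‖deviation A‖ ≤ c ↔ ∀ x, ‖A x - x‖ ≤ c * ‖x‖ :=
  ContinuousLinearMap.opNorm_le_iff hc

theorem norm_sub_le_deviation (A : E ≃ₗᵢ[ℝ] E) (x : E) : ‖A x - x‖ ≤ ‖deviation A‖ * ‖x‖ :=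
  (deviation A).le_opNorm x

theorem deviation_eq_zero_iff {A : E ≃ₗᵢ[ℝ] E} : deviation A = 0 ↔ A = 1 := by
  constructor
  · intro h
    ext x
    have := congrArg (fun T => T x) h
    simpa [sub_eq_zero] using this
  · rintro rfl
    ext x
    simp

theorem norm_deviation_mul_inv (A B : E ≃ₗᵢ[ℝ] E) :
    ‖deviation (A * B⁻¹)‖ ≤ ‖deviation A - deviation B‖ := by
  rw [norm_deviation_le_iff (norm_nonneg _)]
  intro x
  have h := (deviation A - deviation B).le_opNorm (B⁻¹ x)
  have h1 : (deviation A - deviation B) (B⁻¹ x) = A (B⁻¹ x) - x := by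
    simp
  have h2 : ‖B⁻¹ x‖ = ‖x‖ := (B⁻¹ : E ≃ₗᵢ[ℝ] E).norm_map x
  rw [h1, h2] at h
  exact h

/-- A commutator is quadratically closer to the identity than its factors. -/
theorem norm_deviation_commutator (A B : E ≃ₗᵢ[ℝ] E) :
    ‖deviation (A * B * A⁻¹ * B⁻¹)‖ ≤ 2 * ‖deviation A‖ * ‖deviation B‖ := by
  rw [norm_deviation_le_iff (by positivity)]
  intro x
  set y := (B * A)⁻¹ x with hy
  have hx : B (A y) = x := by
    have : (B * A) y = x := (B * A).apply_symm_apply x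
    exact this
  have hyn : ‖y‖ = ‖x‖ := ((B * A)⁻¹ : E ≃ₗᵢ[ℝ] E).norm_map x
  have e1 : (A * B * A⁻¹ * B⁻¹) x = A (B y) := by
    have : (A * B * A⁻¹ * B⁻¹) = A * B * (B * A)⁻¹ := by group
    rw [this]; rfl
  have e2 : A (B y) - x = (A (B y - y) - (B y - y)) - (B (A y - y) - (A y - y)) := by
    simp only [map_sub]
    rw [hx]; abel
  rw [e1, e2]
  calc _ ≤ ‖A (B y - y) - (B y - y)‖ + ‖B (A y - y) - (A y - y)‖ := norm_sub_le _ _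
    _ ≤ ‖deviation A‖ * (‖deviation B‖ * ‖y‖) + ‖deviation B‖ * (‖deviation A‖ * ‖y‖) := by
        gcongr
        · exact (norm_sub_le_deviation A _).trans
            (mul_le_mul_of_nonneg_left (norm_sub_le_deviation B _) (norm_nonneg _))
        · exact (norm_sub_le_deviation B _).trans
            (mul_le_mul_of_nonneg_left (norm_sub_le_deviation A _) (norm_nonneg _))
    _ = _ := by rw [hyn]; ring

/-- The vectors that are maximally displaced by the linear isometry `A`. By the parallelogram law
they form a linear subspace. -/
noncomputable def maxDisplaced (A : E ≃ₗᵢ[ℝ] E) : Submodule ℝ E where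
  carrier := {x | ‖A x - x‖ = ‖deviation A‖ * ‖x‖}
  zero_mem' := by simp
  smul_mem' c x hx := by
    simp only [mem_ofPred_eq, map_smul, ← smul_sub, norm_smul] at hx ⊢
    rw [hx]; ring
  add_mem' {x y} hx hy := by
    simp only [mem_ofPred_eq] at hx hy ⊢
    have h1 := parallelogram_law_with_norm ℝ x y
    have h2 := parallelogram_law_with_norm ℝ (A x - x) (A y - y)
    have h3 := norm_sub_le_deviation A (x + y)
    have h4 := norm_sub_le_deviation A (x - y)
    rw [show A x - x + (A y - y) = A (x + y) - (x + y) by simp only [map_add]; abel,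
      show A x - x - (A y - y) = A (x - y) - (x - y) by simp only [map_sub]; abel, hx, hy] at h2
    have h5 := mul_self_le_mul_self (norm_nonneg _) h4
    refine le_antisymm h3 ?_
    refine (abs_le_of_sq_le_sq' ?_ (norm_nonneg _)).2
    have h6 := congrArg (‖deviation A‖ ^ 2 * ·) h1
    nlinarith

theorem mem_maxDisplaced {A : E ≃ₗᵢ[ℝ] E} {x : E} :
    x ∈ maxDisplaced A ↔ ‖A x - x‖ = ‖deviation A‖ * ‖x‖ := Iff.rfl

theorem map_mem_maxDisplaced {A : E ≃ₗᵢ[ℝ] E} {x : E} :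
    A x ∈ maxDisplaced A ↔ x ∈ maxDisplaced A := by
  rw [mem_maxDisplaced, mem_maxDisplaced, ← map_sub, A.norm_map, A.norm_map]

theorem map_mem_maxDisplaced_orthogonal {A : E ≃ₗᵢ[ℝ] E} {x : E}
    (hx : x ∈ (maxDisplaced A)ᗮ) : A x ∈ (maxDisplaced A)ᗮ := by
  rw [Submodule.mem_orthogonal] at hx ⊢
  intro w hw
  have h : A (A.symm w) = w := A.apply_symm_apply w
  rw [← h, A.inner_map_map]
  exact hx _ (map_mem_maxDisplaced.1 (h.symm ▸ hw))

variable [FiniteDimensional ℝ E]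

/-- The norm of the restriction of `T` to `W` is attained at a unit vector of `W`. For `T = 0`, this
provides a unit vector in `W`. -/
theorem exists_norm_eq_of_sphere (W : Submodule ℝ E) (hW : W ≠ ⊥) (T : E →L[ℝ] E) :
    ∃ x ∈ W, ‖x‖ = 1 ∧ ∀ y ∈ W, ‖T y‖ ≤ ‖T x‖ * ‖y‖ := by
  have hcomp : IsCompact ((W : Set E) ∩ Metric.sphere 0 1) :=
    (isCompact_sphere (0 : E) 1).inter_left W.closed_of_finiteDimensional
  obtain ⟨w, hw, hw0⟩ := Submodule.exists_mem_ne_zero_of_ne_bot hW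
  have hunit : ∀ y ∈ W, y ≠ 0 → ‖y‖⁻¹ • y ∈ (W : Set E) ∩ Metric.sphere 0 1 := fun y hy hy0 =>
    ⟨W.smul_mem _ hy, by simp [norm_smul, inv_mul_cancel₀ (norm_ne_zero_iff.2 hy0)]⟩
  obtain ⟨x, ⟨hxW, hx1⟩, hx⟩ := hcomp.exists_isMaxOn ⟨_, hunit w hw hw0⟩
    (f := fun x => ‖T x‖) (by fun_prop)
  refine ⟨x, hxW, by simpa using hx1, fun y hy => ?_⟩
  rcases eq_or_ne y 0 with rfl | hy0
  · simp
  have := hx (hunit y hy hy0)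
  simp only [mem_ofPred_eq, map_smul, norm_smul, norm_inv, norm_norm] at this
  rwa [inv_mul_le_iff₀ (norm_pos_iff.2 hy0), mul_comm] at this

theorem maxDisplaced_ne_bot [Nontrivial E] (A : E ≃ₗᵢ[ℝ] E) : maxDisplaced A ≠ ⊥ := by
  obtain ⟨x, -, hx1, hx⟩ := exists_norm_eq_of_sphere (⊤ : Submodule ℝ E) top_ne_bot (deviation A)
  have hle : ‖deviation A‖ ≤ ‖deviation A x‖ :=
    ContinuousLinearMap.opNorm_le_bound _ (norm_nonneg _) fun y => hx y trivial
  have hmem : x ∈ maxDisplaced A := by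
    rw [mem_maxDisplaced, hx1, mul_one]
    refine le_antisymm ?_ hle
    have := (deviation A).le_opNorm x
    rwa [hx1, mul_one] at this
  intro h
  rw [h, Submodule.mem_bot] at hmem
  simp [hmem] at hx1

/-- On the orthogonal complement of the maximally displaced vectors the displacement is smaller by a
definite amount. -/
theorem exists_deviation_lt_orthogonal {A : E ≃ₗᵢ[ℝ] E} (hA : 0 < ‖deviation A‖) :
    ∃ m, 0 ≤ m ∧ m < ‖deviation A‖ ∧ ∀ y ∈ (maxDisplaced A)ᗮ, ‖A y - y‖ ≤ m * ‖y‖ := by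
  rcases eq_or_ne (maxDisplaced A)ᗮ ⊥ with h | h
  · refine ⟨0, le_rfl, hA, fun y hy => ?_⟩
    rw [h, Submodule.mem_bot] at hy
    simp [hy]
  obtain ⟨x, hxW, hx1, hx⟩ := exists_norm_eq_of_sphere _ h (deviation A)
  refine ⟨‖deviation A x‖, norm_nonneg _, ?_, fun y hy => hx y hy⟩
  have hle := (deviation A).le_opNorm x
  rw [hx1, mul_one] at hle
  refine lt_of_le_of_ne hle fun heq => ?_
  have hmem : x ∈ maxDisplaced A := by
    rw [mem_maxDisplaced, hx1, mul_one]
    exact heq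
  have := (maxDisplaced A).inner_right_of_mem_orthogonal hmem hxW
  rw [inner_self_eq_zero] at this
  simp [this] at hx1

/-- A group `G` acts on the Euclidean space `E` by the rigid motions `x ↦ A g x + b g`. The action
is crystallographic if it is discrete (`finite`) and cocompact (`cocompact`); both conditions are
stated for the orbit `b` of the origin. In particular, only finitely many elements of `G` act
trivially. -/
structure IsCrystallographic {G : Type*} [Group G] (A : G →* (E ≃ₗᵢ[ℝ] E)) (b : G → E) : Prop where
  trans_mul : ∀ g h, b (g * h) = A g (b h) + b g
  finite : ∀ R : ℝ, {g | ‖b g‖ ≤ R}.Finite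
  cocompact : ∃ R : ℝ, ∀ v : E, ∃ g, ‖v - b g‖ ≤ R

namespace IsCrystallographic

variable {G : Type*} [Group G] {A : G →* (E ≃ₗᵢ[ℝ] E)} {b : G → E}

omit [FiniteDimensional ℝ E] in
theorem trans_one (h : IsCrystallographic A b) : b 1 = 0 := by
  have := h.trans_mul 1 1
  simpa using this

omit [FiniteDimensional ℝ E] in
theorem trans_inv (h : IsCrystallographic A b) (g : G) : b g⁻¹ = -((A g)⁻¹ (b g)) := by
  have := h.trans_mul g⁻¹ g
  rw [inv_mul_cancel, h.trans_one, map_inv] at this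
  exact (neg_eq_of_add_eq_zero_right this.symm).symm

/-- In each direction there are group elements with arbitrarily small rotation part and a
translation part almost in that direction. -/
theorem exists_small_rotation (h : IsCrystallographic A b) {u : E} (hu : ‖u‖ = 1) {ε δ : ℝ}
    (hε : 0 < ε) (hδ : 0 < δ) :
    ∃ g, b g ≠ 0 ∧ ‖deviation (A g)‖ ≤ ε ∧ ‖b g - ‖b g‖ • u‖ ≤ δ * ‖b g‖ := by
  obtain ⟨R, hR⟩ := h.cocompact
  choose γ hγ using fun k : ℕ => hR ((k : ℝ) • u)
  have hbd : ∀ k, dist (deviation (A (γ k))) 0 ≤ 2 := fun k => by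
    rw [dist_zero_right, norm_deviation_le_iff zero_le_two]
    intro x
    calc _ ≤ ‖A (γ k) x‖ + ‖x‖ := norm_sub_le _ _
      _ = _ := by rw [(A (γ k)).norm_map]; ring
  -- the translation part of `γ k` is within `R` of `k • u`, and the rotation parts accumulate
  obtain ⟨i, hi⟩ := exists_dist_le_of_bounded hbd hε
  have hR0 : 0 ≤ R := (norm_nonneg _).trans (hγ 0)
  set C : ℝ := 2 * R + i with hC
  have hC0 : 0 ≤ C := by positivity
  obtain ⟨N, hN⟩ := exists_nat_gt (C + 2 * C / δ)
  obtain ⟨j, hjN, hj⟩ := (frequently_atTop.1 hi) N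
  have hjC : C + 2 * C / δ < j := hN.trans_le (by exact_mod_cast hjN)
  -- the translation part of `γ j * (γ i)⁻¹` is within `C` of `j • u`, which is little for large `j`
  set g := γ j * (γ i)⁻¹
  have hdev : ‖deviation (A g)‖ ≤ ε := by
    rw [map_mul, map_inv]
    refine (norm_deviation_mul_inv _ _).trans ?_
    rwa [← dist_eq_norm]
  have hbi : ‖b (γ i)‖ ≤ R + i := by
    have h1 := norm_sub_norm_le (b (γ i)) ((i : ℝ) • u)
    rw [norm_sub_rev] at h1
    have h2 := hγ i
    rw [norm_smul, hu] at h1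
    simp at h1
    linarith
  have hbg : ‖b g - (j : ℝ) • u‖ ≤ C := by
    have e : b g - (j : ℝ) • u = A (γ j) (b (γ i)⁻¹) - ((j : ℝ) • u - b (γ j)) := by
      rw [h.trans_mul]; abel
    rw [e]
    refine (norm_sub_le _ _).trans ?_
    rw [(A (γ j)).norm_map, h.trans_inv, norm_neg, LinearIsometryEquiv.norm_map]
    have := hγ j
    linarith
  have hlow : (j : ℝ) - C ≤ ‖b g‖ := by
    have h1 := norm_sub_norm_le ((j : ℝ) • u) (b g)
    rw [norm_sub_rev, norm_smul, hu] at h1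
    simp at h1
    linarith
  have hup : ‖b g‖ ≤ j + C := by
    have h1 := norm_sub_norm_le (b g) ((j : ℝ) • u)
    rw [norm_smul, hu] at h1
    simp at h1
    linarith
  have hd : 0 ≤ 2 * C / δ := by positivity
  have hpos : 0 < ‖b g‖ := by linarith
  refine ⟨g, norm_pos_iff.1 hpos, hdev, ?_⟩
  have e : b g - ‖b g‖ • u = (b g - (j : ℝ) • u) + ((j : ℝ) - ‖b g‖) • u := by
    rw [sub_smul]; abel
  have h1 : ‖((j : ℝ) - ‖b g‖) • u‖ ≤ C := by
    rw [norm_smul, hu, mul_one, Real.norm_eq_abs, abs_le]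
    constructor <;> linarith
  have h2 : 2 * C ≤ δ * ‖b g‖ := by
    rw [← div_le_iff₀' hδ]
    linarith
  rw [e]
  refine (norm_add_le _ _).trans ?_
  linarith

omit [FiniteDimensional ℝ E] in
/-- By discreteness, translation parts of minimal length exist in each non-empty set of group
elements. -/
theorem exists_minimal (h : IsCrystallographic A b) (P : G → Prop) (hP : ∃ g, P g) :
    ∃ g, P g ∧ ∀ g', P g' → ‖b g‖ ≤ ‖b g'‖ := by
  obtain ⟨g₀, hg₀⟩ := hP
  obtain ⟨g, hg, hmin⟩ := Set.exists_min_image ({g | ‖b g‖ ≤ ‖b g₀‖} ∩ {g | P g})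
    (fun g => ‖b g‖) ((h.finite _).inter_of_left _) ⟨g₀, le_refl ‖b g₀‖, hg₀⟩
  refine ⟨g, hg.2, fun g' hg' => ?_⟩
  rcases le_total ‖b g'‖ ‖b g₀‖ with hle | hle
  · exact hmin g' ⟨hle, hg'⟩
  · exact hg.1.trans hle

/-- An element whose rotation part is close to the identity is a translation. -/
theorem eq_one_of_deviation_le (h : IsCrystallographic A b) (g : G)
    (hg : ‖deviation (A g)‖ ≤ 1 / 2) : A g = 1 := by
  by_contra hne
  -- the counterexample `α` with the shortest translation part
  obtain ⟨α, ⟨hα, hα1⟩, hαmin⟩ := h.exists_minimal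
    (fun g => ‖deviation (A g)‖ ≤ 1 / 2 ∧ A g ≠ 1) ⟨g, hg, hne⟩
  set m := ‖deviation (A α)‖ with hm
  have hm0 : 0 < m := norm_pos_iff.2 fun h0 => hα1 (deviation_eq_zero_iff.1 h0)
  have : Nontrivial E := by
    by_contra hnt
    rw [not_nontrivial_iff_subsingleton] at hnt
    exact hα1 (LinearIsometryEquiv.ext fun x => Subsingleton.elim _ _)
  obtain ⟨m', hm'0, hm'm, hm'⟩ := exists_deviation_lt_orthogonal hm0
  set W := maxDisplaced (A α) with hW
  obtain ⟨u, huW, hu1, -⟩ := exists_norm_eq_of_sphere W (maxDisplaced_ne_bot _) 0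
  have split : ∀ x : E, ∃ y ∈ W, ∃ z ∈ Wᗮ, x = y + z ∧ ‖x‖ ^ 2 = ‖y‖ ^ 2 + ‖z‖ ^ 2 := fun x => by
    obtain ⟨y, hy, z, hz, rfl⟩ := W.exists_add_mem_mem_orthogonal x
    refine ⟨y, hy, z, hz, rfl, ?_⟩
    have := norm_add_sq_eq_norm_sq_add_norm_sq_of_inner_eq_zero y z
      (W.inner_right_of_mem_orthogonal hy hz)
    nlinarith
  -- `β` is a shortest element with small rotation part and translation part almost in `W`
  obtain ⟨β, ⟨hβ, y, hy, z, hz, hyz, hlt⟩, hβmin⟩ := h.exists_minimal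
    (fun g => ‖deviation (A g)‖ ≤ (m - m') / 16 ∧
      ∃ y ∈ W, ∃ z ∈ Wᗮ, b g = y + z ∧ ‖z‖ < ‖y‖) (by
    obtain ⟨g, hg0, hg1, hg2⟩ := h.exists_small_rotation hu1 (ε := (m - m') / 16) (δ := 1 / 2)
      (by linarith) (by norm_num)
    obtain ⟨y, hy, z, hz, hyz, hpy⟩ := split (b g)
    refine ⟨g, hg1, y, hy, z, hz, hyz, ?_⟩
    have e : b g - ‖b g‖ • u = (y - ‖b g‖ • u) + z := by rw [hyz]; abel
    have h1 := norm_add_sq_eq_norm_sq_add_norm_sq_of_inner_eq_zero (y - ‖b g‖ • u) z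
      (W.inner_right_of_mem_orthogonal (W.sub_mem hy (W.smul_mem _ huW)) hz)
    rw [← e] at h1
    have h2 : 0 < ‖b g‖ := norm_pos_iff.2 hg0
    have h3 : ‖z‖ ≤ 1 / 2 * ‖b g‖ := by
      refine le_trans ?_ hg2
      exact abs_le_of_sq_le_sq' (by nlinarith [sq_nonneg ‖y - ‖b g‖ • u‖]) (norm_nonneg _) |>.2
    refine lt_of_pow_lt_pow_left₀ 2 (norm_nonneg _) ?_
    nlinarith [norm_nonneg z])
  set B := A β
  -- the commutator `c` satisfies the conditions imposed on `β`, but has a shorter translation part: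
  -- this is `(A α - 1) (b β)` up to a remainder `r`, which the bound `(m - m') / 16` makes small
  set c := α * β * α⁻¹ * β⁻¹ with hc
  set D := A c with hD
  have hDc : D = A α * B * (A α)⁻¹ * B⁻¹ := by simp [hD, hc, B]
  have hD1 : ‖deviation D‖ ≤ ‖deviation B‖ := by
    rw [hDc]
    refine (norm_deviation_commutator _ _).trans ?_
    nlinarith [norm_nonneg (deviation B)]
  -- the translation part of the commutator
  set r : E := (b β - D (b β)) + A α ((A α)⁻¹ (b α) - B ((A α)⁻¹ (b α))) with hr
  have hbc : b c = (A α (b β) - b β) + r := by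
    have e1 : c * (β * α) = α * β := by rw [hc]; group
    have e2 := congrArg b e1
    rw [h.trans_mul c, h.trans_mul β α, h.trans_mul α β] at e2
    have e3 : D (B (b α)) = A α (B ((A α)⁻¹ (b α))) := by
      rw [hDc]
      have : A α * B * (A α)⁻¹ * B⁻¹ * B = A α * B * (A α)⁻¹ := by group
      have h2 := congrArg (fun T : E ≃ₗᵢ[ℝ] E => T (b α)) this
      exact h2
    have e4 : A α ((A α)⁻¹ (b α)) = b α := (A α).apply_symm_apply _
    rw [map_add, e3] at e2
    rw [hr, map_sub, e4, eq_sub_of_add_eq' e2]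
    abel
  have hrle : ‖r‖ ≤ 2 * ‖deviation B‖ * ‖b β‖ := by
    rcases eq_or_ne B 1 with hB | hB
    · have hD' : D = 1 := by rw [hDc, hB]; group
      rw [hr, hD', hB]
      have : ∀ x : E, (1 : E ≃ₗᵢ[ℝ] E) x = x := fun x => rfl
      simp only [this, sub_self, map_zero, add_zero, norm_zero]
      positivity
    · have h1 : ‖b α‖ ≤ ‖b β‖ := hαmin β ⟨by linarith, hB⟩
      have h2 : ‖b β - D (b β)‖ ≤ ‖deviation B‖ * ‖b β‖ := by
        rw [norm_sub_rev]
        exact (norm_sub_le_deviation D _).trans (by gcongr)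
      have h3 : ‖A α ((A α)⁻¹ (b α) - B ((A α)⁻¹ (b α)))‖ ≤ ‖deviation B‖ * ‖b α‖ := by
        rw [(A α).norm_map, norm_sub_rev]
        refine (norm_sub_le_deviation B _).trans ?_
        rw [LinearIsometryEquiv.norm_map]
      refine (norm_add_le _ _).trans ?_
      nlinarith [norm_nonneg (deviation B)]
  have hb2 : ‖b β‖ ≤ 2 * ‖y‖ := by
    rw [hyz]
    refine (norm_add_le _ _).trans ?_
    linarith
  have hy0 : 0 < ‖y‖ := (norm_nonneg _).trans_lt hlt
  have hr2 : ‖r‖ ≤ (m - m') / 4 * ‖y‖ := by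
    refine hrle.trans ?_
    nlinarith [norm_nonneg (deviation B), norm_nonneg (b β)]
  obtain ⟨ry, hry, rz, hrz, hryz, hrn⟩ := split r
  have hryle : ‖ry‖ ≤ ‖r‖ := abs_le_of_sq_le_sq' (by nlinarith [sq_nonneg ‖rz‖]) (norm_nonneg _) |>.2
  have hrzle : ‖rz‖ ≤ ‖r‖ := abs_le_of_sq_le_sq' (by nlinarith [sq_nonneg ‖ry‖]) (norm_nonneg _) |>.2
  have hAy : ‖A α y - y‖ = m * ‖y‖ := hy
  have hAz : ‖A α z - z‖ ≤ m' * ‖z‖ := hm' z hz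
  -- `A α - 1` stretches the component in `W` by `m`, and the other one by at most `m' < m`, so that
  -- `c` satisfies the conditions on `β`
  have hnew : ‖b β‖ ≤ ‖b c‖ := by
    refine hβmin c ⟨hD1.trans hβ, (A α y - y) + ry, ?_, (A α z - z) + rz, ?_, ?_, ?_⟩
    · exact W.add_mem (W.sub_mem (map_mem_maxDisplaced.2 hy) hy) hry
    · exact Wᗮ.add_mem (Wᗮ.sub_mem (map_mem_maxDisplaced_orthogonal hz) hz) hrz
    · rw [hbc, hyz, hryz, map_add]; abel
    · have h1 := norm_add_le (A α z - z) rz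
      have h2 := norm_sub_le (A α y - y + ry) ry
      rw [add_sub_cancel_right, hAy] at h2
      have h3 : m' * ‖z‖ ≤ m' * ‖y‖ := by gcongr
      nlinarith
  -- but the translation part of `c` is shorter, as `‖A α - 1‖ ≤ 1 / 2`
  have hlt2 : ‖b c‖ < ‖b β‖ := by
    have hyβ : ‖y‖ ≤ ‖b β‖ := by
      have h1 := norm_add_sq_eq_norm_sq_add_norm_sq_of_inner_eq_zero y z
        (W.inner_right_of_mem_orthogonal hy hz)
      rw [← hyz] at h1
      exact abs_le_of_sq_le_sq' (by nlinarith [sq_nonneg ‖z‖]) (norm_nonneg _) |>.2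
    have h1 := norm_sub_le_deviation (A α) (b β)
    rw [hbc]
    refine (norm_add_le _ _).trans_lt ?_
    have h2 : ‖deviation (A α)‖ * ‖b β‖ ≤ 1 / 2 * ‖b β‖ := by gcongr
    nlinarith
  exact absurd hnew (not_le.2 hlt2)

/-- The translations in a crystallographic group span. -/
theorem span_translations (h : IsCrystallographic A b) :
    Submodule.span ℝ {v | ∃ g, A g = 1 ∧ b g = v} = ⊤ := by
  set L := Submodule.span ℝ {v | ∃ g, A g = 1 ∧ b g = v} with hL
  by_contra hne
  have hbot : Lᗮ ≠ ⊥ := fun h0 => hne (Submodule.orthogonal_eq_bot_iff.1 h0)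
  obtain ⟨u, huL, hu1, -⟩ := exists_norm_eq_of_sphere Lᗮ hbot 0
  -- an element with a small rotation part is a translation, so it cannot point almost in the
  -- direction of a vector `u` that is orthogonal to all translations
  obtain ⟨g, hg0, hg1, hg2⟩ := h.exists_small_rotation hu1 (ε := 1 / 2) (δ := 1 / 2)
    (by norm_num) (by norm_num)
  have hbL : b g ∈ L := Submodule.subset_span ⟨g, h.eq_one_of_deviation_le g hg1, rfl⟩
  have horth : inner ℝ (b g) (-(‖b g‖ • u)) = 0 :=
    L.inner_right_of_mem_orthogonal hbL (Lᗮ.neg_mem (Lᗮ.smul_mem _ huL))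
  have h1 := norm_add_sq_eq_norm_sq_add_norm_sq_of_inner_eq_zero _ _ horth
  rw [← sub_eq_add_neg, norm_neg, norm_smul, hu1] at h1
  have h2 : 0 < ‖b g‖ := norm_pos_iff.2 hg0
  simp only [norm_norm, mul_one] at h1
  nlinarith [norm_nonneg (b g - ‖b g‖ • u)]

/-- The point group of a crystallographic group is finite. -/
theorem finite_range (h : IsCrystallographic A b) : (Set.range A).Finite := by
  by_contra hinf
  set f := Set.Infinite.natEmbedding _ hinf
  have hbd : ∀ k, dist (deviation (f k).1) 0 ≤ 2 := fun k => by
    rw [dist_zero_right, norm_deviation_le_iff zero_le_two]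
    intro x
    calc _ ≤ ‖(f k).1 x‖ + ‖x‖ := norm_sub_le _ _
      _ = _ := by rw [(f k).1.norm_map]; ring
  obtain ⟨i, hi⟩ := exists_dist_le_of_bounded hbd (ε := 1 / 2) (by norm_num)
  obtain ⟨j, hij, hj⟩ := (frequently_atTop.1 hi) (i + 1)
  obtain ⟨g, hg⟩ := (f i).2
  obtain ⟨g', hg'⟩ := (f j).2
  have h1 : A (g' * g⁻¹) = 1 := by
    refine h.eq_one_of_deviation_le _ ?_
    rw [map_mul, map_inv, hg, hg']
    refine (norm_deviation_mul_inv _ _).trans ?_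
    rwa [← dist_eq_norm]
  rw [map_mul, map_inv, mul_inv_eq_one, hg, hg'] at h1
  have := f.injective (Subtype.ext h1)
  omega

end IsCrystallographic

end Bieberbach

/-! ### Differential forms on vector spaces: pull-backs and the homotopy formula -/

section Forms

theorem two_le_smoothness : minSmoothness ℝ 2 ≤ (∞ : WithTop ℕ∞) := by
  rw [minSmoothness_of_isRCLikeNormedField]
  exact WithTop.coe_le_coe.2 le_top

variable {E : Type*} [NormedAddCommGroup E] [NormedSpace ℝ E]
  {E' : Type*} [NormedAddCommGroup E'] [NormedSpace ℝ E']
  {G : Type*} [NormedAddCommGroup G] [NormedSpace ℝ G]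
  {F : Type*} [NormedAddCommGroup F] [NormedSpace ℝ F]

/-- The projection of multilinear forms onto alternating forms. -/
noncomputable def alternatizationCLM (E : Type*) [NormedAddCommGroup E] [NormedSpace ℝ E]
    (F : Type*) [NormedAddCommGroup F] [NormedSpace ℝ F] (k : ℕ) :
    ContinuousMultilinearMap ℝ (fun _ : Fin k => E) F →L[ℝ] E [⋀^Fin k]→L[ℝ] F :=
  LinearMap.mkContinuous
    { toFun := fun f => ((k.factorial : ℝ)⁻¹) • ContinuousMultilinearMap.alternatization f
      map_add' := fun f g => by rw [map_add, smul_add]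
      map_smul' := fun c f => by
        ext v
        simp only [ContinuousAlternatingMap.smul_apply, RingHom.id_apply,
          ContinuousMultilinearMap.alternatization_apply_apply, smul_apply,
          Finset.smul_sum]
        refine Finset.sum_congr rfl fun σ _ => ?_
        rw [smul_comm c, smul_comm c] }
    1 (fun f => by
      refine ContinuousAlternatingMap.opNorm_le_bound _ (by positivity) fun v => ?_
      have hk : (0 : ℝ) < k.factorial := by exact_mod_cast k.factorial_pos
      simp only [LinearMap.coe_mk, AddHom.coe_mk, ContinuousAlternatingMap.smul_apply,
        ContinuousMultilinearMap.alternatization_apply_apply, norm_smul, norm_inv, one_mul]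
      rw [Real.norm_of_nonneg hk.le, inv_mul_le_iff₀ hk]
      refine (norm_sum_le _ _).trans ?_
      have h : ∀ σ : Equiv.Perm (Fin k),
          ‖Equiv.Perm.sign σ • f (v ∘ σ)‖ ≤ ‖f‖ * ∏ i, ‖v i‖ := fun σ => by
        have h1 : ‖Equiv.Perm.sign σ • f (v ∘ σ)‖ = ‖f (v ∘ σ)‖ := by
          rcases Int.units_eq_one_or (Equiv.Perm.sign σ) with h | h <;> simp [h]
        rw [h1]
        refine (f.le_opNorm _).trans_eq ?_
        congr 1
        exact Equiv.prod_comp σ fun i => ‖v i‖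
      refine (Finset.sum_le_sum fun σ _ => h σ).trans_eq ?_
      simp [Fintype.card_perm])

theorem alternatizationCLM_coe {k : ℕ} (f : E [⋀^Fin k]→L[ℝ] F) :
    alternatizationCLM E F k f.toContinuousMultilinearMap = f := by
  ext v
  have h : ∀ σ : Equiv.Perm (Fin k), Equiv.Perm.sign σ • f (v ∘ σ) = f v := fun σ => by
    have h1 : f (v ∘ σ) = Equiv.Perm.sign σ • f v := f.toAlternatingMap.map_perm v σ
    rw [h1, smul_smul, Int.units_mul_self, one_smul]
  have hk : (k.factorial : ℝ) ≠ 0 := by exact_mod_cast k.factorial_ne_zero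
  change (k.factorial : ℝ)⁻¹ •
    (ContinuousMultilinearMap.alternatization f.toContinuousMultilinearMap) v = f v
  rw [ContinuousMultilinearMap.alternatization_apply_apply]
  simp only [ContinuousAlternatingMap.coe_toContinuousMultilinearMap, h, Finset.sum_const,
    Finset.card_univ, Fintype.card_perm, Fintype.card_fin]
  rw [← Nat.cast_smul_eq_nsmul ℝ, smul_smul, inv_mul_cancel₀ hk, one_smul]

/-- The pull-back of an alternating form by a linear map depends smoothly on both. This is known for
multilinear maps, from which alternating maps are obtained by a continuous projection. -/
theorem contDiff_compContinuousLinearMap {k : ℕ} {m : WithTop ℕ∞} :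
    ContDiff ℝ m (fun p : (E' [⋀^Fin k]→L[ℝ] F) × (E →L[ℝ] E') =>
      p.1.compContinuousLinearMap p.2) := by
  have h : ContDiff ℝ m (fun p : (E' [⋀^Fin k]→L[ℝ] F) × (E →L[ℝ] E') =>
      alternatizationCLM E F k
        ((ContinuousMultilinearMap.compContinuousLinearMapContinuousMultilinear ℝ
          (fun _ : Fin k => E) (fun _ : Fin k => E') F (fun _ => p.2))
          (ContinuousAlternatingMap.toContinuousMultilinearMapCLM ℝ p.1))) := by
    refine (alternatizationCLM E F k).contDiff.comp ?_
    refine ContDiff.clm_apply ?_ ?_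
    · exact (ContinuousMultilinearMap.contDiff _).comp (contDiff_pi.2 fun _ => contDiff_snd)
    · exact (ContinuousLinearMap.contDiff _).comp contDiff_fst
  convert h using 1
  ext1 p
  exact (alternatizationCLM_coe (p.1.compContinuousLinearMap p.2)).symm

theorem ContDiffOn.form_pullback {k : ℕ} {m : WithTop ℕ∞} {α : G → E' [⋀^Fin k]→L[ℝ] F}
    {L : G → E →L[ℝ] E'} {s : Set G} (hα : ContDiffOn ℝ m α s) (hL : ContDiffOn ℝ m L s) :
    ContDiffOn ℝ m (fun x => (α x).compContinuousLinearMap (L x)) s :=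
  contDiff_compContinuousLinearMap.comp_contDiffOn (hα.prodMk hL)

end Forms

section Parametric

universe u

variable {E : Type u} [NormedAddCommGroup E] [NormedSpace ℝ E] [FiniteDimensional ℝ E]

/-- Differentiation under the integral. -/
theorem hasFDerivAt_intervalIntegral_of_contDiffOn {W : Type u} [NormedAddCommGroup W]
    [NormedSpace ℝ W] [CompleteSpace W] {f : ℝ × E → W} {O : Set (ℝ × E)} (hO : IsOpen O)
    (hf : ContDiffOn ℝ 1 f O) {z : E} (hz : ∀ t ∈ Icc (0 : ℝ) 1, (t, z) ∈ O) :
    HasFDerivAt (fun z => ∫ t in (0 : ℝ)..1, f (t, z))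
      (∫ t in (0 : ℝ)..1, (fderiv ℝ f (t, z)).comp (ContinuousLinearMap.inr ℝ ℝ E)) z := by
  obtain ⟨v, hv, hvO⟩ : ∃ v ∈ 𝓝 z, Icc (0 : ℝ) 1 ×ˢ v ⊆ O := by
    obtain ⟨u, v, -, hvo, hu, hvz, huv⟩ := generalized_tube_lemma (isCompact_Icc (a := (0 : ℝ)) (b := 1))
      (isCompact_singleton (x := z)) hO (by
        rintro ⟨t, y⟩ ⟨ht, hy⟩
        obtain rfl : y = z := hy
        exact hz t ht)
    exact ⟨v, hvo.mem_nhds (hvz rfl), (prod_mono_left hu).trans huv⟩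
  obtain ⟨δ, hδ, hδv⟩ := Metric.nhds_basis_closedBall.mem_iff.1 hv
  have hsub : Icc (0 : ℝ) 1 ×ˢ Metric.closedBall z δ ⊆ O := (prod_mono_right hδv).trans hvO
  have hcont : ContinuousOn f O := hf.continuousOn
  have hdcont : ContinuousOn (fderiv ℝ f) O := hf.continuousOn_fderiv_of_isOpen hO le_rfl
  have hslice : ∀ y ∈ Metric.closedBall z δ, ContinuousOn (fun t => f (t, y)) (uIcc 0 1) :=
    fun y hy => hcont.comp (by fun_prop) fun t ht => hsub ⟨by rwa [uIcc_of_le zero_le_one] at ht, hy⟩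
  have hmem : ∀ t ∈ Ι (0 : ℝ) 1, t ∈ Icc (0 : ℝ) 1 := fun t ht => by
    rw [uIoc_of_le zero_le_one] at ht; exact ⟨ht.1.le, ht.2⟩
  have hdslice : ContinuousOn
      (fun t => (fderiv ℝ f (t, z)).comp (ContinuousLinearMap.inr ℝ ℝ E)) (uIcc 0 1) := by
    refine ContinuousOn.clm_comp ?_ continuousOn_const
    exact hdcont.comp (by fun_prop) fun t ht =>
      hsub ⟨by rwa [uIcc_of_le zero_le_one] at ht, Metric.mem_closedBall_self hδ.le⟩
  obtain ⟨C, hC⟩ := ((isCompact_Icc (a := (0 : ℝ)) (b := 1)).prod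
    (isCompact_closedBall z δ)).exists_bound_of_continuousOn
      (f := fun p => (fderiv ℝ f p).comp (ContinuousLinearMap.inr ℝ ℝ E))
      ((hdcont.mono hsub).clm_comp continuousOn_const)
  refine intervalIntegral.hasFDerivAt_integral_of_dominated_of_fderiv_le
    (s := Metric.ball z δ) (bound := fun _ => C)
    (F' := fun y t => (fderiv ℝ f (t, y)).comp (ContinuousLinearMap.inr ℝ ℝ E))
    (Metric.ball_mem_nhds z hδ) ?_ ?_ ?_ ?_ ?_ ?_
  · filter_upwards [Metric.ball_mem_nhds z hδ] with y hy
    exact ((hslice y (Metric.ball_subset_closedBall hy)).mono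
      uIoc_subset_uIcc).aestronglyMeasurable measurableSet_uIoc
  · exact (hslice z (Metric.mem_closedBall_self hδ.le)).intervalIntegrable
  · exact (hdslice.mono uIoc_subset_uIcc).aestronglyMeasurable measurableSet_uIoc
  · exact .of_forall fun t ht y hy => hC (t, y) ⟨hmem t ht, Metric.ball_subset_closedBall hy⟩
  · exact intervalIntegrable_const
  · refine .of_forall fun t ht y hy => ?_
    have hmO : (t, y) ∈ O := hsub ⟨hmem t ht, Metric.ball_subset_closedBall hy⟩
    have h1 : HasFDerivAt f (fderiv ℝ f (t, y)) (t, y) :=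
      ((hf.contDiffAt (hO.mem_nhds hmO)).differentiableAt one_ne_zero).hasFDerivAt
    exact h1.comp y (hasFDerivAt_prodMk_right t y)

theorem fderiv_intervalIntegral_apply {W : Type u} [NormedAddCommGroup W]
    [NormedSpace ℝ W] [CompleteSpace W] {f : ℝ × E → W} {O : Set (ℝ × E)} (hO : IsOpen O)
    (hf : ContDiffOn ℝ 1 f O) {z : E} (hz : ∀ t ∈ Icc (0 : ℝ) 1, (t, z) ∈ O) (x : E) :
    fderiv ℝ (fun z => ∫ t in (0 : ℝ)..1, f (t, z)) z x =
      ∫ t in (0 : ℝ)..1, fderiv ℝ f (t, z) (0, x) := by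
  rw [(hasFDerivAt_intervalIntegral_of_contDiffOn hO hf hz).fderiv,
    ContinuousLinearMap.intervalIntegral_apply]
  · rfl
  · refine ContinuousOn.intervalIntegrable (ContinuousOn.clm_comp ?_ continuousOn_const)
    exact (hf.continuousOn_fderiv_of_isOpen hO le_rfl).comp (by fun_prop) fun t ht =>
      hz t (by rwa [uIcc_of_le zero_le_one] at ht)

theorem contDiffOn_intervalIntegral {W : Type u} [NormedAddCommGroup W]
    [NormedSpace ℝ W] [CompleteSpace W] {f : ℝ × E → W} {O : Set (ℝ × E)} (hO : IsOpen O)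
    (hf : ContDiffOn ℝ ∞ f O) {U : Set E} (hU : IsOpen U)
    (hUO : ∀ z ∈ U, ∀ t ∈ Icc (0 : ℝ) 1, (t, z) ∈ O) :
    ContDiffOn ℝ ∞ (fun z => ∫ t in (0 : ℝ)..1, f (t, z)) U := by
  rw [contDiffOn_infty]
  intro k
  induction k generalizing W with
  | zero =>
    exact contDiffOn_zero.2 fun z hz => (hasFDerivAt_intervalIntegral_of_contDiffOn hO
      (hf.of_le (by exact_mod_cast le_top)) (hUO z hz)).continuousAt.continuousWithinAt
  | succ k ih =>
    have hd : ∀ z ∈ U, HasFDerivAt (fun z => ∫ t in (0 : ℝ)..1, f (t, z))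
      (∫ t in (0 : ℝ)..1, (fderiv ℝ f (t, z)).comp (ContinuousLinearMap.inr ℝ ℝ E)) z :=
      fun z hz => hasFDerivAt_intervalIntegral_of_contDiffOn hO
        (hf.of_le (by exact_mod_cast le_top)) (hUO z hz)
    have hf' : ContDiffOn ℝ ∞
        (fun p => (fderiv ℝ f p).comp (ContinuousLinearMap.inr ℝ ℝ E)) O :=
      (hf.fderiv_of_isOpen hO le_rfl).clm_comp contDiffOn_const
    have := ih hf'
    rw [Nat.cast_add, Nat.cast_one, contDiffOn_succ_iff_fderiv_of_isOpen hU]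
    refine ⟨fun z hz => (hd z hz).differentiableAt.differentiableWithinAt, by simp, ?_⟩
    exact this.congr fun z hz => (hd z hz).fderiv

variable {F : Type u} [NormedAddCommGroup F] [NormedSpace ℝ F] [CompleteSpace F] {m : ℕ}

set_option synthInstance.maxHeartbeats 200000 in
/-- Contraction of a form on `ℝ × E` with the vector field `∂/∂t`, restricted to `E`. -/
noncomputable def contractTime (E : Type u) [NormedAddCommGroup E] [NormedSpace ℝ E]
    (F : Type u) [NormedAddCommGroup F] [NormedSpace ℝ F] (m : ℕ) :
    ((ℝ × E) [⋀^Fin (m + 1)]→L[ℝ] F) →L[ℝ] (E [⋀^Fin m]→L[ℝ] F) :=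
  (ContinuousAlternatingMap.compContinuousLinearMapCLM (ContinuousLinearMap.inr ℝ ℝ E)).comp
    ((ContinuousLinearMap.apply ℝ ((ℝ × E) [⋀^Fin m]→L[ℝ] F) ((1, 0) : ℝ × E)).comp
      (ContinuousAlternatingMap.curryLeftLI (𝕜 := ℝ) (E := ℝ × E) (F := F)
        (n := m)).toContinuousLinearMap)

set_option synthInstance.maxHeartbeats 200000 in
/-- The homotopy formula: if `η` is a closed form on a neighbourhood of `[0, 1] × U`, then
`∫₀¹ ι(∂/∂t) η dt` is a primitive of the difference of the restrictions of `η` to `{1} × U`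
and `{0} × U`. -/
theorem extDeriv_integral_contractTime {η : ℝ × E → (ℝ × E) [⋀^Fin (m + 1)]→L[ℝ] F}
    {O : Set (ℝ × E)} (hO : IsOpen O) (hη : ContDiffOn ℝ 1 η O)
    (hclosed : ∀ p ∈ O, extDeriv η p = 0) {z : E} (hz : ∀ t ∈ Icc (0 : ℝ) 1, (t, z) ∈ O) :
    extDeriv (fun z => ∫ t in (0 : ℝ)..1, contractTime E F m (η (t, z))) z =
      (η (1, z)).compContinuousLinearMap (ContinuousLinearMap.inr ℝ ℝ E) -
        (η (0, z)).compContinuousLinearMap (ContinuousLinearMap.inr ℝ ℝ E) := by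
  have hηd : ∀ p ∈ O, HasFDerivAt η (fderiv ℝ η p) p := fun p hp =>
    ((hη.contDiffAt (hO.mem_nhds hp)).differentiableAt one_ne_zero).hasFDerivAt
  have hηc : ContinuousOn (fderiv ℝ η) O := hη.continuousOn_fderiv_of_isOpen hO le_rfl
  have hseg : MapsTo (fun t : ℝ => (t, z)) (uIcc 0 1) O := fun t ht =>
    hz t (by rwa [uIcc_of_le zero_le_one] at ht)
  have hc1 : ContinuousOn (fun t : ℝ => fderiv ℝ η (t, z)) (uIcc 0 1) :=
    hηc.comp (by fun_prop) hseg
  have hd' : ∀ t ∈ uIcc (0 : ℝ) 1, fderiv ℝ (contractTime E F m ∘ η) (t, z) =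
      (contractTime E F m).comp (fderiv ℝ η (t, z)) := fun t ht =>
    ((contractTime E F m).hasFDerivAt.comp (t, z) (hηd _ (hseg ht))).fderiv
  have hint : ∀ x : E, ∀ a : Fin m → E,
      (fderiv ℝ (fun z => ∫ t in (0 : ℝ)..1, contractTime E F m (η (t, z))) z x) a =
      ∫ t in (0 : ℝ)..1, (fderiv ℝ η (t, z) (0, x)) (Matrix.vecCons (1, 0) fun i => (0, a i)) := by
    intro x a
    have h1 := fderiv_intervalIntegral_apply hO
      ((contractTime E F m).contDiff.comp_contDiffOn hη) hz x
    have h2 : ∫ t in (0 : ℝ)..1, fderiv ℝ (contractTime E F m ∘ η) (t, z) (0, x) =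
        ∫ t in (0 : ℝ)..1, contractTime E F m (fderiv ℝ η (t, z) (0, x)) :=
      intervalIntegral.integral_congr fun t ht => by simp only [hd' t ht]; rfl
    rw [h2] at h1
    have hc2 : IntervalIntegrable (fun t => contractTime E F m (fderiv ℝ η (t, z) (0, x)))
        MeasureTheory.volume 0 1 :=
      ((contractTime E F m).continuous.comp_continuousOn
        (hc1.clm_apply continuousOn_const)).intervalIntegrable
    refine (congrArg (fun θ => θ a) h1).trans ?_
    exact ((ContinuousAlternatingMap.apply ℝ E F a).intervalIntegral_comp_comm hc2).symm
  ext v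
  set w : Fin (m + 2) → ℝ × E := Matrix.vecCons (1, 0) fun i => (0, v i) with hw
  have hG : ∀ t ∈ uIcc (0 : ℝ) 1, HasDerivAt (fun t : ℝ => η (t, z) fun i => (0, v i))
      ((fderiv ℝ η (t, z) (1, 0)) fun i => (0, v i)) t := fun t ht => by
    have h1 : HasFDerivAt (fun p => η p fun i => (0, v i)) _ (t, z) :=
      (ContinuousAlternatingMap.apply ℝ (ℝ × E) F fun i => ((0 : ℝ), v i)).hasFDerivAt.comp (t, z)
        (hηd _ (hseg ht))
    exact h1.comp_hasDerivAt t ((hasDerivAt_id t).prodMk (hasDerivAt_const t z))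
  -- `η` is closed: its exterior derivative vanishes on `∂/∂t` and `v`
  have hsum : ∀ t ∈ uIcc (0 : ℝ) 1,
      ∑ i : Fin (m + 1), (-1 : ℤ) ^ (i : ℕ) • (fderiv ℝ η (t, z) (0, v i))
        (Matrix.vecCons (1, 0) fun j => (0, i.removeNth v j)) =
      (fderiv ℝ η (t, z) (1, 0)) fun i => (0, v i) := fun t ht => by
    have h1 := congrArg (fun θ => θ w) (hclosed _ (hseg ht))
    simp only [extDeriv, ContinuousAlternatingMap.alternatizeUncurryFin_apply] at h1
    change _ = (0 : F) at h1
    rw [Fin.sum_univ_succ] at h1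
    have e0 : (0 : Fin (m + 2)).removeNth w = fun i => (0, v i) := by
      ext1 i; simp [hw, Fin.removeNth]
    have e1 : ∀ i : Fin (m + 1), i.succ.removeNth w =
        Matrix.vecCons (1, 0) fun j => (0, i.removeNth v j) := fun i => by
      ext1 j
      refine Fin.cases ?_ (fun j => ?_) j
      · simp [hw, Fin.removeNth]
      · simp [hw, Fin.removeNth]
    rw [e0] at h1
    simp only [e1, Fin.val_succ, Fin.val_zero, pow_succ, pow_zero, one_smul, mul_neg, mul_one,
      neg_smul, Finset.sum_neg_distrib] at h1
    have ew0 : w 0 = (1, 0) := rfl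
    have ew : ∀ i : Fin (m + 1), w i.succ = (0, v i) := fun i => rfl
    simp only [ew0, ew] at h1
    rw [add_neg_eq_zero] at h1
    exact h1.symm
  have hci : ∀ i : Fin (m + 1), ContinuousOn (fun t : ℝ =>
      (-1 : ℤ) ^ (i : ℕ) • (fderiv ℝ η (t, z) (0, v i))
        (Matrix.vecCons (1, 0) fun j => (0, i.removeNth v j))) (uIcc 0 1) := fun i => by
    refine ContinuousOn.zsmul ?_ _
    exact (ContinuousAlternatingMap.apply ℝ (ℝ × E) F _).continuous.comp_continuousOn
      (hc1.clm_apply continuousOn_const)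
  have hcG : ContinuousOn (fun t : ℝ => (fderiv ℝ η (t, z) (1, 0)) fun i => ((0 : ℝ), v i))
      (uIcc 0 1) :=
    (ContinuousAlternatingMap.apply ℝ (ℝ × E) F _).continuous.comp_continuousOn
      (hc1.clm_apply continuousOn_const)
  simp only [extDeriv, ContinuousAlternatingMap.alternatizeUncurryFin_apply, hint]
  calc ∑ i : Fin (m + 1), (-1 : ℤ) ^ (i : ℕ) • ∫ t in (0 : ℝ)..1,
        (fderiv ℝ η (t, z) (0, v i)) (Matrix.vecCons (1, 0) fun j => (0, i.removeNth v j))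
      = ∑ i : Fin (m + 1), ∫ t in (0 : ℝ)..1, (-1 : ℤ) ^ (i : ℕ) •
        (fderiv ℝ η (t, z) (0, v i)) (Matrix.vecCons (1, 0) fun j => (0, i.removeNth v j)) := by
        refine Finset.sum_congr rfl fun i _ => ?_
        simp only [← Int.cast_smul_eq_zsmul ℝ]
        rw [intervalIntegral.integral_smul]
    _ = ∫ t in (0 : ℝ)..1, (fderiv ℝ η (t, z) (1, 0)) fun i => (0, v i) := by
        rw [← intervalIntegral.integral_finsetSum fun i _ => (hci i).intervalIntegrable]
        exact intervalIntegral.integral_congr fun t ht => hsum t ht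
    _ = _ := by
        rw [intervalIntegral.integral_eq_sub_of_hasDerivAt hG hcG.intervalIntegrable]
        rfl

/-- The contraction `(t, z) ↦ P z + t Q z` onto the range of `P`. -/
noncomputable def contraction (P Q : E →L[ℝ] E) (p : ℝ × E) : E := P p.2 + p.1 • Q p.2

omit [FiniteDimensional ℝ E] in
theorem contDiff_contraction (P Q : E →L[ℝ] E) : ContDiff ℝ ∞ (contraction P Q) := by
  unfold contraction; fun_prop

omit [FiniteDimensional ℝ E] in
theorem fderiv_contraction (P Q : E →L[ℝ] E) (t : ℝ) (z : E) (s : ℝ) (x : E) :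
    fderiv ℝ (contraction P Q) (t, z) (s, x) = P x + t • Q x + s • Q z := by
  have h : HasFDerivAt (contraction P Q) (P.comp (ContinuousLinearMap.snd ℝ ℝ E) +
      (t • Q.comp (ContinuousLinearMap.snd ℝ ℝ E) +
        (ContinuousLinearMap.fst ℝ ℝ E).smulRight (Q z))) (t, z) := by
    refine HasFDerivAt.add (P.hasFDerivAt.comp (t, z) hasFDerivAt_snd) ?_
    exact (hasFDerivAt_fst (p := ((t : ℝ), z))).smul (Q.hasFDerivAt.comp (t, z) hasFDerivAt_snd)
  rw [h.fderiv]
  simp [add_assoc]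

/-- The primitive of a closed form `α` that the contraction onto the range of `P` provides. -/
noncomputable def contractionPrimitive (P Q : E →L[ℝ] E) (α : E → E [⋀^Fin (m + 1)]→L[ℝ] F)
    (z : E) : E [⋀^Fin m]→L[ℝ] F :=
  ∫ t in (0 : ℝ)..1, contractTime E F m ((α (contraction P Q (t, z))).compContinuousLinearMap
    (fderiv ℝ (contraction P Q) (t, z)))

section

variable {P Q : E →L[ℝ] E} {α : E → E [⋀^Fin (m + 1)]→L[ℝ] F} {U : Set E}

omit [FiniteDimensional ℝ E] [CompleteSpace F] in
theorem contDiffOn_contraction_pullback (hα : ContDiffOn ℝ ∞ α U) :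
    ContDiffOn ℝ ∞ (fun p => (α (contraction P Q p)).compContinuousLinearMap
      (fderiv ℝ (contraction P Q) p)) (contraction P Q ⁻¹' U) :=
  ContDiffOn.form_pullback (hα.comp (contDiff_contraction P Q).contDiffOn fun _ h => h)
    ((contDiff_contraction P Q).fderiv_right le_rfl).contDiffOn

theorem contDiffOn_contractionPrimitive (hU : IsOpen U) (hα : ContDiffOn ℝ ∞ α U)
    (hPQ : ∀ z ∈ U, ∀ t ∈ Icc (0 : ℝ) 1, P z + t • Q z ∈ U) :
    ContDiffOn ℝ ∞ (contractionPrimitive P Q α) U :=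
  contDiffOn_intervalIntegral (hU.preimage (contDiff_contraction P Q).continuous)
    ((contractTime E F m).contDiff.comp_contDiffOn (contDiffOn_contraction_pullback hα)) hU hPQ

/-- If the closed form `α` vanishes on the range of `P`, onto which its domain is contracted, it is
the exterior derivative of `contractionPrimitive P Q α`. -/
theorem extDeriv_contractionPrimitive (hU : IsOpen U) (hα : ContDiffOn ℝ ∞ α U)
    (hclosed : ∀ z ∈ U, extDeriv α z = 0)
    (hPQ : ∀ z ∈ U, ∀ t ∈ Icc (0 : ℝ) 1, P z + t • Q z ∈ U) (hone : ∀ z, P z + Q z = z)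
    (hP : ∀ z ∈ U, (α (P z)).compContinuousLinearMap P = 0) {z : E} (hz : z ∈ U) :
    extDeriv (contractionPrimitive P Q α) z = α z := by
  have hO : IsOpen (contraction P Q ⁻¹' U) := hU.preimage (contDiff_contraction P Q).continuous
  unfold contractionPrimitive
  rw [extDeriv_integral_contractTime (η := fun p => (α (contraction P Q p)).compContinuousLinearMap
      (fderiv ℝ (contraction P Q) p)) hO
    ((contDiffOn_contraction_pullback hα).of_le (by exact_mod_cast le_top)) ?_ (hPQ z hz)]
  · have h0 : (fderiv ℝ (contraction P Q) (0, z)).comp (ContinuousLinearMap.inr ℝ ℝ E) = P := by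
      ext x; simp [fderiv_contraction]
    have h1 : (fderiv ℝ (contraction P Q) (1, z)).comp (ContinuousLinearMap.inr ℝ ℝ E) =
        ContinuousLinearMap.id ℝ E := by
      ext x; simp [fderiv_contraction, hone]
    have e0 : contraction P Q (0, z) = P z := by simp [contraction]
    have e1 : contraction P Q (1, z) = z := by simp [contraction, hone]
    have key : ∀ (t : ℝ) (L : E →L[ℝ] E),
        (fderiv ℝ (contraction P Q) (t, z)).comp (ContinuousLinearMap.inr ℝ ℝ E) = L →
        ((α (contraction P Q (t, z))).compContinuousLinearMap
          (fderiv ℝ (contraction P Q) (t, z))).compContinuousLinearMap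
            (ContinuousLinearMap.inr ℝ ℝ E) =
        (α (contraction P Q (t, z))).compContinuousLinearMap L := by
      rintro t L rfl; rfl
    rw [key 0 _ h0, key 1 _ h1, e0, e1, hP z hz, sub_zero]
    rfl
  · intro p hp
    have h1 : DifferentiableAt ℝ α (contraction P Q p) :=
      (hα.contDiffAt (hU.mem_nhds hp)).differentiableAt (by simp)
    rw [extDeriv_pullback (r := ∞) h1 (contDiff_contraction P Q).contDiffAt
      two_le_smoothness,
      hclosed _ hp]
    ext v; simp

omit [FiniteDimensional ℝ E] in
/-- A rigid motion `z ↦ A z + b` that commutes with the contraction and preserves `α` preserves its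
primitive. -/
theorem contractionPrimitive_invariant {A : E →L[ℝ] E} {b : E} (hα : ContDiffOn ℝ ∞ α U)
    (hPQ : ∀ z ∈ U, ∀ t ∈ Icc (0 : ℝ) 1, P z + t • Q z ∈ U)
    (hAP : ∀ z, A (P z) = P (A z)) (hAQ : ∀ z, A (Q z) = Q (A z)) (hPb : P b = b) (hQb : Q b = 0)
    (hinv : ∀ z ∈ U, A z + b ∈ U ∧ (α (A z + b)).compContinuousLinearMap A = α z)
    {z : E} (hz : z ∈ U) :
    (contractionPrimitive P Q α (A z + b)).compContinuousLinearMap A =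
      contractionPrimitive P Q α z := by
  have hint : ∀ z ∈ U, IntervalIntegrable (fun t => contractTime E F m
      ((α (contraction P Q (t, z))).compContinuousLinearMap
        (fderiv ℝ (contraction P Q) (t, z)))) MeasureTheory.volume 0 1 := fun z hz => by
    refine ContinuousOn.intervalIntegrable ?_
    refine (contractTime E F m).continuous.comp_continuousOn ?_
    refine (contDiffOn_contraction_pullback (P := P) (Q := Q) hα).continuousOn.comp
      (by fun_prop) fun t ht => ?_
    exact hPQ z hz t (by rwa [uIcc_of_le zero_le_one] at ht)
  have h1 := (ContinuousAlternatingMap.compContinuousLinearMapCLM (F := F) (ι := Fin m)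
    A).intervalIntegral_comp_comm (hint _ (hinv z hz).1)
  unfold contractionPrimitive
  refine h1.symm.trans (intervalIntegral.integral_congr fun t ht => ?_)
  rw [uIcc_of_le zero_le_one] at ht
  ext v
  have e : contraction P Q (t, A z + b) = A (contraction P Q (t, z)) + b := by
    simp [contraction, hAP, hAQ, hPb, hQb]; abel
  have h2 := (hinv _ (hPQ z hz t ht)).2
  change ((α (contraction P Q (t, A z + b))) fun i => fderiv ℝ (contraction P Q) (t, A z + b)
      ((Matrix.vecCons (1, 0) fun i => (0, A (v i)) : Fin (m + 1) → ℝ × E) i)) =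
    (α (contraction P Q (t, z))) fun i => fderiv ℝ (contraction P Q) (t, z)
      ((Matrix.vecCons (1, 0) fun i => (0, v i) : Fin (m + 1) → ℝ × E) i)
  have h3 : α (contraction P Q (t, z)) = (α (A (contraction P Q (t, z)) + b)).compContinuousLinearMap A :=
    h2.symm
  rw [h3, e]
  change _ = (α (A (contraction P Q (t, z)) + b)) fun i => A (fderiv ℝ (contraction P Q) (t, z)
      ((Matrix.vecCons (1, 0) fun i => (0, v i) : Fin (m + 1) → ℝ × E) i))
  congr 1
  ext1 i
  refine Fin.cases ?_ (fun i => ?_) i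
  · simp [fderiv_contraction, hAQ, hQb]
  · simp [fderiv_contraction, hAQ, hAP]

end

end Parametric

/-! ### Rigidity of isometries and of Kähler structures on flat space -/

section Rigidity

variable {E : Type*} [NormedAddCommGroup E] [InnerProductSpace ℝ E]

theorem inner_map_map_of_norm {L : E →L[ℝ] E} (hL : ∀ v, ‖L v‖ = ‖v‖) (v w : E) :
    inner ℝ (L v) (L w) = inner ℝ v w :=
  LinearIsometry.inner_map_map (⟨L.toLinearMap, hL⟩ : E →ₗᵢ[ℝ] E) v w

/-- A trilinear form that is symmetric in the first two and skew in the last two arguments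
vanishes. -/
theorem eq_zero_of_symm_of_skew {X : Type*} {S : X → X → X → ℝ}
    (h1 : ∀ a b c, S a b c = S b a c) (h2 : ∀ a b c, S a b c = -S a c b) (a b c : X) :
    S a b c = 0 := by
  have e1 := h2 a b c
  have e2 := h1 a c b
  have e3 := h2 c a b
  have e4 := h1 c b a
  have e5 := h2 b c a
  have e6 := h1 b a c
  linarith

/-- `f` has a second derivative at each point of an open set on which it is smooth. -/
theorem hasFDerivAt_fderiv_of_contDiffOn {W : Type*} [NormedAddCommGroup W] [NormedSpace ℝ W]
    {f : E → W} {U : Set E} (hU : IsOpen U) (hf : ContDiffOn ℝ ∞ f U) {x : E} (hx : x ∈ U) :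
    HasFDerivAt (fderiv ℝ f) (fderiv ℝ (fderiv ℝ f) x) x :=
  (((hf.fderiv_of_isOpen (m := ∞) hU le_rfl).contDiffAt (hU.mem_nhds hx)).differentiableAt
    (by simp)).hasFDerivAt

theorem HasFDerivAt.apply_vec {V W W' : Type*} [NormedAddCommGroup V] [NormedSpace ℝ V]
    [NormedAddCommGroup W] [NormedSpace ℝ W] [NormedAddCommGroup W'] [NormedSpace ℝ W']
    {L : V → W →L[ℝ] W'} {L' : V →L[ℝ] W →L[ℝ] W'} {x : V} (h : HasFDerivAt L L' x) (v : W) :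
    HasFDerivAt (fun z => L z v) ((ContinuousLinearMap.apply ℝ W' v).comp L') x :=
  (ContinuousLinearMap.apply ℝ W' v).hasFDerivAt.comp x h

theorem fderiv_fderiv_symm {W : Type*} [NormedAddCommGroup W] [NormedSpace ℝ W]
    {f : E → W} {U : Set E} (hU : IsOpen U) (hf : ContDiffOn ℝ ∞ f U) {x : E} (hx : x ∈ U)
    (a b : E) : fderiv ℝ (fderiv ℝ f) x a b = fderiv ℝ (fderiv ℝ f) x b a :=
  (hf.contDiffAt (hU.mem_nhds hx)).isSymmSndFDerivAt two_le_smoothness a b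

/-- An isometry of flat space is affine: the trilinear form `⟪D²h (a, b), Dh c⟫` is symmetric in `a,
b` and skew in `b, c`, and therefore zero. -/
theorem fderiv_fderiv_eq_zero_of_isometry [FiniteDimensional ℝ E] {h : E → E} {U : Set E}
    (hU : IsOpen U) (hh : ContDiffOn ℝ ∞ h U) (hiso : ∀ y ∈ U, ∀ v, ‖fderiv ℝ h y v‖ = ‖v‖)
    {x : E} (hx : x ∈ U) : fderiv ℝ (fderiv ℝ h) x = 0 := by
  set B := fderiv ℝ (fderiv ℝ h) x with hB
  have hd := hasFDerivAt_fderiv_of_contDiffOn hU hh hx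
  have hskew : ∀ a b c, inner ℝ (B a b) (fderiv ℝ h x c) = -inner ℝ (B a c) (fderiv ℝ h x b) := by
    intro a b c
    have hb : ∀ b, HasFDerivAt (fun y => fderiv ℝ h y b)
        ((ContinuousLinearMap.apply ℝ E b).comp B) x := fun b =>
      (ContinuousLinearMap.apply ℝ E b).hasFDerivAt.comp x hd
    have h1 := (hb b).inner ℝ (hb c)
    have h2 : (fun y => inner ℝ (fderiv ℝ h y b) (fderiv ℝ h y c)) =ᶠ[𝓝 x]
        fun _ => inner ℝ b c := by
      filter_upwards [hU.mem_nhds hx] with y hy using inner_map_map_of_norm (hiso y hy) b c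
    have h3 := (h1.congr_of_eventuallyEq h2.symm).unique (hasFDerivAt_const _ x)
    have h4 := congrArg (fun T => T a) h3
    simp at h4
    rw [real_inner_comm (fderiv ℝ h x b) (B a c)]
    linarith
  have hzero := eq_zero_of_symm_of_skew (S := fun a b c => inner ℝ (B a b) (fderiv ℝ h x c))
    (fun a b c => by simp only [hB, fderiv_fderiv_symm hU hh hx a b]) hskew
  have hsurj : Function.Surjective (fderiv ℝ h x) :=
    LinearMap.surjective_of_injective (f := (fderiv ℝ h x).toLinearMap)
      (⟨(fderiv ℝ h x).toLinearMap, hiso x hx⟩ : E →ₗᵢ[ℝ] E).injective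
  ext a b
  obtain ⟨c, hc⟩ := hsurj (B a b)
  have := hzero a b c
  simp only [hc] at this
  simpa using this

/-- A smooth map with isometric differential is locally a rigid motion. -/
theorem exists_rigid_of_isometry [FiniteDimensional ℝ E] {h : E → E} {U : Set E}
    (hU : IsOpen U) (hconv : Convex ℝ U) (hh : ContDiffOn ℝ ∞ h U)
    (hiso : ∀ y ∈ U, ∀ v, ‖fderiv ℝ h y v‖ = ‖v‖) {x : E} (hx : x ∈ U) :
    ∃ A : E ≃ₗᵢ[ℝ] E, (∀ v, A v = fderiv ℝ h x v) ∧ ∀ y ∈ U, h y = h x + A (y - x) := by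
  obtain ⟨A, hA⟩ : ∃ A : E ≃ₗᵢ[ℝ] E, ∀ v, A v = fderiv ℝ h x v :=
    ⟨(⟨(fderiv ℝ h x).toLinearMap, hiso x hx⟩ : E →ₗᵢ[ℝ] E).toLinearIsometryEquiv rfl,
      fun v => rfl⟩
  refine ⟨A, hA, fun y hy => ?_⟩
  have hd1 : DifferentiableOn ℝ h U := hh.differentiableOn (by simp)
  have hconst : ∀ y ∈ U, fderiv ℝ h y = fderiv ℝ h x := fun y hy =>
    hconv.is_const_of_fderivWithin_eq_zero (𝕜 := ℝ)
      (fun y hy => (hasFDerivAt_fderiv_of_contDiffOn hU hh hy).differentiableAt.differentiableWithinAt)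
      (fun y hy => by
        rw [fderivWithin_of_isOpen hU hy, fderiv_fderiv_eq_zero_of_isometry hU hh hiso hy]) hy hx
  have hd2 : ∀ y ∈ U, HasFDerivAt (fun y => h y - fderiv ℝ h x y) 0 y := fun y hy => by
    have := ((hd1 y hy).differentiableAt (hU.mem_nhds hy)).hasFDerivAt.sub
      (fderiv ℝ h x).hasFDerivAt
    rwa [hconst y hy, sub_self] at this
  have h1 := hconv.is_const_of_fderivWithin_eq_zero (𝕜 := ℝ)
    (fun y hy => (hd2 y hy).differentiableAt.differentiableWithinAt)
    (fun y hy => by rw [fderivWithin_of_isOpen hU hy, (hd2 y hy).fderiv]) hy hx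
  rw [hA, map_sub, eq_sub_of_add_eq' (eq_add_of_sub_eq h1).symm]
  abel

/-- The algebra behind `∇J = 0`: `t a b c = ⟪(∇_a J) b, c⟫`, the skew symmetries of `∇J`,
the closedness of the Kähler form and the integrability of `J`. -/
theorem covariant_derivative_eq_zero {E : Type*} [AddCommGroup E] {t : E → E → E → ℝ} {J : E → E}
    (hneg : ∀ a b c, t a b (-c) = -t a b c)
    (hJJ : ∀ v, J (J v) = -v)
    (hskew : ∀ a b c, t a b c = -t a c b) (hJ : ∀ a b c, t a (J b) c = t a b (J c))
    (hclosed : ∀ a b c, t a b c + t b c a + t c a b = 0)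
    (hint : ∀ a b c, t (J a) b c - t (J b) a c + (t a b (J c) - t b a (J c)) = 0) (a b c : E) :
    t a b c = 0 := by
  have h1 := hclosed a (J b) (J c)
  have h2 : t a (J b) (J c) = -t a b c := by rw [hJ, hJJ, hneg]
  have h3 := hint b c (J a)
  rw [hJJ, hneg, hneg] at h3
  have h4 := hclosed a b c
  have h5 := hJ (J b) c a
  have h6 := hskew c b a
  have h7 := hskew (J c) b (J a)
  have h8 : t (J c) a (J b) = t (J c) (J a) b := (hJ (J c) a b).symm
  linarith

/-- An almost complex structure on an open subset of Euclidean space that is Kähler with respect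
to the flat metric is parallel. -/
theorem fderiv_complexStructure_eq_zero {J : E → E →L[ℝ] E} {U : Set E}
    (hU : IsOpen U) (hJ : DifferentiableOn ℝ J U) (hsq : ∀ y ∈ U, ∀ v, J y (J y v) = -v)
    (hiso : ∀ y ∈ U, ∀ v w, inner ℝ (J y v) (J y w) = inner ℝ v w)
    (hclosed : ∀ y ∈ U, ∀ a b c, inner ℝ (fderiv ℝ J y a b) c + inner ℝ (fderiv ℝ J y b c) a +
      inner ℝ (fderiv ℝ J y c a) b = 0)
    (hint : ∀ y ∈ U, ∀ a b, fderiv ℝ J y (J y a) b - fderiv ℝ J y (J y b) a =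
      J y (fderiv ℝ J y a b - fderiv ℝ J y b a))
    {y : E} (hy : y ∈ U) : fderiv ℝ J y = 0 := by
  have hd : HasFDerivAt J (fderiv ℝ J y) y :=
    ((hJ y hy).differentiableAt (hU.mem_nhds hy)).hasFDerivAt
  have hd1 : ∀ b, HasFDerivAt (fun y => J y b) ((ContinuousLinearMap.apply ℝ E b).comp
      (fderiv ℝ J y)) y := fun b => (ContinuousLinearMap.apply ℝ E b).hasFDerivAt.comp y hd
  have hadj : ∀ y ∈ U, ∀ v w, inner ℝ (J y v) w = -inner ℝ v (J y w) := fun y hy v w => by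
    have := hiso y hy v (J y w)
    rw [hsq y hy, inner_neg_right] at this
    linarith
  have hskew : ∀ a b c, inner ℝ (fderiv ℝ J y a b) c = -inner ℝ (fderiv ℝ J y a c) b := by
    intro a b c
    have h1 := ((hd1 b).inner ℝ (hasFDerivAt_const c y)).add
      ((hasFDerivAt_const b y).inner ℝ (hd1 c))
    have h2 : (fun y => inner ℝ (J y b) c + inner ℝ b (J y c)) =ᶠ[𝓝 y] fun _ => (0 : ℝ) := by
      filter_upwards [hU.mem_nhds hy] with x hx
      rw [hadj x hx]; ring
    have h3 := (h1.congr_of_eventuallyEq h2.symm).unique (hasFDerivAt_const _ y)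
    have h4 := congrArg (fun T => T a) h3
    simp at h4
    rw [real_inner_comm b]
    linarith
  have hanti : ∀ a b, fderiv ℝ J y a (J y b) = -J y (fderiv ℝ J y a b) := by
    intro a b
    have h1 : HasFDerivAt (fun x => J x (J x b)) _ y := hd.clm_apply (hd1 b)
    have h2 : (fun x => J x (J x b)) =ᶠ[𝓝 y] fun _ => -b := by
      filter_upwards [hU.mem_nhds hy] with x hx using hsq x hx b
    have h3 := (h1.congr_of_eventuallyEq h2.symm).unique (hasFDerivAt_const _ y)
    have h4 := congrArg (fun T => T a) h3
    simp at h4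
    exact eq_neg_of_add_eq_zero_right h4
  have hzero := covariant_derivative_eq_zero (t := fun a b c => inner ℝ (fderiv ℝ J y a b) c)
    (J := J y) (fun a b c => by simp only [inner_neg_right]) (hsq y hy) hskew
    (fun a b c => by simp only [hanti, inner_neg_left, hadj y hy]; ring)
    (hclosed y hy)
    (fun a b c => by
      have h1 := congrArg (fun v => inner ℝ v c) (hint y hy a b)
      simp only [inner_sub_left, hadj y hy] at h1
      linarith)
  ext a b
  simpa using hzero a b (fderiv ℝ J y a b)

/-- An almost complex structure with holomorphic coordinates has a vanishing Nijenhuis tensor. The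
identity is the difference of the derivatives of `dφ ∘ J = i dφ` in two directions. -/
theorem integrable_of_holomorphic_chart {W : Type*} [NormedAddCommGroup W] [NormedSpace ℂ W]
    {J : E → E →L[ℝ] E} {φ : E → W} {U : Set E}
    (hU : IsOpen U) (hJ : DifferentiableOn ℝ J U)
    (hφ : ContDiffOn ℝ ∞ φ U) (hinj : ∀ y ∈ U, Function.Injective (fderiv ℝ φ y))
    (hhol : ∀ y ∈ U, ∀ v, fderiv ℝ φ y (J y v) = Complex.I • fderiv ℝ φ y v)
    {y : E} (hy : y ∈ U) (a b : E) : fderiv ℝ J y (J y a) b - fderiv ℝ J y (J y b) a =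
      J y (fderiv ℝ J y a b - fderiv ℝ J y b a) := by
  have hd : HasFDerivAt J (fderiv ℝ J y) y :=
    ((hJ y hy).differentiableAt (hU.mem_nhds hy)).hasFDerivAt
  have hd2 := hasFDerivAt_fderiv_of_contDiffOn hU hφ hy
  set Q := fderiv ℝ (fderiv ℝ φ) y
  have hsymm : ∀ a b, Q a b = Q b a := fderiv_fderiv_symm hU hφ hy
  have key : ∀ a b, fderiv ℝ φ y (fderiv ℝ J y a b) = Complex.I • Q a b - Q a (J y b) := by
    intro a b
    have hb : HasFDerivAt (fun y => J y b) ((ContinuousLinearMap.apply ℝ E b).comp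
      (fderiv ℝ J y)) y := (ContinuousLinearMap.apply ℝ E b).hasFDerivAt.comp y hd
    have h1 : HasFDerivAt (fun x => fderiv ℝ φ x (J x b)) _ y := hd2.clm_apply hb
    have h2 : (fun x => fderiv ℝ φ x (J x b)) =ᶠ[𝓝 y] fun x => Complex.I • fderiv ℝ φ x b := by
      filter_upwards [hU.mem_nhds hy] with x hx using hhol x hx b
    have h3 : HasFDerivAt (fun x => Complex.I • fderiv ℝ φ x b)
        (Complex.I • ((ContinuousLinearMap.apply ℝ W b).comp Q)) y :=
      ((ContinuousLinearMap.apply ℝ W b).hasFDerivAt.comp y hd2).const_smul Complex.I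
    have h4 := (h1.congr_of_eventuallyEq h2.symm).unique h3
    have h5 := congrArg (fun T => T a) h4
    simp at h5
    exact eq_sub_of_add_eq h5
  apply hinj y hy
  rw [hhol y hy, map_sub, map_sub, key, key, key, key, hsymm (J y b) (J y a), hsymm (J y a) b,
    hsymm (J y b) a, hsymm b a]
  simp only [smul_sub, smul_smul, Complex.I_mul_I]
  abel

end Rigidity

section Holomorphic

variable {n : ℕ}

/-- A complex linear map multiplies `dz₁ ∧ ⋯ ∧ dzₙ` by its complex determinant, which is expressed
here as the value of the form on the images of the standard basis. -/
theorem stdVolume_map (L : Cn n →L[ℝ] Cn n) (hL : ∀ v, L (Complex.I • v) = Complex.I • L v)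
    (v : Fin n → Cn n) : stdVolume (fun i => L (v i)) =
      stdVolume v * stdVolume fun j => L (EuclideanSpace.single j 1) := by
  have hLC : ∀ (c : ℂ) w, L (c • w) = c • L w := fun c w => by
    have h1 : c • w = c.re • w + c.im • (Complex.I • w) := by
      conv_lhs => rw [← Complex.re_add_im c, add_smul, mul_smul]
      simp only [Complex.coe_smul]
    have h2 : c • L w = c.re • L w + c.im • (Complex.I • L w) := by
      conv_lhs => rw [← Complex.re_add_im c, add_smul, mul_smul]
      simp only [Complex.coe_smul]
    rw [h1, h2, map_add, map_smul, map_smul, hL]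
  unfold stdVolume
  rw [← Matrix.det_mul]
  congr 1
  ext i j
  have h3 : v i = ∑ k, v i k • (EuclideanSpace.single k (1 : ℂ) : Cn n) := by
    ext l
    simp [Finset.sum_apply, Pi.single_apply]
  have h4 : L (v i) = ∑ k, v i k • L (EuclideanSpace.single k 1) := by
    conv_lhs => rw [h3, map_sum]
    simp only [hLC]
  change L (v i) j = _
  rw [h4]
  simp only [Matrix.mul_apply, Matrix.of_apply]
  rw [WithLp.ofLp_sum, Finset.sum_apply]
  rfl

theorem stdVolume_single : stdVolume (fun j => (EuclideanSpace.single j 1 : Cn n)) = 1 := by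
  unfold stdVolume
  have : (Matrix.of fun i j => (EuclideanSpace.single i (1 : ℂ) : Cn n) j) = 1 := by
    ext i j
    simp [Matrix.one_apply, eq_comm]
  rw [this, Matrix.det_one]

/-- A real differentiable map is holomorphic if its derivative commutes with `i`. -/
theorem differentiableAt_complex_of_real {V W : Type*} [NormedAddCommGroup V] [NormedSpace ℂ V]
    [NormedAddCommGroup W] [NormedSpace ℂ W] {f : V → W} {x : V} {f' : V →L[ℝ] W}
    (hf : HasFDerivAt f f' x) (hI : ∀ a, f' (Complex.I • a) = Complex.I • f' a) :
    DifferentiableAt ℂ f x := by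
  have hC : ∀ (c : ℂ) a, f' (c • a) = c • f' a := fun c w => by
    have h1 : c • w = c.re • w + c.im • (Complex.I • w) := by
      conv_lhs => rw [← Complex.re_add_im c, add_smul, mul_smul]
      simp only [Complex.coe_smul]
    have h2 : c • f' w = c.re • f' w + c.im • (Complex.I • f' w) := by
      conv_lhs => rw [← Complex.re_add_im c, add_smul, mul_smul]
      simp only [Complex.coe_smul]
    rw [h1, h2, map_add, map_smul, map_smul, hI]
  let g : V →L[ℂ] W := ⟨⟨⟨f', map_add f'⟩, hC⟩, f'.continuous⟩
  exact (hasFDerivAt_of_restrictScalars ℝ hf (f' := g) (by ext a; rfl)).differentiableAt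

/-- The coefficient of the pull-back of a holomorphic volume form by a holomorphic map. -/
theorem differentiableAt_volume_coefficient {f : Cn n → ℂ} {φ : Cn n → Cn n} {U : Set (Cn n)}
    (hU : IsOpen U) (hφ : ContDiffOn ℝ ∞ φ U)
    (hhol : ∀ y ∈ U, ∀ v, fderiv ℝ φ y (Complex.I • v) = Complex.I • fderiv ℝ φ y v)
    {x : Cn n} (hx : x ∈ U) (hf : DifferentiableAt ℂ f (φ x)) :
    DifferentiableAt ℂ
      (fun z => f (φ z) * stdVolume fun j => fderiv ℝ φ z (EuclideanSpace.single j 1)) x := by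
  have hφC : DifferentiableAt ℂ φ x := differentiableAt_complex_of_real
    ((hφ.contDiffAt (hU.mem_nhds hx)).differentiableAt (by simp)).hasFDerivAt (hhol x hx)
  have hd2 := hasFDerivAt_fderiv_of_contDiffOn hU hφ hx
  have hent : ∀ i j, DifferentiableAt ℂ
      (fun z => fderiv ℝ φ z (EuclideanSpace.single i 1) j) x := fun i j => by
    have h1 : DifferentiableAt ℂ (fun z => fderiv ℝ φ z (EuclideanSpace.single i 1)) x := by
      have h0 : HasFDerivAt (fun z => fderiv ℝ φ z (EuclideanSpace.single i 1))
          ((ContinuousLinearMap.apply ℝ (Cn n) (EuclideanSpace.single i 1)).comp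
            (fderiv ℝ (fderiv ℝ φ) x)) x :=
        HasFDerivAt.apply_vec hd2 _
      refine differentiableAt_complex_of_real h0 fun a => ?_
      change fderiv ℝ (fderiv ℝ φ) x (Complex.I • a) _ = Complex.I • fderiv ℝ (fderiv ℝ φ) x a _
      rw [fderiv_fderiv_symm hU hφ hx, fderiv_fderiv_symm hU hφ hx a]
      have h2 : HasFDerivAt (fun z => fderiv ℝ φ z (Complex.I • a))
          ((ContinuousLinearMap.apply ℝ (Cn n) (Complex.I • a)).comp (fderiv ℝ (fderiv ℝ φ) x)) x :=
        HasFDerivAt.apply_vec hd2 _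
      have h3 : HasFDerivAt (fun z => Complex.I • fderiv ℝ φ z a)
          (Complex.I • (ContinuousLinearMap.apply ℝ (Cn n) a).comp (fderiv ℝ (fderiv ℝ φ) x)) x :=
        (HasFDerivAt.apply_vec hd2 a).const_smul Complex.I
      have h4 : (fun z => fderiv ℝ φ z (Complex.I • a)) =ᶠ[𝓝 x]
          fun z => Complex.I • fderiv ℝ φ z a := by
        filter_upwards [hU.mem_nhds hx] with z hz using hhol z hz a
      exact congrArg (fun T => T (EuclideanSpace.single i 1))
        ((h2.congr_of_eventuallyEq h4.symm).unique h3)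
    exact (EuclideanSpace.proj (𝕜 := ℂ) j).differentiableAt.comp x h1
  refine (hf.comp x hφC).mul ?_
  simp only [stdVolume, Matrix.det_apply, Matrix.of_apply]
  refine DifferentiableAt.fun_sum fun σ _ => ?_
  have hprod : DifferentiableAt ℂ
      (fun z => ∏ i, fderiv ℝ φ z (EuclideanSpace.single (σ i) 1) i) x :=
    (HasFDerivAt.finsetProd (u := Finset.univ) fun i _ =>
      (hent (σ i) i).hasFDerivAt).differentiableAt
  exact hprod.const_smul _

/-- A holomorphic function of constant modulus is locally constant. -/
theorem fderiv_eq_zero_of_norm_eq_one {V : Type*} [NormedAddCommGroup V] [NormedSpace ℂ V]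
    {f : V → ℂ} {x : V} (hf : DifferentiableAt ℂ f x) (hn : ∀ᶠ y in 𝓝 x, ‖f y‖ = 1) :
    fderiv ℂ f x = 0 := by
  have hr : HasFDerivAt f ((fderiv ℂ f x).restrictScalars ℝ) x := hf.hasFDerivAt.restrictScalars ℝ
  have h1 := hr.inner ℝ hr
  have h2 : (fun y => inner ℝ (f y) (f y)) =ᶠ[𝓝 x] fun _ => (1 : ℝ) := by
    filter_upwards [hn] with y hy
    rw [real_inner_self_eq_norm_sq, hy, one_pow]
  have h3 := (h1.congr_of_eventuallyEq h2.symm).unique (hasFDerivAt_const _ x)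
  have h4 : ∀ a, inner ℝ (f x) (fderiv ℂ f x a) = 0 := fun a => by
    have := congrArg (fun T => T a) h3
    simp [real_inner_comm (f x)] at this
    simpa [real_inner_comm] using this
  have hx : f x ≠ 0 := fun h => by
    have := hn.self_of_nhds
    simp [h] at this
  ext a
  have h5 := h4 a
  have h6 := h4 (Complex.I • a)
  rw [map_smul] at h6
  have h7 : fderiv ℂ f x a * (starRingEnd ℂ) (f x) = 0 := by
    simp only [Complex.inner, smul_eq_mul] at h5 h6
    apply Complex.ext
    · simp only [Complex.mul_re, Complex.conj_re, Complex.conj_im, Complex.zero_re] at h5 ⊢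
      linarith
    · simp only [Complex.mul_re, Complex.conj_re, Complex.conj_im, Complex.mul_im, Complex.I_re,
        Complex.I_im, Complex.zero_im] at h6 ⊢
      linarith
  rcases mul_eq_zero.1 h7 with h | h
  · simpa using h
  · exact absurd ((map_eq_zero _).1 h) hx

end Holomorphic

/-! ### Lengths of paths, and pull-backs -/

section
variable {n : ℕ} {M : Type*} [TopologicalSpace M] [ChartedSpace (Cn n) M]
  [IsManifold 𝓘(ℝ, Cn n) ∞ M]

theorem gLength_eq (g : Metric (Cn n) M) (γ : ℝ → M) :
    gLength g γ = ∫⁻ t in Icc (0 : ℝ) 1, ENNReal.ofReal (√(g.inner (γ t)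
      (mfderiv 𝓘(ℝ, ℝ) 𝓘(ℝ, Cn n) γ t (1 : ℝ)) (mfderiv 𝓘(ℝ, ℝ) 𝓘(ℝ, Cn n) γ t (1 : ℝ)))) := by
  unfold gLength
  let : Bundle.RiemannianBundle (fun x : M => TangentSpace 𝓘(ℝ, Cn n) x) := ⟨g.toRiemannianMetric⟩
  rw [Manifold.pathELength_eq_lintegral_mfderiv_Icc]
  congr 1
  ext t
  rw [← ofReal_norm, norm_eq_sqrt_real_inner]
  rfl

theorem gDist_le_gLength (g : Metric (Cn n) M) {γ : ℝ → M}
    (hγ : ContMDiffOn 𝓘(ℝ, ℝ) 𝓘(ℝ, Cn n) 1 γ (Icc 0 1)) : gDist g (γ 0) (γ 1) ≤ gLength g γ := by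
  unfold gLength gDist
  let : Bundle.RiemannianBundle (fun x : M => TangentSpace 𝓘(ℝ, Cn n) x) := ⟨g.toRiemannianMetric⟩
  exact Manifold.riemannianEDist_le_pathELength hγ rfl rfl zero_le_one

theorem exists_path_of_gDist_lt (g : Metric (Cn n) M) {x y : M} {r : ℝ≥0∞} (h : gDist g x y < r) :
    ∃ γ : ℝ → M, γ 0 = x ∧ γ 1 = y ∧ ContMDiffOn 𝓘(ℝ, ℝ) 𝓘(ℝ, Cn n) 1 γ (Icc 0 1) ∧
      gLength g γ < r := by
  unfold gLength
  unfold gDist at h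
  let : Bundle.RiemannianBundle (fun x : M => TangentSpace 𝓘(ℝ, Cn n) x) := ⟨g.toRiemannianMetric⟩
  exact Manifold.exists_lt_of_riemannianEDist_lt h

theorem gDist_triangle (g : Metric (Cn n) M) (x y z : M) :
    gDist g x z ≤ gDist g x y + gDist g y z := by
  unfold gDist
  let : Bundle.RiemannianBundle (fun x : M => TangentSpace 𝓘(ℝ, Cn n) x) := ⟨g.toRiemannianMetric⟩
  exact Manifold.riemannianEDist_triangle

theorem gDist_comm (g : Metric (Cn n) M) (x y : M) : gDist g x y = gDist g y x := by
  unfold gDist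
  let : Bundle.RiemannianBundle (fun x : M => TangentSpace 𝓘(ℝ, Cn n) x) := ⟨g.toRiemannianMetric⟩
  exact Manifold.riemannianEDist_comm

theorem eventually_gDist_lt (g : Metric (Cn n) M) (x : M) {r : ℝ≥0∞} (hr : 0 < r) :
    ∀ᶠ y in 𝓝 x, gDist g x y < r := by
  unfold gDist
  let : Bundle.RiemannianBundle (fun x : M => TangentSpace 𝓘(ℝ, Cn n) x) := ⟨g.toRiemannianMetric⟩
  have : IsContinuousRiemannianBundle (Cn n) (fun x : M => TangentSpace 𝓘(ℝ, Cn n) x) :=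
    ⟨⟨g.inner, g.contMDiff.continuous, fun _ _ _ => rfl⟩⟩
  have : IsManifold 𝓘(ℝ, Cn n) 1 M := IsManifold.of_le (n := ∞) (by simp)
  exact eventually_riemannianEDist_lt 𝓘(ℝ, Cn n) x hr

theorem isOpen_gBall (g : Metric (Cn n) M) (p : M) (r : ℝ) : IsOpen (gBall g p r) := by
  rw [isOpen_iff_mem_nhds]
  intro x hx
  have hx' : gDist g p x < ENNReal.ofReal r := hx
  filter_upwards [eventually_gDist_lt g x (tsub_pos_of_lt hx')] with y hy
  calc gDist g p y ≤ gDist g p x + gDist g x y := gDist_triangle g p x y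
    _ < gDist g p x + (ENNReal.ofReal r - gDist g p x) :=
        ENNReal.add_lt_add_left (hx'.trans ENNReal.ofReal_lt_top).ne hy
    _ = ENNReal.ofReal r := add_tsub_cancel_of_le hx'.le

omit [IsManifold 𝓘(ℝ, Cn n) ∞ M] in
theorem mfderiv_comp_curve {f : Cn n → M} {δ : ℝ → Cn n} {δ' : Cn n} {t : ℝ}
    (hf : MDifferentiableAt 𝓘(ℝ, Cn n) 𝓘(ℝ, Cn n) f (δ t)) (hδ : HasDerivAt δ δ' t) :
    mfderiv 𝓘(ℝ, ℝ) 𝓘(ℝ, Cn n) (fun t => f (δ t)) t (1 : ℝ) =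
      mfderiv 𝓘(ℝ, Cn n) 𝓘(ℝ, Cn n) f (δ t) δ' := by
  have h1 : MDifferentiableAt 𝓘(ℝ, ℝ) 𝓘(ℝ, Cn n) δ t := hδ.differentiableAt.mdifferentiableAt
  have h2 := mfderiv_comp t hf h1
  have h3 : mfderiv 𝓘(ℝ, ℝ) 𝓘(ℝ, Cn n) δ t (1 : ℝ) = δ' := by
    rw [mfderiv_eq_fderiv]
    exact hδ.deriv
  rw [← h3]
  exact congrArg (fun T => T (1 : ℝ)) h2

end

section Pull

variable {E : Type*} [NormedAddCommGroup E] [NormedSpace ℝ E]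
  {E' : Type*} [NormedAddCommGroup E'] [NormedSpace ℝ E']
  {E'' : Type*} [NormedAddCommGroup E''] [NormedSpace ℝ E'']
  {M : Type*} [TopologicalSpace M] [ChartedSpace E M]
  {N : Type*} [TopologicalSpace N] [ChartedSpace E' N]
  {P : Type*} [TopologicalSpace P] [ChartedSpace E'' P]
  {F : Type*} [NormedAddCommGroup F] [NormedSpace ℝ F]

theorem pullBilin_congr {f f' : N → M} {x : N} (h : f =ᶠ[𝓝 x] f') (b : BForm E M) :
    pullBilin (E' := E') f b x = pullBilin (E' := E') f' b x := by
  have h0 : f x = f' x := h.eq_of_nhds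
  have h1 : (mfderiv 𝓘(ℝ, E') 𝓘(ℝ, E) f x : E' →L[ℝ] E) = mfderiv 𝓘(ℝ, E') 𝓘(ℝ, E) f' x :=
    h.mfderiv_eq
  have key : ∀ (p q : M) (D D' : E' →L[ℝ] E), p = q → D = D' →
      ContinuousLinearMap.bilinearComp (E := E) (F := E) (E' := E') (F' := E') (b p) D D =
      ContinuousLinearMap.bilinearComp (E := E) (F := E) (E' := E') (F' := E') (b q) D' D' := by
    rintro p _ D _ rfl rfl; rfl
  exact key _ _ _ _ h0 h1

theorem pullForm_congr {k : ℕ} {f f' : N → M} {x : N} (h : f =ᶠ[𝓝 x] f') (α : DForm E M k F) :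
    pullForm (E' := E') f α x = pullForm (E' := E') f' α x := by
  have h0 : f x = f' x := h.eq_of_nhds
  have h1 : (mfderiv 𝓘(ℝ, E') 𝓘(ℝ, E) f x : E' →L[ℝ] E) = mfderiv 𝓘(ℝ, E') 𝓘(ℝ, E) f' x :=
    h.mfderiv_eq
  have key : ∀ (A : M → E [⋀^Fin k]→L[ℝ] F) (p q : M) (D D' : E' →L[ℝ] E), p = q → D = D' →
      (A p).compContinuousLinearMap D = (A q).compContinuousLinearMap D' := by
    rintro A p _ D _ rfl rfl; rfl
  exact key α _ _ _ _ h0 h1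

theorem pullBilin_comp {f : N → M} {h : P → N} {x : P}
    (hf : MDifferentiableAt 𝓘(ℝ, E') 𝓘(ℝ, E) f (h x))
    (hh : MDifferentiableAt 𝓘(ℝ, E'') 𝓘(ℝ, E') h x) (b : BForm E M) :
    pullBilin (E' := E'') (f ∘ h) b x = pullBilin (E' := E'') h (pullBilin (E' := E') f b) x := by
  have h1 := mfderiv_comp x hf hh
  have key : ∀ (p : M) (D : E'' →L[ℝ] E) (D₁ : E' →L[ℝ] E) (D₂ : E'' →L[ℝ] E'), D = D₁.comp D₂ →
      ContinuousLinearMap.bilinearComp (E := E) (F := E) (E' := E'') (F' := E'') (b p) D D =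
      ContinuousLinearMap.bilinearComp (E := E') (F := E') (E' := E'') (F' := E'')
        (ContinuousLinearMap.bilinearComp (E := E) (F := E) (E' := E') (F' := E') (b p) D₁ D₁)
        D₂ D₂ := by
    rintro p _ D₁ D₂ rfl; rfl
  exact key _ _ _ _ h1

theorem pullForm_comp {k : ℕ} {f : N → M} {h : P → N} {x : P}
    (hf : MDifferentiableAt 𝓘(ℝ, E') 𝓘(ℝ, E) f (h x))
    (hh : MDifferentiableAt 𝓘(ℝ, E'') 𝓘(ℝ, E') h x) (α : DForm E M k F) :
    pullForm (E' := E'') (f ∘ h) α x = pullForm (E' := E'') h (pullForm (E' := E') f α) x := by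
  have h1 := mfderiv_comp x hf hh
  have key : ∀ (A : E [⋀^Fin k]→L[ℝ] F) (D : E'' →L[ℝ] E) (D₁ : E' →L[ℝ] E)
      (D₂ : E'' →L[ℝ] E'), D = D₁.comp D₂ →
      A.compContinuousLinearMap D = (A.compContinuousLinearMap D₁).compContinuousLinearMap D₂ := by
    rintro A _ D₁ D₂ rfl; rfl
  exact key (α (f (h x))) _ _ _ h1

theorem pullForm_eq_fderiv {k : ℕ} (h : E'' → E') (α : E' → E' [⋀^Fin k]→L[ℝ] F) (x : E'') :
    pullForm (E := E') (E' := E'') h α x = (α (h x)).compContinuousLinearMap (fderiv ℝ h x) := by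
  unfold pullForm
  rw [mfderiv_eq_fderiv]
  rfl

theorem pullBilin_eq_fderiv (h : E'' → E') (b : BForm E' E') (x v w : E'') :
    pullBilin (E' := E'') h b x v w = b (h x) (fderiv ℝ h x v) (fderiv ℝ h x w) := by
  unfold pullBilin
  rw [mfderiv_eq_fderiv]
  rfl

/-- The function `c.symm` is an inverse of the chart `c` on the level of differentials. -/
theorem mfderiv_symm_diff [IsManifold 𝓘(ℝ, E) ∞ M] {c : OpenPartialHomeomorph M E}
    (hc : c ∈ IsManifold.maximalAtlas 𝓘(ℝ, E) ∞ M) {y : E} (hy : y ∈ c.target) (v : E) :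
    mfderiv 𝓘(ℝ, E) 𝓘(ℝ, E) c (c.symm y) (mfderiv 𝓘(ℝ, E) 𝓘(ℝ, E) c.symm y v) = v := by
  have h1 := (contMDiffAt_of_mem_maximalAtlas hc (c.map_target hy)).mdifferentiableAt (by simp)
  have h2 := (contMDiffAt_symm_of_mem_maximalAtlas hc hy).mdifferentiableAt (by simp)
  have h3 := mfderiv_comp y h1 h2
  have h4 : (c ∘ c.symm) =ᶠ[𝓝 y] id := by
    filter_upwards [c.open_target.mem_nhds hy] with z hz
    exact c.right_inv hz
  have h5 : mfderiv 𝓘(ℝ, E) 𝓘(ℝ, E) (c ∘ c.symm) y v = v := by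
    have := h4.mfderiv_eq (I := 𝓘(ℝ, E)) (I' := 𝓘(ℝ, E))
    have h6 := congrArg (fun T : E →L[ℝ] E => T v) this
    refine h6.trans ?_
    rw [mfderiv_id]
    rfl
  rw [h3] at h5
  exact h5

end Pull

/-! ### Local isometries from `ℂⁿ` -/

section

theorem stdMetric_self {n : ℕ} (v : Cn n) : stdMetric v v = ‖v‖ ^ 2 := by
  rw [← real_inner_eq_stdMetric, real_inner_self_eq_norm_sq]

theorem hasFDerivAt_affineIsometry {n : ℕ} (T : Cn n ≃ᵃⁱ[ℝ] Cn n) (z : Cn n) :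
    HasFDerivAt T (T.linearIsometryEquiv.toContinuousLinearEquiv : Cn n →L[ℝ] Cn n) z := by
  have h1 : HasFDerivAt (fun x => T.linearIsometryEquiv.toContinuousLinearEquiv (x - z) + T z)
      (T.linearIsometryEquiv.toContinuousLinearEquiv : Cn n →L[ℝ] Cn n) z :=
    (((T.linearIsometryEquiv.toContinuousLinearEquiv : Cn n →L[ℝ] Cn n).hasFDerivAt).comp z
      ((hasFDerivAt_id z).sub_const z)).add_const _
  refine h1.congr_of_eventuallyEq (Eventually.of_forall fun x => ?_)
  have := T.map_vsub x z
  simp only [vsub_eq_sub] at this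
  simp [this]

variable {n : ℕ} {X : Type*} [TopologicalSpace X] [ChartedSpace (Cn n) X]
  [IsManifold 𝓘(ℝ, Cn n) ∞ X]

/-- The smooth charts of `X` that are isometries onto open subsets of `ℂⁿ`. -/
def flatAtlas (g : Metric (Cn n) X) : Set (OpenPartialHomeomorph X (Cn n)) :=
  {c | c ∈ IsManifold.maximalAtlas 𝓘(ℝ, Cn n) ∞ X ∧
    ∀ y ∈ c.source, ∀ v w, g.inner y v w = stdMetric (diffAt c y v) (diffAt c y w)}

/-- The map `f : ℂⁿ → X` is smooth on `U` with `f^*g = g_E`. -/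
structure IsomOn (g : Metric (Cn n) X) (f : Cn n → X) (U : Set (Cn n)) : Prop where
  smooth : ∀ z ∈ U, ContMDiffAt 𝓘(ℝ, Cn n) 𝓘(ℝ, Cn n) ∞ f z
  metric : ∀ z ∈ U, ∀ v w : Cn n, pullBilin (E' := Cn n) f g.inner z v w = stdMetric v w

variable {g : Metric (Cn n) X} {f f' : Cn n → X} {U U' : Set (Cn n)}

theorem IsomOn.mono (h : IsomOn g f U) (hU : U' ⊆ U) : IsomOn g f U' :=
  ⟨fun z hz => h.smooth z (hU hz), fun z hz => h.metric z (hU hz)⟩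

theorem IsomOn.union (h : IsomOn g f U) (h' : IsomOn g f U') : IsomOn g f (U ∪ U') :=
  ⟨fun z hz => hz.elim (h.smooth z) (h'.smooth z), fun z hz => hz.elim (h.metric z) (h'.metric z)⟩

theorem IsomOn.congr (h : IsomOn g f U) (hff : ∀ z ∈ U, f' =ᶠ[𝓝 z] f) : IsomOn g f' U :=
  ⟨fun z hz => (h.smooth z hz).congr_of_eventuallyEq (hff z hz), fun z hz v w => by
    rw [pullBilin_congr (hff z hz), h.metric z hz]⟩

theorem IsomOn.congr_eqOn (h : IsomOn g f U) (hU : IsOpen U) (hff : EqOn f' f U) :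
    IsomOn g f' U :=
  h.congr fun _ hz => hff.eventuallyEq_of_mem (hU.mem_nhds hz)

theorem IsomOn.mdifferentiableAt (h : IsomOn g f U) {z : Cn n} (hz : z ∈ U) :
    MDifferentiableAt 𝓘(ℝ, Cn n) 𝓘(ℝ, Cn n) f z :=
  (h.smooth z hz).mdifferentiableAt (by simp)

theorem IsomOn.continuousAt (h : IsomOn g f U) {z : Cn n} (hz : z ∈ U) : ContinuousAt f z :=
  (h.smooth z hz).continuousAt

theorem IsomOn.comp_affineIsometry (h : IsomOn g f U) (T : Cn n ≃ᵃⁱ[ℝ] Cn n) :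
    IsomOn g (f ∘ T) (T ⁻¹' U) := by
  have hT : ContDiff ℝ ∞ T :=
    T.toAffineIsometry.toContinuousAffineMap.contDiff
  have hTd := hasFDerivAt_affineIsometry T
  refine ⟨fun z hz => (h.smooth _ hz).comp z hT.contDiffAt.contMDiffAt, fun z hz v w => ?_⟩
  refine (congrArg (fun B : Cn n →L[ℝ] Cn n →L[ℝ] ℝ => B v w) (pullBilin_comp
    (h.mdifferentiableAt hz) (hT.contDiffAt.contMDiffAt.mdifferentiableAt (by simp)) _)).trans ?_
  refine (pullBilin_eq_fderiv _ _ _ _ _).trans ?_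
  rw [(hTd z).fderiv]
  refine (h.metric _ hz _ _).trans ?_
  rw [← real_inner_eq_stdMetric, ← real_inner_eq_stdMetric]
  exact T.linearIsometryEquiv.inner_map_map v w

theorem isomOn_symm_of_mem_flatAtlas {c : OpenPartialHomeomorph X (Cn n)} (hc : c ∈ flatAtlas g) :
    IsomOn g c.symm c.target := by
  refine ⟨fun z hz => contMDiffAt_symm_of_mem_maximalAtlas hc.1 hz, fun z hz v w => ?_⟩
  refine (hc.2 _ (c.map_target hz) _ _).trans ?_
  exact congrArg₂ stdMetric (mfderiv_symm_diff hc.1 hz v) (mfderiv_symm_diff hc.1 hz w)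

/-- A locally isometric map `ℂⁿ → X` is, in a flat chart, an affine isometry. -/
theorem IsomOn.eventuallyEq_affineIsometry (h : IsomOn g f U) (hU : IsOpen U) {z : Cn n}
    (hz : z ∈ U) {c : OpenPartialHomeomorph X (Cn n)} (hc : c ∈ flatAtlas g)
    (hzc : f z ∈ c.source) :
    ∃ T : Cn n ≃ᵃⁱ[ℝ] Cn n, T z = c (f z) ∧ f =ᶠ[𝓝 z] c.symm ∘ T := by
  obtain ⟨ε, hε, hball⟩ : ∃ ε > 0, ∀ y ∈ Metric.ball z ε, y ∈ U ∧ f y ∈ c.source := by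
    have := (hU.mem_nhds hz)
    have h2 := (h.continuousAt hz).preimage_mem_nhds (c.open_source.mem_nhds hzc)
    obtain ⟨ε, hε, hb⟩ := Metric.mem_nhds_iff.1 (inter_mem this h2)
    exact ⟨ε, hε, fun y hy => hb hy⟩
  have hsm : ∀ y ∈ Metric.ball z ε, ContMDiffAt 𝓘(ℝ, Cn n) 𝓘(ℝ, Cn n) ∞ (c ∘ f) y := fun y hy =>
    (contMDiffAt_of_mem_maximalAtlas hc.1 (hball y hy).2).comp y (h.smooth y (hball y hy).1)
  have hiso : ∀ y ∈ Metric.ball z ε, ∀ v, ‖fderiv ℝ (c ∘ f) y v‖ = ‖v‖ := by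
    intro y hy v
    have h1 : MDifferentiableAt 𝓘(ℝ, Cn n) 𝓘(ℝ, Cn n) c (f y) :=
      (contMDiffAt_of_mem_maximalAtlas hc.1 (hball y hy).2).mdifferentiableAt (by simp)
    have h2 := mfderiv_comp y h1 (h.mdifferentiableAt (hball y hy).1)
    rw [mfderiv_eq_fderiv] at h2
    have h3 : fderiv ℝ (c ∘ f) y v = diffAt c (f y) (mfderiv 𝓘(ℝ, Cn n) 𝓘(ℝ, Cn n) f y v) :=
      congrArg (fun T : Cn n →L[ℝ] Cn n => T v) h2
    have h4 : stdMetric (fderiv ℝ (c ∘ f) y v) (fderiv ℝ (c ∘ f) y v) = stdMetric v v := by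
      rw [h3, ← hc.2 _ (hball y hy).2]
      exact h.metric y (hball y hy).1 v v
    rw [stdMetric_self, stdMetric_self] at h4
    exact (pow_left_inj₀ (norm_nonneg _) (norm_nonneg _) two_ne_zero).1 h4
  obtain ⟨A, -, hA⟩ := exists_rigid_of_isometry Metric.isOpen_ball (convex_ball z ε)
    (fun y hy => (hsm y hy).contDiffAt.contDiffWithinAt) hiso (Metric.mem_ball_self hε)
  refine ⟨AffineIsometryEquiv.mk' (fun y => c (f z) + A (y - z)) A z (by simp [add_comm]),
    by simp, ?_⟩
  filter_upwards [Metric.ball_mem_nhds z hε] with y hy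
  have := hA y hy
  simp only [Function.comp] at this
  simp only [Function.comp, AffineIsometryEquiv.coe_mk']
  rw [← this, c.left_inv (hball y hy).2]

theorem affineIsometry_eq_of_eventuallyEq {T T' : Cn n ≃ᵃⁱ[ℝ] Cn n} {z : Cn n}
    (h : T =ᶠ[𝓝 z] T') : T = T' := by
  have hz := h.eq_of_nhds
  have key : ∀ v, T.linearIsometryEquiv v = T'.linearIsometryEquiv v := by
    intro v
    have h1 : Tendsto (fun t : ℝ => z + t • v) (𝓝 0) (𝓝 z) := by
      have : Continuous fun t : ℝ => z + t • v := by fun_prop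
      simpa using this.tendsto 0
    have h2 : ∀ᶠ t in 𝓝[≠] (0 : ℝ), T (z + t • v) = T' (z + t • v) ∧ t ≠ 0 :=
      ((h1.eventually h).filter_mono nhdsWithin_le_nhds).and self_mem_nhdsWithin
    obtain ⟨t, ht, ht0⟩ := h2.exists
    have h3 := T.map_vsub (z + t • v) z
    have h4 := T'.map_vsub (z + t • v) z
    simp only [vsub_eq_sub, add_sub_cancel_left, map_smul] at h3 h4
    rw [ht, hz, ← h4] at h3
    exact smul_right_injective _ ht0 h3
  ext1 y
  have h3 := T.map_vsub y z
  have h4 := T'.map_vsub y z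
  simp only [vsub_eq_sub] at h3 h4
  rw [key, h4, hz] at h3
  exact (sub_left_injective h3).symm

/-- Unique continuation for local isometries. -/
theorem IsomOn.eqOn_of_eventuallyEq [T2Space X] (h : IsomOn g f U) (h' : IsomOn g f' U)
    (hg : ∀ x : X, ∃ c ∈ flatAtlas g, x ∈ c.source)
    (hU : IsOpen U) (hc : IsPreconnected U) {a : Cn n} (ha : a ∈ U) (hff : f =ᶠ[𝓝 a] f') :
    EqOn f f' U := by
  have hsub : U ⊆ {z | f =ᶠ[𝓝 z] f'} := by
    refine hc.subset_of_closure_inter_subset (isOpen_setOfPred_eventually_nhds) ⟨a, ha, hff⟩ ?_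
    rintro z ⟨hzcl, hz⟩
    have hzz : f z = f' z := by
      have : ∃ᶠ y in 𝓝 z, f y = f' y :=
        (mem_closure_iff_frequently.1 hzcl).mono fun y (hy : f =ᶠ[𝓝 y] f') => hy.eq_of_nhds
      exact tendsto_nhds_unique_of_frequently_eq (h.continuousAt hz) (h'.continuousAt hz) this
    obtain ⟨c, hcf, hzc⟩ := hg (f z)
    obtain ⟨T, hTz, hT⟩ := h.eventuallyEq_affineIsometry hU hz hcf hzc
    obtain ⟨T', hTz', hT'⟩ := h'.eventuallyEq_affineIsometry hU hz hcf (hzz ▸ hzc)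
    have hmem : ∀ᶠ y in 𝓝 z, T y ∈ c.target ∧ T' y ∈ c.target := by
      refine Eventually.and (T.continuous.continuousAt.eventually_mem ?_)
        (T'.continuous.continuousAt.eventually_mem ?_)
      · exact c.open_target.mem_nhds (hTz ▸ c.map_source hzc)
      · exact c.open_target.mem_nhds (hTz' ▸ c.map_source (hzz ▸ hzc))
    have hall := (hT.and hT').and hmem
    have hfr := (mem_closure_iff_frequently.1 hzcl).and_eventually hall.eventually_nhds
    obtain ⟨y, hy1, hy2⟩ := hfr.exists
    have hTT : T =ᶠ[𝓝 y] T' := by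
      filter_upwards [hy1, hy2] with w hw1 hw2
      have : c.symm (T w) = c.symm (T' w) := by
        rw [← Function.comp_apply (f := c.symm), ← hw2.1.1, hw1, hw2.1.2]; rfl
      exact c.symm.injOn hw2.2.1 hw2.2.2 this
    have := affineIsometry_eq_of_eventuallyEq hTT
    subst this
    exact hT.trans hT'.symm
  exact fun z hz => (hsub hz).eq_of_nhds

theorem IsomOn.contMDiffOn_segment (h : IsomOn g f U) {a b : Cn n} (hab : segment ℝ a b ⊆ U) :
    ContMDiffOn 𝓘(ℝ, ℝ) 𝓘(ℝ, Cn n) 1 (fun t : ℝ => f (a + t • (b - a))) (Icc 0 1) := by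
  intro t ht
  have hδs : ContDiff ℝ ∞ fun t : ℝ => a + t • (b - a) := by fun_prop
  exact (((h.smooth _ (hab (by rw [segment_eq_image']; exact ⟨t, ht, rfl⟩))).comp t
    hδs.contDiffAt.contMDiffAt).of_le (by simp)).contMDiffWithinAt

theorem IsomOn.gLength_segment (h : IsomOn g f U) {a b : Cn n} (hab : segment ℝ a b ⊆ U) :
    gLength g (fun t : ℝ => f (a + t • (b - a))) = ENNReal.ofReal ‖b - a‖ := by
  set δ : ℝ → Cn n := fun t => a + t • (b - a)
  have hδm : ∀ t ∈ Icc (0 : ℝ) 1, δ t ∈ U := fun t ht => hab (by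
    rw [segment_eq_image']; exact ⟨t, ht, rfl⟩)
  have hδ : ∀ t, HasDerivAt δ (b - a) t := fun t => by
    simpa [δ] using (((hasDerivAt_id t).smul_const (b - a)).const_add a)
  rw [gLength_eq, MeasureTheory.setLIntegral_congr_fun (g := fun _ => ENNReal.ofReal ‖b - a‖)
    measurableSet_Icc]
  · simp
  · intro t ht
    have h3 := mfderiv_comp_curve (h.mdifferentiableAt (hδm t ht)) (hδ t)
    have h4 := h.metric _ (hδm t ht) (b - a) (b - a)
    simp only
    rw [h3]
    rw [stdMetric_self] at h4
    have h5 : g.inner (f (δ t)) (mfderiv 𝓘(ℝ, Cn n) 𝓘(ℝ, Cn n) f (δ t) (b - a))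
      (mfderiv 𝓘(ℝ, Cn n) 𝓘(ℝ, Cn n) f (δ t) (b - a)) = ‖b - a‖ ^ 2 := h4
    show ENNReal.ofReal (√(g.inner (f (δ t)) _ _)) = _
    rw [h5, Real.sqrt_sq (norm_nonneg _)]

/-- A locally isometric map does not increase distances along segments. -/
theorem IsomOn.gDist_le (h : IsomOn g f U) {a b : Cn n} (hab : segment ℝ a b ⊆ U) :
    gDist g (f a) (f b) ≤ ENNReal.ofReal ‖b - a‖ := by
  have h2 := gDist_le_gLength g (h.contMDiffOn_segment hab)
  rw [h.gLength_segment hab] at h2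
  simpa using h2

end

/-! ### Continuation of local isometries -/

section

variable {n : ℕ} {X : Type*} [TopologicalSpace X] [ChartedSpace (Cn n) X]
  [IsManifold 𝓘(ℝ, Cn n) ∞ X] {g : Metric (Cn n) X}

theorem IsomOn.isOpenMap {f : Cn n → X} (h : IsomOn g f univ)
    (hg : ∀ x : X, ∃ c ∈ flatAtlas g, x ∈ c.source) : IsOpenMap f := by
  refine IsOpenMap.of_nhds_le fun z => ?_
  obtain ⟨c, hc, hzc⟩ := hg (f z)
  obtain ⟨T, hTz, hT⟩ := h.eventuallyEq_affineIsometry isOpen_univ (mem_univ z) hc hzc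
  have h1 : Filter.map T (𝓝 z) = 𝓝 (T z) := T.toHomeomorph.map_nhds_eq z
  have hTt : T z ∈ c.symm.source := by rw [hTz]; exact c.map_source hzc
  rw [Filter.map_congr hT, ← Filter.map_map, h1, c.symm.map_nhds_eq hTt, hT.eq_of_nhds,
    Function.comp]

/-- The germ of `f₀` at `0` extends to a local isometry on a convex open set that contains `z`. -/
def ExtendsTo (g : Metric (Cn n) X) (f₀ : Cn n → X) (z : Cn n) (U : Set (Cn n)) (f : Cn n → X) :
    Prop :=
  IsOpen U ∧ Convex ℝ U ∧ 0 ∈ U ∧ z ∈ U ∧ IsomOn g f U ∧ f =ᶠ[𝓝 0] f₀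

theorem ExtendsTo.eqOn [T2Space X] (hg : ∀ x : X, ∃ c ∈ flatAtlas g, x ∈ c.source)
    {f₀ f f' : Cn n → X} {z z' : Cn n} {U U' : Set (Cn n)} (h : ExtendsTo g f₀ z U f)
    (h' : ExtendsTo g f₀ z' U' f') : EqOn f f' (U ∩ U') := by
  obtain ⟨hU, hUc, h0, -, hf, hff⟩ := h
  obtain ⟨hU', hUc', h0', -, hf', hff'⟩ := h'
  exact (hf.mono inter_subset_left).eqOn_of_eventuallyEq (hf'.mono inter_subset_right) hg
    (hU.inter hU') (hUc.inter hUc').isPreconnected ⟨h0, h0'⟩ (hff.trans hff'.symm)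

/-- The step beyond the domain of definition: a flat ball of radius `2ε` around a point close to
`f w` serves to extend `f` from `w` to each point `w'` on the ray through `w` at distance less than
`ε` from `w`. -/
theorem ExtendsTo.extend [T2Space X] (hg : ∀ x : X, ∃ c ∈ flatAtlas g, x ∈ c.source)
    {f₀ f : Cn n → X} {z : Cn n} {t t' : ℝ} (ht : 0 ≤ t) (htt : t ≤ t')
    {U : Set (Cn n)} (h : ExtendsTo g f₀ (t • z) U f) {c : OpenPartialHomeomorph X (Cn n)}
    (hc : c ∈ flatAtlas g) (hfc : f (t • z) ∈ c.source) {x : Cn n} {ε : ℝ}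
    (hx : dist (c (f (t • z))) x < ε) (hball : Metric.ball x (2 * ε) ⊆ c.target)
    (hε : (t' - t) * ‖z‖ < ε) : ∃ U' f', ExtendsTo g f₀ (t' • z) U' f' := by
  obtain ⟨hU, hUc, h0, htU, hf, hff⟩ := id h
  obtain ⟨T, hTz, hT⟩ := hf.eventuallyEq_affineIsometry hU htU hc hfc
  set B : Set (Cn n) := T ⁻¹' Metric.ball x (2 * ε)
  have hBo : IsOpen B := Metric.isOpen_ball.preimage T.continuous
  have hBc : Convex ℝ B := (convex_ball x (2 * ε)).affine_preimage T.toAffineEquiv.toAffineMap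
  have hBmem : ∀ r, |r - t| * ‖z‖ < ε → r • z ∈ B := by
    intro r hr
    have h1 : dist (T (r • z)) (T (t • z)) = |r - t| * ‖z‖ := by
      rw [T.dist_map, dist_eq_norm, ← sub_smul, norm_smul, Real.norm_eq_abs]
    have h2 := dist_triangle (T (r • z)) (T (t • z)) x
    rw [h1, hTz] at h2
    simp only [B, mem_preimage, Metric.mem_ball]
    linarith
  have hεpos : 0 < ε := lt_of_le_of_lt dist_nonneg hx
  have htB : t • z ∈ B := hBmem t (by simpa)
  have hisoB : IsomOn g (c.symm ∘ T) B :=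
    (((isomOn_symm_of_mem_flatAtlas hc).mono hball).comp_affineIsometry T)
  have heq : EqOn f (c.symm ∘ T) (U ∩ B) :=
    (hf.mono inter_subset_left).eqOn_of_eventuallyEq (hisoB.mono inter_subset_right) hg
      (hU.inter hBo) (hUc.inter hBc).isPreconnected ⟨htU, htB⟩ hT
  classical
  -- glue `f` and `c.symm ∘ T`, and restrict to a convex neighbourhood of the segment
  set F : Cn n → X := fun y => if y ∈ U then f y else c.symm (T y)
  have hFU : EqOn F f U := fun y hy => if_pos hy
  have hFB : EqOn F (c.symm ∘ T) B := fun y hy => by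
    by_cases hyU : y ∈ U
    · rw [hFU hyU, heq ⟨hyU, hy⟩]
    · exact if_neg hyU
  have hF : IsomOn g F (U ∪ B) := (hf.congr_eqOn hU hFU).union (hisoB.congr_eqOn hBo hFB)
  have hseg : segment ℝ 0 (t' • z) ⊆ U ∪ B := by
    rintro y hy
    rw [segment_eq_image'] at hy
    obtain ⟨r, ⟨hr0, hr1⟩, rfl⟩ := hy
    simp only [sub_zero, zero_add, smul_smul]
    rcases le_total (r * t') t with hrt | hrt
    · left
      rcases ht.eq_or_lt with rfl | ht0
      · have : r * t' = 0 := le_antisymm hrt (mul_nonneg hr0 (ht.trans htt))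
        simpa [this] using h0
      · have := hUc.smul_mem_of_zero_mem h0 htU
          (t := r * t' / t) ⟨div_nonneg (mul_nonneg hr0 (ht.trans htt)) ht, (div_le_one ht0).2 hrt⟩
        rwa [smul_smul, div_mul_cancel₀ _ ht0.ne'] at this
    · right
      apply hBmem
      rw [abs_of_nonneg (by linarith)]
      refine lt_of_le_of_lt (mul_le_mul_of_nonneg_right ?_ (norm_nonneg _)) hε
      have : r * t' ≤ t' := mul_le_of_le_one_left (ht.trans htt) hr1
      linarith
  have hcomp : IsCompact (segment ℝ 0 (t' • z)) := by
    rw [segment_eq_image']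
    exact isCompact_Icc.image (by fun_prop)
  obtain ⟨δ, hδ, hthick⟩ := hcomp.exists_thickening_subset_open (hU.union hBo) hseg
  refine ⟨Metric.thickening δ (segment ℝ 0 (t' • z)), F, Metric.isOpen_thickening,
    (convex_segment _ _).thickening δ,
    Metric.self_subset_thickening hδ _ (left_mem_segment ℝ _ _),
    Metric.self_subset_thickening hδ _ (right_mem_segment ℝ _ _), hF.mono hthick, ?_⟩
  exact (hFU.eventuallyEq_of_mem (hU.mem_nhds h0)).trans hff

/-- In a complete flat manifold, each germ of a local isometry extends along each ray. -/
theorem exists_extendsTo [T2Space X] (hcomplete : IsCompleteMetric g)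
    (hg : ∀ x : X, ∃ c ∈ flatAtlas g, x ∈ c.source) {f₀ : Cn n → X}
    (h₀ : ∃ U f, ExtendsTo g f₀ 0 U f) (z : Cn n) : ∃ U f, ExtendsTo g f₀ z U f := by
  set s : Set ℝ := {t | ∃ U f, ExtendsTo g f₀ (t • z) U f}
  have hs0 : (0 : ℝ) ∈ s := by simpa [s] using h₀
  have hopen : IsOpen s := by
    rw [isOpen_iff_mem_nhds]
    rintro t ⟨U, f, hU, hUc, h0, ht, hf, hff⟩
    have : Continuous fun r : ℝ => r • z := by fun_prop
    filter_upwards [(hU.preimage this).mem_nhds ht] with r hr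
    exact ⟨U, f, hU, hUc, h0, hr, hf, hff⟩
  -- completeness is used for closedness: the values along the ray form a Cauchy sequence
  have hclosed : IsClosed (s ∩ Icc 0 1) := by
    refine isClosed_of_closure_subset fun t ht => ?_
    have htI : t ∈ Icc (0 : ℝ) 1 := closure_minimal inter_subset_right isClosed_Icc ht
    refine ⟨?_, htI⟩
    by_cases hbig : ∃ t' ∈ s, t ≤ t'
    · obtain ⟨t', ⟨U, f, hU, hUc, h0, ht', hf, hff⟩, htt⟩ := hbig
      refine ⟨U, f, hU, hUc, h0, ?_, hf, hff⟩
      rcases htI.1.eq_or_lt with h | h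
      · simpa [← h] using h0
      · have := hUc.smul_mem_of_zero_mem h0 ht' (t := t / t')
          ⟨div_nonneg htI.1 (htI.1.trans htt), (div_le_one (h.trans_le htt)).2 htt⟩
        rwa [smul_smul, div_mul_cancel₀ _ (h.trans_le htt).ne'] at this
    push Not at hbig
    obtain ⟨τ, hτ, hτt⟩ := mem_closure_iff_seq_limit.1 ht
    choose U f hUf using fun k => (hτ k).1
    set u : ℕ → X := fun k => f k (τ k • z)
    have hdist : ∀ j k, gDist g (u j) (u k) ≤ ENNReal.ofReal (|τ k - τ j| * ‖z‖) := by
      have key : ∀ j k, τ j ≤ τ k →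
          gDist g (u j) (u k) ≤ ENNReal.ofReal (|τ k - τ j| * ‖z‖) := by
        intro j k hjk
        obtain ⟨hU, hUc, h0, hk, hf, hff⟩ := id (hUf k)
        have hjU : τ j • z ∈ U k := by
          rcases (hτ j).2.1.eq_or_lt with h | h
          · simpa [← h] using h0
          · have := hUc.smul_mem_of_zero_mem h0 hk (t := τ j / τ k)
              ⟨div_nonneg h.le (h.le.trans hjk), (div_le_one (h.trans_le hjk)).2 hjk⟩
            rwa [smul_smul, div_mul_cancel₀ _ (h.trans_le hjk).ne'] at this
        have h1 : u j = f k (τ j • z) := (hUf j).eqOn hg (hUf k) ⟨(hUf j).2.2.2.1, hjU⟩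
        rw [h1]
        have h2 := hf.gDist_le (hUc.segment_subset hjU hk)
        rwa [← sub_smul, norm_smul, Real.norm_eq_abs] at h2
      intro j k
      rcases le_total (τ j) (τ k) with h | h
      · exact key j k h
      · rw [gDist_comm, abs_sub_comm]; exact key k j h
    obtain ⟨x, hx⟩ := hcomplete u (by
      intro ε hε
      have hpos : 0 < ‖z‖ + 1 := by positivity
      obtain ⟨N, hN⟩ := Metric.cauchySeq_iff.1 hτt.cauchySeq (ε / (‖z‖ + 1)) (by positivity)
      refine ⟨N, fun i hi j hj => (hdist i j).trans_lt ?_⟩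
      rw [ENNReal.ofReal_lt_ofReal_iff hε]
      have := hN j hj i hi
      rw [Real.dist_eq, lt_div_iff₀ hpos] at this
      nlinarith [abs_nonneg (τ j - τ i)])
    obtain ⟨c, hc, hxc⟩ := hg x
    obtain ⟨ε, hε, hball⟩ := Metric.isOpen_iff.1 c.open_target _ (c.map_source hxc)
    have e1 : ∀ᶠ k in atTop, u k ∈ c.source := hx.eventually_mem (c.open_source.mem_nhds hxc)
    have e2 : ∀ᶠ k in atTop, dist (c (u k)) (c x) < ε / 2 :=
      (((c.continuousAt hxc).tendsto.comp hx).eventually (Metric.ball_mem_nhds _ (half_pos hε)))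
    have e3 : ∀ᶠ k in atTop, (t - τ k) * ‖z‖ < ε / 2 := by
      have : Tendsto (fun k => (t - τ k) * ‖z‖) atTop (𝓝 ((t - t) * ‖z‖)) :=
        (tendsto_const_nhds.sub hτt).mul_const _
      rw [sub_self, zero_mul] at this
      exact this.eventually_lt_const (half_pos hε)
    -- a flat ball about the limit `x` contains a term of the sequence, and reaches beyond `t`
    obtain ⟨k, hk1, hk2, hk3⟩ := (e1.and (e2.and e3)).exists
    exact (hUf k).extend hg (hτ k).2.1 (hbig _ (hτ k).1).le hc hk1 hk2
      (by rwa [mul_div_cancel₀ _ two_ne_zero]) hk3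
  have := hclosed.Icc_subset_of_forall_mem_nhdsWithin hs0 (fun t ht =>
    mem_nhdsWithin_of_mem_nhds (hopen.mem_nhds ht.1))
  simpa [s] using this (right_mem_Icc.2 zero_le_one)

/-- A complete flat manifold is the image of a local isometry that is defined on all of `ℂⁿ`. -/
theorem exists_isomOn_univ [T2Space X] (hcomplete : IsCompleteMetric g)
    (hg : ∀ x : X, ∃ c ∈ flatAtlas g, x ∈ c.source) (x₀ : X) :
    ∃ ϖ : Cn n → X, IsomOn g ϖ univ ∧ ϖ 0 = x₀ := by
  obtain ⟨c, hc, hxc⟩ := hg x₀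
  set T : Cn n ≃ᵃⁱ[ℝ] Cn n := AffineIsometryEquiv.vaddConst ℝ (c x₀)
  have hT0 : T 0 = c x₀ := by simp [T]
  set f₀ := c.symm ∘ T
  have hf₀ : f₀ 0 = x₀ := by simp only [f₀, Function.comp, hT0, c.left_inv hxc]
  have h₀ : ∃ U f, ExtendsTo g f₀ 0 U f := by
    have hmem : T ⁻¹' c.target ∈ 𝓝 (0 : Cn n) := T.continuous.continuousAt.preimage_mem_nhds
      (c.open_target.mem_nhds (hT0 ▸ c.map_source hxc))
    obtain ⟨ε, hε, hb⟩ := Metric.mem_nhds_iff.1 hmem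
    exact ⟨Metric.ball 0 ε, f₀, Metric.isOpen_ball, convex_ball _ _, Metric.mem_ball_self hε,
      Metric.mem_ball_self hε,
      ((isomOn_symm_of_mem_flatAtlas hc).comp_affineIsometry T).mono hb, EventuallyEq.rfl⟩
  choose U f hUf using exists_extendsTo hcomplete hg h₀
  refine ⟨fun z => f z z, ⟨?_, ?_⟩, ?_⟩
  rotate_left 2
  · have := (hUf 0).2.2.2.2.2.eq_of_nhds
    exact this.trans hf₀
  all_goals
    intro z _
    have heq : EqOn (fun y => f y y) (f z) (U z) := fun y hy =>
      (hUf y).eqOn hg (hUf z) ⟨(hUf y).2.2.2.1, hy⟩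
    have := (hUf z).2.2.2.2.1.congr_eqOn (hUf z).1 heq
  · exact this.smooth z (hUf z).2.2.2.1
  · exact this.metric z (hUf z).2.2.2.1

/-- On the ball around each point `a` of a fibre, a local isometry of `ℂⁿ` has the same form. -/
theorem IsomOn.eqOn_ball [T2Space X] (hg : ∀ x : X, ∃ c ∈ flatAtlas g, x ∈ c.source)
    {ϖ : Cn n → X} (h : IsomOn g ϖ univ) {c : OpenPartialHomeomorph X (Cn n)}
    (hc : c ∈ flatAtlas g) {y : Cn n} {ε : ℝ} (hball : Metric.ball y ε ⊆ c.target) {z : Cn n}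
    (hzc : ϖ z ∈ c.source) (hz : c (ϖ z) ∈ Metric.ball y ε) :
    ∃ T : Cn n ≃ᵃⁱ[ℝ] Cn n, T z = c (ϖ z) ∧ EqOn ϖ (c.symm ∘ T) (T ⁻¹' Metric.ball y ε) := by
  obtain ⟨T, hTz, hT⟩ := h.eventuallyEq_affineIsometry isOpen_univ (mem_univ z) hc hzc
  refine ⟨T, hTz, (h.mono (subset_univ _)).eqOn_of_eventuallyEq
    (((isomOn_symm_of_mem_flatAtlas hc).mono hball).comp_affineIsometry T) hg
    (Metric.isOpen_ball.preimage T.continuous) ?_ (a := z) ?_ hT⟩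
  · exact ((convex_ball y ε).affine_preimage T.toAffineEquiv.toAffineMap).isPreconnected
  · simpa [hTz] using hz

/-- A local isometry `ℂⁿ → X` is a covering. -/
theorem IsomOn.isCoveringMap [T2Space X] (hg : ∀ x : X, ∃ c ∈ flatAtlas g, x ∈ c.source)
    {ϖ : Cn n → X} (h : IsomOn g ϖ univ) : IsCoveringMap ϖ := by
  intro x
  have hcont : Continuous ϖ := continuous_iff_continuousAt.2 fun z => h.continuousAt (mem_univ z)
  obtain ⟨c, hc, hxc⟩ := hg x
  obtain ⟨ε, hε, hball⟩ := Metric.isOpen_iff.1 c.open_target _ (c.map_source hxc)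
  set N : Set X := c.source ∩ c ⁻¹' Metric.ball (c x) ε
  have hN : IsOpen N := c.isOpen_inter_preimage Metric.isOpen_ball
  have hxN : x ∈ N := ⟨hxc, Metric.mem_ball_self hε⟩
  -- the isometry at a point of the fibre
  have hfib : ∀ a : ϖ ⁻¹' {x}, ∃ T : Cn n ≃ᵃⁱ[ℝ] Cn n, T a = c x ∧
      EqOn ϖ (c.symm ∘ T) (Metric.ball a ε) := by
    rintro ⟨a, ha⟩
    have ha' : ϖ a = x := ha
    obtain ⟨T, hT1, hT2⟩ := h.eqOn_ball hg hc hball (z := a) (by rwa [ha'])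
      (by rw [ha']; exact Metric.mem_ball_self hε)
    rw [ha'] at hT1
    refine ⟨T, hT1, hT2.mono fun y hy => ?_⟩
    simp only [mem_preimage, Metric.mem_ball, ← hT1, T.dist_map]
    exact hy
  choose T hTa hT using hfib
  have hTball : ∀ a : ϖ ⁻¹' {x}, ∀ y ∈ Metric.ball (a : Cn n) ε, T a y ∈ Metric.ball (c x) ε := by
    intro a y hy
    rw [Metric.mem_ball, ← hTa a, (T a).dist_map]
    exact hy
  have hexh : ∀ z, ϖ z ∈ N → ∃ a : ϖ ⁻¹' {x}, z ∈ Metric.ball (a : Cn n) ε := by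
    intro z hz
    obtain ⟨T', h1, h2⟩ := h.eqOn_ball hg hc hball hz.1 hz.2
    refine ⟨⟨T'.symm (c x), ?_⟩, ?_⟩
    · have := h2 (x := T'.symm (c x)) (by simpa using hε)
      rw [mem_preimage, mem_singleton_iff, this]
      simp [c.left_inv hxc]
    · rw [Metric.mem_ball, ← T'.dist_map]
      simpa [h1] using hz.2
  have hdisj : ∀ a b : ϖ ⁻¹' {x}, a ≠ b → Disjoint (Metric.ball (a : Cn n) ε)
      (Metric.ball (b : Cn n) ε) := by
    intro a b hab
    rw [Set.disjoint_left]
    intro z hza hzb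
    apply hab
    have : T a = T b := by
      apply affineIsometry_eq_of_eventuallyEq (z := z)
      filter_upwards [Metric.isOpen_ball.mem_nhds hza, Metric.isOpen_ball.mem_nhds hzb]
        with y hya hyb
      exact c.symm.injOn (hball (hTball a y hya)) (hball (hTball b y hyb))
        ((hT a hya).symm.trans (hT b hyb))
    have h2 := hTa a
    rw [this, ← hTa b] at h2
    exact Subtype.ext ((T b).injective h2)
  by_cases hne : Nonempty (ϖ ⁻¹' {x})
  · have hdisc : DiscreteTopology (ϖ ⁻¹' {x}) := by
      rw [discreteTopology_iff_isOpen_singleton]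
      intro a
      refine ⟨Metric.ball a ε, Metric.isOpen_ball, ?_⟩
      ext b
      simp only [mem_preimage, mem_singleton_iff]
      constructor
      · intro hb
        by_contra hab
        exact Set.disjoint_left.1 (hdisj b a hab) (Metric.mem_ball_self hε) hb
      · rintro rfl
        exact Metric.mem_ball_self hε
    have : Nonempty (X → Cn n) := ⟨fun _ => 0⟩
    have hsurj : ∀ a : ϖ ⁻¹' {x}, SurjOn ϖ (Metric.ball (a : Cn n) ε) N := by
      rintro a y ⟨hyc, hy⟩
      have hmem : (T a).symm (c y) ∈ Metric.ball (a : Cn n) ε := by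
        rw [Metric.mem_ball, ← (T a).dist_map, hTa]
        simpa using hy
      refine ⟨(T a).symm (c y), hmem, ?_⟩
      rw [hT a hmem]
      simp [c.left_inv hyc]
    let t := IsOpen.trivializationDiscrete (f := ϖ) (fun a : ϖ ⁻¹' {x} => Metric.ball (a : Cn n) ε)
      N hN (by
        intro a W hW
        refine ⟨fun hWo => (hWo.preimage hcont).inter Metric.isOpen_ball, fun hWo => ?_⟩
        have := (h.isOpenMap hg) _ hWo
        convert this using 1
        ext y
        constructor
        · intro hy
          obtain ⟨z, hz, rfl⟩ := hsurj a (hW hy)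
          exact ⟨z, ⟨hy, hz⟩, rfl⟩
        · rintro ⟨z, ⟨hz, -⟩, rfl⟩
          exact hz)
      (by
        intro a y hy y' hy' hyy
        rw [hT a hy, hT a hy'] at hyy
        exact (T a).injective (c.symm.injOn (hball (hTball a y hy)) (hball (hTball a y' hy')) hyy))
      hsurj (fun a b hab => hdisj a b hab)
      (fun z hz => by
        obtain ⟨a, ha⟩ := hexh z hz
        exact mem_iUnion.2 ⟨a, ha⟩)
    exact (IsEvenlyCovered.of_trivialization (t := t) hxN)
  · rw [not_nonempty_iff] at hne
    refine IsEvenlyCovered.of_preimage_eq_empty _ (hN.mem_nhds hxN) ?_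
    ext z
    simp only [mem_preimage, mem_empty_iff_false, iff_false]
    intro hz
    obtain ⟨a, -⟩ := hexh z hz
    exact hne.false a

/-- The image of a covering map is also closed, since the fibres are homeomorphic near each point.
-/
theorem surjective_of_isCoveringMap {E : Type*} [TopologicalSpace E] [Nonempty E]
    {Y : Type*} [TopologicalSpace Y] [PreconnectedSpace Y]
    {f : E → Y} (hf : IsCoveringMap f) : Function.Surjective f := by
  rw [← range_eq_univ]
  refine IsClopen.eq_univ ⟨?_, hf.isOpenMap.isOpen_range⟩ (range_nonempty f)
  rw [← isOpen_compl_iff, isOpen_iff_mem_nhds]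
  intro x hx
  obtain ⟨-, U, hxU, hU, -, H, hH⟩ := hf x
  filter_upwards [hU.mem_nhds hxU]
  rintro y hy ⟨e, rfl⟩
  have hI := (H ⟨e, hy⟩).2
  apply hx
  refine ⟨(H.symm (⟨x, hxU⟩, hI)).1, ?_⟩
  have := hH (H.symm (⟨x, hxU⟩, hI))
  rw [H.apply_symm_apply] at this
  exact this.symm

end

/-! ### Local inverses, and forms in charts -/

section

/-- A field of alternating maps is smooth if all of its values at constant vectors are. -/
theorem contDiffAt_of_apply {E V F : Type*} [NormedAddCommGroup E] [NormedSpace ℝ E]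
    [NormedAddCommGroup V] [NormedSpace ℝ V] [FiniteDimensional ℝ V]
    [NormedAddCommGroup F] [NormedSpace ℝ F] [FiniteDimensional ℝ F] {k : ℕ}
    {α : E → V [⋀^Fin k]→L[ℝ] F} {m : ℕ∞ω} {x : E}
    (h : ∀ v : Fin k → V, ContDiffAt ℝ m (fun y => α y v) x) : ContDiffAt ℝ m α x := by
  let b := Module.finBasis ℝ V
  let ev : (V [⋀^Fin k]→L[ℝ] F) →ₗ[ℝ] ((Fin k → Fin (Module.finrank ℝ V)) → F) :=
    { toFun := fun a i => a fun j => b (i j)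
      map_add' := fun _ _ => rfl
      map_smul' := fun _ _ => rfl }
  have hev : LinearMap.ker ev = ⊥ := by
    rw [LinearMap.ker_eq_bot]
    intro a a' haa
    have : a.toMultilinearMap = a'.toMultilinearMap :=
      Module.Basis.ext_multilinear (fun _ => b) fun i => congrFun haa i
    ext v
    exact congrArg (fun T => T v) this
  obtain ⟨L, hL⟩ := ev.exists_leftInverse_of_injective hev
  have h1 : ContDiffAt ℝ m (fun y => ev (α y)) x := contDiffAt_pi.2 fun i => h _
  have h2 := (L.toContinuousLinearMap.contDiff.contDiffAt (x := ev (α x))).comp x h1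
  refine h2.congr_of_eventuallyEq (Eventually.of_forall fun y => ?_)
  exact (congrArg (fun T : (V [⋀^Fin k]→L[ℝ] F) →ₗ[ℝ] _ => T (α y)) hL).symm

variable {n : ℕ} {X : Type*} [TopologicalSpace X] [ChartedSpace (Cn n) X]
  [IsManifold 𝓘(ℝ, Cn n) ∞ X]

/-- An injective endomorphism of `ℂⁿ` is invertible. -/
theorem exists_equiv_of_injective {L : Cn n →L[ℝ] Cn n} (hL : Function.Injective L) :
    ∃ e : Cn n ≃L[ℝ] Cn n, (e : Cn n →L[ℝ] Cn n) = L :=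
  ⟨(LinearEquiv.ofInjectiveEndo L.toLinearMap hL).toContinuousLinearEquiv, by ext; rfl⟩

theorem IsomOn.mfderiv_injective {g : Metric (Cn n) X} {ϖ : Cn n → X} {U : Set (Cn n)}
    (h : IsomOn g ϖ U) {z : Cn n} (hz : z ∈ U) :
    Function.Injective (mfderiv 𝓘(ℝ, Cn n) 𝓘(ℝ, Cn n) ϖ z) := by
  rw [injective_iff_map_eq_zero]
  intro (v : Cn n) hv
  have h1 := h.metric z hz v v
  have h2 : pullBilin (E' := Cn n) ϖ g.inner z v v = 0 := by
    have : pullBilin (E' := Cn n) ϖ g.inner z v v = g.inner (ϖ z)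
      (mfderiv 𝓘(ℝ, Cn n) 𝓘(ℝ, Cn n) ϖ z v) (mfderiv 𝓘(ℝ, Cn n) 𝓘(ℝ, Cn n) ϖ z v) := rfl
    rw [this, hv, map_zero]
  rw [h2, stdMetric_self] at h1
  have := pow_eq_zero_iff two_ne_zero |>.1 h1.symm
  exact (norm_eq_zero (E := Cn n)).1 this

omit [IsManifold 𝓘(ℝ, Cn n) ∞ X] in
theorem fderiv_comp_chart {c : OpenPartialHomeomorph X (Cn n)}
    (hc : c ∈ IsManifold.maximalAtlas 𝓘(ℝ, Cn n) ∞ X) {ϖ : Cn n → X} {z : Cn n}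
    (hϖ : MDifferentiableAt 𝓘(ℝ, Cn n) 𝓘(ℝ, Cn n) ϖ z) (hz : ϖ z ∈ c.source) (v : Cn n) :
    fderiv ℝ (c ∘ ϖ) z v = diffAt c (ϖ z) (mfderiv 𝓘(ℝ, Cn n) 𝓘(ℝ, Cn n) ϖ z v) := by
  have h1 : MDifferentiableAt 𝓘(ℝ, Cn n) 𝓘(ℝ, Cn n) c (ϖ z) :=
    (contMDiffAt_of_mem_maximalAtlas hc hz).mdifferentiableAt (by simp)
  have h2 := mfderiv_comp z h1 hϖ
  rw [mfderiv_eq_fderiv] at h2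
  exact congrArg (fun T : Cn n →L[ℝ] Cn n => T v) h2

omit [IsManifold 𝓘(ℝ, Cn n) ∞ X] in
theorem diffAt_injective {c : OpenPartialHomeomorph X (Cn n)}
    (hc : c ∈ IsManifold.maximalAtlas 𝓘(ℝ, Cn n) ∞ X) {x : X} (hx : x ∈ c.source) :
    Function.Injective (diffAt c x) := by
  have h1 : MDifferentiableAt 𝓘(ℝ, Cn n) 𝓘(ℝ, Cn n) c x :=
    (contMDiffAt_of_mem_maximalAtlas hc hx).mdifferentiableAt (by simp)
  have h2 : MDifferentiableAt 𝓘(ℝ, Cn n) 𝓘(ℝ, Cn n) c.symm (c x) :=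
    (contMDiffAt_symm_of_mem_maximalAtlas hc (c.map_source hx)).mdifferentiableAt (by simp)
  have h3 := mfderiv_comp x h2 h1
  have h4 : (c.symm ∘ c) =ᶠ[𝓝 x] id := by
    filter_upwards [c.open_source.mem_nhds hx] with z hz
    exact c.left_inv hz
  have h5 := h4.mfderiv_eq (I := 𝓘(ℝ, Cn n)) (I' := 𝓘(ℝ, Cn n))
  intro v w hvw
  have key : ∀ v : Cn n, mfderiv 𝓘(ℝ, Cn n) 𝓘(ℝ, Cn n) c.symm (c x) (diffAt c x v) = v := by
    intro v
    have h6 := congrArg (fun T : Cn n →L[ℝ] Cn n => T v) (h3.symm.trans h5)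
    refine Eq.trans h6 ?_
    rw [mfderiv_id]
    rfl
  rw [← key v, ← key w]
  exact congrArg _ hvw

/-- The exterior derivative of a 2-form as a cyclic sum. -/
theorem closed_two_form_cyclic {α : Cn n → Cn n [⋀^Fin 2]→L[ℝ] ℝ} {z : Cn n}
    (hα : DifferentiableAt ℝ α z) (h : extDeriv α z = 0) (a b c : Cn n) :
    fderiv ℝ α z a ![b, c] + fderiv ℝ α z b ![c, a] + fderiv ℝ α z c ![a, b] = 0 := by
  have h1 := congrArg (fun T => T ![a, b, c]) h
  simp only [extDeriv_apply hα] at h1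
  rw [Fin.sum_univ_three] at h1
  have e0 : Fin.removeNth 0 ![a, b, c] = ![b, c] := by ext i; fin_cases i <;> rfl
  have e1 : Fin.removeNth 1 ![a, b, c] = ![a, c] := by ext i; fin_cases i <;> rfl
  have e2 : Fin.removeNth 2 ![a, b, c] = ![a, b] := by ext i; fin_cases i <;> rfl
  have hsw : fderiv ℝ α z b ![c, a] = -fderiv ℝ α z b ![a, c] := by
    have := (fderiv ℝ α z b).map_swap ![a, c] (i := 0) (j := 1) (by decide)
    refine Eq.trans ?_ this
    refine congrArg (fderiv ℝ α z b) ?_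
    ext i; fin_cases i <;> rfl
  have hv : ∀ v w, fderiv ℝ (fun x => α x v) z w = fderiv ℝ α z w v := fun v w =>
    congrArg (fun T => T w) ((ContinuousAlternatingMap.apply ℝ (Cn n) ℝ v).hasFDerivAt.comp z
      hα.hasFDerivAt).fderiv
  rw [e0, e1, e2] at h1
  simp only [hv] at h1
  simp at h1
  rw [hsw]
  linarith

omit [IsManifold 𝓘(ℝ, Cn n) ∞ X] in
/-- A local inverse, in a chart `c`, of a map `G : ℂⁿ → X` that is a local diffeomorphism at `z`. -/
theorem exists_local_inverse {G : Cn n → X} {z : Cn n}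
    (hG : ContMDiffAt 𝓘(ℝ, Cn n) 𝓘(ℝ, Cn n) ∞ G z)
    (hinj : Function.Injective (mfderiv 𝓘(ℝ, Cn n) 𝓘(ℝ, Cn n) G z))
    {c : OpenPartialHomeomorph X (Cn n)} (hc : c ∈ IsManifold.maximalAtlas 𝓘(ℝ, Cn n) ∞ X)
    (hzc : G z ∈ c.source) :
    ∃ s : Cn n → Cn n, ContDiffAt ℝ ∞ s (c (G z)) ∧ s (c (G z)) = z ∧
      (∀ᶠ w in 𝓝 (c (G z)), G (s w) = c.symm w) ∧ ∀ᶠ y in 𝓝 z, s (c (G y)) = y := by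
  have hφ : ContDiffAt ℝ ∞ (c ∘ G) z :=
    ((contMDiffAt_of_mem_maximalAtlas hc hzc).comp z hG).contDiffAt
  have hinj' : Function.Injective (fderiv ℝ (c ∘ G) z) := by
    intro v w hvw
    rw [fderiv_comp_chart hc (hG.mdifferentiableAt (by simp)) hzc,
      fderiv_comp_chart hc (hG.mdifferentiableAt (by simp)) hzc] at hvw
    exact hinj (diffAt_injective hc hzc hvw)
  obtain ⟨e, he⟩ := exists_equiv_of_injective hinj'
  have hd : HasFDerivAt (c ∘ G) (e : Cn n →L[ℝ] Cn n) z :=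
    he ▸ (hφ.differentiableAt (by simp)).hasFDerivAt
  have hst := hφ.hasStrictFDerivAt' hd (by simp)
  have hs : ContDiffAt ℝ ∞ (hst.localInverse (c ∘ G) e z) (c (G z)) :=
    hφ.to_localInverse hd (by simp)
  refine ⟨hst.localInverse (c ∘ G) e z, hs, hst.localInverse_apply_image, ?_,
    hst.eventually_left_inverse⟩
  have h1 : ∀ᶠ w in 𝓝 (c (G z)), G (hst.localInverse (c ∘ G) e z w) ∈ c.source := by
    have : ContinuousAt (fun w => G (hst.localInverse (c ∘ G) e z w)) (c (G z)) := by
      refine ContinuousAt.comp (g := G) ?_ hs.continuousAt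
      rw [show hst.localInverse (c ∘ G) e z (c (G z)) = z from hst.localInverse_apply_image]
      exact hG.continuousAt
    refine this.eventually_mem (c.open_source.mem_nhds ?_)
    rwa [show hst.localInverse (c ∘ G) e z (c (G z)) = z from hst.localInverse_apply_image]
  have h2 : ∀ᶠ w in 𝓝 (c (G z)), c (G (hst.localInverse (c ∘ G) e z w)) = w :=
    hst.eventually_right_inverse
  filter_upwards [h1, h2] with w hw1 hw2
  rw [← c.left_inv hw1, hw2]

omit [IsManifold 𝓘(ℝ, Cn n) ∞ X] in
/-- Near `y`, a form in the chart `c` is the pull-back by `s` of its pull-back by `G`, where `s` is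
a local section of `c ∘ G`. -/
theorem formInChart_eventuallyEq {F : Type*} [NormedAddCommGroup F] [NormedSpace ℝ F] {k : ℕ}
    {G : Cn n → X} {s : Cn n → Cn n} {y : Cn n} (hs : ContDiffAt ℝ ∞ s y)
    (hG : ∀ᶠ z in 𝓝 (s y), MDifferentiableAt 𝓘(ℝ, Cn n) 𝓘(ℝ, Cn n) G z)
    {c : OpenPartialHomeomorph X (Cn n)} (hsc : ∀ᶠ w in 𝓝 y, G (s w) = c.symm w)
    (α : DForm (Cn n) X k F) :
    formInChart c α =ᶠ[𝓝 y] fun w =>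
      (pullForm (E' := Cn n) G α (s w) : Cn n [⋀^Fin k]→L[ℝ] F).compContinuousLinearMap
        (fderiv ℝ s w) := by
  have hs' : ∀ᶠ w in 𝓝 y, ContDiffAt ℝ 1 s w :=
    (hs.of_le (by simp)).eventually (by simp)
  filter_upwards [hsc.eventually_nhds, hs', hs.continuousAt.eventually hG] with w hw hw' hGw
  have h1 : pullForm (E' := Cn n) c.symm α w = pullForm (E' := Cn n) (G ∘ s) α w :=
    (pullForm_congr hw α).symm
  refine h1.trans ((pullForm_comp hGw (hw'.differentiableAt (by simp)).mdifferentiableAt α).trans ?_)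
  exact pullForm_eq_fderiv s _ w

/-- The pull-back of the Kähler form under a local isometry `ϖ` is closed wherever it is smooth. -/
theorem extDeriv_pull_kform (X₀ : CalabiYau n X) {ϖ : Cn n → X} (h : IsomOn X₀.g ϖ univ)
    {α : Cn n → Cn n [⋀^Fin 2]→L[ℝ] ℝ} (hαdef : ∀ z, α z = pullForm (E' := Cn n) ϖ X₀.kform z)
    {z : Cn n} (hα : ContDiffAt ℝ ∞ α z) : extDeriv α z = 0 := by
  set c := chartAt (Cn n) (ϖ z)
  have hc : c ∈ IsManifold.maximalAtlas 𝓘(ℝ, Cn n) ∞ X := IsManifold.chart_mem_maximalAtlas _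
  have hzc : ϖ z ∈ c.source := mem_chart_source _ _
  set y := c (ϖ z)
  have hy : y ∈ c.target := c.map_source hzc
  obtain ⟨s, hs, hsy, hsc, -⟩ := exists_local_inverse (h.smooth z (mem_univ z))
    (h.mfderiv_injective (mem_univ z)) hc hzc
  have hform : formInChart c X₀.kform =ᶠ[𝓝 y]
      fun w => (α (s w)).compContinuousLinearMap (fderiv ℝ s w) := by
    refine (formInChart_eventuallyEq hs (Eventually.of_forall fun z =>
      h.mdifferentiableAt (mem_univ z)) hsc X₀.kform).trans (Eventually.of_forall fun w => ?_)
    show _ = (α (s w)).compContinuousLinearMap _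
    rw [hαdef]
    rfl
  have h0 := X₀.kform_closed c (chart_mem_atlas _ _) y ⟨hy, mem_univ _⟩
  rw [hform.extDeriv_eq] at h0
  have hpb := extDeriv_pullback (f := s) (x := y) (r := ∞)
    (show DifferentiableAt ℝ α (s y) by rw [hsy]; exact hα.differentiableAt (by simp)) hs
    two_le_smoothness
  have h3 : formInChart c (0 : DForm (Cn n) X 3 ℝ) y = 0 := by
    unfold formInChart pullForm
    ext v; rfl
  have hinj : Function.Injective (fderiv ℝ s y) := by
    have hcs : ContMDiffAt 𝓘(ℝ, Cn n) 𝓘(ℝ, Cn n) ∞ (c ∘ ϖ) (s y) := by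
      rw [hsy]
      exact (contMDiffAt_of_mem_maximalAtlas hc hzc).comp z (h.smooth z (mem_univ z))
    have h5 : HasFDerivAt ((c ∘ ϖ) ∘ s) ((fderiv ℝ (c ∘ ϖ) (s y)).comp (fderiv ℝ s y)) y :=
      (hcs.contDiffAt.differentiableAt (by simp)).hasFDerivAt.comp y
        (hs.differentiableAt (by simp)).hasFDerivAt
    have h6 : ((c ∘ ϖ) ∘ s) =ᶠ[𝓝 y] id := by
      filter_upwards [hsc, c.open_target.mem_nhds hy] with w hw hw'
      simp only [Function.comp, hw, c.right_inv hw', id]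
    have h7 := h5.unique ((hasFDerivAt_id y).congr_of_eventuallyEq h6)
    intro v w hvw
    have h8 := fun v => congrArg (fun T : Cn n →L[ℝ] Cn n => T v) h7
    have hv := h8 v
    have hw := h8 w
    simp only [ContinuousLinearMap.comp_apply, ContinuousLinearMap.id_apply] at hv hw
    rw [← hv, ← hw, hvw]
  obtain ⟨e, he⟩ := exists_equiv_of_injective hinj
  have h9 := hpb.symm.trans (h0.trans h3)
  rw [hsy] at h9
  ext v
  have h10 := congrArg (fun T => T fun i => e.symm (v i)) h9
  simp only [ContinuousAlternatingMap.compContinuousLinearMap_apply] at h10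
  rw [← he] at h10
  simpa [Function.comp_def] using h10

end

/-! ### The complex structure is parallel -/

section

variable {n : ℕ} {X : Type*} [TopologicalSpace X] [ChartedSpace (Cn n) X]
  [IsManifold 𝓘(ℝ, Cn n) ∞ X]

/-- Multiplication by `i` as a real linear map. -/
noncomputable def mulI (n : ℕ) : Cn n →L[ℝ] Cn n :=
  ((Complex.I • ContinuousLinearMap.id ℂ (Cn n)) : Cn n →L[ℂ] Cn n).restrictScalars ℝ

@[simp] theorem mulI_apply (v : Cn n) : mulI n v = Complex.I • v := rfl

/-- The pull-back of the complex structure of a Kähler manifold by a local isometry from `ℂⁿ` is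
constant: closedness of the Kähler form and integrability show that its derivative vanishes. -/
theorem exists_complexStructure_eq (X₀ : CalabiYau n X) {ϖ : Cn n → X}
    (h : IsomOn X₀.g ϖ univ) :
    ∃ J₀ : Cn n →L[ℝ] Cn n, (∀ v, J₀ (J₀ v) = -v) ∧
      (∀ v w : Cn n, inner ℝ (J₀ v) (J₀ w) = inner ℝ v w) ∧
      ∀ z v, mfderiv 𝓘(ℝ, Cn n) 𝓘(ℝ, Cn n) ϖ z (J₀ v) =
        X₀.J (ϖ z) (mfderiv 𝓘(ℝ, Cn n) 𝓘(ℝ, Cn n) ϖ z v) := by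
  choose L hL using fun z => exists_equiv_of_injective (n := n)
    (L := mfderiv 𝓘(ℝ, Cn n) 𝓘(ℝ, Cn n) ϖ z) (h.mfderiv_injective (mem_univ z))
  have hL' : ∀ z v, L z v = mfderiv 𝓘(ℝ, Cn n) 𝓘(ℝ, Cn n) ϖ z v := fun z v =>
    congrArg (fun T : Cn n →L[ℝ] Cn n => T v) (hL z)
  let JX : X → Cn n →L[ℝ] Cn n := X₀.J
  let gX : X → Cn n →L[ℝ] Cn n →L[ℝ] ℝ := X₀.g.inner
  let J : Cn n → Cn n →L[ℝ] Cn n := fun z =>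
    ((L z).symm : Cn n →L[ℝ] Cn n).comp ((JX (ϖ z)).comp (L z : Cn n →L[ℝ] Cn n))
  have hLJ : ∀ z v, L z (J z v) = JX (ϖ z) (L z v) := fun z v => by simp [J]
  have hgL : ∀ z v w, gX (ϖ z) (L z v) (L z w) = inner ℝ v w := by
    intro z v w
    rw [real_inner_eq_stdMetric, hL', hL']
    exact h.metric z (mem_univ z) v w
  have hsq : ∀ z v, J z (J z v) = -v := by
    intro z v
    apply (L z).injective
    rw [hLJ, hLJ, map_neg]
    exact X₀.J_sq (ϖ z) (L z v)
  have hiso : ∀ z v w, inner ℝ (J z v) (J z w) = inner ℝ v w := by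
    intro z v w
    rw [← hgL z, ← hgL z, hLJ, hLJ]
    exact X₀.J_isometry (ϖ z) (L z v) (L z w)
  -- holomorphic charts
  have hchart : ∀ z, ∃ (φ : Cn n → Cn n) (U : Set (Cn n)), IsOpen U ∧ z ∈ U ∧
      ContDiffOn ℝ ∞ φ U ∧ (∀ y ∈ U, Function.Injective (fderiv ℝ φ y)) ∧
      ∀ y ∈ U, ∀ v, fderiv ℝ φ y (J y v) = Complex.I • fderiv ℝ φ y v := by
    intro z
    obtain ⟨c, hc, hzc, hcJ, -⟩ := X₀.holomorphic (ϖ z)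
    have hcont : Continuous ϖ := continuous_iff_continuousAt.2 fun z => h.continuousAt (mem_univ z)
    have hfd : ∀ y ∈ ϖ ⁻¹' c.source, ∀ v, fderiv ℝ (c ∘ ϖ) y v = diffAt c (ϖ y) (L y v) := by
      intro y hy v
      rw [fderiv_comp_chart hc (h.mdifferentiableAt (mem_univ y)) hy, hL']
    refine ⟨c ∘ ϖ, ϖ ⁻¹' c.source, c.open_source.preimage hcont, hzc, ?_, ?_, ?_⟩
    · intro y hy
      exact ((contMDiffAt_of_mem_maximalAtlas hc hy).comp y
        (h.smooth y (mem_univ y))).contDiffAt.contDiffWithinAt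
    · intro y hy v w hvw
      rw [hfd y hy, hfd y hy] at hvw
      exact (L y).injective (diffAt_injective hc hy hvw)
    · intro y hy v
      rw [hfd y hy, hfd y hy, hLJ]
      exact hcJ _ hy _
  -- in terms of holomorphic coordinates `φ`, the pulled back structure is `dφ⁻¹ ∘ i ∘ dφ`
  have hJ : ContDiff ℝ ∞ J := by
    rw [contDiff_iff_contDiffAt]
    intro z
    obtain ⟨φ, U, hU, hzU, hφ, hinj, hhol⟩ := hchart z
    have hd : ContDiffAt ℝ ∞ (fderiv ℝ φ) z :=
      ((hφ.contDiffAt (hU.mem_nhds hzU)).fderiv_right (by simp))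
    obtain ⟨e, he⟩ := exists_equiv_of_injective (hinj z hzU)
    have h1 : ContDiffAt ℝ ∞ (fun y => (fderiv ℝ φ y).inverse.comp
        ((mulI n).comp (fderiv ℝ φ y))) z := by
      have h0 : ContDiffAt ℝ ∞ (fun y => (fderiv ℝ φ y).inverse) z := by
        refine ContDiffAt.comp (g := ContinuousLinearMap.inverse) z ?_ hd
        rw [← he]
        exact contDiffAt_map_inverse e
      exact h0.clm_comp ((contDiffAt_const (c := mulI n)).clm_comp hd)
    refine h1.congr_of_eventuallyEq ?_
    filter_upwards [hU.mem_nhds hzU] with y hy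
    obtain ⟨e', he'⟩ := exists_equiv_of_injective (hinj y hy)
    ext1 v
    have h2 := hhol y hy v
    rw [← he'] at h2 ⊢
    simp only [ContinuousLinearMap.inverse_equiv, ContinuousLinearMap.comp_apply, mulI_apply]
    rw [← h2]
    simp
  -- the pulled back Kähler form, which is closed
  let α : Cn n → Cn n [⋀^Fin 2]→L[ℝ] ℝ := fun z => pullForm (E' := Cn n) ϖ X₀.kform z
  have hα : ∀ z v w, α z ![v, w] = inner ℝ (J z v) w := by
    intro z v w
    rw [← hgL z, hLJ, hL', hL']
    refine Eq.trans ?_ (X₀.kform_apply (ϖ z) _ _)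
    refine congrArg (X₀.kform (ϖ z)) ?_
    ext i; fin_cases i <;> rfl
  have hαs : ∀ z, ContDiffAt ℝ ∞ α z := by
    intro z
    refine contDiffAt_of_apply fun v => ?_
    have : (fun y => α y v) = fun y => inner ℝ (J y (v 0)) (v 1) := by
      ext y
      rw [← hα]
      congr 1
      ext i; fin_cases i <;> rfl
    rw [this]
    exact (hJ.contDiffAt.clm_apply contDiffAt_const).inner ℝ contDiffAt_const
  have hαd : ∀ z, extDeriv α z = 0 := fun z => extDeriv_pull_kform X₀ h (fun _ => rfl) (hαs z)
  have hJα : ∀ z a b c, fderiv ℝ α z a ![b, c] = inner ℝ (fderiv ℝ J z a b) c := by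
    intro z a b c
    have h1 : HasFDerivAt (fun y => α y ![b, c]) ((ContinuousAlternatingMap.apply ℝ (Cn n) ℝ
        ![b, c]).comp (fderiv ℝ α z)) z := (ContinuousAlternatingMap.apply ℝ (Cn n) ℝ
        ![b, c]).hasFDerivAt.comp z ((hαs z).differentiableAt (by simp)).hasFDerivAt
    have h2 := (HasFDerivAt.apply_vec ((hJ.differentiable (by simp)) z).hasFDerivAt b).inner ℝ
      (hasFDerivAt_const c z)
    simp only [hα] at h1
    have h3 := congrArg (fun T => T a) (h1.unique h2)
    refine Eq.trans h3 ?_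
    simp [fderivInnerCLM_apply]
  have hconst : ∀ z, fderiv ℝ J z = 0 := by
    intro z
    obtain ⟨φ, U, hU, hzU, hφ, hinj, hhol⟩ := hchart z
    refine fderiv_complexStructure_eq_zero hU (hJ.differentiable (by simp)).differentiableOn
      (fun y _ => hsq y) (fun y _ => hiso y) (fun y _ a b c => ?_) (fun y hy a b => ?_) hzU
    · rw [← hJα, ← hJα, ← hJα]
      exact closed_two_form_cyclic ((hαs y).differentiableAt (by simp)) (hαd y) a b c
    · exact integrable_of_holomorphic_chart hU (hJ.differentiable (by simp)).differentiableOn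
        hφ hinj hhol hy a b
  have hJ0 : ∀ z, J z = J 0 := fun z =>
    is_const_of_fderiv_eq_zero (hJ.differentiable (by simp)) hconst z 0
  refine ⟨J 0, hsq 0, hiso 0, fun z v => ?_⟩
  rw [← hJ0 z]
  have := hLJ z v
  rw [hL', hL'] at this
  exact this

/-- Each orthogonal complex structure on `ℂⁿ` has unitary frames. -/
theorem exists_unitary_frame {J : Cn n →L[ℝ] Cn n} (hsq : ∀ v, J (J v) = -v)
    (hiso : ∀ v w : Cn n, inner ℝ (J v) (J w) = inner ℝ v w) :
    ∀ m ≤ n, ∃ e : Fin m → Cn n, (∀ i j, inner ℝ (e i) (e j) = if i = j then (1 : ℝ) else 0) ∧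
      ∀ i j, inner ℝ (e i) (J (e j)) = (0 : ℝ) := by
  intro m
  induction m with
  | zero => exact fun _ => ⟨fun _ => 0, fun i => i.elim0, fun i => i.elim0⟩
  | succ m ih =>
    intro hm
    obtain ⟨e, he1, he2⟩ := ih (by omega)
    have hskew : ∀ v w, inner ℝ (J v) w = -inner ℝ v (J w) := fun v w => by
      have := hiso v (J w)
      rw [hsq, inner_neg_right] at this
      linarith
    have hJself : ∀ v, inner ℝ v (J v) = (0 : ℝ) := fun v => by
      have := hskew v v
      rw [real_inner_comm] at this
      linarith
    set W : Submodule ℝ (Cn n) := Submodule.span ℝ (range (Sum.elim e fun i => J (e i)))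
    have hW : Module.finrank ℝ W < Module.finrank ℝ (Cn n) := by
      have h1 : Module.finrank ℝ W ≤ Fintype.card (Fin m ⊕ Fin m) := finrank_range_le_card _
      have h2 : Module.finrank ℝ (Cn n) = 2 * n := by
        rw [← Module.finrank_mul_finrank ℝ ℂ (Cn n), Complex.finrank_real_complex]
        simp
      rw [Fintype.card_sum, Fintype.card_fin] at h1
      omega
    have hne : Wᗮ ≠ ⊥ := by
      intro h
      rw [Submodule.orthogonal_eq_bot_iff] at h
      rw [h, finrank_top] at hW
      exact lt_irrefl _ hW
    obtain ⟨u, hu, hu0⟩ := Submodule.exists_mem_ne_zero_of_ne_bot hne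
    have hn : ‖u‖ ≠ 0 := norm_ne_zero_iff.2 hu0
    set f : Cn n := ‖u‖⁻¹ • u
    have hf1 : inner ℝ f f = (1 : ℝ) := by
      rw [real_inner_self_eq_norm_sq, norm_smul, norm_inv, norm_norm, inv_mul_cancel₀ hn, one_pow]
    have hfW : ∀ w ∈ W, inner ℝ w f = (0 : ℝ) := fun w hw => by
      rw [inner_smul_right, (Submodule.mem_orthogonal W u).1 hu w hw, mul_zero]
    have hef : ∀ i, inner ℝ (e i) f = (0 : ℝ) := fun i =>
      hfW _ (Submodule.subset_span ⟨Sum.inl i, rfl⟩)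
    have hJef : ∀ i, inner ℝ (J (e i)) f = (0 : ℝ) := fun i =>
      hfW _ (Submodule.subset_span ⟨Sum.inr i, rfl⟩)
    refine ⟨Fin.snoc (α := fun _ => Cn n) e f, fun i j => ?_, fun i j => ?_⟩
    · refine Fin.lastCases ?_ (fun i => ?_) i <;> refine Fin.lastCases ?_ (fun j => ?_) j
      · simp only [Fin.snoc_last, if_true]; exact hf1
      · simp only [Fin.snoc_last, Fin.snoc_castSucc]
        rw [real_inner_comm, hef, if_neg (Fin.castSucc_lt_last j).ne']
      · simp only [Fin.snoc_last, Fin.snoc_castSucc]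
        rw [hef, if_neg (Fin.castSucc_lt_last i).ne]
      · simp only [Fin.snoc_castSucc, Fin.castSucc_inj]
        exact he1 i j
    · refine Fin.lastCases ?_ (fun i => ?_) i <;> refine Fin.lastCases ?_ (fun j => ?_) j
      · simp only [Fin.snoc_last]; exact hJself f
      · simp only [Fin.snoc_last, Fin.snoc_castSucc]
        rw [real_inner_comm, hJef]
      · simp only [Fin.snoc_last, Fin.snoc_castSucc]
        have := hskew (e i) f
        rw [hJef] at this
        linarith
      · simp only [Fin.snoc_castSucc]
        exact he2 i j

/-- Each orthogonal complex structure on `ℂⁿ` is isometric to the standard one. -/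
theorem exists_isometry_mulI {J : Cn n →L[ℝ] Cn n} (hsq : ∀ v, J (J v) = -v)
    (hiso : ∀ v w : Cn n, inner ℝ (J v) (J w) = inner ℝ v w) :
    ∃ A : Cn n ≃ₗᵢ[ℝ] Cn n, ∀ v, A (Complex.I • v) = J (A v) := by
  obtain ⟨e, he1, he2⟩ := exists_unitary_frame hsq hiso n le_rfl
  let A : Cn n →ₗ[ℝ] Cn n :=
    { toFun := fun v => ∑ j, ((v j).re • e j + (v j).im • J (e j))
      map_add' := fun v w => by
        rw [← Finset.sum_add_distrib]
        refine Finset.sum_congr rfl fun j _ => ?_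
        simp only [PiLp.add_apply, Complex.add_re, Complex.add_im, add_smul]
        abel
      map_smul' := fun t v => by
        rw [Finset.smul_sum]
        refine Finset.sum_congr rfl fun j _ => ?_
        simp [mul_smul] }
  have hA : ∀ v, A v = ∑ j, ((v j).re • e j + (v j).im • J (e j)) := fun _ => rfl
  have hnorm : ∀ v, ‖A v‖ = ‖v‖ := by
    intro v
    have h1 : inner ℝ (A v) (A v) = ‖v‖ ^ 2 := by
      have he3 : ∀ i j, inner ℝ (J (e i)) (e j) = (0 : ℝ) := fun i j => by
        rw [real_inner_comm, he2]
      rw [hA, sum_inner, EuclideanSpace.norm_sq_eq]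
      refine Finset.sum_congr rfl fun i _ => ?_
      rw [inner_sum, Finset.sum_eq_single i]
      · simp only [inner_add_left, inner_add_right, inner_smul_left, inner_smul_right, hiso, he1,
          he2, he3]
        rw [← Complex.normSq_eq_norm_sq, Complex.normSq_apply]
        simp
      · intro j _ hji
        simp only [inner_add_left, inner_add_right, inner_smul_left, inner_smul_right, hiso, he1,
          he2, he3, if_neg hji.symm]
        simp
      · simp
    rw [real_inner_self_eq_norm_sq] at h1
    exact (pow_left_inj₀ (norm_nonneg _) (norm_nonneg _) two_ne_zero).1 h1
  refine ⟨(⟨A, hnorm⟩ : Cn n →ₗᵢ[ℝ] Cn n).toLinearIsometryEquiv rfl, fun v => ?_⟩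
  show A (Complex.I • v) = J (A v)
  rw [hA, hA, map_sum]
  refine Finset.sum_congr rfl fun j _ => ?_
  simp [hsq, add_comm]

end

/-! ### The flat universal covering -/

section

variable {n : ℕ} {X : Type*} [TopologicalSpace X] [ChartedSpace (Cn n) X]
  [IsManifold 𝓘(ℝ, Cn n) ∞ X]

theorem stdMetric_mulI (v w : Cn n) : stdMetric (Complex.I • v) w = stdKahler v w := by
  simp [stdMetric, stdKahler]

theorem IsomOn.smooth_comp_linearIsometry {g : Metric (Cn n) X} {ϖ : Cn n → X}
    (h : IsomOn g ϖ univ) (A : Cn n ≃ₗᵢ[ℝ] Cn n) : IsomOn g (fun z => ϖ (A z)) univ :=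
  h.comp_affineIsometry A.toAffineIsometryEquiv

theorem mfderiv_comp_linearIsometry {g : Metric (Cn n) X} {ϖ : Cn n → X}
    (h : IsomOn g ϖ univ) (A : Cn n ≃ₗᵢ[ℝ] Cn n) (z v : Cn n) :
    mfderiv 𝓘(ℝ, Cn n) 𝓘(ℝ, Cn n) (fun z => ϖ (A z)) z v =
      mfderiv 𝓘(ℝ, Cn n) 𝓘(ℝ, Cn n) ϖ (A z) (A v) := by
  have hA : HasFDerivAt A (A.toContinuousLinearEquiv : Cn n →L[ℝ] Cn n) z :=
    (A.toContinuousLinearEquiv : Cn n →L[ℝ] Cn n).hasFDerivAt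
  have h1 := mfderiv_comp z (h.mdifferentiableAt (mem_univ (A z)))
    hA.differentiableAt.mdifferentiableAt
  have h2 := congrArg (fun T : Cn n →L[ℝ] Cn n => T v) h1
  refine Eq.trans h2 ?_
  rw [mfderiv_eq_fderiv, hA.fderiv]
  rfl

/-- The complete flat Calabi–Yau manifold `X` has a universal covering by the standard `ℂⁿ`. -/
theorem exists_isFlatUniversalCover [T2Space X] (hn : 0 < n) (X₀ : CalabiYau n X)
    (hcomplete : IsCompleteMetric X₀.g) (hflat : IsFlatMetric X₀.g) (x₀ : X) :
    ∃ ϖ : Cn n → X, IsFlatUniversalCover X₀ ϖ ∧ ϖ 0 = x₀ := by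
  have hg : ∀ x : X, ∃ c ∈ flatAtlas X₀.g, x ∈ c.source := fun x => by
    obtain ⟨c, h1, h2, h3⟩ := hflat x
    exact ⟨c, ⟨h1, h3⟩, h2⟩
  obtain ⟨ϖ₁, h₁, h₁0⟩ := exists_isomOn_univ hcomplete hg x₀
  obtain ⟨J₀, hsq, hiso, hJ₀⟩ := exists_complexStructure_eq X₀ h₁
  obtain ⟨A, hA⟩ := exists_isometry_mulI hsq hiso
  set ϖ₂ : Cn n → X := fun z => ϖ₁ (A z)
  have h₂ : IsomOn X₀.g ϖ₂ univ := h₁.smooth_comp_linearIsometry A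
  have h₂0 : ϖ₂ 0 = x₀ := by simp only [ϖ₂, map_zero, h₁0]
  have hJ₂ : ∀ z v : Cn n, mfderiv 𝓘(ℝ, Cn n) 𝓘(ℝ, Cn n) ϖ₂ z (Complex.I • v : Cn n) =
      X₀.J (ϖ₂ z) (mfderiv 𝓘(ℝ, Cn n) 𝓘(ℝ, Cn n) ϖ₂ z v) := by
    intro z v
    refine (mfderiv_comp_linearIsometry h₁ A z _).trans ?_
    rw [hA, hJ₀]
    exact congrArg (X₀.J (ϖ₂ z)) (mfderiv_comp_linearIsometry h₁ A z v).symm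
  have hkahler : ∀ (ϖ : Cn n → X), IsomOn X₀.g ϖ univ →
      (∀ z v : Cn n, mfderiv 𝓘(ℝ, Cn n) 𝓘(ℝ, Cn n) ϖ z (Complex.I • v : Cn n) =
        X₀.J (ϖ z) (mfderiv 𝓘(ℝ, Cn n) 𝓘(ℝ, Cn n) ϖ z v)) →
      ∀ z v w : Cn n, pullForm ϖ X₀.kform z ![v, w] = stdKahler v w := by
    intro ϖ h hJ z v w
    rw [← stdMetric_mulI, ← h.metric z (mem_univ z)]
    have h1 : pullBilin (E' := Cn n) ϖ X₀.g.inner z (Complex.I • v : Cn n) w =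
      X₀.g.inner (ϖ z) (mfderiv 𝓘(ℝ, Cn n) 𝓘(ℝ, Cn n) ϖ z (Complex.I • v : Cn n))
        (mfderiv 𝓘(ℝ, Cn n) 𝓘(ℝ, Cn n) ϖ z w) := rfl
    rw [h1, hJ, ← X₀.kform_apply]
    refine congrArg (X₀.kform (ϖ z)) ?_
    ext i; fin_cases i <;> rfl
  -- the holomorphic volume form has constant coefficient
  set F : Cn n → ℂ := fun z => pullForm (E' := Cn n) ϖ₂ X₀.vform z
    fun j => (EuclideanSpace.single j 1 : Cn n)
  have hvol : ∀ z, DifferentiableAt ℂ F z ∧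
      ∀ v : Fin n → Cn n, pullForm (E' := Cn n) ϖ₂ X₀.vform z v = F z * stdVolume v := by
    intro z
    obtain ⟨c, hc, hzc, hcJ, f, hf, hfv⟩ := X₀.holomorphic (ϖ₂ z)
    have hcont : Continuous ϖ₂ := continuous_iff_continuousAt.2 fun z => h₂.continuousAt (mem_univ z)
    set U := ϖ₂ ⁻¹' c.source
    have hU : IsOpen U := c.open_source.preimage hcont
    have hfd : ∀ y ∈ U, ∀ v, fderiv ℝ (c ∘ ϖ₂) y v =
        diffAt c (ϖ₂ y) (mfderiv 𝓘(ℝ, Cn n) 𝓘(ℝ, Cn n) ϖ₂ y v) := fun y hy v =>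
      fderiv_comp_chart hc (h₂.mdifferentiableAt (mem_univ y)) hy v
    have hhol : ∀ y ∈ U, ∀ v, fderiv ℝ (c ∘ ϖ₂) y (Complex.I • v) =
        Complex.I • fderiv ℝ (c ∘ ϖ₂) y v := by
      intro y hy v
      rw [hfd y hy, hfd y hy, hJ₂]
      exact hcJ _ hy _
    have hφ : ContDiffOn ℝ ∞ (c ∘ ϖ₂) U := fun y hy =>
      ((contMDiffAt_of_mem_maximalAtlas hc hy).comp y
        (h₂.smooth y (mem_univ y))).contDiffAt.contDiffWithinAt
    have hval : ∀ y ∈ U, ∀ v : Fin n → Cn n, pullForm (E' := Cn n) ϖ₂ X₀.vform y v =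
        f (c (ϖ₂ y)) * (stdVolume v *
          stdVolume fun j => fderiv ℝ (c ∘ ϖ₂) y (EuclideanSpace.single j 1)) := by
      intro y hy v
      rw [← stdVolume_map _ (hhol y hy)]
      refine (hfv _ hy _).trans ?_
      congr 2
      ext i
      rw [hfd y hy]
      rfl
    have hF : ∀ y ∈ U, F y = f (c (ϖ₂ y)) *
        stdVolume fun j => fderiv ℝ (c ∘ ϖ₂) y (EuclideanSpace.single j 1) := by
      intro y hy
      simp only [F]
      rw [hval y hy, stdVolume_single, one_mul]
    refine ⟨?_, fun v => ?_⟩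
    · refine (differentiableAt_volume_coefficient hU hφ hhol hzc (f := f)
        (hf.differentiableAt (c.open_target.mem_nhds (c.map_source hzc)))).congr_of_eventuallyEq ?_
      filter_upwards [hU.mem_nhds hzc] with y hy using hF y hy
    · rw [hval z hzc, hF z hzc]
      ring
  have hnorm : ∀ z, ‖F z‖ = 1 := by
    intro z
    refine X₀.normalized (ϖ₂ z) _ (fun i j => ?_) (fun i j => ?_)
    · refine (h₂.metric z (mem_univ z) _ _).trans ?_
      rw [stdMetric, EuclideanSpace.inner_single_left]
      by_cases hij : i = j
      · simp [hij]
      · simp [hij]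
    · have := hkahler ϖ₂ h₂ hJ₂ z (EuclideanSpace.single i 1) (EuclideanSpace.single j 1)
      have h0 : stdKahler (EuclideanSpace.single i 1 : Cn n) (EuclideanSpace.single j 1) = 0 := by
        rw [stdKahler, EuclideanSpace.inner_single_left]
        by_cases hij : i = j
        · simp [hij]
        · simp [hij]
      rw [h0] at this
      refine Eq.trans ?_ this
      refine congrArg (X₀.kform (ϖ₂ z)) ?_
      ext k; fin_cases k <;> rfl
  have hF0 : ∀ z, F z = F 0 := fun z => is_const_of_fderiv_eq_zero (𝕜 := ℂ)
    (fun y => (hvol y).1)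
    (fun y => fderiv_eq_zero_of_norm_eq_one (hvol y).1 (Eventually.of_forall hnorm)) z 0
  -- normalize the coefficient by a rotation
  obtain ⟨ζ, hζ⟩ := IsAlgClosed.exists_pow_nat_eq (F 0)⁻¹ hn
  have hζ1 : ‖ζ‖ = 1 := by
    have := congrArg norm hζ
    rw [norm_pow, norm_inv, hnorm, inv_one] at this
    exact (pow_eq_one_iff_of_nonneg (norm_nonneg _) hn.ne').1 this
  let B : Cn n ≃ₗᵢ[ℝ] Cn n :=
    (⟨((ζ • ContinuousLinearMap.id ℂ (Cn n)).restrictScalars ℝ).toLinearMap, fun v => by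
      simp [norm_smul, hζ1]⟩ : Cn n →ₗᵢ[ℝ] Cn n).toLinearIsometryEquiv rfl
  have hB : ∀ v, B v = ζ • v := fun _ => rfl
  have h₃ : IsomOn X₀.g (fun z => ϖ₂ (B z)) univ := h₂.smooth_comp_linearIsometry B
  refine ⟨fun z => ϖ₂ (B z), ⟨h₃.isCoveringMap hg, fun z => h₃.smooth z (mem_univ z),
    fun z => h₃.metric z (mem_univ z), hkahler _ h₃ fun z v => ?_, fun z v => ?_⟩, ?_⟩
  · refine (mfderiv_comp_linearIsometry h₂ B z _).trans ?_
    have hBv : B (Complex.I • v) = Complex.I • B v := by rw [hB, hB, smul_comm]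
    rw [hBv, hJ₂]
    exact congrArg (X₀.J (ϖ₂ (B z))) (mfderiv_comp_linearIsometry h₂ B z v).symm
  · have h1 : pullForm (E' := Cn n) (fun z => ϖ₂ (B z)) X₀.vform z v =
        pullForm (E' := Cn n) ϖ₂ X₀.vform (B z) fun i => B (v i) := by
      refine congrArg (X₀.vform (ϖ₂ (B z))) ?_
      ext i
      exact mfderiv_comp_linearIsometry h₂ B z (v i)
    have h2 : (stdVolume fun i => B (v i)) = ζ ^ n * stdVolume v := by
      unfold stdVolume
      have : (Matrix.of fun i j => (B (v i)) j) = ζ • Matrix.of fun i j => v i j := by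
        ext i j; simp [hB]
      rw [this, Matrix.det_smul, Fintype.card_fin]
    have hne : F 0 ≠ 0 := norm_ne_zero_iff.1 (by rw [hnorm]; exact one_ne_zero)
    refine h1.trans ?_
    rw [(hvol (B z)).2, h2, hF0, hζ, mul_inv_cancel_left₀ hne]
  · simp [h₂0]

end

/-! ### Deck transformations -/

section

variable {n : ℕ} {X : Type*} [TopologicalSpace X] [ChartedSpace (Cn n) X]
  [IsManifold 𝓘(ℝ, Cn n) ∞ X]

theorem IsFlatUniversalCover.isomOn {X₀ : CalabiYau n X} {ϖ : Cn n → X}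
    (h : IsFlatUniversalCover X₀ ϖ) : IsomOn X₀.g ϖ univ :=
  ⟨fun z _ => h.smooth z, fun z _ => h.metric z⟩

theorem exists_flatAtlas {g : Metric (Cn n) X} (hflat : IsFlatMetric g) (x : X) :
    ∃ c ∈ flatAtlas g, x ∈ c.source := by
  obtain ⟨c, h1, h2, h3⟩ := hflat x
  exact ⟨c, ⟨h1, h3⟩, h2⟩

variable {g : Metric (Cn n) X} {ϖ : Cn n → X}

/-- Points of one fibre are related by an affine isometry over `X`. -/
theorem IsomOn.exists_affineIsometry_of_eq [T2Space X] (h : IsomOn g ϖ univ)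
    (hflat : IsFlatMetric g) {a b : Cn n} (hab : ϖ a = ϖ b) :
    ∃ T : Cn n ≃ᵃⁱ[ℝ] Cn n, T a = b ∧ ∀ z, ϖ (T z) = ϖ z := by
  obtain ⟨c, hc, hac⟩ := exists_flatAtlas hflat (ϖ a)
  obtain ⟨T, hTa, hT⟩ := h.eventuallyEq_affineIsometry isOpen_univ (mem_univ a) hc hac
  obtain ⟨T', hTb, hT'⟩ := h.eventuallyEq_affineIsometry isOpen_univ (mem_univ b) hc (hab ▸ hac)
  set R : Cn n ≃ᵃⁱ[ℝ] Cn n := T.trans T'.symm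
  have hRa : R a = b := by
    simp only [R, AffineIsometryEquiv.coe_trans, Function.comp, hTa, hab, ← hTb,
      T'.symm_apply_apply]
  refine ⟨R, hRa, fun z => ?_⟩
  have h1 : IsomOn g (ϖ ∘ R) univ := h.comp_affineIsometry R
  refine h1.eqOn_of_eventuallyEq h (exists_flatAtlas hflat) isOpen_univ isPreconnected_univ
    (mem_univ a) ?_ (mem_univ z)
  have h2 : ∀ᶠ y in 𝓝 a, ϖ (R y) = c.symm (T' (R y)) := by
    have : Tendsto R (𝓝 a) (𝓝 b) := hRa ▸ R.continuous.tendsto a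
    exact this.eventually hT'
  filter_upwards [hT, h2] with y hy1 hy2
  rw [Function.comp, hy2, hy1]
  simp [R]

/-- Deck transformations of a local isometry from `ℂⁿ` are affine isometries. -/
theorem IsomOn.exists_affineIsometry_of_deck [T2Space X] (h : IsomOn g ϖ univ)
    (hflat : IsFlatMetric g) {γ : Cn n ≃ₜ Cn n} (hγ : γ ∈ deckGroup ϖ) :
    ∃ T : Cn n ≃ᵃⁱ[ℝ] Cn n, ∀ z, γ z = T z := by
  obtain ⟨T, hT0, hT⟩ := h.exists_affineIsometry_of_eq hflat (hγ 0).symm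
  refine ⟨T, fun z => ?_⟩
  have hcov := h.isCoveringMap (exists_flatAtlas hflat)
  exact congrFun (hcov.eq_of_comp_eq γ.continuous T.continuous
    (by ext y; simp only [Function.comp, hT]; exact hγ y) 0 hT0.symm) z

theorem IsomOn.exists_deck_of_eq [T2Space X] (h : IsomOn g ϖ univ)
    (hflat : IsFlatMetric g) {a b : Cn n} (hab : ϖ a = ϖ b) :
    ∃ γ ∈ deckGroup ϖ, γ a = b := by
  obtain ⟨T, hTa, hT⟩ := h.exists_affineIsometry_of_eq hflat hab
  exact ⟨T.toHomeomorph, hT, hTa⟩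

/-- Deck transformations are determined by one value. -/
theorem IsomOn.deck_ext [T2Space X] (h : IsomOn g ϖ univ) (hflat : IsFlatMetric g)
    {γ δ : Cn n ≃ₜ Cn n} (hγ : γ ∈ deckGroup ϖ) (hδ : δ ∈ deckGroup ϖ) {a : Cn n}
    (hab : γ a = δ a) : γ = δ := by
  have hcov := h.isCoveringMap (exists_flatAtlas hflat)
  ext1 z
  exact congrFun (hcov.eq_of_comp_eq γ.continuous δ.continuous
    (by ext y; exact (hγ y).trans (hδ y).symm) a hab) z

/-- A deck transformation `γ` has the form `γ z = A z + γ 0` with `A` orthogonal. -/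
theorem IsomOn.exists_linear_of_deck [T2Space X] (h : IsomOn g ϖ univ)
    (hflat : IsFlatMetric g) {γ : Cn n ≃ₜ Cn n} (hγ : γ ∈ deckGroup ϖ) :
    ∃ A : Cn n ≃ₗᵢ[ℝ] Cn n, ∀ z, γ z = A z + γ 0 := by
  obtain ⟨T, hT⟩ := h.exists_affineIsometry_of_deck hflat hγ
  refine ⟨T.linearIsometryEquiv, fun z => ?_⟩
  have := T.map_vsub z 0
  simp only [vsub_eq_sub, sub_zero] at this
  rw [this, hT, hT, sub_add_cancel]

/-- The linear part of a deck transformation is complex linear. -/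
theorem IsFlatUniversalCover.linear_mulI {X₀ : CalabiYau n X} (h : IsFlatUniversalCover X₀ ϖ)
    {γ : Cn n ≃ₜ Cn n} (hγ : γ ∈ deckGroup ϖ) {A : Cn n ≃ₗᵢ[ℝ] Cn n}
    (hA : ∀ z, γ z = A z + γ 0) (v : Cn n) : A (Complex.I • v) = Complex.I • A v := by
  have hd : HasFDerivAt γ (A.toContinuousLinearEquiv : Cn n →L[ℝ] Cn n) 0 := by
    have h1 : HasFDerivAt (fun z => A.toContinuousLinearEquiv z + γ 0)
      (A.toContinuousLinearEquiv : Cn n →L[ℝ] Cn n) 0 :=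
      (A.toContinuousLinearEquiv : Cn n →L[ℝ] Cn n).hasFDerivAt.add_const _
    exact h1.congr_of_eventuallyEq (Eventually.of_forall hA)
  have hk : ∀ v w, stdKahler (A v) (A w) = stdKahler v w := by
    intro v w
    rw [← h.kahler 0 v w, ← h.kahler (γ 0)]
    have h1 : pullForm (E' := Cn n) ϖ X₀.kform 0 = pullForm (E' := Cn n) (ϖ ∘ γ) X₀.kform 0 :=
      pullForm_congr (Eventually.of_forall fun z => (hγ z).symm) _
    have h2 : pullForm (E' := Cn n) (ϖ ∘ γ) X₀.kform 0 = _ :=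
      pullForm_comp (h.isomOn.mdifferentiableAt (mem_univ (γ 0)))
        hd.differentiableAt.mdifferentiableAt X₀.kform
    rw [h1, h2]
    have h3 := pullForm_eq_fderiv (γ : Cn n → Cn n)
      (pullForm (E' := Cn n) ϖ X₀.kform : Cn n → Cn n [⋀^Fin 2]→L[ℝ] ℝ) 0
    rw [hd.fderiv] at h3
    refine Eq.trans ?_ (congrArg (fun T : Cn n [⋀^Fin 2]→L[ℝ] ℝ => T ![v, w]) h3).symm
    refine congrArg (pullForm (E' := Cn n) ϖ X₀.kform (γ 0)) ?_
    ext i; fin_cases i <;> rfl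
  refine ext_inner_right ℝ fun w => ?_
  obtain ⟨w, rfl⟩ := A.surjective w
  rw [A.inner_map_map, real_inner_eq_stdMetric, real_inner_eq_stdMetric, stdMetric_mulI,
    stdMetric_mulI, hk]

/-! ### Lifts of paths, and distances -/

theorem IsomOn.contDiffOn_lift (h : IsomOn g ϖ univ) (hflat : IsFlatMetric g) {γ : ℝ → X}
    {δ : ℝ → Cn n} (hγ : ContMDiffOn 𝓘(ℝ, ℝ) 𝓘(ℝ, Cn n) 1 γ (Icc 0 1))
    (hδ : ContinuousOn δ (Icc 0 1)) (hϖ : ∀ t ∈ Icc (0 : ℝ) 1, ϖ (δ t) = γ t) :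
    ContDiffOn ℝ 1 δ (Icc 0 1) := by
  intro t ht
  obtain ⟨c, hc, htc⟩ := exists_flatAtlas hflat (ϖ (δ t))
  obtain ⟨T, hTt, hT⟩ := h.eventuallyEq_affineIsometry isOpen_univ (mem_univ (δ t)) hc htc
  have hTs : ContDiff ℝ 1 T.symm := T.symm.toAffineIsometry.toContinuousAffineMap.contDiff
  have h1 : ContMDiffWithinAt 𝓘(ℝ, ℝ) 𝓘(ℝ, Cn n) 1 (c ∘ γ) (Icc 0 1) t := by
    have := contMDiffAt_of_mem_maximalAtlas hc.1 (hϖ t ht ▸ htc)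
    exact (this.of_le (by simp)).comp_contMDiffWithinAt t (hγ t ht)
  have h2 : ContDiffWithinAt ℝ 1 (T.symm ∘ (c ∘ γ)) (Icc 0 1) t :=
    hTs.contDiffAt.comp_contDiffWithinAt t h1.contDiffWithinAt
  have hev : ∀ᶠ s in 𝓝[Icc 0 1] t, δ s = (T.symm ∘ (c ∘ γ)) s := by
    have e1 : ∀ᶠ s in 𝓝[Icc 0 1] t, ϖ (δ s) = c.symm (T (δ s)) := (hδ t ht).eventually hT
    have e2 : ∀ᶠ s in 𝓝[Icc 0 1] t, T (δ s) ∈ c.target := by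
      have : Tendsto (fun s => T (δ s)) (𝓝[Icc 0 1] t) (𝓝 (T (δ t))) :=
        (T.continuous.tendsto _).comp (hδ t ht)
      exact this.eventually_mem (c.open_target.mem_nhds (hTt ▸ c.map_source htc))
    filter_upwards [e1, e2, self_mem_nhdsWithin] with s h1 h2 h3
    simp only [Function.comp, ← hϖ s h3, h1, c.right_inv h2, T.symm_apply_apply]
  exact h2.congr_of_eventuallyEq hev (hev.self_of_nhdsWithin ht)

theorem IsomOn.exists_lift (h : IsomOn g ϖ univ) (hcov : IsCoveringMap ϖ)
    (hflat : IsFlatMetric g) {γ : ℝ → X}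
    (hγ : ContMDiffOn 𝓘(ℝ, ℝ) 𝓘(ℝ, Cn n) 1 γ (Icc 0 1)) {z : Cn n} (hz : γ 0 = ϖ z) :
    ∃ δ : ℝ → Cn n, ContDiffOn ℝ 1 δ (Icc 0 1) ∧ δ 0 = z ∧ ∀ t ∈ Icc (0 : ℝ) 1, ϖ (δ t) = γ t := by
  let γI : C(unitInterval, X) := ⟨fun t => γ t, hγ.continuousOn.domRestrict⟩
  have hz' : γI 0 = ϖ z := hz
  let Γ := hcov.liftPath γI z hz'
  let δ : ℝ → Cn n := fun t => Γ (projIcc 0 1 zero_le_one t)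
  have hδ : Continuous δ := Γ.continuous.comp continuous_projIcc
  have hlift : ∀ t ∈ Icc (0 : ℝ) 1, ϖ (δ t) = γ t := by
    intro t ht
    have := congrFun (hcov.liftPath_lifts γI z hz') (projIcc 0 1 zero_le_one t)
    simp only [Function.comp] at this
    refine this.trans ?_
    rw [projIcc_of_mem zero_le_one ht]
    rfl
  refine ⟨δ, h.contDiffOn_lift hflat hγ hδ.continuousOn hlift, ?_, hlift⟩
  have h0 : projIcc (0 : ℝ) 1 zero_le_one 0 = 0 := projIcc_left _
  simp only [δ, h0]
  exact hcov.liftPath_zero γI z hz'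

theorem gLength_congr {γ γ' : ℝ → X} (h : EqOn γ γ' (Icc 0 1)) : gLength g γ = gLength g γ' := by
  rw [gLength_eq, gLength_eq, ← MeasureTheory.restrict_Ioo_eq_restrict_Icc]
  refine MeasureTheory.setLIntegral_congr_fun measurableSet_Ioo fun t ht => ?_
  have h1 : γ =ᶠ[𝓝 t] γ' := by
    filter_upwards [Icc_mem_nhds ht.1 ht.2] with s hs using h hs
  have h2 := pullBilin_congr (E' := ℝ) h1 g.inner
  have h3 := congrArg (fun B : ℝ →L[ℝ] ℝ →L[ℝ] ℝ => B 1 1) h2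
  exact congrArg (fun r => ENNReal.ofReal √r) h3

theorem IsomOn.edist_le_gLength (h : IsomOn g ϖ univ) {γ : ℝ → X} {δ : ℝ → Cn n}
    (hδ : ContDiffOn ℝ 1 δ (Icc 0 1)) (hϖ : ∀ t ∈ Icc (0 : ℝ) 1, ϖ (δ t) = γ t) :
    edist (δ 0) (δ 1) ≤ gLength g γ := by
  rw [gLength_congr (γ' := fun t => ϖ (δ t)) fun t ht => (hϖ t ht).symm, edist_comm,
    edist_eq_enorm_sub]
  refine (enorm_sub_le_lintegral_derivWithin_Icc_of_contDiffOn_Icc hδ zero_le_one).trans ?_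
  rw [gLength_eq, ← MeasureTheory.restrict_Ioo_eq_restrict_Icc]
  refine (MeasureTheory.setLIntegral_congr_fun measurableSet_Ioo fun t ht => ?_).le
  have hmem := Icc_mem_nhds ht.1 ht.2
  have hd : HasDerivAt δ (derivWithin δ (Icc 0 1) t) t :=
    ((hδ.differentiableOn (by simp) t (Ioo_subset_Icc_self ht)).hasDerivWithinAt).hasDerivAt hmem
  have h3 := mfderiv_comp_curve (h.mdifferentiableAt (mem_univ (δ t))) hd
  have h4 := h.metric _ (mem_univ (δ t)) (derivWithin δ (Icc 0 1) t) (derivWithin δ (Icc 0 1) t)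
  rw [stdMetric_self] at h4
  simp only [h3]
  have h5 : g.inner (ϖ (δ t)) (mfderiv 𝓘(ℝ, Cn n) 𝓘(ℝ, Cn n) ϖ (δ t) (derivWithin δ (Icc 0 1) t))
    (mfderiv 𝓘(ℝ, Cn n) 𝓘(ℝ, Cn n) ϖ (δ t) (derivWithin δ (Icc 0 1) t)) =
      ‖derivWithin δ (Icc 0 1) t‖ ^ 2 := h4
  refine Eq.trans ?_ (congrArg (fun r => ENNReal.ofReal √r) h5).symm
  simp only [Real.sqrt_sq (norm_nonneg _), ofReal_norm]

/-- The metric balls of a flat manifold are the images of the balls of `ℂⁿ`: paths lift to paths of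
the same length. -/
theorem IsomOn.gDist_lt_iff (h : IsomOn g ϖ univ) (hcov : IsCoveringMap ϖ)
    (hflat : IsFlatMetric g) {z : Cn n} {x : X} {r : ℝ} :
    gDist g (ϖ z) x < ENNReal.ofReal r ↔ ∃ w ∈ Metric.ball z r, ϖ w = x := by
  constructor
  · intro hx
    obtain ⟨γ, h0, h1, hγ, hlen⟩ := exists_path_of_gDist_lt g hx
    obtain ⟨δ, hδ, hδ0, hδϖ⟩ := h.exists_lift hcov hflat hγ h0
    refine ⟨δ 1, ?_, ?_⟩
    · have := (h.edist_le_gLength hδ hδϖ).trans_lt hlen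
      rw [hδ0, edist_dist] at this
      rw [Metric.mem_ball']
      exact lt_of_not_ge fun hge => absurd this (not_lt.2 (ENNReal.ofReal_le_ofReal hge))
    · rw [hδϖ 1 (right_mem_Icc.2 zero_le_one), h1]
  · rintro ⟨w, hw, rfl⟩
    refine (h.gDist_le (subset_univ _)).trans_lt ?_
    rw [Metric.mem_ball, dist_eq_norm] at hw
    exact (ENNReal.ofReal_lt_ofReal_iff (lt_of_le_of_lt (norm_nonneg _) hw)).2 hw

/-- Straight segments project to geodesics. -/
theorem IsomOn.isGeodesic (h : IsomOn g ϖ univ) (hcov : IsCoveringMap ϖ)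
    (hflat : IsFlatMetric g) (a b : Cn n) : IsGeodesic g fun t => ϖ (a + t • (b - a)) := by
  refine ⟨‖b - a‖, norm_nonneg _, fun t _ => ?_⟩
  set z := a + t • (b - a)
  obtain ⟨e, hze, hee⟩ := hcov.isLocalHomeomorph z
  obtain ⟨ρ, hρ, hball⟩ := Metric.isOpen_iff.1 e.open_source z hze
  have hinj : InjOn ϖ (Metric.ball z ρ) := hee ▸ (e.injOn.mono hball)
  have hpos : 0 < 4 * (‖b - a‖ + 1) := by positivity
  refine ⟨ρ / (4 * (‖b - a‖ + 1)), by positivity, ?_⟩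
  have hnear : ∀ s ∈ Metric.ball t (ρ / (4 * (‖b - a‖ + 1))),
      a + s • (b - a) ∈ Metric.ball z (ρ / 4) := by
    intro s hs
    rw [Metric.mem_ball, Real.dist_eq, lt_div_iff₀ hpos] at hs
    rw [Metric.mem_ball, dist_eq_norm]
    have : a + s • (b - a) - z = (s - t) • (b - a) := by simp only [z]; module
    rw [this, norm_smul, Real.norm_eq_abs]
    nlinarith [abs_nonneg (s - t), norm_nonneg (b - a)]
  intro s hs s' hs'
  have hdist : ‖(a + s' • (b - a)) - (a + s • (b - a))‖ = ‖b - a‖ * |s - s'| := by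
    have : (a + s' • (b - a)) - (a + s • (b - a)) = (s' - s) • (b - a) := by module
    rw [this, norm_smul, Real.norm_eq_abs, abs_sub_comm, mul_comm]
  refine le_antisymm (hdist ▸ h.gDist_le (subset_univ _)) (le_of_not_gt fun hlt => ?_)
  obtain ⟨w, hw, hwe⟩ := (h.gDist_lt_iff hcov hflat).1 hlt
  have h1 := hnear s hs.2
  have h2 := hnear s' hs'.2
  rw [Metric.mem_ball] at h1 h2 hw
  have h3 : dist (a + s' • (b - a)) (a + s • (b - a)) < ρ / 2 := by
    have := dist_triangle_right (a + s' • (b - a)) (a + s • (b - a)) z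
    linarith
  rw [dist_eq_norm, hdist] at h3
  have h4 : dist w z < ρ := by
    have := dist_triangle w (a + s • (b - a)) z
    linarith
  have h5 : w = a + s' • (b - a) := hinj h4 (by rw [Metric.mem_ball]; linarith) hwe
  rw [h5, dist_eq_norm, hdist] at hw
  exact lt_irrefl _ hw

end

/-! ### The preimage of the soul -/

section

/-- A closed convex set through `0` is a linear subspace as soon as the segments that end at one of
its points can be continued beyond this point inside of the set, to first order. -/
theorem coe_span_eq_of_convex {E : Type*} [NormedAddCommGroup E] [NormedSpace ℝ E]
    [FiniteDimensional ℝ E] {C : Set E} (hc : Convex ℝ C) (hcl : IsClosed C) (h0 : (0 : E) ∈ C)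
    (hsub : ∀ x ∈ C, ∀ y ∈ C, ∃ η : ℝ → E, HasDerivAt η (x - y) 0 ∧ η 0 = x ∧
      ∀ᶠ t in 𝓝[>] 0, η t ∈ C) : (Submodule.span ℝ C : Set E) = C := by
  set W := Submodule.span ℝ C
  set C' : Set W := Subtype.val ⁻¹' C
  have hc' : Convex ℝ C' := hc.linear_preimage W.subtype
  have hcl' : IsClosed C' := hcl.preimage continuous_subtype_val
  have h0' : (0 : W) ∈ C' := h0
  have hne : (interior C').Nonempty := by
    rw [hc'.interior_nonempty_iff_affineSpan_eq_top,
      AffineSubspace.affineSpan_eq_top_iff_vectorSpan_eq_top_of_nonempty ℝ W W ⟨0, h0'⟩,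
      vectorSpan_eq_span_vsub_set_right ℝ h0']
    simp only [vsub_eq_sub, sub_zero, image_id']
    exact Submodule.span_span_coe_preimage
  obtain ⟨y, hy⟩ := hne
  -- `x` lies strictly between the point `η t` of `C` beyond `x` and a point `y'` close to `y`,
  -- which is an interior point
  have hopen : C' ⊆ interior C' := by
    rintro x hx
    obtain ⟨η, hη, hη0, hηC⟩ := hsub x hx y (show y ∈ C' from interior_subset hy)
    obtain ⟨O, hO, hOi⟩ := isOpen_induced_iff.1 (isOpen_interior (s := C'))
    have hlim : Tendsto (fun t : ℝ => (x : E) - t⁻¹ • (η t - η 0)) (𝓝[>] 0) (𝓝 (y : E)) := by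
      have h1 := hη.tendsto_slope_zero_right
      simp only [zero_add] at h1
      have h2 := (tendsto_const_nhds (x := (x : E))).sub h1
      simpa using h2
    have hyO : (y : E) ∈ O := by
      have : y ∈ Subtype.val ⁻¹' O := by rw [hOi]; exact hy
      exact this
    obtain ⟨t, ⟨htC, htO⟩, ht⟩ := ((hηC.and (hlim.eventually_mem (hO.mem_nhds hyO))).and
      self_mem_nhdsWithin).exists
    have ht : 0 < t := ht
    have hηW : η t ∈ W := Submodule.subset_span htC
    set u : W := ⟨η t, hηW⟩
    set y' : W := x - t⁻¹ • (u - x)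
    have hy' : y' ∈ interior C' := by
      rw [← hOi]
      show ((y' : W) : E) ∈ O
      rw [hη0] at htO
      exact htO
    have h1 := hc'.combo_interior_self_mem_interior hy' (show u ∈ C' from htC)
      (a := t / (1 + t)) (b := 1 / (1 + t)) (by positivity) (by positivity)
      (by field_simp; ring)
    convert h1 using 1
    have h2 : (t / (1 + t)) • t⁻¹ • (u - x) = (1 / (1 + t)) • (u - x) := by
      rw [smul_smul]; congr 1; field_simp
    simp only [y']
    rw [smul_sub, h2, smul_sub, sub_add_eq_add_sub, sub_sub_eq_add_sub]
    have h3 : (t / (1 + t)) • x + (1 / (1 + t)) • x = x := by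
      rw [← add_smul]
      have : t / (1 + t) + 1 / (1 + t) = 1 := by field_simp; ring
      rw [this, one_smul]
    rw [add_right_comm, h3, add_sub_cancel_right]
  have huniv : C' = univ := IsClopen.eq_univ
    ⟨hcl', (subset_interior_iff_isOpen.1 hopen)⟩ ⟨0, h0'⟩
  refine Subset.antisymm (fun x hx => ?_) Submodule.subset_span
  have : (⟨x, hx⟩ : W) ∈ C' := huniv ▸ mem_univ _
  exact this

variable {n : ℕ} {X : Type*} [TopologicalSpace X] [ChartedSpace (Cn n) X]
  [IsManifold 𝓘(ℝ, Cn n) ∞ X] {g : Metric (Cn n) X} {ϖ : Cn n → X} {S : Set X}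

/-- The preimage of a soul in the universal covering is a linear subspace. -/
theorem IsomOn.exists_submodule_eq_preimage [T2Space X] (h : IsomOn g ϖ univ)
    (hcov : IsCoveringMap ϖ) (hflat : IsFlatMetric g) (hS : IsSoul g S) (h0 : ϖ 0 ∈ S) :
    ∃ V : Submodule ℝ (Cn n), (V : Set (Cn n)) = ϖ ⁻¹' S := by
  have hcont : Continuous ϖ := continuous_iff_continuousAt.2 fun z => h.continuousAt (mem_univ z)
  have hseg : ∀ x ∈ ϖ ⁻¹' S, ∀ y ∈ ϖ ⁻¹' S, ∀ t ∈ Icc (0 : ℝ) 1,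
      x + t • (y - x) ∈ ϖ ⁻¹' S := fun x hx y hy t ht =>
    hS.totallyConvex _ (h.isGeodesic hcov hflat x y) (by simpa using hx) (by simpa using hy) t ht
  refine ⟨Submodule.span ℝ (ϖ ⁻¹' S), coe_span_eq_of_convex ?_
    (hS.compact.isClosed.preimage hcont) h0 fun x hx y hy => ?_⟩
  · rw [convex_iff_segment_subset]
    intro x hx y hy w hw
    rw [segment_eq_image'] at hw
    obtain ⟨t, ht, rfl⟩ := hw
    exact hseg x hx y hy t ht
  · obtain ⟨c, hc, hxc, W, hW⟩ := hS.submanifold _ hx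
    obtain ⟨s, hs, hsx, hsc, hsl⟩ := exists_local_inverse (h.smooth x (mem_univ x))
      (h.mfderiv_injective (mem_univ x)) hc hxc
    have hφ : DifferentiableAt ℝ (c ∘ ϖ) x :=
      ((contMDiffAt_of_mem_maximalAtlas hc hxc).comp x
        (h.smooth x (mem_univ x))).contDiffAt.differentiableAt (by simp)
    have hl : HasDerivAt (fun t : ℝ => x + t • (y - x)) (y - x) 0 := by
      simpa using (((hasDerivAt_id (0 : ℝ)).smul_const (y - x)).const_add x)
    -- In a submanifold chart, the geodesic from `x` to `y` starts in the direction `w₀`, which is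
    -- tangent to `S`. Hence the straight line in direction `-w₀` stays in `S`, and it continues the
    -- geodesic beyond `x` to first order.
    set w₀ := fderiv ℝ (c ∘ ϖ) x (y - x)
    have hcurve : HasDerivAt (fun t : ℝ => (c ∘ ϖ) (x + t • (y - x))) w₀ 0 := by
      have h1 : HasFDerivAt (c ∘ ϖ) (fderiv ℝ (c ∘ ϖ) x) (x + (0 : ℝ) • (y - x)) := by
        simpa using hφ.hasFDerivAt
      exact h1.comp_hasDerivAt 0 hl
    have hcx : c (ϖ x) ∈ W := (hW _ hxc).1 hx
    have hw₀ : w₀ ∈ W := by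
      have h1 := hcurve.tendsto_slope_zero_right
      have hev : ∀ᶠ t in 𝓝[>] (0 : ℝ), t⁻¹ • ((c ∘ ϖ) (x + (0 + t) • (y - x)) -
          (c ∘ ϖ) (x + (0 : ℝ) • (y - x))) ∈ (W : Set (Cn n)) := by
        have e1 : ∀ᶠ t in 𝓝 (0 : ℝ), ϖ (x + t • (y - x)) ∈ c.source := by
          have : Continuous fun t : ℝ => ϖ (x + t • (y - x)) := by fun_prop
          exact this.continuousAt.eventually_mem (c.open_source.mem_nhds (by simpa using hxc))
        have e2 : ∀ᶠ t in 𝓝[>] (0 : ℝ), t < 1 :=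
          mem_nhdsWithin_of_mem_nhds (Iio_mem_nhds zero_lt_one)
        filter_upwards [e1.filter_mono nhdsWithin_le_nhds, e2, self_mem_nhdsWithin] with t h1 h2 h3
        simp only [zero_add, zero_smul, add_zero]
        refine W.smul_mem _ (W.sub_mem ?_ hcx)
        exact (hW _ h1).1 (hseg x hx y hy t ⟨le_of_lt h3, h2.le⟩)
      exact (Submodule.closed_of_finiteDimensional W).mem_of_tendsto h1 hev
    have hη : HasDerivAt (fun t : ℝ => c (ϖ x) - t • w₀) (-w₀) 0 := by
      simpa using ((hasDerivAt_id (0 : ℝ)).smul_const w₀).const_sub (c (ϖ x))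
    refine ⟨fun t => s (c (ϖ x) - t • w₀), ?_, by simp [hsx], ?_⟩
    · have hsd := (hs.differentiableAt (by simp)).hasFDerivAt
      have h1 : HasFDerivAt (s ∘ (c ∘ ϖ)) ((fderiv ℝ s (c (ϖ x))).comp (fderiv ℝ (c ∘ ϖ) x)) x :=
        hsd.comp x hφ.hasFDerivAt
      have h2 : s ∘ (c ∘ ϖ) =ᶠ[𝓝 x] id := hsl
      have h3 := h1.unique ((hasFDerivAt_id x).congr_of_eventuallyEq h2)
      have h4 : fderiv ℝ s (c (ϖ x)) w₀ = y - x :=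
        congrArg (fun T : Cn n →L[ℝ] Cn n => T (y - x)) h3
      have h5 : HasFDerivAt s (fderiv ℝ s (c (ϖ x))) (c (ϖ x) - (0 : ℝ) • w₀) := by
        simpa using hsd
      have h6 := h5.comp_hasDerivAt 0 hη
      rw [map_neg, h4, neg_sub] at h6
      exact h6
    · have hcη : Tendsto (fun t : ℝ => c (ϖ x) - t • w₀) (𝓝[>] 0) (𝓝 (c (ϖ x))) := by
        have := hη.continuousAt.tendsto
        simp only [zero_smul, sub_zero] at this
        exact this.mono_left nhdsWithin_le_nhds
      filter_upwards [hcη.eventually hsc,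
        hcη.eventually_mem (c.open_target.mem_nhds (c.map_source hxc))] with t ht1 ht2
      rw [mem_preimage, ht1, hW _ (c.map_target ht2), c.right_inv ht2]
      exact W.sub_mem hcx (W.smul_mem _ hw₀)

end

/-! ### The deck group on the preimage of the soul -/

section

variable {n : ℕ}

section

variable {X : Type*} {ϖ : Cn n → X} {S : Set X} {V : Submodule ℝ (Cn n)}

theorem deck_mem_iff {γ : Cn n ≃ₜ Cn n} (hγ : γ ∈ deckGroup ϖ) (hV : (V : Set (Cn n)) = ϖ ⁻¹' S)
    (z : Cn n) : γ z ∈ V ↔ z ∈ V := by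
  have h : ∀ w, w ∈ V ↔ ϖ w ∈ S := fun w => by
    rw [← SetLike.mem_coe, hV, mem_preimage]
  rw [h, h, hγ z]

theorem mem_transLattice_iff {b : V} :
    b ∈ transLattice ϖ V ↔ ∃ γ ∈ holonomyKernel ϖ V, ∀ v ∈ V, γ v = v + b := Iff.rfl

end

section

variable {X : Type*} [TopologicalSpace X] {ϖ : Cn n → X} {S : Set X}

/-- Each compact set is the image of a bounded set. -/
theorem exists_image_ball_of_isCompact (hcov : IsCoveringMap ϖ)
    (hsurj : Function.Surjective ϖ) (hS : IsCompact S) :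
    ∃ R, S ⊆ ϖ '' Metric.ball 0 R := by
  obtain ⟨k, hk⟩ := hS.elim_directed_cover (fun k : ℕ => ϖ '' Metric.ball 0 k)
    (fun k => hcov.isOpenMap _ Metric.isOpen_ball) (fun x _ => by
      obtain ⟨z, rfl⟩ := hsurj x
      obtain ⟨k, hk⟩ := exists_nat_gt ‖z‖
      exact mem_iUnion.2 ⟨k, z, by simpa using hk, rfl⟩)
    (directed_of_isDirected_le fun i j hij => image_mono
      (Metric.ball_subset_ball (by exact_mod_cast hij)))
  exact ⟨k, hk⟩

end

variable {X : Type*} [TopologicalSpace X] [ChartedSpace (Cn n) X]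
  [IsManifold 𝓘(ℝ, Cn n) ∞ X] {g : Metric (Cn n) X} {ϖ : Cn n → X} {S : Set X}
  {V : Submodule ℝ (Cn n)}

/-- The linear part of a deck transformation, on the preimage of the soul. -/
theorem IsomOn.exists_linear_on [T2Space X] (h : IsomOn g ϖ univ) (hflat : IsFlatMetric g)
    (hV : (V : Set (Cn n)) = ϖ ⁻¹' S) (γ : deckGroup ϖ) :
    ∃ B : V ≃ₗᵢ[ℝ] V, ∀ v : V, (B v : Cn n) = γ.1 v - γ.1 0 := by
  obtain ⟨A, hA⟩ := h.exists_linear_of_deck hflat γ.2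
  have hA' : ∀ z, A z = γ.1 z - γ.1 0 := fun z => by rw [hA z]; abel
  have hmem : ∀ v : V, A v ∈ V := fun v => by
    rw [hA']
    exact V.sub_mem ((deck_mem_iff γ.2 hV _).2 v.2) ((deck_mem_iff γ.2 hV _).2 V.zero_mem)
  let B : V →ₗᵢ[ℝ] V := ⟨A.toLinearEquiv.toLinearMap.restrict fun v hv => hmem ⟨v, hv⟩, fun v => by
    exact A.norm_map v⟩
  exact ⟨B.toLinearIsometryEquiv rfl, fun v => hA' v⟩

/-- The linear parts of the deck transformations, on the preimage `V` of the soul. -/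
noncomputable def deckLinear [T2Space X] (h : IsomOn g ϖ univ) (hflat : IsFlatMetric g)
    (hV : (V : Set (Cn n)) = ϖ ⁻¹' S) : deckGroup ϖ →* (V ≃ₗᵢ[ℝ] V) :=
  MonoidHom.mk' (fun γ => (h.exists_linear_on hflat hV γ).choose) (by
    intro γ δ
    have hs := fun γ => (h.exists_linear_on hflat hV γ).choose_spec
    ext1 v
    apply Subtype.ext
    rw [hs, LinearIsometryEquiv.coe_mul, Function.comp_apply, hs, hs]
    obtain ⟨A, hA⟩ := h.exists_linear_of_deck hflat γ.2
    show γ.1 (δ.1 v) - γ.1 (δ.1 0) = _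
    rw [hA (δ.1 v), hA (δ.1 0), hA (δ.1 v - δ.1 0), map_sub]
    abel)

theorem deckLinear_apply [T2Space X] (h : IsomOn g ϖ univ) (hflat : IsFlatMetric g)
    (hV : (V : Set (Cn n)) = ϖ ⁻¹' S) (γ : deckGroup ϖ) (v : V) :
    (deckLinear h hflat hV γ v : Cn n) = γ.1 v - γ.1 0 :=
  (h.exists_linear_on hflat hV γ).choose_spec v

/-- The deck group acts properly discontinuously: fibres of the covering are closed and discrete,
and deck transformations are determined by the image of one point. -/
theorem IsomOn.finite_deck [T2Space X] (h : IsomOn g ϖ univ) (hcov : IsCoveringMap ϖ)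
    (hflat : IsFlatMetric g) (z : Cn n) (R : ℝ) :
    {γ : deckGroup ϖ | ‖γ.1 z‖ ≤ R}.Finite := by
  have hd : DiscreteTopology (ϖ ⁻¹' {ϖ z}) := (hcov (ϖ z)).discreteTopology_fiber
  have hcl : IsClosed (ϖ ⁻¹' {ϖ z}) := isClosed_singleton.preimage hcov.continuous
  have hfin : (Metric.closedBall 0 R ∩ ϖ ⁻¹' {ϖ z}).Finite := by
    refine ((isCompact_closedBall 0 R).inter_right hcl).finite ?_
    exact IsDiscrete.mono ⟨hd⟩ inter_subset_right
  refine Set.Finite.of_finite_image (f := fun γ : deckGroup ϖ => γ.1 z) (hfin.subset ?_) ?_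
  · rintro _ ⟨γ, hγ, rfl⟩
    exact ⟨by simpa using hγ, γ.2 z⟩
  · intro γ _ δ _ hγδ
    exact Subtype.ext (h.deck_ext hflat γ.2 δ.2 hγδ)

/-- The deck group acts on the preimage of the soul as a crystallographic group. -/
theorem IsomOn.isCrystallographic [T2Space X] [ConnectedSpace X] (h : IsomOn g ϖ univ)
    (hcov : IsCoveringMap ϖ) (hflat : IsFlatMetric g) (hS : IsCompact S)
    (hV : (V : Set (Cn n)) = ϖ ⁻¹' S) :
    IsCrystallographic (E := V) (deckLinear h hflat hV)
      fun γ => ⟨γ.1 0, (deck_mem_iff γ.2 hV 0).2 V.zero_mem⟩ where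
  trans_mul γ δ := by
    apply Subtype.ext
    rw [Submodule.coe_add, deckLinear_apply, sub_add_cancel]
    rfl
  finite R := h.finite_deck hcov hflat 0 R
  cocompact := by
    obtain ⟨R, hR⟩ := exists_image_ball_of_isCompact hcov (surjective_of_isCoveringMap hcov) hS
    refine ⟨R, fun v => ?_⟩
    have hvS : ϖ v ∈ S := by
      have : (v : Cn n) ∈ (V : Set (Cn n)) := v.2
      rwa [hV] at this
    obtain ⟨w, hw, hwv⟩ := hR hvS
    obtain ⟨γ, hγ, hγw⟩ := h.exists_deck_of_eq hflat hwv
    refine ⟨⟨γ, hγ⟩, ?_⟩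
    obtain ⟨T, hT⟩ := h.exists_affineIsometry_of_deck hflat hγ
    show ‖(v : Cn n) - γ 0‖ ≤ R
    rw [← hγw, hT, hT, ← dist_eq_norm, T.dist_map]
    exact (Metric.mem_ball.1 hw).le

theorem deckLinear_eq_one_iff [T2Space X] (h : IsomOn g ϖ univ) (hflat : IsFlatMetric g)
    (hV : (V : Set (Cn n)) = ϖ ⁻¹' S) (γ : deckGroup ϖ) :
    deckLinear h hflat hV γ = 1 ↔ γ.1 ∈ holonomyKernel ϖ V := by
  constructor
  · intro h1
    refine ⟨γ.2, γ.1 0, (deck_mem_iff γ.2 hV 0).2 V.zero_mem, fun v hv => ?_⟩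
    have := deckLinear_apply h hflat hV γ ⟨v, hv⟩
    rw [h1] at this
    have h2 : v = γ.1 v - γ.1 0 := this
    rw [← sub_eq_iff_eq_add, ← h2]
  · rintro ⟨-, b, -, hb⟩
    ext1 v
    apply Subtype.ext
    rw [deckLinear_apply, hb v v.2, hb 0 V.zero_mem]
    simp

theorem span_transLattice [T2Space X] [ConnectedSpace X] (h : IsomOn g ϖ univ)
    (hcov : IsCoveringMap ϖ) (hflat : IsFlatMetric g) (hS : IsCompact S)
    (hV : (V : Set (Cn n)) = ϖ ⁻¹' S) :
    Submodule.span ℝ (transLattice ϖ V : Set V) = ⊤ := by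
  rw [eq_top_iff, ← (h.isCrystallographic hcov hflat hS hV).span_translations]
  refine Submodule.span_mono ?_
  rintro _ ⟨γ, hγ, rfl⟩
  refine mem_transLattice_iff.2 ⟨γ.1, (deckLinear_eq_one_iff h hflat hV γ).1 hγ, fun v hv => ?_⟩
  have := deckLinear_apply h hflat hV γ ⟨v, hv⟩
  rw [hγ] at this
  have h2 : v = γ.1 v - γ.1 0 := this
  show γ.1 v = v + γ.1 0
  rw [← sub_eq_iff_eq_add, ← h2]

theorem discreteTopology_transLattice [T2Space X] (h : IsomOn g ϖ univ)
    (hcov : IsCoveringMap ϖ) (hflat : IsFlatMetric g) :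
    DiscreteTopology (transLattice ϖ V) := by
  refine discreteTopology_of_isOpen_singleton_zero ?_
  have hfin : {b : transLattice ϖ V | ‖b‖ ≤ 1}.Finite := by
    choose γ hγ hγb using fun b : transLattice ϖ V => mem_transLattice_iff.1 b.2
    have h0 : ∀ b, γ b 0 = ((b : V) : Cn n) := fun b => by
      rw [hγb b 0 V.zero_mem, zero_add]
    refine Set.Finite.of_finite_image
      (f := fun b => (⟨γ b, (hγ b).1⟩ : deckGroup ϖ))
      ((h.finite_deck hcov hflat 0 1).subset ?_) ?_
    · rintro _ ⟨b, hb, rfl⟩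
      show ‖γ b 0‖ ≤ 1
      rw [h0]
      exact hb
    · intro b _ b' _ hbb
      have : γ b = γ b' := congrArg Subtype.val hbb
      apply Subtype.ext
      apply Subtype.ext
      rw [← h0, ← h0, this]
  have hopen : IsOpen (Metric.ball (0 : transLattice ϖ V) 1 ∩
      ({b : transLattice ϖ V | ‖b‖ ≤ 1} \ {0})ᶜ) :=
    Metric.isOpen_ball.inter (hfin.subset sdiff_subset).isClosed.isOpen_compl
  convert hopen using 1
  ext b
  simp only [mem_singleton_iff, mem_inter_iff, Metric.mem_ball, dist_zero_right, mem_compl_iff,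
    Set.mem_sdiff, mem_ofPred_eq, not_and, not_not]
  constructor
  · rintro rfl
    simp
  · rintro ⟨h1, h2⟩
    exact h2 h1.le

theorem normal_holonomyKernel [T2Space X] (h : IsomOn g ϖ univ) (hflat : IsFlatMetric g)
    (hV : (V : Set (Cn n)) = ϖ ⁻¹' S) :
    ((holonomyKernel ϖ V).subgroupOf (deckGroup ϖ)).Normal := by
  have : (holonomyKernel ϖ V).subgroupOf (deckGroup ϖ) = (deckLinear h hflat hV).ker := by
    ext γ
    rw [Subgroup.mem_subgroupOf, MonoidHom.mem_ker, deckLinear_eq_one_iff]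
  rw [this]
  infer_instance

end

/-! ### Holomorphic functions of several variables -/

section

variable {E : Type*} [NormedAddCommGroup E] [NormedSpace ℂ E] [FiniteDimensional ℂ E]

/-- The partial derivatives of a holomorphic function of several variables are holomorphic: they
are given by Cauchy's integral formula on discs, which can be differentiated under the integral. -/
theorem differentiableAt_fderiv_apply {f : E → ℂ} {U : Set E} (hU : IsOpen U)
    (hf : DifferentiableOn ℂ f U) {z₀ : E} (hz₀ : z₀ ∈ U) (v : E) :
    DifferentiableAt ℂ (fun z => fderiv ℂ f z v) z₀ := by
  have : ProperSpace E := FiniteDimensional.proper ℂ E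
  have : ProperSpace (E →L[ℂ] ℂ) := FiniteDimensional.proper ℂ _
  obtain ⟨R, hR, hRU⟩ := Metric.isOpen_iff.1 hU z₀ hz₀
  set ρ := R / 5 with hρdef
  have hρ : 0 < ρ := by positivity
  have hsub : Metric.closedBall z₀ (4 * ρ) ⊆ U :=
    (Metric.closedBall_subset_ball (by linarith)).trans hRU
  obtain ⟨C, hC⟩ := (isCompact_closedBall z₀ (4 * ρ)).exists_bound_of_continuousOn
    (hf.continuousOn.mono hsub)
  have hC0 : 0 ≤ C := (norm_nonneg _).trans (hC z₀ (Metric.mem_closedBall_self (by positivity)))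
  -- Cauchy estimate
  have hest : ∀ z ∈ Metric.ball z₀ (3 * ρ), ‖fderiv ℂ f z‖ ≤ (2 * C) / ρ := by
    intro z hz
    have hzsub : Metric.ball z ρ ⊆ Metric.closedBall z₀ (4 * ρ) := fun w hw => by
      have := dist_triangle w z z₀
      rw [Metric.mem_ball] at hw hz
      rw [Metric.mem_closedBall]
      linarith
    refine Complex.norm_fderiv_le_div_of_mapsTo_ball (hf.mono (hzsub.trans hsub))
      (fun w hw => ?_) hρ
    rw [Metric.mem_closedBall, dist_eq_norm]
    have h1 := hC w (hzsub hw)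
    have h2 := hC z (hzsub (Metric.mem_ball_self hρ))
    have h3 := norm_sub_le (f w) (f z)
    linarith
  -- reduction to short vectors
  suffices hsmall : ∀ v : E, ‖v‖ ≤ ρ → DifferentiableAt ℂ (fun z => fderiv ℂ f z v) z₀ by
    set c : ℂ := ((ρ / (‖v‖ + 1) : ℝ) : ℂ)
    have hpos : 0 < ‖v‖ + 1 := by positivity
    have hc : c ≠ 0 := by
      simp only [c, ne_eq, Complex.ofReal_eq_zero]
      positivity
    have h1 : ‖c • v‖ ≤ ρ := by
      rw [norm_smul, Complex.norm_real, Real.norm_of_nonneg (by positivity), div_mul_eq_mul_div,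
        div_le_iff₀ hpos]
      nlinarith [norm_nonneg v]
    have h2 := (hsmall (c • v) h1).const_mul c⁻¹
    refine h2.congr_of_eventuallyEq (Eventually.of_forall fun z => ?_)
    simp only [map_smul, smul_eq_mul]
    rw [inv_mul_cancel_left₀ hc]
  clear v
  intro v hv
  have hmem : ∀ z ∈ Metric.ball z₀ ρ, ∀ ζ : ℂ, ‖ζ‖ < 2 → z + ζ • v ∈ Metric.ball z₀ (3 * ρ) := by
    intro z hz ζ hζ
    rw [Metric.mem_ball, dist_eq_norm] at hz ⊢
    have h1 : ‖z + ζ • v - z₀‖ ≤ ‖z - z₀‖ + ‖ζ • v‖ := by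
      rw [add_sub_right_comm]; exact norm_add_le _ _
    rw [norm_smul] at h1
    nlinarith [norm_nonneg ζ, norm_nonneg v]
  have hballU : Metric.ball z₀ (3 * ρ) ⊆ U :=
    (Metric.ball_subset_closedBall.trans (Metric.closedBall_subset_closedBall (by linarith))).trans
      hsub
  set k : ℝ → ℂ := fun θ => (2 * Real.pi * Complex.I)⁻¹ * (deriv (circleMap 0 1) θ *
    ((circleMap 0 1 θ) ^ 2)⁻¹)
  have hk : Continuous k := by
    have h0 : ∀ θ, circleMap 0 1 θ ≠ 0 := fun θ => circleMap_ne_center one_ne_zero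
    simp only [k, deriv_circleMap]
    refine continuous_const.mul (((continuous_circleMap 0 1).mul continuous_const).mul
      (((continuous_circleMap 0 1).pow 2).inv₀ fun θ => pow_ne_zero 2 (h0 θ)))
  have hcirc : ∀ θ, ‖circleMap 0 1 θ‖ < 2 := fun θ => by
    simp
  have hcauchy : ∀ z ∈ Metric.ball z₀ ρ, fderiv ℂ f z v =
      ∫ θ in (0 : ℝ)..2 * Real.pi, k θ * f (z + circleMap 0 1 θ • v) := by
    intro z hz
    have hd : DifferentiableOn ℂ (fun ζ : ℂ => f (z + ζ • v)) (Metric.ball 0 2) := by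
      refine hf.comp (by fun_prop) fun ζ hζ => hballU (hmem z hz ζ ?_)
      simpa using hζ
    have h1 := Complex.cderiv_eq_deriv Metric.isOpen_ball hd zero_lt_one (z := 0)
      (Metric.closedBall_subset_ball (by norm_num))
    have h2 : deriv (fun ζ : ℂ => f (z + ζ • v)) 0 = fderiv ℂ f z v := by
      have h3 : HasFDerivAt f (fderiv ℂ f z) (z + (0 : ℂ) • v) := by
        have hz' : z ∈ U := by
          have := hballU (hmem z hz 0 (by simp))
          simpa using this
        simpa using ((hf z hz').differentiableAt (hU.mem_nhds hz')).hasFDerivAt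
      have h4 : HasDerivAt (fun ζ : ℂ => z + ζ • v) v 0 := by
        simpa using ((hasDerivAt_id (0 : ℂ)).smul_const v).const_add z
      exact (h3.comp_hasDerivAt 0 h4).deriv
    rw [← h2, ← h1, Complex.cderiv, circleIntegral, smul_eq_mul, ← intervalIntegral.integral_const_mul]
    refine intervalIntegral.integral_congr fun θ _ => ?_
    simp only [k, sub_zero, smul_eq_mul]
    ring
  have hdiff := intervalIntegral.hasFDerivAt_integral_of_dominated_of_fderiv_le
    (μ := MeasureTheory.volume) (a := 0) (b := 2 * Real.pi) (x₀ := z₀) (s := Metric.ball z₀ ρ)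
    (F := fun z θ => k θ * f (z + circleMap 0 1 θ • v))
    (F' := fun z θ => k θ • fderiv ℂ f (z + circleMap 0 1 θ • v))
    (bound := fun θ => ‖k θ‖ * (2 * C / ρ)) (𝕜 := ℂ) (Metric.ball_mem_nhds z₀ hρ)
  have hFc : ∀ z ∈ Metric.ball z₀ ρ, Continuous fun θ => k θ * f (z + circleMap 0 1 θ • v) := by
    intro z hz
    refine hk.mul (hf.continuousOn.comp_continuous (by fun_prop) fun θ =>
      hballU (hmem z hz _ (hcirc θ)))
  have h := hdiff ?_ ?_ ?_ ?_ ?_ ?_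
  · refine (h.differentiableAt).congr_of_eventuallyEq ?_
    filter_upwards [Metric.ball_mem_nhds z₀ hρ] with z hz using hcauchy z hz
  · filter_upwards [Metric.ball_mem_nhds z₀ hρ] with z hz
    exact (hFc z hz).aestronglyMeasurable
  · exact (hFc z₀ (Metric.mem_ball_self hρ)).intervalIntegrable _ _
  · borelize E
    refine hk.aestronglyMeasurable.smul ?_
    have h1 : Measurable fun θ : ℝ => z₀ + circleMap 0 1 θ • v := by
      have : Continuous fun θ : ℝ => z₀ + circleMap 0 1 θ • v := by fun_prop
      exact this.measurable
    exact ((measurable_fderiv ℂ f).comp h1).aestronglyMeasurable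
  · refine Eventually.of_forall fun θ _ z hz => ?_
    rw [norm_smul]
    exact mul_le_mul_of_nonneg_left (hest _ (hmem z hz _ (hcirc θ))) (norm_nonneg _)
  · exact (hk.norm.mul continuous_const).intervalIntegrable _ _
  · refine Eventually.of_forall fun θ _ z hz => ?_
    have hzU := hballU (hmem z hz _ (hcirc θ))
    have h1 : HasFDerivAt f (fderiv ℂ f (z + circleMap 0 1 θ • v)) (z + circleMap 0 1 θ • v) :=
      ((hf _ hzU).differentiableAt (hU.mem_nhds hzU)).hasFDerivAt
    have h2 : HasFDerivAt (fun z => z + circleMap 0 1 θ • v) (ContinuousLinearMap.id ℂ E) z :=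
      (hasFDerivAt_id z).add_const _
    exact (h1.comp z h2).const_mul (k θ)

/-- Holomorphic functions of several variables are smooth. -/
theorem contDiffOn_of_differentiableOn_complex {U : Set E} (hU : IsOpen U) {f : E → ℂ}
    (hf : DifferentiableOn ℂ f U) : ContDiffOn ℂ ∞ f U := by
  rw [contDiffOn_infty]
  intro N
  induction N generalizing f with
  | zero => exact contDiffOn_zero.2 hf.continuousOn
  | succ N ih =>
    have : ((N + 1 : ℕ) : ℕ∞ω) = (N : ℕ∞ω) + 1 := by norm_cast
    rw [this, contDiffOn_succ_iff_fderiv_of_isOpen hU]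
    refine ⟨hf, fun h => absurd h (by simp), contDiffOn_clm_apply.2 fun v => ih fun z hz => ?_⟩
    exact (differentiableAt_fderiv_apply hU hf hz v).differentiableWithinAt

end

/-! ### Holomorphic volume forms -/

section

variable {n : ℕ}

/-- The standard holomorphic volume form as a continuous complex multilinear form. -/
noncomputable def stdVolumeForm (n : ℕ) : Cn n [⋀^Fin n]→L[ℂ] ℂ where
  __ := (Matrix.detRowAlternating (R := ℂ) (n := Fin n)).compLinearMap
    (WithLp.linearEquiv 2 ℂ (Fin n → ℂ)).toLinearMap
  cont := by
    show Continuous fun v : Fin n → Cn n => Matrix.det (Matrix.of fun i j => v i j)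
    refine Continuous.matrix_det (continuous_matrix fun i j => ?_)
    exact (EuclideanSpace.proj (𝕜 := ℂ) j).continuous.comp (continuous_apply i)

/-- A holomorphic multiple of `dz₁ ∧ ⋯ ∧ dzₙ` is closed. -/
theorem extDeriv_holomorphic_smul {f : Cn n → ℂ} {z : Cn n} (hf : DifferentiableAt ℂ f z) :
    extDeriv (fun w => f w • (stdVolumeForm n).restrictScalars ℝ) z = 0 := by
  have hd : DifferentiableAt ℂ (fun w => f w • stdVolumeForm n) z := hf.smul_const _
  have hdR : DifferentiableAt ℝ (fun w => f w • (stdVolumeForm n).restrictScalars ℝ) z :=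
    (hf.restrictScalars ℝ).smul_const _
  ext v
  have h1 : extDeriv (fun w => f w • stdVolumeForm n) z v = 0 := by
    -- there are no complex `(n + 1)`-forms on `ℂⁿ`
    refine AlternatingMap.map_linearDependent
      (extDeriv (fun w => f w • stdVolumeForm n) z).toAlternatingMap v fun h => ?_
    have := h.fintype_card_le_finrank
    simp at this
  rw [extDeriv_apply hdR]
  rw [extDeriv_apply hd] at h1
  refine Eq.trans (Finset.sum_congr rfl fun i _ => ?_) h1
  have h2 : DifferentiableAt ℂ (fun w => (f w • stdVolumeForm n) (i.removeNth v)) z := by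
    simp only [ContinuousAlternatingMap.smul_apply, smul_eq_mul]
    exact hf.mul_const _
  have h3 := h2.fderiv_restrictScalars ℝ
  exact congrArg (fun T : Cn n →L[ℝ] ℂ => (-1) ^ (i : ℕ) • T (v i)) h3

variable {M : Type*} [TopologicalSpace M] [ChartedSpace (Cn n) M] [IsManifold 𝓘(ℝ, Cn n) ∞ M]

/-- In a holomorphic chart, the volume form is a holomorphic multiple of `dz₁ ∧ ⋯ ∧ dzₙ`. -/
theorem exists_pullForm_vform_eventuallyEq (Y : CalabiYau n M) {G : Cn n → M} {z : Cn n}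
    (hG : ContMDiffAt 𝓘(ℝ, Cn n) 𝓘(ℝ, Cn n) ∞ G z) :
    ∃ (φ : Cn n → Cn n) (f : Cn n → ℂ) (U : Set (Cn n)), IsOpen U ∧ DifferentiableOn ℂ f U ∧
      φ z ∈ U ∧ ContDiffAt ℝ ∞ φ z ∧
      EventuallyEq (β := Cn n [⋀^Fin n]→L[ℝ] ℂ) (𝓝 z) (pullForm (E' := Cn n) G Y.vform) fun y =>
        (f (φ y) • (stdVolumeForm n).restrictScalars ℝ).compContinuousLinearMap (fderiv ℝ φ y) := by
  obtain ⟨c, hc, hzc, -, f, hf, hv⟩ := Y.holomorphic (G z)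
  refine ⟨c ∘ G, f, c.target, c.open_target, hf, c.map_source hzc,
    ((contMDiffAt_of_mem_maximalAtlas hc hzc).comp z hG).contDiffAt, ?_⟩
  have hG' : ∀ᶠ y in 𝓝 z, ContMDiffAt 𝓘(ℝ, Cn n) 𝓘(ℝ, Cn n) 1 G y := by
    have : IsManifold 𝓘(ℝ, Cn n) 1 M := IsManifold.of_le (n := ∞) (by simp)
    exact (contMDiffAt_iff_contMDiffAt_nhds (by simp)).1 (hG.of_le (by simp))
  filter_upwards [hG', hG.continuousAt.eventually_mem (c.open_source.mem_nhds hzc)] with y hy hyc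
  ext v
  refine (hv (G y) hyc _).trans ?_
  refine congrArg (fun t => f (c (G y)) * stdVolume t) ?_
  funext i
  exact (fderiv_comp_chart hc (hy.mdifferentiableAt (by simp)) hyc (v i)).symm

theorem contDiffAt_pullForm_vform (Y : CalabiYau n M) {G : Cn n → M} {z : Cn n}
    (hG : ContMDiffAt 𝓘(ℝ, Cn n) 𝓘(ℝ, Cn n) ∞ G z) :
    ContDiffAt ℝ ∞ (E := Cn n) (F := Cn n [⋀^Fin n]→L[ℝ] ℂ) (pullForm (E' := Cn n) G Y.vform) z := by
  obtain ⟨φ, f, U, hU, hf, hz, hφ, h⟩ := exists_pullForm_vform_eventuallyEq Y hG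
  refine ContDiffAt.congr_of_eventuallyEq ?_ h
  have hfs : ContDiffAt ℝ ∞ f (φ z) :=
    ((contDiffOn_of_differentiableOn_complex hU hf).contDiffAt (hU.mem_nhds hz)).restrict_scalars ℝ
  have h1 : ContDiffAt ℝ ∞ (fun y => f (φ y) • (stdVolumeForm n).restrictScalars ℝ) z :=
    (hfs.comp z hφ).smul contDiffAt_const
  exact contDiff_compContinuousLinearMap.contDiffAt.comp z
    (h1.prodMk (hφ.fderiv_right (m := ∞) (by simp)))

theorem extDeriv_pullForm_vform (Y : CalabiYau n M) {G : Cn n → M} {z : Cn n}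
    (hG : ContMDiffAt 𝓘(ℝ, Cn n) 𝓘(ℝ, Cn n) ∞ G z) :
    extDeriv (E := Cn n) (F := ℂ) (pullForm (E' := Cn n) G Y.vform) z = 0 := by
  obtain ⟨φ, f, U, hU, hf, hz, hφ, h⟩ := exists_pullForm_vform_eventuallyEq Y hG
  have hfz : DifferentiableAt ℂ f (φ z) := (hf _ hz).differentiableAt (hU.mem_nhds hz)
  have hd : DifferentiableAt ℝ (fun w => f w • (stdVolumeForm n).restrictScalars ℝ) (φ z) :=
    (hfz.restrictScalars ℝ).smul_const _
  rw [h.extDeriv_eq]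
  refine (extDeriv_pullback (f := φ) (x := z) (r := ∞) hd hφ two_le_smoothness).trans ?_
  rw [extDeriv_holomorphic_smul hfz]
  ext v; rfl

end

/-! ### Primitives of forms on the image of a tube -/

section

variable {m : ℕ} {M : Type*} [TopologicalSpace M] [ChartedSpace (Cn (m + 1)) M]
  [IsManifold 𝓘(ℝ, Cn (m + 1)) ∞ M]

open Classical in
/-- The push-forward of a form by a local diffeomorphism `G` defined on `T`: its value at a point of
`G(T)` is computed with an arbitrary preimage. -/
noncomputable def pushForm {k : ℕ} (G : Cn (m + 1) → M) (T : Set (Cn (m + 1)))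
    (β : Cn (m + 1) → Cn (m + 1) [⋀^Fin k]→L[ℝ] ℂ) : DForm (Cn (m + 1)) M k ℂ := fun x =>
  if h : ∃ z ∈ T, G z = x then
    (β h.choose).compContinuousLinearMap (ContinuousLinearMap.inverse
      (mfderiv 𝓘(ℝ, Cn (m + 1)) 𝓘(ℝ, Cn (m + 1)) G h.choose : Cn (m + 1) →L[ℝ] Cn (m + 1)))
  else 0

variable {G : Cn (m + 1) → M} {T : Set (Cn (m + 1))} (hT : IsOpen T)
  (hG : ∀ z ∈ T, ContMDiffAt 𝓘(ℝ, Cn (m + 1)) 𝓘(ℝ, Cn (m + 1)) ∞ G z)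
  (hinj : ∀ z ∈ T, Function.Injective (mfderiv 𝓘(ℝ, Cn (m + 1)) 𝓘(ℝ, Cn (m + 1)) G z))

include hT hG in
omit [IsManifold 𝓘(ℝ, Cn (m + 1)) ∞ M] in
/-- A form pulled back by a map that is invariant under a rigid motion is invariant. -/
theorem pullForm_invariant {k : ℕ} {A : Cn (m + 1) →L[ℝ] Cn (m + 1)} {b : Cn (m + 1)}
    (h : ∀ y ∈ T, A y + b ∈ T ∧ G (A y + b) = G y) (α : DForm (Cn (m + 1)) M k ℂ)
    {z : Cn (m + 1)} (hz : z ∈ T) :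
    (pullForm (E' := Cn (m + 1)) G α (A z + b) :
      Cn (m + 1) [⋀^Fin k]→L[ℝ] ℂ).compContinuousLinearMap A = pullForm (E' := Cn (m + 1)) G α z := by
  have hd : HasFDerivAt (fun y => A y + b) A z := A.hasFDerivAt.add_const b
  have h1 : (G ∘ fun y => A y + b) =ᶠ[𝓝 z] G := by
    filter_upwards [hT.mem_nhds hz] with y hy using (h y hy).2
  have h2 := pullForm_comp (f := G) (h := fun y => A y + b) (x := z)
    ((hG _ (h z hz).1).mdifferentiableAt (by simp)) hd.differentiableAt.mdifferentiableAt α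
  have h3 := pullForm_eq_fderiv (fun y => A y + b) (pullForm (E' := Cn (m + 1)) G α) z
  rw [hd.fderiv] at h3
  exact h3.symm.trans (h2.symm.trans (pullForm_congr h1 α))

include hT hG hinj in
omit [IsManifold 𝓘(ℝ, Cn (m + 1)) ∞ M] in
/-- The push-forward of `β` pulls back to `β` if points with the same image are related by rigid
motions that preserve `β`, since its values do not depend then on the choice of preimages. -/
theorem pullForm_pushForm {k : ℕ} {β : Cn (m + 1) → Cn (m + 1) [⋀^Fin k]→L[ℝ] ℂ}
    (hdeck : ∀ z ∈ T, ∀ w ∈ T, G z = G w → ∃ (A : Cn (m + 1) →L[ℝ] Cn (m + 1)) (b : Cn (m + 1)),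
      A z + b = w ∧ (∀ y ∈ T, A y + b ∈ T ∧ G (A y + b) = G y) ∧
        (β (A z + b)).compContinuousLinearMap A = β z) {z : Cn (m + 1)} (hz : z ∈ T) :
    pullForm (E' := Cn (m + 1)) G (pushForm G T β) z = β z := by
  have hex : ∃ w ∈ T, G w = G z := ⟨z, hz, rfl⟩
  obtain ⟨hw, hwz⟩ := hex.choose_spec
  obtain ⟨A, b, hAb, hA, hβ⟩ := hdeck z hz _ hw hwz.symm
  set w := hex.choose
  have hd : HasFDerivAt (fun y => A y + b) A z := A.hasFDerivAt.add_const b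
  have h1 : (G ∘ fun y => A y + b) =ᶠ[𝓝 z] G := by
    filter_upwards [hT.mem_nhds hz] with y hy using (hA y hy).2
  have h2 := mfderiv_comp z ((hG _ (hA z hz).1).mdifferentiableAt (by simp))
    hd.differentiableAt.mdifferentiableAt
  rw [h1.mfderiv_eq, mfderiv_eq_fderiv, hd.fderiv] at h2
  obtain ⟨e, he⟩ := exists_equiv_of_injective (hinj w hw)
  have h3 : ∀ v : Cn (m + 1), (mfderiv 𝓘(ℝ, Cn (m + 1)) 𝓘(ℝ, Cn (m + 1)) G z v : Cn (m + 1)) =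
      e (A v) := fun v => by
    refine (congrArg (fun L : Cn (m + 1) →L[ℝ] Cn (m + 1) => L v) h2).trans ?_
    have : ∀ p, p = w → (mfderiv 𝓘(ℝ, Cn (m + 1)) 𝓘(ℝ, Cn (m + 1)) G p (A v) : Cn (m + 1)) =
        e (A v) := by
      rintro p rfl
      exact congrArg (fun L : Cn (m + 1) →L[ℝ] Cn (m + 1) => L (A v)) he.symm
    exact this _ hAb
  rw [← hβ, hAb]
  ext v
  have h4 : pushForm G T β (G z) = (β w).compContinuousLinearMap (ContinuousLinearMap.inverse
      (mfderiv 𝓘(ℝ, Cn (m + 1)) 𝓘(ℝ, Cn (m + 1)) G w : Cn (m + 1) →L[ℝ] Cn (m + 1))) := dif_pos hex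
  refine (congrArg (fun L : Cn (m + 1) [⋀^Fin k]→L[ℝ] ℂ => L fun i =>
    (mfderiv 𝓘(ℝ, Cn (m + 1)) 𝓘(ℝ, Cn (m + 1)) G z (v i) : Cn (m + 1))) h4).trans ?_
  refine congrArg (β w) (funext fun i => ?_)
  have h5 : ContinuousLinearMap.inverse (mfderiv 𝓘(ℝ, Cn (m + 1)) 𝓘(ℝ, Cn (m + 1)) G w :
      Cn (m + 1) →L[ℝ] Cn (m + 1)) = (e.symm : Cn (m + 1) →L[ℝ] Cn (m + 1)) :=
    (congrArg (ContinuousLinearMap.inverse (M := Cn (m + 1)) (M₂ := Cn (m + 1))) he.symm).trans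
      (ContinuousLinearMap.inverse_equiv e)
  refine (congrArg (fun L : Cn (m + 1) →L[ℝ] Cn (m + 1) =>
    L (mfderiv 𝓘(ℝ, Cn (m + 1)) 𝓘(ℝ, Cn (m + 1)) G z (v i) : Cn (m + 1))) h5).trans ?_
  exact (congrArg e.symm (h3 (v i))).trans (e.symm_apply_apply _)

include hT hG hinj in
/-- A form on `M` whose pull-back by a local diffeomorphism `G` has the smooth primitive `β`, which
descends to `M`, is exact on the image of `G`. -/
theorem isExactOn_of_pullForm {k : ℕ} {β : Cn (m + 1) → Cn (m + 1) [⋀^Fin k]→L[ℝ] ℂ}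
    (hβ : ContDiffOn ℝ ∞ β T) {α : DForm (Cn (m + 1)) M (k + 1) ℂ}
    (hβα : ∀ z ∈ T, extDeriv β z = pullForm (E' := Cn (m + 1)) G α z)
    {β' : DForm (Cn (m + 1)) M k ℂ} (hpull : ∀ z ∈ T, pullForm (E' := Cn (m + 1)) G β' z = β z)
    {U : Set M} (hU : U ⊆ G '' T) : IsExactOn U α := by
  have key : ∀ c ∈ atlas (Cn (m + 1)) M, ∀ y ∈ chartDomain c U, ∃ s : Cn (m + 1) → Cn (m + 1),
      ContDiffAt ℝ ∞ s y ∧ s y ∈ T ∧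
      formInChart c β' =ᶠ[𝓝 y] (fun w => (β (s w)).compContinuousLinearMap (fderiv ℝ s w)) ∧
      formInChart c α y = (pullForm (E' := Cn (m + 1)) G α (s y) :
        Cn (m + 1) [⋀^Fin (k + 1)]→L[ℝ] ℂ).compContinuousLinearMap (fderiv ℝ s y) := by
    rintro c hc y ⟨hyt, hyU⟩
    obtain ⟨z, hz, hzy⟩ := hU hyU
    have hcm := IsManifold.subset_maximalAtlas (I := 𝓘(ℝ, Cn (m + 1))) (n := ∞) hc
    have hzc : G z ∈ c.source := by rw [hzy]; exact c.map_target hyt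
    have hcy : c (G z) = y := by rw [hzy]; exact c.right_inv hyt
    obtain ⟨s, hs, hsz, hsc, -⟩ := exists_local_inverse (hG z hz) (hinj z hz) hcm hzc
    rw [hcy] at hs hsz hsc
    have hGev : ∀ᶠ w in 𝓝 (s y), MDifferentiableAt 𝓘(ℝ, Cn (m + 1)) 𝓘(ℝ, Cn (m + 1)) G w := by
      rw [hsz]
      filter_upwards [hT.mem_nhds hz] with w hw using (hG w hw).mdifferentiableAt (by simp)
    refine ⟨s, hs, by rwa [hsz], ?_, (formInChart_eventuallyEq hs hGev hsc α).eq_of_nhds⟩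
    refine (formInChart_eventuallyEq hs hGev hsc β').trans ?_
    filter_upwards [hs.continuousAt.eventually_mem (hT.mem_nhds (hsz.symm ▸ hz))] with w hw
    exact congrArg (fun L : Cn (m + 1) [⋀^Fin k]→L[ℝ] ℂ =>
      L.compContinuousLinearMap (fderiv ℝ s w)) (hpull _ hw)
  refine ⟨β', fun c hc y hy => ?_, fun c hc y hy => ?_⟩
  · obtain ⟨s, hs, hsT, h1, -⟩ := key c hc y hy
    refine ContDiffAt.contDiffWithinAt (ContDiffAt.congr_of_eventuallyEq ?_ h1)
    exact contDiff_compContinuousLinearMap.contDiffAt.comp y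
      (((hβ.contDiffAt (hT.mem_nhds hsT)).comp y hs).prodMk (hs.fderiv_right (m := ∞) (by simp)))
  · obtain ⟨s, hs, hsT, h1, h2⟩ := key c hc y hy
    rw [h1.extDeriv_eq, h2]
    refine (extDeriv_pullback (r := ∞) ((hβ.contDiffAt (hT.mem_nhds hsT)).differentiableAt
      (by simp)) hs two_le_smoothness).trans ?_
    rw [hβα _ hsT]
    rfl

include hT hG hinj in
/-- If a map `G` on a neighbourhood of a subspace `V` of dimension at most `m` is a local
diffeomorphism whose fibres are orbits of rigid motions that preserve `V`, then
holomorphic volume forms are exact on its image: contract to `V`. -/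
theorem isExactOn_vform_of_finrank_le (Y : CalabiYau (m + 1) M) {V : Submodule ℝ (Cn (m + 1))}
    (hV : Module.finrank ℝ V ≤ m)
    (hstar : ∀ z ∈ T, ∀ t ∈ Icc (0 : ℝ) 1,
      V.starProjection z + t • Vᗮ.starProjection z ∈ T)
    (hdeck : ∀ z ∈ T, ∀ w ∈ T, G z = G w →
      ∃ (A : Cn (m + 1) →L[ℝ] Cn (m + 1)) (b : Cn (m + 1)), A z + b = w ∧ b ∈ V ∧
        (∀ y, A (V.starProjection y) = V.starProjection (A y)) ∧
        ∀ y ∈ T, A y + b ∈ T ∧ G (A y + b) = G y)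
    {U : Set M} (hU : U ⊆ G '' T) : IsExactOn U Y.vform := by
  set P := V.starProjection
  set Q := Vᗮ.starProjection
  have hPQone : ∀ z, P z + Q z = z := fun z => V.starProjection_add_starProjection_orthogonal z
  let α : Cn (m + 1) → Cn (m + 1) [⋀^Fin (m + 1)]→L[ℝ] ℂ := pullForm (E' := Cn (m + 1)) G Y.vform
  have hα : ContDiffOn ℝ ∞ α T := fun z hz =>
    (contDiffAt_pullForm_vform Y (hG z hz)).contDiffWithinAt
  have hβ := contDiffOn_contractionPrimitive hT hα hstar
  have hβα : ∀ z ∈ T, extDeriv (contractionPrimitive P Q α) z = α z := fun z hz =>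
    extDeriv_contractionPrimitive hT hα (fun z hz => extDeriv_pullForm_vform Y (hG z hz)) hstar
      -- a form of degree `m + 1` vanishes on `V`, which has dimension at most `m`
      hPQone (fun z _ => by
        ext v
        refine AlternatingMap.map_linearDependent (α (P z)).toAlternatingMap (fun i => P (v i))
          fun h => ?_
        have h1 : LinearIndependent ℝ fun i => (⟨P (v i), V.starProjection_apply_mem _⟩ : V) :=
          LinearIndependent.of_comp V.subtype h
        have h2 := h1.fintype_card_le_finrank
        simp at h2
        omega) hz
  refine isExactOn_of_pullForm hT hG hinj hβ hβα (fun z hz =>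
    pullForm_pushForm hT hG hinj (fun z hz w hw hzw => ?_) hz) hU
  obtain ⟨A, b, hAb, hbV, hAP, hA⟩ := hdeck z hz w hw hzw
  refine ⟨A, b, hAb, hA, contractionPrimitive_invariant hα hstar hAP (fun y => ?_) ?_ ?_
    (fun y hy => ⟨(hA y hy).1, pullForm_invariant hT hG hA Y.vform hy⟩) hz⟩
  · have h1 : ∀ y, Q y = y - P y := fun y => eq_sub_of_add_eq' (hPQone y)
    rw [h1, h1, map_sub, hAP]
  · exact V.starProjection_eq_self_iff.2 hbV
  · have h1 : Q b = b - P b := eq_sub_of_add_eq' (hPQone b)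
    rw [h1, show P b = b from V.starProjection_eq_self_iff.2 hbV, sub_self]

end

/-! ### Lifts of short paths -/

section

variable {n : ℕ} {M : Type*} [TopologicalSpace M] [ChartedSpace (Cn n) M]
  [IsManifold 𝓘(ℝ, Cn n) ∞ M]

/-- Short paths that start at `G z₀` end in the image of a ball about `z₀` on which `G` does not
contract too much. -/
theorem exists_preimage_of_gLength_lt [T2Space M] (g : Metric (Cn n) M) {G : Cn n → M}
    {z₀ : Cn n} {ρ C : ℝ} (hρ : 0 < ρ) (hC : 0 ≤ C)
    (hG : ∀ w ∈ Metric.closedBall z₀ ρ, ContMDiffAt 𝓘(ℝ, Cn n) 𝓘(ℝ, Cn n) ∞ G w)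
    (hcmp : ∀ w ∈ Metric.closedBall z₀ ρ, ∀ v : Cn n,
      ‖v‖ ≤ C * √(g.inner (G w) (mfderiv 𝓘(ℝ, Cn n) 𝓘(ℝ, Cn n) G w v)
        (mfderiv 𝓘(ℝ, Cn n) 𝓘(ℝ, Cn n) G w v)))
    {γ : ℝ → M} (hγ : ContMDiffOn 𝓘(ℝ, ℝ) 𝓘(ℝ, Cn n) 1 γ (Icc 0 1)) (h0 : γ 0 = G z₀)
    (hlen : ENNReal.ofReal C * gLength g γ < ENNReal.ofReal ρ) :
    ∃ w ∈ Metric.ball z₀ ρ, G w = γ 1 := by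
  set f : ℝ → ℝ≥0∞ := fun t => ENNReal.ofReal (√(g.inner (γ t)
      (mfderiv 𝓘(ℝ, ℝ) 𝓘(ℝ, Cn n) γ t (1 : ℝ)) (mfderiv 𝓘(ℝ, ℝ) 𝓘(ℝ, Cn n) γ t (1 : ℝ)))) with hf
  rw [gLength_eq] at hlen
  set l : ℝ → ℝ≥0∞ := fun t => ∫⁻ u in Icc 0 t, f u with hl
  have hlmono : Monotone l := fun a b hab => MeasureTheory.lintegral_mono_set (Icc_subset_Icc_right hab)
  set P : ℝ → Prop := fun t => ∃ w ∈ Metric.closedBall z₀ ρ, G w = γ t ∧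
    edist w z₀ ≤ ENNReal.ofReal C * l t with hP
  have hmemball : ∀ {w t}, t ≤ (1 : ℝ) → edist w z₀ ≤ ENNReal.ofReal C * l t →
      w ∈ Metric.ball z₀ ρ := by
    intro w t ht hw
    have h1 : edist w z₀ < ENNReal.ofReal ρ :=
      (hw.trans (mul_le_mul_right (hlmono ht) _)).trans_lt hlen
    rw [edist_dist] at h1
    exact (ENNReal.ofReal_lt_ofReal_iff hρ).1 h1
  have hP0 : P 0 := ⟨z₀, Metric.mem_closedBall_self hρ.le, h0.symm, by simp⟩
  have hinj : ∀ w ∈ Metric.closedBall z₀ ρ,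
      Function.Injective (mfderiv 𝓘(ℝ, Cn n) 𝓘(ℝ, Cn n) G w) := by
    intro w hw
    rw [injective_iff_map_eq_zero]
    intro (v : Cn n) hv
    have h1 := hcmp w hw v
    rw [hv] at h1
    simp only [map_zero, Real.sqrt_zero, mul_zero] at h1
    exact (norm_le_zero_iff (E := Cn n)).1 h1
  -- the points up to which the path can be lifted
  set A : Set ℝ := {t | ∀ s ∈ Icc 0 t, P s} with hA
  -- limits of lifted points are lifted points, by compactness
  have hleft : ∀ t ∈ Icc (0 : ℝ) 1, (∀ s ∈ Ico 0 t, P s) → P t := by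
    intro t ht hs
    rcases eq_or_lt_of_le ht.1 with rfl | h0t
    · exact hP0
    obtain ⟨u, -, hu, hut⟩ := exists_seq_strictMono_tendsto' h0t
    choose w hw hGw hwl using fun i => hs (u i) ⟨(hu i).1.le, (hu i).2⟩
    obtain ⟨w₀, hw₀, φ, hφ, hlim⟩ := (isCompact_closedBall z₀ ρ).tendsto_subseq hw
    refine ⟨w₀, hw₀, ?_, ?_⟩
    · have h1 : Tendsto (fun i => G (w (φ i))) atTop (𝓝 (G w₀)) :=
        (hG w₀ hw₀).continuousAt.tendsto.comp hlim
      have h2 : Tendsto (fun i => γ (u (φ i))) atTop (𝓝 (γ t)) := by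
        refine Tendsto.comp (hγ.continuousOn t ht) (tendsto_nhdsWithin_iff.2
          ⟨hut.comp hφ.tendsto_atTop, Eventually.of_forall fun i =>
            ⟨(hu _).1.le, (hu _).2.le.trans ht.2⟩⟩)
      simp only [hGw] at h1
      exact tendsto_nhds_unique h1 h2
    · have h1 : Tendsto (fun i => edist (w (φ i)) z₀) atTop (𝓝 (edist w₀ z₀)) :=
        hlim.edist tendsto_const_nhds
      exact le_of_tendsto' h1 fun i =>
        (hwl _).trans (mul_le_mul_right (hlmono (hu _).2.le) _)
  have hclosed : IsClosed (A ∩ Icc 0 1) := by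
    refine isClosed_of_closure_subset fun t ht => ?_
    have htI : t ∈ Icc (0 : ℝ) 1 := by
      rw [← isClosed_Icc.closure_eq]
      exact closure_mono inter_subset_right ht
    refine ⟨?_, htI⟩
    have hlt : ∀ s ∈ Ico 0 t, P s := by
      intro s hs
      obtain ⟨t', ht', hst'⟩ := mem_closure_iff.1 ht (Ioi s) isOpen_Ioi hs.2
      exact hst'.1 s ⟨hs.1, le_of_lt ht'⟩
    intro s hs
    rcases eq_or_lt_of_le hs.2 with rfl | hst
    · exact hleft s htI hlt
    · exact hlt s ⟨hs.1, hst⟩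
  -- a lift is continued with a local inverse of `G`
  have hstep : ∀ t ∈ A ∩ Ico 0 1, ∀ y ∈ Ioi t, (A ∩ Ioc t y).Nonempty := by
    rintro t ⟨htA, ht⟩ y hy
    obtain ⟨w, hw, hGw, hwl⟩ := htA t ⟨ht.1, le_rfl⟩
    have hwb := hmemball ht.2.le hwl
    set c := chartAt (Cn n) (G w)
    have hc : c ∈ IsManifold.maximalAtlas 𝓘(ℝ, Cn n) ∞ M := IsManifold.chart_mem_maximalAtlas _
    have hwc : G w ∈ c.source := mem_chart_source _ _
    obtain ⟨s, hs, hsw, hsc, -⟩ := exists_local_inverse (hG w hw) (hinj w hw) hc hwc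
    set δ : ℝ → Cn n := fun u => s (c (γ u))
    have htI : t ∈ Icc (0 : ℝ) 1 := ⟨ht.1, ht.2.le⟩
    have hcγ : ContinuousWithinAt (fun u => c (γ u)) (Icc 0 1) t :=
      (ContinuousAt.comp_continuousWithinAt (g := c) (c.continuousAt (hGw ▸ hwc))
        (hγ.continuousOn t htI))
    have hcγt : c (γ t) = c (G w) := by rw [hGw]
    have hs1 : ∀ᶠ x in 𝓝 (c (G w)), ContDiffAt ℝ 1 s x :=
      (hs.of_le (by simp)).eventually (by simp)
    have hev : ∀ᶠ u in 𝓝[Icc 0 1] t, γ u ∈ c.source ∧ G (δ u) = γ u ∧ δ u ∈ Metric.ball z₀ ρ ∧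
        ContDiffAt ℝ 1 s (c (γ u)) := by
      have h1 : Tendsto (fun u => c (γ u)) (𝓝[Icc 0 1] t) (𝓝 (c (G w))) := hcγt ▸ hcγ
      have h2 : ∀ᶠ u in 𝓝[Icc 0 1] t, γ u ∈ c.source :=
        (hγ.continuousOn t htI).eventually_mem (c.open_source.mem_nhds (hGw ▸ hwc))
      have h3 : Tendsto δ (𝓝[Icc 0 1] t) (𝓝 w) := by
        have := hs.continuousAt.tendsto.comp h1
        rwa [hsw] at this
      filter_upwards [h2, h1.eventually hsc, h3.eventually (Metric.isOpen_ball.mem_nhds hwb),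
        h1.eventually hs1] with u hu1 hu2 hu3 hu4
      exact ⟨hu1, hu2.trans (c.left_inv hu1), hu3, hu4⟩
    obtain ⟨ε, hε, hεI⟩ := Metric.mem_nhdsWithin_iff.1 hev
    set b := min (min y 1) (t + ε / 2)
    have htb : t < b := lt_min (lt_min hy ht.2) (by linarith)
    have hb1 : b ≤ 1 := (min_le_left _ _).trans (min_le_right _ _)
    have hbε : b ≤ t + ε / 2 := min_le_right _ _
    have hprop : ∀ u ∈ Icc t b, γ u ∈ c.source ∧ G (δ u) = γ u ∧ δ u ∈ Metric.ball z₀ ρ ∧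
        ContDiffAt ℝ 1 s (c (γ u)) := by
      intro u hu
      refine hεI ⟨?_, ht.1.trans hu.1, hu.2.trans hb1⟩
      rw [Metric.mem_ball, Real.dist_eq, abs_of_nonneg (by linarith [hu.1])]
      linarith [hu.2]
    have hδt : δ t = w := by simp only [δ, hcγt, hsw]
    have hδ : ContDiffOn ℝ 1 δ (Icc t b) := by
      intro u hu
      obtain ⟨h1, -, -, h4⟩ := hprop u hu
      have h5 : ContMDiffWithinAt 𝓘(ℝ, ℝ) 𝓘(ℝ, Cn n) 1 (fun u => c (γ u)) (Icc t b) u :=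
        ContMDiffAt.comp_contMDiffWithinAt (g := c) u
          ((contMDiffAt_of_mem_maximalAtlas hc h1).of_le (by simp))
          ((hγ u ⟨ht.1.trans hu.1, hu.2.trans hb1⟩).mono
            (Icc_subset_Icc ht.1 hb1))
      exact h4.comp_contDiffWithinAt u h5.contDiffWithinAt
    refine ⟨b, fun v hv => ?_, htb, (min_le_left _ _).trans (min_le_left _ _)⟩
    rcases le_or_gt v t with hvt | hvt
    · exact htA v ⟨hv.1, hvt⟩
    obtain ⟨-, hGv, hvball, -⟩ := hprop v ⟨hvt.le, hv.2⟩
    refine ⟨δ v, Metric.ball_subset_closedBall hvball, hGv, ?_⟩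
    have hest : edist (δ v) (δ t) ≤ ENNReal.ofReal C * ∫⁻ u in Ioo t v, f u := by
      rw [edist_eq_enorm_sub]
      have hsubv : Icc t v ⊆ Icc t b := Icc_subset_Icc_right hv.2
      refine (enorm_sub_le_lintegral_derivWithin_Icc_of_contDiffOn_Icc (hδ.mono hsubv)
        hvt.le).trans ?_
      rw [← MeasureTheory.restrict_Ioo_eq_restrict_Icc, ← MeasureTheory.lintegral_const_mul'
        _ _ ENNReal.ofReal_ne_top]
      refine MeasureTheory.setLIntegral_mono' measurableSet_Ioo fun u hu => ?_
      have hmem := Icc_mem_nhds hu.1 hu.2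
      have hd : HasDerivAt δ (derivWithin δ (Icc t v) u) u :=
        (((hδ.mono hsubv).differentiableOn (by simp) u
          (Ioo_subset_Icc_self hu)).hasDerivWithinAt).hasDerivAt hmem
      obtain ⟨-, hGu, huball, -⟩ := hprop u (hsubv (Ioo_subset_Icc_self hu))
      have hucl := Metric.ball_subset_closedBall huball
      have h3 := mfderiv_comp_curve ((hG _ hucl).mdifferentiableAt (by simp)) hd
      have h6 : (fun u => G (δ u)) =ᶠ[𝓝 u] γ := by
        filter_upwards [hmem] with u' hu' using (hprop u' (hsubv hu')).2.1
      have h7 := congrArg (fun B : ℝ →L[ℝ] ℝ →L[ℝ] ℝ => B 1 1)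
        (pullBilin_congr (E' := ℝ) h6 g.inner)
      have h8 := hcmp _ hucl (derivWithin δ (Icc t v) u)
      rw [← h3] at h8
      rw [← ofReal_norm, ← ENNReal.ofReal_mul hC]
      refine ENNReal.ofReal_le_ofReal (h8.trans (le_of_eq ?_))
      exact congrArg (fun r => C * √r) h7
    have hsplit : l t + ∫⁻ u in Ioo t v, f u ≤ l v := by
      rw [hl]
      rw [← MeasureTheory.lintegral_union measurableSet_Ioo
        (Set.disjoint_left.2 fun u hu hu' => not_lt.2 hu.2 hu'.1)]
      refine MeasureTheory.lintegral_mono_set (union_subset (Icc_subset_Icc_right hvt.le) ?_)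
      exact fun u hu => ⟨ht.1.trans hu.1.le, hu.2.le⟩
    calc edist (δ v) z₀ ≤ edist (δ v) (δ t) + edist (δ t) z₀ := edist_triangle _ _ _
      _ ≤ ENNReal.ofReal C * (∫⁻ u in Ioo t v, f u) + ENNReal.ofReal C * l t :=
        add_le_add hest (by rw [hδt]; exact hwl)
      _ = ENNReal.ofReal C * (l t + ∫⁻ u in Ioo t v, f u) := by rw [← mul_add, add_comm (l t)]
      _ ≤ ENNReal.ofReal C * l v := mul_le_mul_right hsplit _
  have h1 : (1 : ℝ) ∈ A := hclosed.Icc_subset_of_forall_exists_gt (a := 0) (b := 1)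
    (fun s hs => by
      obtain rfl : s = 0 := le_antisymm hs.2 hs.1
      exact hP0) hstep ⟨zero_le_one, le_rfl⟩
  obtain ⟨w, -, hGw, hwl⟩ := h1 1 ⟨zero_le_one, le_rfl⟩
  exact ⟨w, hmemball le_rfl hwl, hGw⟩

end

/-! ### Uniform estimates from smooth convergence -/

section

variable {n : ℕ} {X : Type*} [TopologicalSpace X] [ChartedSpace (Cn n) X]

/-- Smooth convergence contains uniform convergence on compact sets. -/
theorem ConvSmooth.eventually_norm_sub_le {E V : Type*} [NormedAddCommGroup E] [NormedSpace ℝ E]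
    [NormedAddCommGroup V] [NormedSpace ℝ V] {s : Set E} {T : ℕ → E → V} {T' : E → V}
    (h : ConvSmooth s T T') {K : Set E} (hKs : K ⊆ s) (hK : IsCompact K) {ε : ℝ} (hε : 0 < ε) :
    ∀ᶠ k in atTop, ∀ y ∈ K, ‖T k y - T' y‖ ≤ ε := by
  filter_upwards [Metric.tendstoUniformlyOn_iff.1 (h 0 K hKs hK) ε hε] with k hk y hy
  have h1 := hk y hy
  simp only [iteratedFDeriv_zero_eq_comp, Function.comp, LinearIsometryEquiv.dist_map] at h1
  rw [dist_comm, dist_eq_norm] at h1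
  exact h1.le

variable [IsManifold 𝓘(ℝ, Cn n) ∞ X]

omit [IsManifold 𝓘(ℝ, Cn n) ∞ X] in
theorem pullForm_eq_formInChart {F : Type*} [NormedAddCommGroup F] [NormedSpace ℝ F] {k : ℕ}
    {ϖ : Cn n → X} {c : OpenPartialHomeomorph X (Cn n)}
    (hc : c ∈ IsManifold.maximalAtlas 𝓘(ℝ, Cn n) ∞ X) {z : Cn n}
    (hϖ : ContMDiffAt 𝓘(ℝ, Cn n) 𝓘(ℝ, Cn n) ∞ ϖ z) (hz : ϖ z ∈ c.source)
    (α : DForm (Cn n) X k F) :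
    pullForm (E' := Cn n) ϖ α z =
      (formInChart c α (c (ϖ z))).compContinuousLinearMap (fderiv ℝ (c ∘ ϖ) z) := by
  have h1 : c.symm ∘ (c ∘ ϖ) =ᶠ[𝓝 z] ϖ := by
    filter_upwards [hϖ.continuousAt.eventually_mem (c.open_source.mem_nhds hz)] with w hw
    exact c.left_inv hw
  refine (pullForm_congr h1 α).symm.trans ?_
  have h2 : ContMDiffAt 𝓘(ℝ, Cn n) 𝓘(ℝ, Cn n) ∞ (c ∘ ϖ) z :=
    (contMDiffAt_of_mem_maximalAtlas hc hz).comp z hϖ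
  refine (pullForm_comp (f := c.symm) (h := c ∘ ϖ)
    ((contMDiffAt_symm_of_mem_maximalAtlas hc (c.map_source hz)).mdifferentiableAt (by simp))
    (h2.mdifferentiableAt (by simp)) α).trans ?_
  exact pullForm_eq_fderiv (c ∘ ϖ) (formInChart c α) z

omit [IsManifold 𝓘(ℝ, Cn n) ∞ X] in
theorem pullBilin_eq_bilinInChart
    {ϖ : Cn n → X} {c : OpenPartialHomeomorph X (Cn n)}
    (hc : c ∈ IsManifold.maximalAtlas 𝓘(ℝ, Cn n) ∞ X) {z : Cn n}
    (hϖ : ContMDiffAt 𝓘(ℝ, Cn n) 𝓘(ℝ, Cn n) ∞ ϖ z) (hz : ϖ z ∈ c.source)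
    (b : BForm (Cn n) X) (v w : Cn n) :
    pullBilin (E' := Cn n) ϖ b z v w =
      bilinInChart c b (c (ϖ z)) (fderiv ℝ (c ∘ ϖ) z v) (fderiv ℝ (c ∘ ϖ) z w) := by
  have h1 : c.symm ∘ (c ∘ ϖ) =ᶠ[𝓝 z] ϖ := by
    filter_upwards [hϖ.continuousAt.eventually_mem (c.open_source.mem_nhds hz)] with w hw
    exact c.left_inv hw
  have h2 : ContMDiffAt 𝓘(ℝ, Cn n) 𝓘(ℝ, Cn n) ∞ (c ∘ ϖ) z :=
    (contMDiffAt_of_mem_maximalAtlas hc hz).comp z hϖ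
  have h3 := (pullBilin_congr h1 b).symm.trans (pullBilin_comp (f := c.symm) (h := c ∘ ϖ)
    ((contMDiffAt_symm_of_mem_maximalAtlas hc (c.map_source hz)).mdifferentiableAt (by simp))
    (h2.mdifferentiableAt (by simp)) b)
  refine (congrArg (fun B : Cn n →L[ℝ] Cn n →L[ℝ] ℝ => B v w) h3).trans ?_
  exact pullBilin_eq_fderiv (c ∘ ϖ) (bilinInChart c b) z v w

/-- A neighbourhood on which a map is controlled by a chart. -/
theorem exists_compact_nhds_chart {ϖ : Cn n → X} (hϖ : ContMDiff 𝓘(ℝ, Cn n) 𝓘(ℝ, Cn n) ∞ ϖ)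
    {U : Set X} (hU : IsOpen U) {z : Cn n} (hz : ϖ z ∈ U) :
    ∃ c ∈ atlas (Cn n) X, ∃ N ∈ 𝓝 z, ∃ C : ℝ, 0 < C ∧ IsCompact N ∧
      (∀ w ∈ N, ϖ w ∈ c.source ∧ ‖fderiv ℝ (c ∘ ϖ) w‖ ≤ C) ∧
      IsCompact ((c ∘ ϖ) '' N) ∧ (c ∘ ϖ) '' N ⊆ chartDomain c U := by
  set c := chartAt (Cn n) (ϖ z)
  have hc : c ∈ IsManifold.maximalAtlas 𝓘(ℝ, Cn n) ∞ X := IsManifold.chart_mem_maximalAtlas _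
  have hzc : ϖ z ∈ c.source := mem_chart_source _ _
  have hφ : ∀ w, ϖ w ∈ c.source → ContDiffAt ℝ ∞ (c ∘ ϖ) w := fun w hw =>
    ((contMDiffAt_of_mem_maximalAtlas hc hw).comp w (hϖ w)).contDiffAt
  have hcont : ContinuousAt (fderiv ℝ (c ∘ ϖ)) z :=
    ((hφ z hzc).fderiv_right (m := 0) (by simp)).continuousAt
  have h1 : ∀ᶠ w in 𝓝 z, ϖ w ∈ c.source ∧ ϖ w ∈ U ∧
      ‖fderiv ℝ (c ∘ ϖ) w‖ ≤ ‖fderiv ℝ (c ∘ ϖ) z‖ + 1 := by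
    filter_upwards [hϖ.continuous.continuousAt.eventually_mem (c.open_source.mem_nhds hzc),
      hϖ.continuous.continuousAt.eventually_mem (hU.mem_nhds hz),
      hcont.norm.eventually_le_const (lt_add_one _)] with w h1 h2 h3 using ⟨h1, h2, h3⟩
  obtain ⟨r, hr, hsub⟩ := Metric.nhds_basis_closedBall.mem_iff.1 h1
  refine ⟨c, chart_mem_atlas _ _, Metric.closedBall z r, Metric.closedBall_mem_nhds z hr,
    ‖fderiv ℝ (c ∘ ϖ) z‖ + 1, by positivity, isCompact_closedBall z r,
    fun w hw => ⟨(hsub hw).1, (hsub hw).2.2⟩, ?_, ?_⟩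
  · exact (isCompact_closedBall z r).image_of_continuousOn fun w hw =>
      (hφ w (hsub hw).1).continuousAt.continuousWithinAt
  · rintro _ ⟨w, hw, rfl⟩
    refine ⟨c.map_source (hsub hw).1, ?_⟩
    show c.symm (c (ϖ w)) ∈ U
    rw [c.left_inv (hsub hw).1]
    exact (hsub hw).2.1

/-- Convergence of forms in charts implies uniform convergence of the coefficients of the forms
pulled back to `ℂⁿ`: a compact set is covered by finitely many pieces that are mapped to single
charts. -/
theorem FormConvOn.eventually_pullForm {F : Type*} [NormedAddCommGroup F] [NormedSpace ℝ F] {k : ℕ}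
    {ϖ : Cn n → X} (hϖ : ContMDiff 𝓘(ℝ, Cn n) 𝓘(ℝ, Cn n) ∞ ϖ) {U : Set X} (hU : IsOpen U)
    {α : ℕ → DForm (Cn n) X k F} {α' : DForm (Cn n) X k F} (h : FormConvOn U α α')
    {K : Set (Cn n)} (hK : IsCompact K) (hKU : ∀ z ∈ K, ϖ z ∈ U) {ε : ℝ} (hε : 0 < ε)
    (v : Fin k → Cn n) :
    ∀ᶠ i in atTop, ∀ z ∈ K, ‖(pullForm (E' := Cn n) ϖ (α i) z : Cn n [⋀^Fin k]→L[ℝ] F) v -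
      (pullForm (E' := Cn n) ϖ α' z : Cn n [⋀^Fin k]→L[ℝ] F) v‖ ≤ ε := by
  refine hK.induction_on (p := fun K => ∀ᶠ i in atTop, ∀ z ∈ K,
    ‖(pullForm (E' := Cn n) ϖ (α i) z : Cn n [⋀^Fin k]→L[ℝ] F) v -
      (pullForm (E' := Cn n) ϖ α' z : Cn n [⋀^Fin k]→L[ℝ] F) v‖ ≤ ε) (by simp)
    (fun s t hst ht => ht.mono fun i hi z hz => hi z (hst hz))
    (fun s t hs ht => (hs.and ht).mono fun i hi z hz => hz.elim (hi.1 z) (hi.2 z)) fun z hz => ?_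
  obtain ⟨c, hc, N, hN, C, hC, -, hNc, hcpt, hsub⟩ := exists_compact_nhds_chart hϖ hU (hKU z hz)
  refine ⟨N, mem_nhdsWithin_of_mem_nhds hN, ?_⟩
  have hcm := IsManifold.subset_maximalAtlas (I := 𝓘(ℝ, Cn n)) (n := ∞) hc
  set D := ∏ i, (C * ‖v i‖)
  have hD : 0 ≤ D := Finset.prod_nonneg fun i _ => by positivity
  filter_upwards [(h c hc).eventually_norm_sub_le hsub hcpt (ε := ε / (D + 1)) (by positivity)]
    with i hi w hw
  rw [pullForm_eq_formInChart hcm (hϖ w) (hNc w hw).1, pullForm_eq_formInChart hcm (hϖ w)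
    (hNc w hw).1]
  set L := fderiv ℝ (c ∘ ϖ) w
  have h1 := hi (c (ϖ w)) ⟨w, hw, rfl⟩
  calc ‖formInChart c (α i) (c (ϖ w)) (fun j => L (v j)) -
        formInChart c α' (c (ϖ w)) (fun j => L (v j))‖
      = ‖(formInChart c (α i) (c (ϖ w)) - formInChart c α' (c (ϖ w))) fun j => L (v j)‖ := rfl
    _ ≤ ‖formInChart c (α i) (c (ϖ w)) - formInChart c α' (c (ϖ w))‖ * ∏ j, ‖L (v j)‖ :=
        ContinuousAlternatingMap.le_opNorm _ _
    _ ≤ (ε / (D + 1)) * D := by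
        refine mul_le_mul h1 (Finset.prod_le_prod (fun _ _ => norm_nonneg _) fun j _ => ?_)
          (Finset.prod_nonneg fun _ _ => norm_nonneg _) (by positivity)
        exact (L.le_opNorm _).trans (mul_le_mul_of_nonneg_right (hNc w hw).2 (norm_nonneg _))
    _ ≤ ε := by
        rw [div_mul_eq_mul_div, div_le_iff₀ (by positivity)]
        nlinarith

/-- The analogue of `FormConvOn.eventually_pullForm` for quadratic forms. -/
theorem BilinConvOn.eventually_pullBilin
    {ϖ : Cn n → X} (hϖ : ContMDiff 𝓘(ℝ, Cn n) 𝓘(ℝ, Cn n) ∞ ϖ) {U : Set X} (hU : IsOpen U)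
    {b : ℕ → BForm (Cn n) X} {b' : BForm (Cn n) X} (h : BilinConvOn U b b')
    {K : Set (Cn n)} (hK : IsCompact K) (hKU : ∀ z ∈ K, ϖ z ∈ U) {ε : ℝ} (hε : 0 < ε) :
    ∀ᶠ i in atTop, ∀ z ∈ K, ∀ v : Cn n, |pullBilin (E' := Cn n) ϖ (b i) z v v -
      pullBilin (E' := Cn n) ϖ b' z v v| ≤ ε * ‖v‖ ^ 2 := by
  refine hK.induction_on (p := fun K => ∀ᶠ i in atTop, ∀ z ∈ K, ∀ v : Cn n,
    |pullBilin (E' := Cn n) ϖ (b i) z v v - pullBilin (E' := Cn n) ϖ b' z v v| ≤ ε * ‖v‖ ^ 2)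
    (by simp) (fun s t hst ht => ht.mono fun i hi z hz => hi z (hst hz))
    (fun s t hs ht => (hs.and ht).mono fun i hi z hz => hz.elim (hi.1 z) (hi.2 z)) fun z hz => ?_
  obtain ⟨c, hc, N, hN, C, hC, -, hNc, hcpt, hsub⟩ := exists_compact_nhds_chart hϖ hU (hKU z hz)
  refine ⟨N, mem_nhdsWithin_of_mem_nhds hN, ?_⟩
  have hcm := IsManifold.subset_maximalAtlas (I := 𝓘(ℝ, Cn n)) (n := ∞) hc
  filter_upwards [(h c hc).eventually_norm_sub_le hsub hcpt (ε := ε / C ^ 2) (by positivity)]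
    with i hi w hw v
  rw [pullBilin_eq_bilinInChart hcm (hϖ w) (hNc w hw).1, pullBilin_eq_bilinInChart hcm (hϖ w)
    (hNc w hw).1]
  set L := fderiv ℝ (c ∘ ϖ) w
  have h1 := hi (c (ϖ w)) ⟨w, hw, rfl⟩
  have h2 : ‖L v‖ ≤ C * ‖v‖ :=
    (L.le_opNorm _).trans (mul_le_mul_of_nonneg_right (hNc w hw).2 (norm_nonneg _))
  calc |bilinInChart c (b i) (c (ϖ w)) (L v) (L v) - bilinInChart c b' (c (ϖ w)) (L v) (L v)|
      = ‖(bilinInChart c (b i) (c (ϖ w)) - bilinInChart c b' (c (ϖ w))) (L v) (L v)‖ := rfl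
    _ ≤ ‖bilinInChart c (b i) (c (ϖ w)) - bilinInChart c b' (c (ϖ w))‖ * ‖L v‖ * ‖L v‖ :=
        ContinuousLinearMap.le_opNorm₂ _ _ _
    _ ≤ (ε / C ^ 2) * (C * ‖v‖) * (C * ‖v‖) := by gcongr
    _ = ε * ‖v‖ ^ 2 := by field_simp

end

/-! ### The dimension of the soul -/

section

theorem apply_starProjection_of_preserves {E : Type*} [NormedAddCommGroup E]
    [InnerProductSpace ℝ E] {V : Submodule ℝ E} [V.HasOrthogonalProjection]
    (A : E ≃ₗᵢ[ℝ] E) (h1 : ∀ v, A v ∈ V ↔ v ∈ V) (y : E) :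
    A (V.starProjection y) = V.starProjection (A y) := by
  refine (V.eq_starProjection_of_mem_of_inner_eq_zero ((h1 _).2 (V.starProjection_apply_mem y))
    fun w hw => ?_).symm
  have h2 : w = A (A.symm w) := (A.apply_symm_apply w).symm
  rw [h2, ← map_sub, A.inner_map_map]
  refine V.starProjection_inner_eq_zero y _ ?_
  rw [← h1, ← h2]
  exact hw

variable {n : ℕ} {X : Type*} [TopologicalSpace X] [ChartedSpace (Cn n) X]
  [IsManifold 𝓘(ℝ, Cn n) ∞ X] [T2Space X] {ϖ : Cn n → X} {S : Set X} {V : Submodule ℝ (Cn n)}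

omit [TopologicalSpace X] [ChartedSpace (Cn n) X] [IsManifold 𝓘(ℝ, Cn n) ∞ X] [T2Space X] in
theorem deck_linear_mem_iff {γ : Cn n ≃ₜ Cn n} (hγ : γ ∈ deckGroup ϖ)
    (hV : (V : Set (Cn n)) = ϖ ⁻¹' S) {A : Cn n ≃ₗᵢ[ℝ] Cn n} (hA : ∀ z, γ z = A z + γ 0)
    (v : Cn n) : A v ∈ V ↔ v ∈ V := by
  have h0 : γ 0 ∈ V := (deck_mem_iff hγ hV 0).2 V.zero_mem
  rw [← deck_mem_iff hγ hV v, hA v]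
  exact (V.add_mem_iff_left h0).symm

/-- Tubes about the preimage of the soul project to bounded sets. -/
theorem exists_tube_subset_gBall [ConnectedSpace X] {g : Metric (Cn n) X} (h : IsomOn g ϖ univ)
    (hcov : IsCoveringMap ϖ) (hflat : IsFlatMetric g) (hS : IsCompact S)
    (hV : (V : Set (Cn n)) = ϖ ⁻¹' S) (z₀ : Cn n) (τ : ℝ) :
    ∃ r, 0 < r ∧ ∀ z, ‖Vᗮ.starProjection z‖ < τ → ϖ z ∈ gBall g (ϖ z₀) r := by
  obtain ⟨R, hR⟩ := exists_image_ball_of_isCompact hcov (surjective_of_isCoveringMap hcov) hS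
  refine ⟨max (R + τ + ‖z₀‖) 1, by positivity, fun z hz => ?_⟩
  have h1 : ϖ (V.starProjection z) ∈ S := by
    have : V.starProjection z ∈ (V : Set (Cn n)) := V.starProjection_apply_mem z
    rwa [hV] at this
  obtain ⟨b, hb, hbe⟩ := hR h1
  obtain ⟨T, hT, hTe⟩ := h.exists_affineIsometry_of_eq hflat hbe.symm
  refine (h.gDist_lt_iff hcov hflat).2 ⟨T z, ?_, hTe z⟩
  have h2 : dist (T z) b < τ := by
    rw [← hT, T.dist_map, dist_eq_norm]
    rwa [← eq_sub_of_add_eq' (V.starProjection_add_starProjection_orthogonal z)]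
  rw [Metric.mem_ball] at hb ⊢
  have h3 := dist_triangle4 (T z) b 0 z₀
  rw [dist_zero_left] at h3
  exact lt_max_of_lt_left (by linarith)

/-- If the classes of the volume forms on balls of comparable size do not vanish, the soul has at
least half the dimension of `X`: otherwise these balls could be contracted
to a space of smaller dimension. -/
theorem le_finrank_of_not_isExactOn [ConnectedSpace X]
    {M : ℕ → Type*} [∀ k, TopologicalSpace (M k)] [∀ k, ChartedSpace (Cn n) (M k)]
    [∀ k, IsManifold 𝓘(ℝ, Cn n) ∞ (M k)] [∀ k, T2Space (M k)]
    {Y : ∀ k, CalabiYau n (M k)} {p : ∀ k, M k} {lam : ℕ → ℝ} (hlam : ∀ k, 0 < lam k)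
    {σ : ℝ} (hΩ : ∀ k, ¬ IsExactOn (gBall (Y k).g (p k) (σ * lam k)) (Y k).vform)
    {X₀ : CalabiYau n X} {p₀ : X} (hflat : IsFlatMetric X₀.g)
    (hlim : IsRescaledLimit Y p lam X₀ p₀) (hS : IsCompact S)
    (h : IsFlatUniversalCover X₀ ϖ) (hV : (V : Set (Cn n)) = ϖ ⁻¹' S) :
    n ≤ Module.finrank ℝ V := by
  by_contra! hdim
  obtain ⟨m, rfl⟩ : ∃ m, n = m + 1 := ⟨n - 1, by omega⟩
  have hiso := h.isomOn
  obtain ⟨z₀, rfl⟩ := surjective_of_isCoveringMap h.covering p₀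
  -- The pulled back rescaled metric will be at least `1 / 4` of the Euclidean one, so that paths of
  -- length `σ * lam k` lift to paths of length at most `2 * |σ|`.
  set ρ : ℝ := 2 * |σ| + 1 with hρdef
  have hρ : 0 < ρ := by positivity
  -- `T` is the tube about `V` that contains the ball of radius `ρ` about `z₀`
  set τ := ‖Vᗮ.starProjection z₀‖ + ρ + 1
  set T : Set (Cn (m + 1)) := {z | ‖Vᗮ.starProjection z‖ < τ}
  have hT : IsOpen T := isOpen_lt (by fun_prop) continuous_const
  have hballT : Metric.closedBall z₀ ρ ⊆ T := by
    intro w hw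
    have h1 : ‖Vᗮ.starProjection (w - z₀)‖ ≤ ‖w - z₀‖ := Vᗮ.norm_starProjection_apply_le _
    have h2 : ‖Vᗮ.starProjection w‖ ≤ ‖Vᗮ.starProjection z₀‖ + ‖Vᗮ.starProjection (w - z₀)‖ := by
      rw [map_sub]
      simpa using norm_add_le (Vᗮ.starProjection z₀) (Vᗮ.starProjection w - Vᗮ.starProjection z₀)
    rw [Metric.mem_closedBall, dist_eq_norm] at hw
    show _ < ‖Vᗮ.starProjection z₀‖ + ρ + 1
    linarith
  obtain ⟨r, hr, hTr⟩ := exists_tube_subset_gBall hiso h.covering hflat hS hV z₀ τ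
  obtain ⟨F, hF, hg, -, -⟩ := hlim r hr
  have hopen : IsOpen (gBall X₀.g (ϖ z₀) r) := isOpen_gBall _ _ _
  have hgev := hg.eventually_pullBilin h.smooth hopen (isCompact_closedBall z₀ ρ)
    (fun z hz => hTr z (hballT hz)) (ε := 3 / 4) (by norm_num)
  obtain ⟨k, ⟨hF0, hFs, hFinj, hFd⟩, hgk⟩ := (hF.and hgev).exists
  refine hΩ k ?_
  have hFat : ∀ z ∈ T, ContMDiffAt 𝓘(ℝ, Cn (m + 1)) 𝓘(ℝ, Cn (m + 1)) ∞ (F k) (ϖ z) := fun z hz =>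
    hFs.contMDiffAt (hopen.mem_nhds (hTr z hz))
  have hGs : ∀ z ∈ T, ContMDiffAt 𝓘(ℝ, Cn (m + 1)) 𝓘(ℝ, Cn (m + 1)) ∞ (F k ∘ ϖ) z := fun z hz =>
    (hFat z hz).comp z (h.smooth z)
  have hGd : ∀ z ∈ T, mfderiv 𝓘(ℝ, Cn (m + 1)) 𝓘(ℝ, Cn (m + 1)) (F k ∘ ϖ) z =
      (mfderiv 𝓘(ℝ, Cn (m + 1)) 𝓘(ℝ, Cn (m + 1)) (F k) (ϖ z)).comp
        (mfderiv 𝓘(ℝ, Cn (m + 1)) 𝓘(ℝ, Cn (m + 1)) ϖ z) := fun z hz =>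
    mfderiv_comp z ((hFat z hz).mdifferentiableAt (by simp)) (hiso.mdifferentiableAt (mem_univ z))
  have hGinj : ∀ z ∈ T,
      Function.Injective (mfderiv 𝓘(ℝ, Cn (m + 1)) 𝓘(ℝ, Cn (m + 1)) (F k ∘ ϖ) z) := by
    intro z hz
    rw [hGd z hz]
    exact (hFd _ (hTr z hz)).comp (hiso.mfderiv_injective (mem_univ z))
  have hQP : ∀ z, Vᗮ.starProjection (V.starProjection z) = 0 := fun z =>
    (Vᗮ.starProjection_apply_eq_zero_iff).2
      (V.le_orthogonal_orthogonal (V.starProjection_apply_mem z))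
  refine isExactOn_vform_of_finrank_le (G := F k ∘ ϖ) hT hGs hGinj (Y k) (V := V) (by omega)
    ?_ ?_ ?_
  · -- the tube is star-shaped about `V`
    intro z (hz : _ < τ) t ht
    show ‖_‖ < τ
    rw [map_add, hQP, zero_add, map_smul,
      Vᗮ.starProjection_eq_self_iff.2 (Vᗮ.starProjection_apply_mem z), norm_smul, Real.norm_eq_abs,
      abs_of_nonneg ht.1]
    exact (mul_le_of_le_one_left (norm_nonneg _) ht.2).trans_lt hz
  · intro z hz w hw hzw
    have h1 : ϖ z = ϖ w := hFinj (hTr z hz) (hTr w hw) hzw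
    obtain ⟨γ, hγ, hγz⟩ := hiso.exists_deck_of_eq hflat h1
    obtain ⟨A, hA⟩ := hiso.exists_linear_of_deck hflat hγ
    have hb : γ 0 ∈ V := (deck_mem_iff hγ hV 0).2 V.zero_mem
    have hAP := apply_starProjection_of_preserves A (deck_linear_mem_iff hγ hV hA)
    refine ⟨A.toContinuousLinearEquiv, γ 0, (hA z).symm.trans hγz, hb, hAP, fun y hy => ⟨?_, ?_⟩⟩
    · show ‖Vᗮ.starProjection (A y + γ 0)‖ < τ
      have h2 : ∀ y, Vᗮ.starProjection y = y - V.starProjection y := fun y =>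
        eq_sub_of_add_eq' (V.starProjection_add_starProjection_orthogonal y)
      have h3 : Vᗮ.starProjection (A y + γ 0) = A (Vᗮ.starProjection y) := by
        rw [h2, h2, map_add, V.starProjection_eq_self_iff.2 hb, map_sub, hAP]
        abel
      rw [h3, A.norm_map]
      exact hy
    · show F k (ϖ (A y + γ 0)) = F k (ϖ y)
      rw [← hA y, hγ y]
  · -- the ball is covered by `F k ∘ ϖ`, which does not contract too much near `z₀`
    intro x hx
    obtain ⟨γ, hγ0, hγ1, hγ, hlen⟩ := exists_path_of_gDist_lt (Y k).g hx
    have hl := hlam k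
    have hcmp : ∀ w ∈ Metric.closedBall z₀ ρ, ∀ v : Cn (m + 1),
        ‖v‖ ≤ 2 / lam k * √((Y k).g.inner ((F k ∘ ϖ) w)
          (mfderiv 𝓘(ℝ, Cn (m + 1)) 𝓘(ℝ, Cn (m + 1)) (F k ∘ ϖ) w v)
          (mfderiv 𝓘(ℝ, Cn (m + 1)) 𝓘(ℝ, Cn (m + 1)) (F k ∘ ϖ) w v)) := by
      intro w hw v
      have h1 := hgk w hw v
      have h2 : pullBilin (E' := Cn (m + 1)) ϖ X₀.g.inner w v v = ‖v‖ ^ 2 :=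
        (h.metric w v v).trans (stdMetric_self v)
      have h3 : pullBilin (E' := Cn (m + 1)) ϖ (pullBilin (E' := Cn (m + 1)) (F k)
          (fun x => ((lam k) ^ 2)⁻¹ • (Y k).g.inner x)) w v v = ((lam k) ^ 2)⁻¹ *
          (Y k).g.inner ((F k ∘ ϖ) w)
            (mfderiv 𝓘(ℝ, Cn (m + 1)) 𝓘(ℝ, Cn (m + 1)) (F k ∘ ϖ) w v)
            (mfderiv 𝓘(ℝ, Cn (m + 1)) 𝓘(ℝ, Cn (m + 1)) (F k ∘ ϖ) w v) :=
        congrArg (fun B : Cn (m + 1) →L[ℝ] Cn (m + 1) →L[ℝ] ℝ => B v v) (pullBilin_comp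
          ((hFat w (hballT hw)).mdifferentiableAt (by simp)) (hiso.mdifferentiableAt (mem_univ w))
          (fun x => ((lam k) ^ 2)⁻¹ • (Y k).g.inner x)).symm
      rw [h2, h3] at h1
      set q : ℝ := (Y k).g.inner ((F k ∘ ϖ) w)
            (mfderiv 𝓘(ℝ, Cn (m + 1)) 𝓘(ℝ, Cn (m + 1)) (F k ∘ ϖ) w v)
            (mfderiv 𝓘(ℝ, Cn (m + 1)) 𝓘(ℝ, Cn (m + 1)) (F k ∘ ϖ) w v)
      have h4 : ‖v‖ ^ 2 ≤ (2 / lam k) ^ 2 * q := by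
        have := (abs_le.1 h1).1
        have h5 : (2 / lam k) ^ 2 * q = 4 * (((lam k) ^ 2)⁻¹ * q) := by field_simp; ring
        rw [h5]
        linarith
      have h6 := Real.sqrt_le_sqrt h4
      rwa [Real.sqrt_sq (norm_nonneg _), Real.sqrt_mul (by positivity),
        Real.sqrt_sq (by positivity)] at h6
    have hlen' : ENNReal.ofReal (2 / lam k) * gLength (Y k).g γ < ENNReal.ofReal ρ := by
      calc ENNReal.ofReal (2 / lam k) * gLength (Y k).g γ
          ≤ ENNReal.ofReal (2 / lam k) * ENNReal.ofReal (σ * lam k) := mul_le_mul_right hlen.le _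
        _ = ENNReal.ofReal (2 / lam k * (σ * lam k)) := (ENNReal.ofReal_mul (by positivity)).symm
        _ = ENNReal.ofReal (2 * σ) := by congr 1; field_simp
        _ < ENNReal.ofReal ρ := by
          refine (ENNReal.ofReal_lt_ofReal_iff hρ).2 ?_
          have := le_abs_self σ
          rw [hρdef]
          linarith
    obtain ⟨w, hw, hwx⟩ := exists_preimage_of_gLength_lt (Y k).g (G := F k ∘ ϖ) (z₀ := z₀)
      hρ (by positivity) (fun w hw => hGs w (hballT hw)) hcmp hγ (by rw [hγ0]; exact hF0.symm) hlen'
    exact ⟨w, hballT (Metric.ball_subset_closedBall hw), hwx.trans hγ1⟩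

end

/-! ### Continuity of the Kähler form -/

section

variable {n : ℕ} {M : Type*} [TopologicalSpace M] [ChartedSpace (Cn n) M]
  [IsManifold 𝓘(ℝ, Cn n) ∞ M]

theorem continuousOn_bilinInChart (g : Metric (Cn n) M) {c : OpenPartialHomeomorph M (Cn n)}
    (hc : c ∈ IsManifold.maximalAtlas 𝓘(ℝ, Cn n) ∞ M) :
    ContinuousOn (fun p : Cn n × Cn n × Cn n => bilinInChart c g.inner p.1 p.2.1 p.2.2)
      (Prod.fst ⁻¹' c.target) := by
  let : Bundle.RiemannianBundle (fun x : M => TangentSpace 𝓘(ℝ, Cn n) x) := ⟨g.toRiemannianMetric⟩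
  have : IsContinuousRiemannianBundle (Cn n) (fun x : M => TangentSpace 𝓘(ℝ, Cn n) x) :=
    ⟨⟨g.inner, g.contMDiff.continuous, fun _ _ _ => rfl⟩⟩
  have : IsManifold 𝓘(ℝ, Cn n) 1 M := IsManifold.of_le (n := ∞) (by simp)
  have hs : ContMDiffOn 𝓘(ℝ, Cn n) 𝓘(ℝ, Cn n) ∞ c.symm c.target := fun y hy =>
    (contMDiffAt_symm_of_mem_maximalAtlas hc hy).contMDiffWithinAt
  have ht := hs.continuousOn_tangentMapWithin (by simp) c.open_target.uniqueMDiffOn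
  have key : ∀ q : Cn n × Cn n × Cn n → Cn n, Continuous q →
      ContinuousOn (fun p : Cn n × Cn n × Cn n =>
        (⟨c.symm p.1, mfderiv 𝓘(ℝ, Cn n) 𝓘(ℝ, Cn n) c.symm p.1 (q p)⟩ :
          TotalSpace (Cn n) (TangentSpace 𝓘(ℝ, Cn n) : M → Type))) (Prod.fst ⁻¹' c.target) := by
    intro q hq
    have h1 : Continuous fun p : Cn n × Cn n × Cn n =>
        (⟨p.1, q p⟩ : TangentBundle 𝓘(ℝ, Cn n) (Cn n)) :=
      (tangentBundleModelSpaceHomeomorph 𝓘(ℝ, Cn n)).symm.continuous.comp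
        (continuous_fst.prodMk hq)
    refine (ht.comp h1.continuousOn fun p hp => hp).congr fun p hp => ?_
    simp only [Function.comp, tangentMapWithin]
    rw [mfderivWithin_of_isOpen c.open_target hp]
  exact (key _ (continuous_fst.comp continuous_snd)).inner_bundle
    (key _ (continuous_snd.comp continuous_snd))

omit [IsManifold 𝓘(ℝ, Cn n) ∞ M] in
theorem bilinInChart_diffAt {c : OpenPartialHomeomorph M (Cn n)}
    (hc : c ∈ IsManifold.maximalAtlas 𝓘(ℝ, Cn n) ∞ M) {x : M} (hx : x ∈ c.source)
    (b : BForm (Cn n) M) (v w : Cn n) :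
    bilinInChart c b (c x) (diffAt c x v) (diffAt c x w) = b x v w := by
  have hsym : ∀ u : Cn n, (mfderiv 𝓘(ℝ, Cn n) 𝓘(ℝ, Cn n) c.symm (c x) (diffAt c x u) :
      Cn n) = u := by
    intro u
    have h2 : MDifferentiableAt 𝓘(ℝ, Cn n) 𝓘(ℝ, Cn n) c.symm (c x) :=
      (contMDiffAt_symm_of_mem_maximalAtlas hc (c.map_source hx)).mdifferentiableAt (by simp)
    have h3 := mfderiv_comp x h2
      ((contMDiffAt_of_mem_maximalAtlas hc hx).mdifferentiableAt (by simp))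
    have h4 : (c.symm ∘ c) =ᶠ[𝓝 x] id := by
      filter_upwards [c.open_source.mem_nhds hx] with z hz
      exact c.left_inv hz
    have h5 := h4.mfderiv_eq (I := 𝓘(ℝ, Cn n)) (I' := 𝓘(ℝ, Cn n))
    refine (congrArg (fun T : Cn n →L[ℝ] Cn n => T u) (h3.symm.trans h5)).trans ?_
    rw [mfderiv_id]
    rfl
  have key : ∀ (p : M) (B : M → Cn n →L[ℝ] Cn n →L[ℝ] ℝ) (a' b' : Cn n), p = x → a' = v →
      b' = w → B p a' b' = B x v w := by
    rintro _ _ _ _ rfl rfl rfl; rfl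
  exact key _ b _ _ (c.left_inv hx) (hsym v) (hsym w)

/-- In a holomorphic chart, the Kähler form is given by the metric and multiplication by `i`. -/
theorem pullForm_kform_apply (Y : CalabiYau n M) {c : OpenPartialHomeomorph M (Cn n)}
    (hc : c ∈ IsManifold.maximalAtlas 𝓘(ℝ, Cn n) ∞ M) {G : Cn n → M} {y : Cn n}
    (hyc : G y ∈ c.source)
    (hcJ : ∀ x ∈ c.source, ∀ v, diffAt c x (Y.J x v) = Complex.I • diffAt c x v)
    (hy : MDifferentiableAt 𝓘(ℝ, Cn n) 𝓘(ℝ, Cn n) G y) (v w : Cn n) :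
    (pullForm (E' := Cn n) G Y.kform y : Cn n [⋀^Fin 2]→L[ℝ] ℝ) ![v, w] =
      bilinInChart c Y.g.inner (c (G y)) (Complex.I • fderiv ℝ (c ∘ G) y v)
        (fderiv ℝ (c ∘ G) y w) := by
  have h1 := bilinInChart_diffAt hc hyc Y.g.inner
    (Y.J (G y) (mfderiv 𝓘(ℝ, Cn n) 𝓘(ℝ, Cn n) G y v)) (mfderiv 𝓘(ℝ, Cn n) 𝓘(ℝ, Cn n) G y w)
  rw [hcJ _ hyc, ← Y.kform_apply] at h1
  rw [fderiv_comp_chart hc hy hyc, fderiv_comp_chart hc hy hyc]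
  refine Eq.trans (congrArg (Y.kform (G y)) ?_) h1.symm
  ext i; fin_cases i <;> rfl

theorem continuousAt_comp_derivatives {f : Cn n × Cn n × Cn n → ℝ} {s : Set (Cn n)}
    (hf : ContinuousOn f (Prod.fst ⁻¹' s)) (hs : IsOpen s) {φ : Cn n → Cn n}
    {D : Cn n → Cn n →L[ℝ] Cn n} {z : Cn n} (hφ : ContinuousAt φ z) (hD : ContinuousAt D z)
    (hz : φ z ∈ s) (v w : Cn n) :
    ContinuousAt (fun y => f (φ y, Complex.I • D y v, D y w)) z := by
  have h3 : ∀ u, ContinuousAt (fun y => D y u) z := fun u => hD.clm_apply continuousAt_const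
  have h4 : ContinuousAt (fun y => Complex.I • D y v) z :=
    (mulI n).continuous.continuousAt.comp (h3 v)
  have h5 : ContinuousAt (fun y => (φ y, Complex.I • D y v, D y w)) z :=
    hφ.prodMk (h4.prodMk (h3 w))
  exact ContinuousAt.comp (g := f)
    (hf.continuousAt ((hs.preimage continuous_fst).mem_nhds hz)) h5

/-- The pulled back Kähler form is continuous. Continuity is not part of the structure, but the
Kähler form is given by the metric and the complex structure, that is, by the metric and the
derivative of a holomorphic chart. -/
theorem continuousAt_pullForm_kform (Y : CalabiYau n M) {G : Cn n → M} {z : Cn n}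
    (hG : ContMDiffAt 𝓘(ℝ, Cn n) 𝓘(ℝ, Cn n) ∞ G z) (v w : Cn n) :
    ContinuousAt (fun y => (pullForm (E' := Cn n) G Y.kform y : Cn n [⋀^Fin 2]→L[ℝ] ℝ) ![v, w])
      z := by
  obtain ⟨c, hc, hzc, hcJ, -⟩ := Y.holomorphic (G z)
  have hφ : ContDiffAt ℝ ∞ (c ∘ G) z :=
    ((contMDiffAt_of_mem_maximalAtlas hc hzc).comp z hG).contDiffAt
  have hdφ : ContinuousAt (fderiv ℝ (c ∘ G)) z :=
    (hφ.fderiv_right (m := 0) (by simp)).continuousAt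
  have hG' : ∀ᶠ y in 𝓝 z, ContMDiffAt 𝓘(ℝ, Cn n) 𝓘(ℝ, Cn n) 1 G y := by
    have : IsManifold 𝓘(ℝ, Cn n) 1 M := IsManifold.of_le (n := ∞) (by simp)
    exact (contMDiffAt_iff_contMDiffAt_nhds (by simp)).1 (hG.of_le (by simp))
  have h1 : (fun y => (pullForm (E' := Cn n) G Y.kform y : Cn n [⋀^Fin 2]→L[ℝ] ℝ) ![v, w])
      =ᶠ[𝓝 z] fun y => bilinInChart c Y.g.inner (c (G y))
        (Complex.I • fderiv ℝ (c ∘ G) y v) (fderiv ℝ (c ∘ G) y w) := by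
    filter_upwards [hG', hG.continuousAt.eventually_mem (c.open_source.mem_nhds hzc)] with y hy hyc
    exact pullForm_kform_apply Y hc hyc hcJ (hy.mdifferentiableAt (by simp)) v w
  have h2 := continuousAt_comp_derivatives (continuousOn_bilinInChart Y.g hc) c.open_target
    hφ.continuousAt hdφ (c.map_source hzc) v w
  exact h2.congr h1.symm

end

/-! ### Periods of the Kähler forms -/

section

theorem isCompact_stdTriangle : IsCompact stdTriangle := by
  have h1 : IsClosed stdTriangle :=
    (isClosed_le continuous_const continuous_fst).inter
      ((isClosed_le continuous_const continuous_snd).inter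
        (isClosed_le (continuous_fst.add continuous_snd) continuous_const))
  refine (isCompact_Icc (a := ((0 : ℝ), (0 : ℝ))) (b := (1, 1))).of_isClosed_subset h1 ?_
  rintro ⟨x, y⟩ ⟨hx, hy, hxy⟩
  simp only at hx hy hxy
  exact ⟨⟨hx, hy⟩, ⟨by simp only; linarith, by simp only; linarith⟩⟩

theorem volume_real_stdTriangle_pos : 0 < MeasureTheory.volume.real stdTriangle := by
  have h1 : ((Ioo (0 : ℝ) (1 / 2)) ×ˢ (Ioo (0 : ℝ) (1 / 2))) ⊆ stdTriangle := by
    rintro ⟨x, y⟩ ⟨hx, hy⟩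
    exact ⟨hx.1.le, hy.1.le, by linarith [hx.2, hy.2]⟩
  have hfin : MeasureTheory.volume stdTriangle ≠ ⊤ := isCompact_stdTriangle.measure_lt_top.ne
  refine ENNReal.toReal_pos (fun h0 => ?_) hfin
  have h2 := MeasureTheory.measure_mono_null h1 h0
  have h3 : IsOpen ((Ioo (0 : ℝ) (1 / 2)) ×ˢ (Ioo (0 : ℝ) (1 / 2))) := isOpen_Ioo.prod isOpen_Ioo
  exact (h3.measure_pos MeasureTheory.volume ⟨(1 / 4, 1 / 4), by norm_num [mem_prod]⟩).ne' h2

variable {n : ℕ} {M : Type*} [TopologicalSpace M] [ChartedSpace (Cn n) M]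

omit [TopologicalSpace M] [ChartedSpace (Cn n) M] in
/-- The two triangles into which the diagonal cuts the parallelogram spanned by `a` and `b` form a
cycle when mapped to a space in which opposite edges agree. -/
theorem chainBoundary_parallelogram {G : Cn n → M} {a b : Cn n}
    (ha : ∀ t : ℝ, G (t • b + a) = G (t • b)) (hb : ∀ t : ℝ, G (t • a + b) = G (t • a)) :
    chainBoundary (Finsupp.single (fun p : ℝ × ℝ => G (p.1 • a + p.2 • (a + b))) 1 -
      Finsupp.single (fun p : ℝ × ℝ => G (p.1 • b + p.2 • (a + b))) 1) = 0 := by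
  unfold chainBoundary
  rw [Finsupp.sum_sub_index (by
    intro σ m₁ m₂
    simp only [Finsupp.single_sub]
    abel), Finsupp.sum_single_index (by simp), Finsupp.sum_single_index (by simp)]
  have e1 : (fun t : Icc (0 : ℝ) 1 => G ((1 - (t : ℝ)) • a + (t : ℝ) • (a + b))) =
      fun t : Icc (0 : ℝ) 1 => G ((0 : ℝ) • (a + b) + (t : ℝ) • b) := by
    ext t
    rw [zero_smul, zero_add, ← ha]
    congr 1
    module
  have e2 : (fun t : Icc (0 : ℝ) 1 => G ((1 - (t : ℝ)) • b + (t : ℝ) • (a + b))) =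
      fun t : Icc (0 : ℝ) 1 => G ((0 : ℝ) • (a + b) + (t : ℝ) • a) := by
    ext t
    rw [zero_smul, zero_add, ← hb]
    congr 1
    module
  simp only [e1, e2]
  simp only [zero_smul, zero_add, add_zero]
  abel

/-- The integral of a 2-form over the image of an affine triangle. -/
theorem simplexIntegral_comp {G : Cn n → M} {a b : Cn n} (α : DForm (Cn n) M 2 ℝ)
    (hG : ∀ p : ℝ × ℝ, MDifferentiableAt 𝓘(ℝ, Cn n) 𝓘(ℝ, Cn n) G (p.1 • a + p.2 • b)) :
    simplexIntegral α (fun p : ℝ × ℝ => G (p.1 • a + p.2 • b)) =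
      ∫ p in stdTriangle, (pullForm (E' := Cn n) G α (p.1 • a + p.2 • b) :
        Cn n [⋀^Fin 2]→L[ℝ] ℝ) ![a, b] := by
  unfold simplexIntegral
  congr 1
  ext p
  let L : ℝ × ℝ →L[ℝ] Cn n :=
    (ContinuousLinearMap.fst ℝ ℝ ℝ).smulRight a + (ContinuousLinearMap.snd ℝ ℝ ℝ).smulRight b
  have hL : HasFDerivAt (fun p : ℝ × ℝ => p.1 • a + p.2 • b) L p := L.hasFDerivAt
  have h1 := mfderiv_comp p (hG p) hL.differentiableAt.mdifferentiableAt
  rw [mfderiv_eq_fderiv, hL.fderiv] at h1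
  have h2 : ∀ q : ℝ × ℝ, (mfderiv 𝓘(ℝ, ℝ × ℝ) 𝓘(ℝ, Cn n)
      (fun p : ℝ × ℝ => G (p.1 • a + p.2 • b)) p q : Cn n) =
      mfderiv 𝓘(ℝ, Cn n) 𝓘(ℝ, Cn n) G (p.1 • a + p.2 • b) (L q) := fun q =>
    congrArg (fun T : ℝ × ℝ →L[ℝ] Cn n => T q) h1
  have e1 : L (1, 0) = a := by simp [L]
  have e2 : L (0, 1) = b := by simp [L]
  refine congrArg (α (G (p.1 • a + p.2 • b))) ?_
  ext i
  fin_cases i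
  · refine (h2 (1, 0)).trans ?_
    rw [e1]
    rfl
  · refine (h2 (0, 1)).trans ?_
    rw [e2]
    rfl

theorem norm_setIntegral_stdTriangle_sub_le {f : ℝ × ℝ → ℝ} (hf : ContinuousOn f stdTriangle)
    {c ε : ℝ} (h : ∀ p ∈ stdTriangle, ‖f p - c‖ ≤ ε) :
    ‖(∫ p in stdTriangle, f p) - MeasureTheory.volume.real stdTriangle * c‖ ≤
      ε * MeasureTheory.volume.real stdTriangle := by
  have hfin := isCompact_stdTriangle.measure_lt_top (μ := MeasureTheory.volume)
  have h1 : ∫ _ in stdTriangle, c = MeasureTheory.volume.real stdTriangle * c := by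
    rw [MeasureTheory.setIntegral_const, smul_eq_mul]
  rw [← h1, ← MeasureTheory.integral_sub (hf.integrableOn_compact isCompact_stdTriangle)
    (MeasureTheory.integrableOn_const hfin.ne)]
  exact MeasureTheory.norm_setIntegral_le_of_norm_le_const hfin h

variable {X : Type*} [TopologicalSpace X] [ChartedSpace (Cn n) X]
  [IsManifold 𝓘(ℝ, Cn n) ∞ X] [T2Space X] {ϖ : Cn n → X} {S : Set X} {V : Submodule ℝ (Cn n)}

theorem stdKahler_self (a : Cn n) : stdKahler a a = 0 := by
  unfold stdKahler
  rw [inner_self_eq_norm_sq_to_K]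
  norm_cast

theorem stdKahler_symm (a b : Cn n) : stdKahler a b = -stdKahler b a := by
  unfold stdKahler
  rw [← inner_conj_symm a b, Complex.conj_im]

theorem stdKahler_add_right (a b c : Cn n) : stdKahler a (b + c) = stdKahler a b + stdKahler a c := by
  simp [stdKahler]

/-- The periods of the integral Kähler forms over the torus spanned by two translations `a`, `b` of
the soul are integers, but after rescaling they converge to a multiple of `ω_E(a, b)`. -/
theorem stdKahler_eq_zero_of_translations [ConnectedSpace X]
    {M : ℕ → Type*} [∀ k, TopologicalSpace (M k)] [∀ k, ChartedSpace (Cn n) (M k)]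
    [∀ k, IsManifold 𝓘(ℝ, Cn n) ∞ (M k)]
    {Y : ∀ k, CalabiYau n (M k)} (hint : ∀ k, IsIntegralClass (Y k).kform)
    {p : ∀ k, M k} {lam : ℕ → ℝ} (hlam : ∀ k, 0 < lam k) (hlam0 : Tendsto lam atTop (𝓝 0))
    {X₀ : CalabiYau n X} {p₀ : X} (hflat : IsFlatMetric X₀.g)
    (hlim : IsRescaledLimit Y p lam X₀ p₀) (hS : IsCompact S)
    (h : IsFlatUniversalCover X₀ ϖ) (hV : (V : Set (Cn n)) = ϖ ⁻¹' S) {a b : Cn n}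
    (haV : a ∈ V) (hbV : b ∈ V) (ha : ∀ v ∈ V, ϖ (v + a) = ϖ v) (hb : ∀ v ∈ V, ϖ (v + b) = ϖ v) :
    stdKahler a b = 0 := by
  by_contra hs
  set s := stdKahler a b
  have hiso := h.isomOn
  obtain ⟨z₀, rfl⟩ := surjective_of_isCoveringMap h.covering p₀
  obtain ⟨r, hr, htube⟩ := exists_tube_subset_gBall hiso h.covering hflat hS hV z₀ 1
  have hVr : ∀ z ∈ V, ϖ z ∈ gBall X₀.g (ϖ z₀) r := fun z hz => htube z (by
    rw [(Vᗮ.starProjection_apply_eq_zero_iff).2 (V.le_orthogonal_orthogonal hz), norm_zero]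
    exact one_pos)
  obtain ⟨F, hF, -, hω, -⟩ := hlim r hr
  have hopen : IsOpen (gBall X₀.g (ϖ z₀) r) := isOpen_gBall _ _ _
  set A := MeasureTheory.volume.real stdTriangle with hA
  have hApos : 0 < A := volume_real_stdTriangle_pos
  have hspos : 0 < |s| := abs_pos.2 hs
  have hmemV : ∀ c ∈ V, ∀ p : ℝ × ℝ, p.1 • c + p.2 • (a + b) ∈ V := fun c hc p =>
    V.add_mem (V.smul_mem _ hc) (V.smul_mem _ (V.add_mem haV hbV))
  have hconv : ∀ c ∈ V, ∀ᶠ k in atTop, ∀ p ∈ stdTriangle,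
      ‖(pullForm (E' := Cn n) ϖ (pullForm (E' := Cn n) (F k)
        (fun x => ((lam k) ^ 2)⁻¹ • (Y k).kform x)) (p.1 • c + p.2 • (a + b)) :
          Cn n [⋀^Fin 2]→L[ℝ] ℝ) ![c, a + b] - stdKahler c (a + b)‖ ≤ |s| / 2 := by
    intro c hc
    have hcont : Continuous fun p : ℝ × ℝ => p.1 • c + p.2 • (a + b) := by fun_prop
    have h1 := hω.eventually_pullForm h.smooth hopen (isCompact_stdTriangle.image hcont)
      (by rintro _ ⟨p, -, rfl⟩; exact hVr _ (hmemV c hc p)) (half_pos hspos) ![c, a + b]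
    filter_upwards [h1] with k hk p hp
    exact le_of_eq_of_le (congrArg (fun t => ‖_ - t‖)
      (h.kahler (p.1 • c + p.2 • (a + b)) c (a + b)).symm) (hk _ ⟨p, hp, rfl⟩)
  have hlam1 : ∀ᶠ k in atTop, 3 * A * |s| * (lam k) ^ 2 < 1 := by
    have h1 : Tendsto (fun k => 3 * A * |s| * (lam k) ^ 2) atTop (𝓝 (3 * A * |s| * 0 ^ 2)) :=
      (hlam0.pow 2).const_mul _
    exact h1.eventually (gt_mem_nhds (by simp))
  obtain ⟨k, ⟨-, hFs, -, -⟩, hk1, hk2, hk3⟩ :=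
    (hF.and ((hconv a haV).and ((hconv b hbV).and hlam1))).exists
  set G := F k ∘ ϖ
  have hFat : ∀ z ∈ V, ContMDiffAt 𝓘(ℝ, Cn n) 𝓘(ℝ, Cn n) ∞ (F k) (ϖ z) := fun z hz =>
    hFs.contMDiffAt (hopen.mem_nhds (hVr z hz))
  have hG : ∀ z ∈ V, ContMDiffAt 𝓘(ℝ, Cn n) 𝓘(ℝ, Cn n) ∞ G z := fun z hz =>
    (hFat z hz).comp z (h.smooth z)
  have hl := hlam k
  -- the integrals over the two triangles
  have hI : ∀ c ∈ V, (∀ p ∈ stdTriangle,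
      ‖(pullForm (E' := Cn n) ϖ (pullForm (E' := Cn n) (F k)
        (fun x => ((lam k) ^ 2)⁻¹ • (Y k).kform x)) (p.1 • c + p.2 • (a + b)) :
          Cn n [⋀^Fin 2]→L[ℝ] ℝ) ![c, a + b] - stdKahler c (a + b)‖ ≤ |s| / 2) →
      |((lam k) ^ 2)⁻¹ * simplexIntegral (Y k).kform
        (fun p : ℝ × ℝ => G (p.1 • c + p.2 • (a + b))) - A * stdKahler c (a + b)| ≤
          |s| / 2 * A := by
    intro c hc hest
    rw [simplexIntegral_comp _ fun p => (hG _ (hmemV c hc p)).mdifferentiableAt (by simp),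
      ← MeasureTheory.integral_const_mul]
    refine norm_setIntegral_stdTriangle_sub_le ?_ fun p hp => ?_
    · refine continuousOn_const.mul (Continuous.continuousOn ?_)
      refine continuous_iff_continuousAt.2 fun p => ?_
      exact ContinuousAt.comp (f := fun p : ℝ × ℝ => p.1 • c + p.2 • (a + b))
        (continuousAt_pullForm_kform (Y k) (hG _ (hmemV c hc p)) c (a + b)) (by fun_prop)
    · refine le_of_eq_of_le ?_ (hest p hp)
      have h3 := pullForm_comp ((hFat _ (hmemV c hc p)).mdifferentiableAt (by simp))
        (hiso.mdifferentiableAt (mem_univ (p.1 • c + p.2 • (a + b))))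
        (fun x => ((lam k) ^ 2)⁻¹ • (Y k).kform x)
      have h4 := congrArg (fun T : Cn n [⋀^Fin 2]→L[ℝ] ℝ => T ![c, a + b]) h3
      exact congrArg (fun t => ‖t - stdKahler c (a + b)‖) h4
  have hI1 := hI a haV hk1
  have hI2 := hI b hbV hk2
  rw [stdKahler_add_right, stdKahler_self, zero_add] at hI1
  rw [stdKahler_add_right, stdKahler_self, add_zero, stdKahler_symm b a] at hI2
  -- the two triangles form a cycle
  set σ₁ : ℝ × ℝ → M k := fun p => G (p.1 • a + p.2 • (a + b))
  set σ₂ : ℝ × ℝ → M k := fun p => G (p.1 • b + p.2 • (a + b))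
  have hsmooth : ∀ c ∈ V, ContMDiff 𝓘(ℝ, ℝ × ℝ) 𝓘(ℝ, Cn n) ∞
      fun p : ℝ × ℝ => G (p.1 • c + p.2 • (a + b)) := by
    intro c hc p
    have h1 : ContDiff ℝ ∞ fun p : ℝ × ℝ => p.1 • c + p.2 • (a + b) :=
      (contDiff_fst.smul contDiff_const).add (contDiff_snd.smul contDiff_const)
    exact ContMDiffAt.comp (g := G) (f := fun p : ℝ × ℝ => p.1 • c + p.2 • (a + b)) p
      (hG _ (hmemV c hc p)) h1.contMDiff.contMDiffAt
  obtain ⟨m, hm⟩ := hint k (Finsupp.single σ₁ 1 - Finsupp.single σ₂ 1) (by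
    classical
    intro σ hσ
    have h1 := Finsupp.support_sub hσ
    rw [Finset.mem_union] at h1
    rcases h1 with h1 | h1
    · obtain rfl := Finset.mem_singleton.1 (Finsupp.support_single_subset h1)
      exact hsmooth a haV
    · obtain rfl := Finset.mem_singleton.1 (Finsupp.support_single_subset h1)
      exact hsmooth b hbV)
    (chainBoundary_parallelogram (fun t => congrArg (F k) (ha _ (V.smul_mem t hbV)))
      fun t => congrArg (F k) (hb _ (V.smul_mem t haV)))
  rw [Finsupp.sum_sub_index (by intro σ m₁ m₂; push_cast; ring), Finsupp.sum_single_index (by simp),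
    Finsupp.sum_single_index (by simp)] at hm
  push_cast at hm
  rw [one_mul, one_mul] at hm
  -- by integrality, the difference of the integrals is an integer `m`; rescaled, it is close to `2
  -- * A * s`
  have hkey : |((lam k) ^ 2)⁻¹ * m - 2 * A * s| ≤ A * |s| := by
    rw [← hm]
    rw [abs_le] at hI1 hI2 ⊢
    constructor
    · linarith [hI1.1, hI2.2]
    · linarith [hI1.2, hI2.1]
  have hAs : |2 * A * s| = 2 * A * |s| := by rw [abs_mul, abs_of_pos (by positivity)]
  -- so `m ≠ 0`, and then `(lam k)⁻² ≤ 3 * A * |s|`, which is false for small `lam k`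
  have hm0 : m ≠ 0 := by
    rintro rfl
    rw [Int.cast_zero, mul_zero, zero_sub, abs_neg, hAs] at hkey
    nlinarith
  have hm1 : (1 : ℝ) ≤ |(m : ℝ)| := by
    exact_mod_cast Int.one_le_abs hm0
  have h5 : ((lam k) ^ 2)⁻¹ * |(m : ℝ)| ≤ 3 * A * |s| := by
    have h6 := abs_sub_abs_le_abs_sub (((lam k) ^ 2)⁻¹ * (m : ℝ)) (2 * A * s)
    rw [hAs, abs_mul, abs_of_pos (inv_pos.2 (pow_pos hl 2))] at h6
    linarith
  have h7 : ((lam k) ^ 2)⁻¹ ≤ 3 * A * |s| :=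
    (le_mul_of_one_le_right (by positivity) hm1).trans h5
  have h8 : 1 ≤ 3 * A * |s| * (lam k) ^ 2 := by
    have := mul_le_mul_of_nonneg_right h7 (pow_pos hl 2).le
    rwa [inv_mul_cancel₀ (pow_pos hl 2).ne'] at this
  linarith

end

/-! ### Lagrangian subspaces -/

section

variable {n : ℕ} {V : Submodule ℝ (Cn n)}

theorem real_inner_mulI (v w : Cn n) : inner ℝ (mulI n v) w = stdKahler v w := by
  rw [real_inner_eq_stdMetric, mulI_apply, stdMetric_mulI]

theorem stdKahler_eq_zero_of_span {L : Set V} (hL : Submodule.span ℝ L = ⊤)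
    (h : ∀ a ∈ L, ∀ b ∈ L, stdKahler (a : Cn n) (b : Cn n) = 0) {v w : Cn n} (hv : v ∈ V)
    (hw : w ∈ V) : stdKahler v w = 0 := by
  have h1 : ∀ b ∈ L, ∀ v : V, inner ℝ (mulI n v) (b : Cn n) = 0 := by
    intro b hb v
    have hv : v ∈ Submodule.span ℝ L := hL ▸ Submodule.mem_top
    induction hv using Submodule.span_induction with
    | mem x hx => rw [real_inner_mulI]; exact h x hx b hb
    | zero => simp
    | add x y _ _ hx hy => rw [Submodule.coe_add, map_add, inner_add_left, hx, hy, add_zero]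
    | smul c x _ hx => rw [Submodule.coe_smul, map_smul, inner_smul_left, hx, mul_zero]
  have h2 : ∀ w : V, inner ℝ (mulI n v) (w : Cn n) = 0 := by
    intro w
    have hw : w ∈ Submodule.span ℝ L := hL ▸ Submodule.mem_top
    induction hw using Submodule.span_induction with
    | mem x hx => exact h1 x hx ⟨v, hv⟩
    | zero => simp
    | add x y _ _ hx hy => rw [Submodule.coe_add, inner_add_right, hx, hy, add_zero]
    | smul c x _ hx => rw [Submodule.coe_smul, inner_smul_right, hx, mul_zero]
  rw [← real_inner_mulI]
  exact h2 ⟨w, hw⟩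

theorem finrank_real_Cn (n : ℕ) : Module.finrank ℝ (Cn n) = 2 * n := by
  rw [finrank_real_of_complex, finrank_euclideanSpace_fin]

theorem mulI_injective : Function.Injective (mulI n) := fun v w h => by
  have h1 : (Complex.I • v : Cn n) = Complex.I • w := h
  exact smul_right_injective _ Complex.I_ne_zero h1

theorem map_mulI_le_orthogonal (hiso : ∀ v ∈ V, ∀ w ∈ V, stdKahler v w = 0) :
    V.map (mulI n).toLinearMap ≤ Vᗮ := by
  rintro _ ⟨v, hv, rfl⟩
  rw [Submodule.mem_orthogonal']
  exact fun w hw => (real_inner_mulI v w).trans (hiso v hv w hw)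

theorem finrank_map_mulI : Module.finrank ℝ (V.map (mulI n).toLinearMap) = Module.finrank ℝ V :=
  (Submodule.equivMapOfInjective (mulI n).toLinearMap mulI_injective V).finrank_eq.symm

/-- Isotropic subspaces of at least half the dimension are Lagrangian. -/
theorem finrank_eq_of_isotropic (hiso : ∀ v ∈ V, ∀ w ∈ V, stdKahler v w = 0)
    (hn : n ≤ Module.finrank ℝ V) : Module.finrank ℝ V = n := by
  have h1 := Submodule.finrank_mono (map_mulI_le_orthogonal hiso)
  have h2 := V.finrank_add_finrank_orthogonal
  rw [finrank_real_Cn] at h2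
  rw [finrank_map_mulI] at h1
  omega

theorem orthogonal_eq_map_mulI (hiso : ∀ v ∈ V, ∀ w ∈ V, stdKahler v w = 0)
    (hn : n ≤ Module.finrank ℝ V) : V.map (mulI n).toLinearMap = Vᗮ := by
  refine Submodule.eq_of_le_of_finrank_eq (map_mulI_le_orthogonal hiso) ?_
  have h1 := finrank_eq_of_isotropic hiso hn
  have h2 := V.finrank_add_finrank_orthogonal
  rw [finrank_real_Cn] at h2
  rw [finrank_map_mulI]
  omega

/-- A complex linear map that is the identity on a Lagrangian subspace is the identity. -/
theorem eq_self_of_eq_self_on_lagrangian (hiso : ∀ v ∈ V, ∀ w ∈ V, stdKahler v w = 0)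
    (hn : n ≤ Module.finrank ℝ V) {A : Cn n →ₗ[ℝ] Cn n}
    (hA : ∀ v, A (Complex.I • v) = Complex.I • A v) (hAV : ∀ v ∈ V, A v = v) (z : Cn n) :
    A z = z := by
  rw [← V.starProjection_add_starProjection_orthogonal z, map_add,
    hAV _ (V.starProjection_apply_mem z)]
  congr 1
  have h1 : Vᗮ.starProjection z ∈ V.map (mulI n).toLinearMap := by
    rw [orthogonal_eq_map_mulI hiso hn]
    exact Vᗮ.starProjection_apply_mem z
  obtain ⟨w, hw, hwz⟩ := h1
  have h2 : Complex.I • w = Vᗮ.starProjection z := hwz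
  rw [← h2, hA, hAV w hw]

/-- The restriction of `dz₁ ∧ ⋯ ∧ dzₙ` to a real subspace of dimension `n` has constant phase. -/
theorem exists_phase (hdim : Module.finrank ℝ V = n) :
    ∃ θ : ℝ, ∀ a : Fin n → V,
      (Complex.exp (θ * Complex.I) * stdVolume fun i => (a i : Cn n)).im = 0 := by
  let b : Module.Basis (Fin n) ℝ V := Module.finBasisOfFinrankEq ℝ V hdim
  let f : V [⋀^Fin n]→ₗ[ℝ] ℂ :=
    ((stdVolumeForm n).restrictScalars ℝ).toAlternatingMap.compLinearMap V.subtype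
  have hf : ∀ a : Fin n → V, f a = stdVolume fun i => (a i : Cn n) := fun a => rfl
  set e := Complex.exp (((-(f b).arg : ℝ) : ℂ) * Complex.I)
  have he : e * f b = (‖f b‖ : ℂ) := by
    conv_lhs => rw [← Complex.norm_mul_exp_arg_mul_I (f b)]
    rw [mul_left_comm, ← Complex.exp_add]
    simp
  let g : V [⋀^Fin n]→ₗ[ℝ] ℝ :=
    (Complex.imLm.comp (LinearMap.mulLeft ℝ e)).compAlternatingMap f
  have hg : g b = 0 := by
    show (e * f b).im = 0
    rw [he, Complex.ofReal_im]
  refine ⟨-(f b).arg, fun a => ?_⟩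
  have h1 := congrArg (fun T => T a) (g.eq_smul_basis_det b)
  simp only [hg, zero_smul, AlternatingMap.zero_apply] at h1
  exact h1

end

/-! ### The holonomy covering -/

section

variable {n : ℕ} {X : Type*} {ϖ : Cn n → X} {V : Submodule ℝ (Cn n)}

theorem holCover_eq_iff {z w : Cn n} :
    (Quotient.mk (holSetoid ϖ V) z : HolCover ϖ V) = Quotient.mk (holSetoid ϖ V) w ↔
      ∃ γ ∈ holonomyKernel ϖ V, γ z = w :=
  Quotient.eq

theorem isOpenMap_holCover_mk : IsOpenMap (Quotient.mk (holSetoid ϖ V)) := by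
  intro U hU
  have h1 : Quotient.mk (holSetoid ϖ V) ⁻¹' (Quotient.mk (holSetoid ϖ V) '' U) =
      ⋃ γ : holonomyKernel ϖ V, γ.1 ⁻¹' U := by
    ext z
    simp only [mem_preimage, mem_image, mem_iUnion]
    constructor
    · rintro ⟨u, hu, huz⟩
      obtain ⟨γ, hγ, rfl⟩ := holCover_eq_iff.1 huz.symm
      exact ⟨⟨γ, hγ⟩, hu⟩
    · rintro ⟨γ, hγ⟩
      exact ⟨_, hγ, (holCover_eq_iff.2 ⟨γ.1, γ.2, rfl⟩).symm⟩
  show IsOpen (Quotient.mk (holSetoid ϖ V) ⁻¹' (Quotient.mk (holSetoid ϖ V) '' U))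
  rw [h1]
  exact isOpen_iUnion fun γ => hU.preimage γ.1.continuous

variable [TopologicalSpace X]

theorem continuous_holProj (hcov : IsCoveringMap ϖ) : Continuous (holProj ϖ V) :=
  continuous_quot_lift _ hcov.continuous

theorem isOpenMap_holProj (hcov : IsCoveringMap ϖ) : IsOpenMap (holProj ϖ V) := by
  intro U hU
  have h1 : holProj ϖ V '' U = ϖ '' (Quotient.mk (holSetoid ϖ V) ⁻¹' U) := by
    ext x
    constructor
    · rintro ⟨a, ha, rfl⟩
      obtain ⟨z, rfl⟩ := Quotient.exists_rep a
      exact ⟨z, ha, rfl⟩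
    · rintro ⟨z, hz, rfl⟩
      exact ⟨_, hz, rfl⟩
  rw [h1]
  exact hcov.isOpenMap _ (hU.preimage continuous_quotient_mk')

theorem exists_nhds_injOn (hcov : IsCoveringMap ϖ) (z : Cn n) :
    ∃ U ∈ 𝓝 z, InjOn ϖ U := by
  obtain ⟨e, hze, he⟩ := hcov.isLocalHomeomorph z
  exact ⟨e.source, e.open_source.mem_nhds hze, he ▸ e.injOn⟩

theorem isLocallyInjective_holProj (hcov : IsCoveringMap ϖ) :
    IsLocallyInjective (holProj ϖ V) := by
  rw [isLocallyInjective_iff_nhds]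
  intro a
  obtain ⟨z, rfl⟩ := Quotient.exists_rep a
  obtain ⟨U, hU, hinj⟩ := exists_nhds_injOn hcov z
  refine ⟨_, isOpenMap_holCover_mk.image_mem_nhds hU, ?_⟩
  rintro _ ⟨u, hu, rfl⟩ _ ⟨u', hu', rfl⟩ huu'
  exact congrArg _ (hinj hu hu' huu')

variable [ChartedSpace (Cn n) X] [IsManifold 𝓘(ℝ, Cn n) ∞ X] {g : Metric (Cn n) X} {S : Set X}

/-- Two points of a fibre are separated by images of neighbourhoods on which the universal covering
is injective. -/
theorem isSeparatedMap_holProj [T2Space X] (h : IsomOn g ϖ univ) (hcov : IsCoveringMap ϖ)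
    (hflat : IsFlatMetric g) : IsSeparatedMap (holProj ϖ V) := by
  rw [isSeparatedMap_iff_nhds]
  intro a b hab hne
  obtain ⟨z, rfl⟩ := Quotient.exists_rep a
  obtain ⟨w, rfl⟩ := Quotient.exists_rep b
  obtain ⟨γ, hγ, rfl⟩ := h.exists_deck_of_eq hflat (a := z) (b := w) hab
  obtain ⟨U, hU, hinj⟩ := exists_nhds_injOn hcov z
  refine ⟨_, isOpenMap_holCover_mk.image_mem_nhds hU, _,
    isOpenMap_holCover_mk.image_mem_nhds (γ.isOpenMap.image_mem_nhds hU), ?_⟩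
  rw [Set.disjoint_left]
  rintro _ ⟨u, hu, rfl⟩ ⟨_, ⟨u', hu', rfl⟩, huu'⟩
  obtain ⟨κ, hκ, hκu⟩ := holCover_eq_iff.1 huu'
  have h1 : u' = u := hinj hu' hu (by rw [← hκu, hκ.1, hγ])
  have h2 : κ * γ = 1 := h.deck_ext hflat (mul_mem hκ.1 hγ) (one_mem _) (a := u) (h1 ▸ hκu)
  exact hne (holCover_eq_iff.2 ⟨γ, eq_inv_of_mul_eq_one_right h2 ▸ inv_mem hκ, rfl⟩)

/-- Lifts through the covering projection are unique. -/
theorem eq_of_holProj_comp_eq [T2Space X] (h : IsomOn g ϖ univ) (hcov : IsCoveringMap ϖ)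
    (hflat : IsFlatMetric g) {A : Type*} [TopologicalSpace A] [PreconnectedSpace A]
    {f f' : A → HolCover ϖ V} (hf : Continuous f) (hf' : Continuous f')
    (hff : ∀ a, holProj ϖ V (f a) = holProj ϖ V (f' a)) (a : A) (ha : f a = f' a) : f = f' :=
  (isSeparatedMap_holProj h hcov hflat).eq_of_comp_eq (isLocallyInjective_holProj hcov) hf hf'
    (funext hff) a ha

/-- Deck transformations of `ϖ` descend to the holonomy covering. -/
theorem exists_descend [T2Space X] (h : IsomOn g ϖ univ) (hflat : IsFlatMetric g)
    (hV : (V : Set (Cn n)) = ϖ ⁻¹' S) {γ : Cn n ≃ₜ Cn n} (hγ : γ ∈ deckGroup ϖ) :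
    ∃ δ ∈ deckGroup (holProj ϖ V), ∀ z, δ (Quotient.mk (holSetoid ϖ V) z) =
      Quotient.mk (holSetoid ϖ V) (γ z) := by
  have hN := normal_holonomyKernel h hflat hV
  have hmap : ∀ γ ∈ deckGroup ϖ, ∀ z w, holSetoid ϖ V z w → holSetoid ϖ V (γ z) (γ w) := by
    rintro γ hγ z w ⟨κ, hκ, rfl⟩
    refine ⟨γ * κ * γ⁻¹, hN.conj_mem ⟨κ, hκ.1⟩ hκ ⟨γ, hγ⟩, ?_⟩
    simp [Homeomorph.mul_apply]
  have hc : ∀ γ : Cn n ≃ₜ Cn n, Continuous fun z => Quotient.mk (holSetoid ϖ V) (γ z) :=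
    fun γ => continuous_quotient_mk'.comp γ.continuous
  have hγ' := inv_mem hγ
  refine ⟨⟨⟨Quotient.map γ (hmap γ hγ), Quotient.map (γ⁻¹ : Cn n ≃ₜ Cn n) (hmap _ hγ'), ?_, ?_⟩,
    continuous_quot_lift _ (hc γ), continuous_quot_lift _ (hc γ⁻¹)⟩, ?_, fun z => rfl⟩
  · rintro ⟨z⟩
    exact congrArg (Quotient.mk (holSetoid ϖ V)) (γ.symm_apply_apply z)
  · rintro ⟨z⟩
    exact congrArg (Quotient.mk (holSetoid ϖ V)) (γ.apply_symm_apply z)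
  · rintro ⟨z⟩
    exact hγ z

theorem deck_holProj_ext [T2Space X] (h : IsomOn g ϖ univ) (hcov : IsCoveringMap ϖ)
    (hflat : IsFlatMetric g) {δ δ' : HolCover ϖ V ≃ₜ HolCover ϖ V}
    (hδ : δ ∈ deckGroup (holProj ϖ V)) (hδ' : δ' ∈ deckGroup (holProj ϖ V)) {a : HolCover ϖ V}
    (ha : δ a = δ' a) : δ = δ' := by
  ext1 b
  exact congrFun (eq_of_holProj_comp_eq h hcov hflat δ.continuous δ'.continuous
    (fun b => (hδ b).trans (hδ' b).symm) a ha) b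

theorem exists_deck_holProj_of_eq [T2Space X] (h : IsomOn g ϖ univ)
    (hflat : IsFlatMetric g) (hV : (V : Set (Cn n)) = ϖ ⁻¹' S) {a b : HolCover ϖ V}
    (hab : holProj ϖ V a = holProj ϖ V b) : ∃ δ ∈ deckGroup (holProj ϖ V), δ a = b := by
  obtain ⟨z, rfl⟩ := Quotient.exists_rep a
  obtain ⟨w, rfl⟩ := Quotient.exists_rep b
  obtain ⟨γ, hγ, rfl⟩ := h.exists_deck_of_eq hflat (a := z) (b := w) hab
  obtain ⟨δ, hδ, hδγ⟩ := exists_descend h hflat hV hγ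
  exact ⟨δ, hδ, hδγ z⟩

/-- Deck transformations of the holonomy covering lift to `ℂⁿ`. -/
theorem exists_deck_lift [T2Space X] (h : IsomOn g ϖ univ) (hcov : IsCoveringMap ϖ)
    (hflat : IsFlatMetric g) (hV : (V : Set (Cn n)) = ϖ ⁻¹' S)
    {δ : HolCover ϖ V ≃ₜ HolCover ϖ V} (hδ : δ ∈ deckGroup (holProj ϖ V)) :
    ∃ γ ∈ deckGroup ϖ, ∀ z, δ (Quotient.mk (holSetoid ϖ V) z) =
      Quotient.mk (holSetoid ϖ V) (γ z) := by
  obtain ⟨w, hw⟩ := Quotient.exists_rep (δ (Quotient.mk (holSetoid ϖ V) 0))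
  have h0 : ϖ 0 = ϖ w := by
    have := hδ (Quotient.mk (holSetoid ϖ V) 0)
    rw [← hw] at this
    exact this.symm
  obtain ⟨γ, hγ, rfl⟩ := h.exists_deck_of_eq hflat h0
  obtain ⟨δ', hδ', hδγ⟩ := exists_descend h hflat hV hγ
  obtain rfl : δ = δ' := deck_holProj_ext h hcov hflat hδ hδ' (hw.symm.trans (hδγ 0).symm)
  exact ⟨γ, hγ, hδγ⟩

/-- The deck group of `holProj` acts freely and properly discontinuously, with quotient `X`. -/
theorem isCoveringMap_holProj [T2Space X] [ConnectedSpace X] (h : IsomOn g ϖ univ)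
    (hcov : IsCoveringMap ϖ) (hflat : IsFlatMetric g) (hV : (V : Set (Cn n)) = ϖ ⁻¹' S) :
    IsCoveringMap (holProj ϖ V) := by
  let G := deckGroup (holProj ϖ V)
  let _ : MulAction G (HolCover ϖ V) :=
    { smul := fun δ a => δ.1 a
      one_smul := fun a => rfl
      mul_smul := fun δ δ' a => rfl }
  have hsmul : ∀ (δ : G) (a : HolCover ϖ V), δ • a = δ.1 a := fun _ _ => rfl
  have hsurj : Function.Surjective (holProj ϖ V) := fun x => by
    obtain ⟨z, rfl⟩ := surjective_of_isCoveringMap hcov x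
    exact ⟨Quotient.mk _ z, rfl⟩
  suffices IsQuotientCoveringMap (holProj ϖ V) G from this.isCoveringMap
  refine { toIsQuotientMap := (isOpenMap_holProj hcov).isQuotientMap (continuous_holProj hcov) hsurj
           toContinuousConstSMul := ⟨fun δ => δ.1.continuous⟩
           apply_eq_iff_mem_orbit := ?_
           disjoint := ?_ }
  · intro a b
    constructor
    · intro hab
      obtain ⟨δ, hδ, hδa⟩ := exists_deck_holProj_of_eq h hflat hV hab.symm
      exact ⟨⟨δ, hδ⟩, hδa⟩
    · rintro ⟨δ, rfl⟩
      exact δ.2 b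
  · intro a
    obtain ⟨z, rfl⟩ := Quotient.exists_rep a
    obtain ⟨U, hU, hinj⟩ := exists_nhds_injOn hcov z
    refine ⟨_, isOpenMap_holCover_mk.image_mem_nhds hU, ?_⟩
    rintro δ ⟨_, ⟨_, ⟨u, hu, rfl⟩, huu'⟩, ⟨u', hu', rfl⟩⟩
    have h1 : u' = u := hinj hu' hu (by
      have := δ.2 (Quotient.mk (holSetoid ϖ V) u)
      rw [← hsmul, show δ • _ = _ from huu'] at this
      exact this)
    subst h1
    exact Subtype.ext (deck_holProj_ext h hcov hflat δ.2 (one_mem _) huu')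

/-- The deck group of `holProj` is the quotient of the deck group by the holonomy kernel, and so it
is in bijection with the finite point group. -/
theorem finite_deck_holProj [T2Space X] [ConnectedSpace X] (h : IsomOn g ϖ univ)
    (hcov : IsCoveringMap ϖ) (hflat : IsFlatMetric g) (hS : IsCompact S)
    (hV : (V : Set (Cn n)) = ϖ ⁻¹' S) : Finite (deckGroup (holProj ϖ V)) := by
  have hfin := (h.isCrystallographic hcov hflat hS hV).finite_range
  choose γ hγ hγδ using fun δ : deckGroup (holProj ϖ V) => exists_deck_lift h hcov hflat hV δ.2
  have := hfin.to_subtype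
  refine Finite.of_injective (fun δ => (⟨_, mem_range_self ⟨γ δ, hγ δ⟩⟩ :
    range (deckLinear h hflat hV))) fun δ δ' hδ => ?_
  have h1 : deckLinear h hflat hV ⟨γ δ, hγ δ⟩ = deckLinear h hflat hV ⟨γ δ', hγ δ'⟩ :=
    congrArg Subtype.val hδ
  rw [← inv_mul_eq_one, ← map_inv, ← map_mul, deckLinear_eq_one_iff] at h1
  have hN := (normal_holonomyKernel h hflat hV).mem_comm (a := (⟨γ δ, hγ δ⟩ : deckGroup ϖ)⁻¹)
    (b := ⟨γ δ', hγ δ'⟩) h1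
  refine Subtype.ext (deck_holProj_ext h hcov hflat δ.2 δ'.2 (a := Quotient.mk _ 0) ?_)
  rw [hγδ, hγδ]
  refine holCover_eq_iff.2 ⟨_, hN, ?_⟩
  show γ δ' ((γ δ)⁻¹ (γ δ 0)) = γ δ' 0
  rw [Homeomorph.inv_apply, Homeomorph.symm_apply_apply]

end

/-! ### The product structure -/

section

variable {n : ℕ} {X : Type*} {ϖ : Cn n → X} {V : Submodule ℝ (Cn n)}

theorem holCover_eq_iff_of_translations (hK : ∀ γ ∈ holonomyKernel ϖ V, ∀ z, γ z = z + γ 0)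
    {z w : Cn n} :
    (Quotient.mk (holSetoid ϖ V) z : HolCover ϖ V) = Quotient.mk (holSetoid ϖ V) w ↔
      ∃ l ∈ transLattice ϖ V, w = z + (l : V) := by
  rw [holCover_eq_iff]
  constructor
  · rintro ⟨γ, hγ, rfl⟩
    obtain ⟨b, hb, hγb⟩ := hγ.2
    refine ⟨⟨b, hb⟩, ⟨γ, hγ, hγb⟩, ?_⟩
    rw [hK γ hγ, hγb 0 V.zero_mem, zero_add]
  · rintro ⟨l, ⟨γ, hγ, hγl⟩, rfl⟩
    exact ⟨γ, hγ, by rw [hK γ hγ, hγl 0 V.zero_mem, zero_add]⟩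

/-- The splitting `ℂⁿ = V ⊕ Vᗮ`, followed by the projection of `V` to the torus `V / Λ`. -/
noncomputable def torusSplitting (ϖ : Cn n → X) (V : Submodule ℝ (Cn n)) (z : Cn n) :
    WithLp 2 (HolTorus ϖ V × Vᗮ) :=
  WithLp.toLp 2 (Submodule.Quotient.mk (V.orthogonalProjectionOnto z), Vᗮ.orthogonalProjectionOnto z)

theorem torusSplitting_add (v : V) (w : Vᗮ) : torusSplitting ϖ V ((v : Cn n) + (w : Cn n)) =
    WithLp.toLp 2 (Submodule.Quotient.mk v, w) := by
  have h1 : V.orthogonalProjectionOnto (w : Cn n) = 0 :=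
    Submodule.orthogonalProjectionOnto_eq_zero_iff.2 w.2
  have h2 : Vᗮ.orthogonalProjectionOnto (v : Cn n) = 0 :=
    Submodule.orthogonalProjectionOnto_eq_zero_iff.2 (V.le_orthogonal_orthogonal v.2)
  simp [torusSplitting, h1, h2]

theorem exists_add_eq (V : Submodule ℝ (Cn n)) (z : Cn n) :
    ∃ (v : V) (w : Vᗮ), (v : Cn n) + (w : Cn n) = z :=
  ⟨V.orthogonalProjectionOnto z, Vᗮ.orthogonalProjectionOnto z,
    V.starProjection_add_starProjection_orthogonal z⟩

/-- The fibres of `torusSplitting` are the orbits of the holonomy kernel. -/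
theorem torusSplitting_eq_iff (hK : ∀ γ ∈ holonomyKernel ϖ V, ∀ z, γ z = z + γ 0) {z w : Cn n} :
    torusSplitting ϖ V z = torusSplitting ϖ V w ↔
      (Quotient.mk (holSetoid ϖ V) z : HolCover ϖ V) = Quotient.mk (holSetoid ϖ V) w := by
  obtain ⟨v, y, rfl⟩ := exists_add_eq V z
  obtain ⟨v', y', rfl⟩ := exists_add_eq V w
  rw [holCover_eq_iff_of_translations hK, torusSplitting_add, torusSplitting_add,
    (WithLp.toLp_injective 2).eq_iff, Prod.mk.injEq, eq_comm (a := Submodule.Quotient.mk v),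
    Submodule.Quotient.eq]
  constructor
  · rintro ⟨h1, rfl⟩
    refine ⟨_, h1, ?_⟩
    rw [Submodule.coe_sub]
    abel
  · rintro ⟨l, hl, hle⟩
    have h1 : ((v' - v - l : V) : Cn n) = ((y - y' : Vᗮ) : Cn n) := by
      push_cast
      rw [sub_eq_sub_iff_add_eq_add, sub_add_eq_add_sub, hle]
      abel
    have h2 : ((v' - v - l : V) : Cn n) = 0 := by
      refine (Submodule.disjoint_def.1 V.isOrtho_orthogonal_right.disjoint) _ (v' - v - l).2 ?_
      rw [h1]
      exact (y - y').2
    refine ⟨?_, ?_⟩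
    · rw [← sub_eq_zero.1 (Subtype.ext h2 : v' - v - l = 0)] at hl
      exact hl
    · rw [h1] at h2
      exact sub_eq_zero.1 (Subtype.ext h2)

theorem isOpenQuotientMap_torusSplitting : IsOpenQuotientMap (torusSplitting ϖ V) := by
  have hsurj : Function.Surjective (torusSplitting ϖ V) := by
    rintro ⟨x, w⟩
    obtain ⟨v, rfl⟩ := Submodule.Quotient.mk_surjective _ x
    exact ⟨_, torusSplitting_add v w⟩
  have h1 : IsOpenQuotientMap (Prod.map Submodule.Quotient.mk id : V × Vᗮ → HolTorus ϖ V × Vᗮ) :=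
    IsOpenQuotientMap.prodMap QuotientAddGroup.isOpenQuotientMap_mk IsOpenQuotientMap.id
  let e : Cn n ≃ₜ V × Vᗮ :=
    { toFun := fun z => (V.orthogonalProjectionOnto z, Vᗮ.orthogonalProjectionOnto z)
      invFun := fun p => (p.1 : Cn n) + (p.2 : Cn n)
      left_inv := fun z => V.starProjection_add_starProjection_orthogonal z
      right_inv := fun p => by
        have h1 : V.orthogonalProjectionOnto (p.2 : Cn n) = 0 :=
          Submodule.orthogonalProjectionOnto_eq_zero_iff.2 p.2.2
        have h2 : Vᗮ.orthogonalProjectionOnto (p.1 : Cn n) = 0 :=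
          Submodule.orthogonalProjectionOnto_eq_zero_iff.2 (V.le_orthogonal_orthogonal p.1.2)
        simp [h1, h2]
      continuous_toFun := by fun_prop
      continuous_invFun := by fun_prop }
  exact ((WithLp.homeomorphProd 2 (HolTorus ϖ V) Vᗮ).symm.isOpenQuotientMap.comp h1).comp
    e.isOpenQuotientMap

/-- The holonomy covering is `V / Λ × Vᗮ`. -/
theorem exists_homeomorph_torus (hK : ∀ γ ∈ holonomyKernel ϖ V, ∀ z, γ z = z + γ 0) :
    ∃ Φ : WithLp 2 (HolTorus ϖ V × Vᗮ) ≃ₜ HolCover ϖ V,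
      ∀ (v : V) (w : Vᗮ), Φ (WithLp.toLp 2 (Submodule.Quotient.mk v, w)) =
        Quotient.mk (holSetoid ϖ V) ((v : Cn n) + (w : Cn n)) := by
  have hq := isOpenQuotientMap_torusSplitting (ϖ := ϖ) (V := V)
  let f : HolCover ϖ V → WithLp 2 (HolTorus ϖ V × Vᗮ) :=
    Quotient.lift (torusSplitting ϖ V) fun z w hzw =>
      (torusSplitting_eq_iff hK).2 (Quotient.sound hzw)
  have hf : ∀ z, f (Quotient.mk _ z) = torusSplitting ϖ V z := fun z => rfl
  have hbij : Function.Bijective f := by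
    constructor
    · rintro ⟨z⟩ ⟨w⟩ hzw
      exact (torusSplitting_eq_iff hK).1 hzw
    · intro x
      obtain ⟨z, rfl⟩ := hq.surjective x
      exact ⟨Quotient.mk _ z, rfl⟩
  have hopen : IsOpenMap f := by
    intro U hU
    have h1 : f '' U = torusSplitting ϖ V '' (Quotient.mk (holSetoid ϖ V) ⁻¹' U) := by
      ext x
      constructor
      · rintro ⟨⟨z⟩, ha, rfl⟩
        exact ⟨z, ha, rfl⟩
      · rintro ⟨z, hz, rfl⟩
        exact ⟨_, hz, rfl⟩
    rw [h1]
    exact hq.isOpenMap _ (hU.preimage continuous_quotient_mk')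
  let Ψ := (Equiv.ofBijective f hbij).toHomeomorphOfContinuousOpen
    (continuous_quot_lift _ hq.continuous) hopen
  refine ⟨Ψ.symm, fun v w => ?_⟩
  rw [Homeomorph.symm_apply_eq]
  exact (torusSplitting_add v w).symm

end

/-! ### The distance of the holonomy covering -/

section

variable {n : ℕ} {X : Type*} {ϖ : Cn n → X} {V : Submodule ℝ (Cn n)}

theorem norm_add_sq_of_orthogonal (v : V) (w : Vᗮ) :
    ‖(v : Cn n) + (w : Cn n)‖ ^ 2 = ‖v‖ ^ 2 + ‖w‖ ^ 2 := by
  have := norm_add_sq_eq_norm_sq_add_norm_sq_real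
    (Submodule.inner_right_of_mem_orthogonal v.2 w.2)
  rw [sq, this, sq, sq]
  rfl

theorem norm_mk_holTorus_le (u : V) : ‖(Submodule.Quotient.mk u : HolTorus ϖ V)‖ ≤ ‖u‖ :=
  Submodule.Quotient.norm_mk_le _ u

/-- The infimum in the quotient norm is attained, as the lattice is discrete. -/
theorem exists_norm_mk_holTorus_eq [DiscreteTopology (transLattice ϖ V)] (u : V) :
    ∃ l ∈ transLattice ϖ V, ‖(Submodule.Quotient.mk u : HolTorus ϖ V)‖ = ‖u - l‖ := by
  have hd : DiscreteTopology (transLattice ϖ V).toAddSubgroup :=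
    inferInstanceAs (DiscreteTopology (transLattice ϖ V))
  obtain ⟨l, hl, h1⟩ := (AddSubgroup.isClosed_of_discrete
    (H := (transLattice ϖ V).toAddSubgroup)).exists_infDist_eq_dist ⟨0, zero_mem _⟩ u
  refine ⟨l, hl, ?_⟩
  rw [← dist_eq_norm, ← h1]
  exact QuotientAddGroup.norm_mk (S := (transLattice ϖ V).toAddSubgroup) u

theorem edist_toLp_eq (x x' : HolTorus ϖ V) (w w' : Vᗮ) :
    edist (WithLp.toLp 2 (x, w)) (WithLp.toLp 2 (x', w')) =
      ENNReal.ofReal √(‖x - x'‖ ^ 2 + ‖w - w'‖ ^ 2) := by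
  refine (edist_eq_enorm_sub (E := WithLp 2 (HolTorus ϖ V × Vᗮ)) _ _).trans ?_
  rw [← ofReal_norm]
  exact congrArg ENNReal.ofReal (WithLp.prod_norm_eq_of_L2 (α := HolTorus ϖ V) (β := Vᗮ) _)

variable [TopologicalSpace X] [ChartedSpace (Cn n) X] [IsManifold 𝓘(ℝ, Cn n) ∞ X]
  {g : Metric (Cn n) X}

/-- The projection of a segment is a path of the same length. -/
theorem coverDist_mk_le (h : IsomOn g ϖ univ) (z w : Cn n) :
    coverDist g (holProj ϖ V) (Quotient.mk (holSetoid ϖ V) z) (Quotient.mk (holSetoid ϖ V) w) ≤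
      edist z w := by
  let c : Path (Quotient.mk (holSetoid ϖ V) z : HolCover ϖ V) (Quotient.mk (holSetoid ϖ V) w) :=
    { toFun := fun t => Quotient.mk (holSetoid ϖ V) (z + (t : ℝ) • (w - z))
      continuous_toFun := continuous_quotient_mk'.comp (by fun_prop)
      source' := by simp
      target' := by simp }
  have hc : ∀ t ∈ Icc (0 : ℝ) 1, holProj ϖ V (c.extend t) = ϖ (z + t • (w - z)) := by
    intro t ht
    rw [c.extend_apply ht]
    rfl
  refine (iInf₂_le c ((h.contMDiffOn_segment (fun _ _ => mem_univ _)).congr hc)).trans ?_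
  rw [gLength_congr hc, h.gLength_segment (fun _ _ => mem_univ _), edist_comm, edist_dist,
    dist_eq_norm]

/-- A path that starts at the class of `z` lifts to a path in `ℂⁿ` that starts at `z` and has the
same length. -/
theorem exists_edist_le_of_path [T2Space X] (h : IsomOn g ϖ univ) (hcov : IsCoveringMap ϖ)
    (hflat : IsFlatMetric g) {z : Cn n} {b : HolCover ϖ V} (c : Path (Quotient.mk (holSetoid ϖ V) z) b)
    (hc : ContMDiffOn 𝓘(ℝ, ℝ) 𝓘(ℝ, Cn n) 1 (fun t => holProj ϖ V (c.extend t)) (Icc 0 1)) :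
    ∃ w, Quotient.mk (holSetoid ϖ V) w = b ∧
      edist z w ≤ gLength g (fun t => holProj ϖ V (c.extend t)) := by
  obtain ⟨δ, hδ, hδ0, hδϖ⟩ := h.exists_lift hcov hflat hc (z := z) (by
    rw [c.extend_zero]
    rfl)
  have hle := h.edist_le_gLength hδ hδϖ
  rw [hδ0] at hle
  refine ⟨δ 1, ?_, hle⟩
  have h1 : (fun t : unitInterval => Quotient.mk (holSetoid ϖ V) (δ t)) = c := by
    refine eq_of_holProj_comp_eq h hcov hflat
      (continuous_quotient_mk'.comp hδ.continuousOn.domRestrict) c.continuous (fun t => ?_) 0 ?_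
    · have h2 := hδϖ t t.2
      rw [c.extend_apply t.2] at h2
      exact h2
    · rw [c.source]
      exact congrArg (Quotient.mk (holSetoid ϖ V)) hδ0
  exact (congrFun h1 1).trans c.target

/-- The identification of `V / Λ × Vᗮ` with the holonomy covering is an isometry. A minimizing
segment in `ℂⁿ` ends at the representative that realizes the quotient norm of `V / Λ`. -/
theorem coverDist_eq_edist [T2Space X] (h : IsomOn g ϖ univ) (hcov : IsCoveringMap ϖ)
    (hflat : IsFlatMetric g) (hK : ∀ γ ∈ holonomyKernel ϖ V, ∀ z, γ z = z + γ 0)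
    {Φ : WithLp 2 (HolTorus ϖ V × Vᗮ) → HolCover ϖ V}
    (hΦ : ∀ (v : V) (w : Vᗮ), Φ (WithLp.toLp 2 (Submodule.Quotient.mk v, w)) =
      Quotient.mk (holSetoid ϖ V) ((v : Cn n) + (w : Cn n)))
    (a b : WithLp 2 (HolTorus ϖ V × Vᗮ)) :
    coverDist g (holProj ϖ V) (Φ a) (Φ b) = edist a b := by
  have hd : DiscreteTopology (transLattice ϖ V) := discreteTopology_transLattice h hcov hflat
  obtain ⟨x, w⟩ := a
  obtain ⟨x', w'⟩ := b
  obtain ⟨v, rfl⟩ := Submodule.Quotient.mk_surjective _ x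
  obtain ⟨v', rfl⟩ := Submodule.Quotient.mk_surjective _ x'
  have hsq : ∀ l : V, edist ((v : Cn n) + w) ((v' : Cn n) + w' + l) =
      ENNReal.ofReal √(‖v - v' - l‖ ^ 2 + ‖w - w'‖ ^ 2) := by
    intro l
    rw [edist_dist, dist_eq_norm, ← norm_add_sq_of_orthogonal, Real.sqrt_sq (norm_nonneg _)]
    congr 2
    push_cast
    abel
  rw [edist_toLp_eq, ← Submodule.Quotient.mk_sub]
  apply le_antisymm
  · obtain ⟨l, hl, hle⟩ := exists_norm_mk_holTorus_eq (ϖ := ϖ) (v - v')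
    have h1 : (Quotient.mk (holSetoid ϖ V) ((v' : Cn n) + w') : HolCover ϖ V) =
        Quotient.mk (holSetoid ϖ V) ((v' : Cn n) + w' + l) :=
      (holCover_eq_iff_of_translations hK).2 ⟨l, hl, rfl⟩
    rw [hΦ, hΦ, h1, hle, ← hsq]
    exact coverDist_mk_le h _ _
  · refine le_iInf₂ fun c hc => ?_
    obtain ⟨u, hu, hle⟩ := exists_edist_le_of_path (z := (v : Cn n) + w) h hcov hflat
      (c.cast (hΦ v w).symm rfl) hc
    refine le_trans ?_ hle
    rw [hΦ] at hu
    obtain ⟨l, hl, rfl⟩ := (holCover_eq_iff_of_translations hK).1 hu.symm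
    rw [hsq]
    have h1 : (Submodule.Quotient.mk (v - v') : HolTorus ϖ V) =
        Submodule.Quotient.mk (v - v' - l) := by
      rw [Submodule.Quotient.eq]
      simpa using hl
    refine ENNReal.ofReal_le_ofReal (Real.sqrt_le_sqrt ?_)
    gcongr
    rw [h1]
    exact norm_mk_holTorus_le _

/-- Deck transformations preserve the distance of the covering space. -/
theorem coverDist_deck {Y : Type*} [TopologicalSpace Y] {f : Y → X} {δ : Y ≃ₜ Y}
    (hδ : δ ∈ deckGroup f) (a b : Y) : coverDist g f (δ a) (δ b) = coverDist g f a b := by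
  have key : ∀ δ ∈ deckGroup f, ∀ a b, coverDist g f (δ a) (δ b) ≤ coverDist g f a b := by
    intro δ hδ a b
    refine le_iInf₂ fun c hc => ?_
    have h1 : (fun t => f ((c.map δ.continuous).extend t)) = fun t => f (c.extend t) := by
      ext t
      exact hδ _
    refine (iInf₂_le (c.map δ.continuous) (h1 ▸ hc)).trans (h1 ▸ le_rfl)
  refine le_antisymm (key δ hδ a b) ?_
  have := key δ⁻¹ (inv_mem hδ) (δ a) (δ b)
  simpa only [Homeomorph.inv_apply, Homeomorph.symm_apply_apply] using this

end

/-! ### The product action, and the soul -/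

section

section

variable {n : ℕ} {X : Type*} {ϖ : Cn n → X} {V : Submodule ℝ (Cn n)} {S : Set X}

theorem range_torus_eq (hV : (V : Set (Cn n)) = ϖ ⁻¹' S)
    {Φ : WithLp 2 (HolTorus ϖ V × Vᗮ) ≃ₜ HolCover ϖ V}
    (hΦ : ∀ (v : V) (w : Vᗮ), Φ (WithLp.toLp 2 (Submodule.Quotient.mk v, w)) =
      Quotient.mk (holSetoid ϖ V) ((v : Cn n) + (w : Cn n))) :
    range (fun x : HolTorus ϖ V => Φ (WithLp.toLp 2 (x, 0))) = holProj ϖ V ⁻¹' S := by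
  ext a
  constructor
  · rintro ⟨x, rfl⟩
    obtain ⟨v, rfl⟩ := Submodule.Quotient.mk_surjective _ x
    have h1 : (v : Cn n) ∈ ϖ ⁻¹' S := hV ▸ v.2
    simp only [hΦ, Submodule.coe_zero, add_zero]
    exact h1
  · obtain ⟨z, rfl⟩ := Quotient.exists_rep a
    intro hz
    have h1 : z ∈ (V : Set (Cn n)) := hV ▸ hz
    refine ⟨Submodule.Quotient.mk ⟨z, h1⟩, ?_⟩
    simp only [hΦ, Submodule.coe_zero, add_zero]

end

theorem image_preimage_of_mem_deckGroup {X Y : Type*} [TopologicalSpace Y] {f : Y → X}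
    {δ : Y ≃ₜ Y} (hδ : δ ∈ deckGroup f) (S : Set X) : δ '' (f ⁻¹' S) = f ⁻¹' S := by
  ext a
  constructor
  · rintro ⟨b, hb, rfl⟩
    exact mem_preimage.2 ((hδ b).symm ▸ hb)
  · intro ha
    refine ⟨δ.symm a, ?_, δ.apply_symm_apply a⟩
    have h1 := hδ (δ.symm a)
    rw [δ.apply_symm_apply] at h1
    exact mem_preimage.2 (h1 ▸ ha)

variable {n : ℕ} {X : Type*} [TopologicalSpace X] [ChartedSpace (Cn n) X]
  [IsManifold 𝓘(ℝ, Cn n) ∞ X] {g : Metric (Cn n) X} {ϖ : Cn n → X} {V : Submodule ℝ (Cn n)}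
  {S : Set X}

/-- An isometry that preserves `V` preserves `Vᗮ`. -/
theorem exists_linear_on_orthogonal {A : Cn n ≃ₗᵢ[ℝ] Cn n} (hA : ∀ v, A v ∈ V ↔ v ∈ V) :
    ∃ B : Vᗮ ≃ₗᵢ[ℝ] Vᗮ, ∀ w : Vᗮ, (B w : Cn n) = A w := by
  have hmem : ∀ w ∈ Vᗮ, A w ∈ Vᗮ := by
    intro w hw
    rw [Submodule.mem_orthogonal] at hw ⊢
    intro v hv
    rw [← A.apply_symm_apply v, A.inner_map_map]
    exact hw _ ((hA _).1 (by rwa [A.apply_symm_apply]))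
  let B : Vᗮ →ₗᵢ[ℝ] Vᗮ := ⟨A.toLinearEquiv.toLinearMap.restrict hmem, fun v => A.norm_map v⟩
  exact ⟨B.toLinearIsometryEquiv rfl, fun w => rfl⟩

/-- A deck transformation of the holonomy covering lifts to a rigid motion of `ℂⁿ` that preserves
`V`, and whose linear part preserves `Vᗮ`. -/
theorem exists_product_map [T2Space X] (h : IsomOn g ϖ univ) (hcov : IsCoveringMap ϖ)
    (hflat : IsFlatMetric g) (hV : (V : Set (Cn n)) = ϖ ⁻¹' S)
    {Φ : WithLp 2 (HolTorus ϖ V × Vᗮ) ≃ₜ HolCover ϖ V}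
    (hΦ : ∀ (v : V) (w : Vᗮ), Φ (WithLp.toLp 2 (Submodule.Quotient.mk v, w)) =
      Quotient.mk (holSetoid ϖ V) ((v : Cn n) + (w : Cn n)))
    {δ : HolCover ϖ V ≃ₜ HolCover ϖ V} (hδ : δ ∈ deckGroup (holProj ϖ V)) :
    ∃ (f : HolTorus ϖ V → HolTorus ϖ V) (A : Vᗮ ≃ₗᵢ[ℝ] Vᗮ), ∀ x y,
      δ (Φ (WithLp.toLp 2 (x, y))) = Φ (WithLp.toLp 2 (f x, A y)) := by
  obtain ⟨γ, hγ, hγδ⟩ := exists_deck_lift h hcov hflat hV hδ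
  obtain ⟨A, hA⟩ := h.exists_linear_of_deck hflat hγ
  obtain ⟨B, hB⟩ := exists_linear_on_orthogonal (deck_linear_mem_iff hγ hV hA)
  have key : ∀ (v : V) (y : Vᗮ), δ (Φ (WithLp.toLp 2 (Submodule.Quotient.mk v, y))) =
      Φ (WithLp.toLp 2
        (Submodule.Quotient.mk ⟨γ v, (deck_mem_iff hγ hV _).2 v.2⟩, B y)) := by
    intro v y
    rw [hΦ, hΦ, hγδ]
    refine congrArg (Quotient.mk (holSetoid ϖ V)) ?_
    show γ (v + y) = γ v + (B y : Cn n)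
    rw [hA, map_add, hB, hA v]
    abel
  refine ⟨fun x => (Φ.symm (δ (Φ (WithLp.toLp 2 (x, 0))))).fst, B, fun x y => ?_⟩
  obtain ⟨v, rfl⟩ := Submodule.Quotient.mk_surjective _ x
  dsimp only
  rw [key, key, Φ.symm_apply_apply]
  rfl

/-- The map of the torus in `exists_product_map` is an isometry, because deck transformations
preserve the distance and `Φ` is an isometry. -/
theorem exists_product_isometry [T2Space X] (h : IsomOn g ϖ univ) (hcov : IsCoveringMap ϖ)
    (hflat : IsFlatMetric g) (hV : (V : Set (Cn n)) = ϖ ⁻¹' S)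
    (hK : ∀ γ ∈ holonomyKernel ϖ V, ∀ z, γ z = z + γ 0)
    {Φ : WithLp 2 (HolTorus ϖ V × Vᗮ) ≃ₜ HolCover ϖ V}
    (hΦ : ∀ (v : V) (w : Vᗮ), Φ (WithLp.toLp 2 (Submodule.Quotient.mk v, w)) =
      Quotient.mk (holSetoid ϖ V) ((v : Cn n) + (w : Cn n)))
    {δ : HolCover ϖ V ≃ₜ HolCover ϖ V} (hδ : δ ∈ deckGroup (holProj ϖ V)) :
    ∃ (f : HolTorus ϖ V ≃ᵢ HolTorus ϖ V) (A : Vᗮ ≃ₗᵢ[ℝ] Vᗮ), ∀ x y,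
      δ (Φ (WithLp.toLp 2 (x, y))) = Φ (WithLp.toLp 2 (f x, A y)) := by
  obtain ⟨f, A, hf⟩ := exists_product_map h hcov hflat hV hΦ hδ
  obtain ⟨f', A', hf'⟩ := exists_product_map h hcov hflat hV hΦ (inv_mem hδ)
  have hinv : ∀ x, f (f' x) = x := by
    intro x
    have h1 := hf (f' x) (A' 0)
    rw [← hf', Homeomorph.inv_apply, Homeomorph.apply_symm_apply, Φ.injective.eq_iff,
      (WithLp.toLp_injective 2).eq_iff, Prod.mk.injEq] at h1
    exact h1.1.symm
  have hinv' : ∀ x, f' (f x) = x := by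
    intro x
    have h1 := hf' (f x) (A 0)
    rw [← hf, Homeomorph.inv_apply, Homeomorph.symm_apply_apply, Φ.injective.eq_iff,
      (WithLp.toLp_injective 2).eq_iff, Prod.mk.injEq] at h1
    exact h1.1.symm
  have hiso : Isometry f := by
    intro x x'
    have h1 := coverDist_deck (g := g) hδ (Φ (WithLp.toLp 2 (x, 0))) (Φ (WithLp.toLp 2 (x', 0)))
    rw [hf, hf, map_zero, coverDist_eq_edist h hcov hflat hK hΦ,
      coverDist_eq_edist h hcov hflat hK hΦ] at h1
    exact (WithLp.edist_toLp_fst 2 _ Vᗮ (f x) (f x')).symm.trans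
      (h1.trans (WithLp.edist_toLp_fst 2 _ Vᗮ x x'))
  exact ⟨⟨⟨f, f', hinv', hinv⟩, hiso⟩, A, hf⟩

/-- The covering group acts on `V / Λ × Vᗮ` by products of isometries. -/
theorem exists_product_action [T2Space X] (h : IsomOn g ϖ univ) (hcov : IsCoveringMap ϖ)
    (hflat : IsFlatMetric g) (hV : (V : Set (Cn n)) = ϖ ⁻¹' S)
    (hK : ∀ γ ∈ holonomyKernel ϖ V, ∀ z, γ z = z + γ 0)
    {Φ : WithLp 2 (HolTorus ϖ V × Vᗮ) ≃ₜ HolCover ϖ V}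
    (hΦ : ∀ (v : V) (w : Vᗮ), Φ (WithLp.toLp 2 (Submodule.Quotient.mk v, w)) =
      Quotient.mk (holSetoid ϖ V) ((v : Cn n) + (w : Cn n))) :
    ∃ (ρ₁ : deckGroup (holProj ϖ V) →* (HolTorus ϖ V ≃ᵢ HolTorus ϖ V))
      (ρ₂ : deckGroup (holProj ϖ V) →* (Vᗮ ≃ₗᵢ[ℝ] Vᗮ)),
      ∀ (γ : deckGroup (holProj ϖ V)) (x : HolTorus ϖ V) (y : Vᗮ),
        γ.1 (Φ (WithLp.toLp 2 (x, y))) = Φ (WithLp.toLp 2 (ρ₁ γ x, ρ₂ γ y)) := by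
  choose f A hf using fun δ : deckGroup (holProj ϖ V) =>
    exists_product_isometry h hcov hflat hV hK hΦ δ.2
  have hmul : ∀ δ δ' x y, f (δ * δ') x = f δ (f δ' x) ∧ A (δ * δ') y = A δ (A δ' y) := by
    intro δ δ' x y
    have h1 : δ.1 (δ'.1 (Φ (WithLp.toLp 2 (x, y)))) = _ := hf (δ * δ') x y
    rw [hf, hf, Φ.injective.eq_iff, (WithLp.toLp_injective 2).eq_iff, Prod.mk.injEq] at h1
    exact ⟨h1.1.symm, h1.2.symm⟩
  refine ⟨MonoidHom.mk' f fun δ δ' => ?_, MonoidHom.mk' A fun δ δ' => ?_, hf⟩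
  · ext1 x
    exact (hmul δ δ' x 0).1
  · ext1 y
    exact (hmul δ δ' 0 y).2

/-- The torus `V / Λ × {0}` covers the soul: the projection to `S` is an open quotient map, whose
fibres are the orbits of the covering group. -/
theorem exists_quotient_torus [T2Space X] [ConnectedSpace X] (h : IsomOn g ϖ univ)
    (hcov : IsCoveringMap ϖ) (hflat : IsFlatMetric g) (hV : (V : Set (Cn n)) = ϖ ⁻¹' S)
    {Φ : WithLp 2 (HolTorus ϖ V × Vᗮ) ≃ₜ HolCover ϖ V}
    (hΦ : ∀ (v : V) (w : Vᗮ), Φ (WithLp.toLp 2 (Submodule.Quotient.mk v, w)) =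
      Quotient.mk (holSetoid ϖ V) ((v : Cn n) + (w : Cn n))) :
    ∃ q : HolTorus ϖ V → S,
      (∀ x, (q x : X) = holProj ϖ V (Φ (WithLp.toLp 2 (x, 0)))) ∧ IsQuotientMap q ∧
      ∀ x x', q x = q x' ↔ ∃ γ ∈ deckGroup (holProj ϖ V),
        γ (Φ (WithLp.toLp 2 (x, 0))) = Φ (WithLp.toLp 2 (x', 0)) := by
  have hrange := range_torus_eq hV hΦ
  have hcont : Continuous fun x : HolTorus ϖ V => holProj ϖ V (Φ (WithLp.toLp 2 (x, 0))) :=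
    (continuous_holProj hcov).comp
      (Φ.continuous.comp ((WithLp.prod_continuous_toLp 2 _ Vᗮ).comp (by fun_prop)))
  let q : HolTorus ϖ V → S := fun x => ⟨holProj ϖ V (Φ (WithLp.toLp 2 (x, 0))), by
    rw [← mem_preimage, ← hrange]
    exact mem_range_self x⟩
  refine ⟨q, fun x => rfl, ?_, fun x x' => ?_⟩
  · have hopen : IsOpenMap q := by
      intro U hU
      -- a point of the covering over `S` lies on the torus, so `q '' U` is the trace on `S` of the
      -- image of the open set `U × Vᗮ`
      have h1 : q '' U = Subtype.val ⁻¹' (holProj ϖ V '' (Φ '' (WithLp.fst ⁻¹' U))) := by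
        ext s
        constructor
        · rintro ⟨x, hx, rfl⟩
          exact ⟨_, ⟨WithLp.toLp 2 (x, 0), hx, rfl⟩, rfl⟩
        · rintro ⟨_, ⟨p, hp, rfl⟩, hps⟩
          have h2 : Φ p ∈ holProj ϖ V ⁻¹' S := mem_preimage.2 (hps ▸ s.2)
          rw [← hrange] at h2
          obtain ⟨x, hx⟩ := h2
          obtain rfl := Φ.injective hx
          exact ⟨x, hp, Subtype.ext hps⟩
      rw [h1]
      refine (isOpenMap_holProj hcov _ (Φ.isOpenMap _ (hU.preimage ?_))).preimage
        continuous_subtype_val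
      exact continuous_fst.comp (WithLp.prod_continuous_ofLp 2 _ Vᗮ)
    refine hopen.isQuotientMap (hcont.subtype_mk _) fun s => ?_
    obtain ⟨z, hz⟩ := surjective_of_isCoveringMap hcov (s : X)
    have h1 : (Quotient.mk (holSetoid ϖ V) z : HolCover ϖ V) ∈ holProj ϖ V ⁻¹' S :=
      mem_preimage.2 (show ϖ z ∈ S from hz ▸ s.2)
    rw [← hrange] at h1
    obtain ⟨x, hx⟩ := h1
    refine ⟨x, Subtype.ext ?_⟩
    exact (congrArg (holProj ϖ V) hx).trans hz
  · constructor
    · intro hxx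
      exact exists_deck_holProj_of_eq h hflat hV (congrArg Subtype.val hxx)
    · rintro ⟨γ, hγ, hγx⟩
      refine Subtype.ext ?_
      show holProj ϖ V _ = holProj ϖ V _
      rw [← hγx, hγ]

end

/-! ### Translations and phase -/

section

variable {n : ℕ} {X : Type*} [TopologicalSpace X] [ChartedSpace (Cn n) X]
  [IsManifold 𝓘(ℝ, Cn n) ∞ X] {X₀ : CalabiYau n X} {ϖ : Cn n → X} {V : Submodule ℝ (Cn n)}
  {S : Set X}

/-- If the linear part of a deck transformation is the identity on the Lagrangian `V`, it is the
identity, since it is complex linear. So the holonomy kernel consists of translations. -/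
theorem eq_add_of_mem_holonomyKernel [T2Space X] (hflat : IsFlatMetric X₀.g)
    (h : IsFlatUniversalCover X₀ ϖ) (hiso : ∀ v ∈ V, ∀ w ∈ V, stdKahler v w = 0)
    (hn : n ≤ Module.finrank ℝ V) {γ : Cn n ≃ₜ Cn n} (hγ : γ ∈ holonomyKernel ϖ V) (z : Cn n) :
    γ z = z + γ 0 := by
  obtain ⟨A, hA⟩ := h.isomOn.exists_linear_of_deck hflat hγ.1
  obtain ⟨b, hb, hγb⟩ := hγ.2
  have hb0 : γ 0 = b := by rw [hγb 0 V.zero_mem, zero_add]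
  have h1 := eq_self_of_eq_self_on_lagrangian hiso hn (A := A.toLinearEquiv.toLinearMap)
    (h.linear_mulI hγ.1 hA) (fun v hv => by
      have h2 := hA v
      rw [hγb v hv, hb0] at h2
      exact (add_right_cancel h2).symm) z
  rw [hA z]
  exact congrArg (· + γ 0) h1

/-- All translates of a Lagrangian subspace of `ℂⁿ` have the same phase. -/
theorem exists_isSpecialLagrangian (h : IsFlatUniversalCover X₀ ϖ)
    (hiso : ∀ v ∈ V, ∀ w ∈ V, stdKahler v w = 0) (hdim : Module.finrank ℝ V = n) :
    ∃ θ : ℝ, ∀ y : Cn n, IsSpecialLagrangian X₀ θ fun v : V => ϖ ((v : Cn n) + y) := by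
  obtain ⟨θ, hθ⟩ := exists_phase hdim
  refine ⟨θ, fun y => ?_⟩
  let τ : V → Cn n := fun v => (v : Cn n) + y
  have hd : ∀ v, HasFDerivAt τ V.subtypeL v := fun v => V.subtypeL.hasFDerivAt.add_const y
  have hτ : ContMDiff 𝓘(ℝ, V) 𝓘(ℝ, Cn n) ∞ τ :=
    (V.subtypeL.contDiff.add contDiff_const).contMDiff
  have hmϖ : ∀ z, MDifferentiableAt 𝓘(ℝ, Cn n) 𝓘(ℝ, Cn n) ϖ z := fun z =>
    (h.smooth z).mdifferentiableAt (by simp)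
  have hmτ : ∀ v, MDifferentiableAt 𝓘(ℝ, V) 𝓘(ℝ, Cn n) τ v := fun v =>
    (hd v).differentiableAt.mdifferentiableAt
  have hk : ∀ v, pullForm (E' := V) (ϖ ∘ τ) X₀.kform v =
      (pullForm (E' := Cn n) ϖ X₀.kform (τ v)).compContinuousLinearMap V.subtypeL := by
    intro v
    have h1 := pullForm_eq_fderiv τ (pullForm (E' := Cn n) ϖ X₀.kform) v
    rw [(hd v).fderiv] at h1
    exact (pullForm_comp (hmϖ _) (hmτ v) _).trans h1
  have hv : ∀ v, pullForm (E' := V) (ϖ ∘ τ) X₀.vform v =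
      (pullForm (E' := Cn n) ϖ X₀.vform (τ v)).compContinuousLinearMap V.subtypeL := by
    intro v
    have h1 := pullForm_eq_fderiv τ (pullForm (E' := Cn n) ϖ X₀.vform) v
    rw [(hd v).fderiv] at h1
    exact (pullForm_comp (hmϖ _) (hmτ v) _).trans h1
  refine ⟨hdim, h.smooth.comp hτ, fun v => ?_, fun v => ?_, fun v a => ?_⟩
  · have h1 := mfderiv_comp v (hmϖ _) (hmτ v)
    rw [mfderiv_eq_fderiv (f := τ), (hd v).fderiv] at h1
    refine (congrArg (fun T : V →L[ℝ] Cn n => Function.Injective T) h1).mpr ?_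
    exact (h.isomOn.mfderiv_injective (mem_univ _)).comp Subtype.val_injective
  · refine (hk v).trans (ContinuousAlternatingMap.ext fun a => ?_)
    have h1 := h.kahler (τ v) (a 0) (a 1)
    rw [hiso _ (a 0).2 _ (a 1).2] at h1
    refine Eq.trans ?_ h1
    refine congrArg (pullForm (E' := Cn n) ϖ X₀.kform (τ v)) ?_
    ext i : 1
    fin_cases i <;> rfl
  · have h1 := congrArg (fun T : V [⋀^Fin n]→L[ℝ] ℂ => T a) (hv v)
    have h2 := h.volume (τ v) (fun i => (a i : Cn n))
    refine Eq.trans (congrArg (fun c : ℂ => (Complex.exp (θ * Complex.I) * c).im)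
      (h1.trans h2)) (hθ a)

end

end BlowUp

theorem proposition3p1 {n : ℕ} (hn : 0 < n)
    -- closed Calabi–Yau manifolds with an integral Kähler class
    {M : ℕ → Type*} [∀ k, TopologicalSpace (M k)] [∀ k, ChartedSpace (Cn n) (M k)]
    [∀ k, IsManifold 𝓘(ℝ, Cn n) ∞ (M k)] [∀ k, T2Space (M k)] [∀ k, CompactSpace (M k)]
    (Y : ∀ k, CalabiYau n (M k)) (p : ∀ k, M k)
    (hint : ∀ k, IsIntegralClass (Y k).kform)
    -- scales tending to zero, with `[Ω_k] ≠ 0` on balls of comparable size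
    (lam : ℕ → ℝ) (hlam : ∀ k, 0 < lam k) (hlam0 : Tendsto lam atTop (𝓝 0))
    (σ : ℝ) (hΩ : ∀ k, ¬ IsExactOn (gBall (Y k).g (p k) (σ * lam k)) (Y k).vform)
    -- the blow-up limit, a complete flat Calabi–Yau manifold, and its soul
    {X : Type*} [TopologicalSpace X] [ChartedSpace (Cn n) X] [IsManifold 𝓘(ℝ, Cn n) ∞ X]
    [T2Space X] [ConnectedSpace X] (X₀ : CalabiYau n X) (p₀ : X)
    (hcomplete : IsCompleteMetric X₀.g) (hflat : IsFlatMetric X₀.g)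
    (hlim : IsRescaledLimit Y p lam X₀ p₀)
    (S : Set X) (hS : IsSoul X₀.g S) :
    -- the universal covering exists
    (∃ ϖ : Cn n → X, IsFlatUniversalCover X₀ ϖ ∧ ϖ 0 ∈ S) ∧
    ∀ ϖ : Cn n → X, IsFlatUniversalCover X₀ ϖ → ϖ 0 ∈ S →
      -- the preimage of the soul is a linear subspace `V`
      ∃ V : Submodule ℝ (Cn n), (V : Set (Cn n)) = ϖ ⁻¹' S ∧
      -- `Λ` is a lattice in `V`
      (DiscreteTopology (transLattice ϖ V) ∧
        Submodule.span ℝ (transLattice ϖ V : Set V) = ⊤) ∧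
      -- `π : X̃ → X` is a finite normal covering
      ((holonomyKernel ϖ V).subgroupOf (deckGroup ϖ)).Normal ∧
      IsCoveringMap (holProj ϖ V) ∧ Finite (deckGroup (holProj ϖ V)) ∧
      (∀ a b : HolCover ϖ V, holProj ϖ V a = holProj ϖ V b →
        ∃ γ ∈ deckGroup (holProj ϖ V), γ a = b) ∧
      ∃ Φ : WithLp 2 (HolTorus ϖ V × Vᗮ) ≃ₜ HolCover ϖ V,
        -- `Φ` is induced by `V ⊕ Vᗮ = ℂⁿ`, and is an isometry to `π^* g₀`
        (∀ (v : V) (w : Vᗮ), Φ (WithLp.toLp 2 (Submodule.Quotient.mk v, w)) =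
          Quotient.mk (holSetoid ϖ V) ((v : Cn n) + (w : Cn n))) ∧
        (∀ a b, coverDist X₀.g (holProj ϖ V) (Φ a) (Φ b) = edist a b) ∧
        -- the action of the covering group is a product action (by isometries)
        (∃ (ρ₁ : deckGroup (holProj ϖ V) →* (HolTorus ϖ V ≃ᵢ HolTorus ϖ V))
          (ρ₂ : deckGroup (holProj ϖ V) →* (Vᗮ ≃ₗᵢ[ℝ] Vᗮ)),
          ∀ (γ : deckGroup (holProj ϖ V)) (x : HolTorus ϖ V) (y : Vᗮ),
            γ.1 (Φ (WithLp.toLp 2 (x, y))) = Φ (WithLp.toLp 2 (ρ₁ γ x, ρ₂ γ y))) ∧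
        -- `T × {0}` is the preimage of `S`, it is invariant, and `S` is its quotient
        (Set.range (fun x : HolTorus ϖ V => Φ (WithLp.toLp 2 (x, 0))) = holProj ϖ V ⁻¹' S) ∧
        (∀ γ ∈ deckGroup (holProj ϖ V),
          γ '' Set.range (fun x : HolTorus ϖ V => Φ (WithLp.toLp 2 (x, 0))) =
            Set.range (fun x : HolTorus ϖ V => Φ (WithLp.toLp 2 (x, 0)))) ∧
        (∃ q : HolTorus ϖ V → S,
          (∀ x, (q x : X) = holProj ϖ V (Φ (WithLp.toLp 2 (x, 0)))) ∧
          IsQuotientMap q ∧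
          ∀ x x', q x = q x' ↔ ∃ γ ∈ deckGroup (holProj ϖ V),
            γ (Φ (WithLp.toLp 2 (x, 0))) = Φ (WithLp.toLp 2 (x', 0))) ∧
        -- all slices `T × {y}` are special Lagrangian, of the same phase
        ∃ θ : ℝ, ∀ y : Vᗮ, IsSpecialLagrangian X₀ θ
          (fun v : V => holProj ϖ V (Φ (WithLp.toLp 2 (Submodule.Quotient.mk v, y)))) := by
  refine ⟨?_, fun ϖ h h0 => ?_⟩
  · obtain ⟨x, hx⟩ := hS.nonempty
    obtain ⟨ϖ, h, hϖ⟩ := exists_isFlatUniversalCover hn X₀ hcomplete hflat x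
    exact ⟨ϖ, h, hϖ ▸ hx⟩
  have hi := h.isomOn
  have hcov := h.covering
  obtain ⟨V, hV⟩ := hi.exists_submodule_eq_preimage hcov hflat hS h0
  have hspan := span_transLattice hi hcov hflat hS.compact hV
  have hdim := le_finrank_of_not_isExactOn hlam hΩ hflat hlim hS.compact h hV
  have htrans : ∀ a ∈ (transLattice ϖ V : Set V), ∀ v ∈ V, ϖ (v + (a : V)) = ϖ v := by
    rintro a ⟨γ, hγ, hγa⟩ v hv
    rw [← hγa v hv, hγ.1]
  have hiso : ∀ v ∈ V, ∀ w ∈ V, stdKahler v w = 0 := fun v hv w hw =>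
    stdKahler_eq_zero_of_span hspan (fun a ha b hb =>
      stdKahler_eq_zero_of_translations hint hlam hlam0 hflat hlim hS.compact h hV a.2 b.2
        (htrans a ha) (htrans b hb)) hv hw
  have hK : ∀ γ ∈ holonomyKernel ϖ V, ∀ z, γ z = z + γ 0 := fun γ hγ z =>
    eq_add_of_mem_holonomyKernel hflat h hiso hdim hγ z
  obtain ⟨Φ, hΦ⟩ := exists_homeomorph_torus hK
  have hrange := range_torus_eq hV hΦ
  obtain ⟨θ, hθ⟩ := exists_isSpecialLagrangian h hiso (finrank_eq_of_isotropic hiso hdim)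
  refine ⟨V, hV, ⟨discreteTopology_transLattice hi hcov hflat, hspan⟩,
    normal_holonomyKernel hi hflat hV, isCoveringMap_holProj hi hcov hflat hV,
    finite_deck_holProj hi hcov hflat hS.compact hV,
    fun a b hab => exists_deck_holProj_of_eq hi hflat hV hab, Φ, hΦ,
    coverDist_eq_edist hi hcov hflat hK hΦ, exists_product_action hi hcov hflat hV hK hΦ,
    hrange, fun γ hγ => ?_, exists_quotient_torus hi hcov hflat hV hΦ, θ, fun y => ?_⟩
  · rw [hrange, image_preimage_of_mem_deckGroup hγ]
  · simp only [hΦ]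
    exact hθ y
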